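/- Work on $\mathbb R^3$ with real-valued tempered distributions. Let $S(t)=e^{t\Delta}$, let $\mathbb P$ be the Leray projector (symbol $\delta_{jk}-\xi_j\xi_k/|\xi|^2$) and, for $\ell>2$, let $S_\ell(t)=e^{-t(-\Delta)^{\ell/2}}$. For a Banach space $E\subset\mathcal S'(\mathbb R^3)$ put $\|f\|_{E}=\max_i\|f_i\|_E$ for vector (or matrix) fields $f$ with entries in $E$. The Banach space $E$ is called *functional and translation invariant* if $\mathcal S\subset E\subset\mathcal S'$ with continuous inclusions; either both inclusions have dense range, or $E=F^*$ for a Banach space $F$ with continuous inclusions $\mathcal S\subset F\subset\mathcal S'$ of dense range (the duality extending the pairing of $\mathcal S'$ and $\mathcal S$); and $\|f(\cdot-y)\|_E=\|f\|_E$ for all $f\in E$, $y\in\mathbb R^3$. It is called *adequate* (to the Navier–Stokes system) if moreover the product of any two elements of $E$ is a well-defined tempered distribution (the limit in $\mathcal S'$ of the products of the regularizations by an arbitrary Schwartz mollifier), and there are $T_0>0$ and a positive $\omega\in L^1(0,T_0)$ with $$\|\mathbb P\nabla\cdot S(\tau)(f\otimes g)\|_E\le\omega(\tau)\|f\|_E\|g\|_E\qquad(f,g\in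 E^3,\ 0<\tau<T_0).$$ Its norm has *scaling degree* $k$ if for all $f\in E$, $\lambda>0$ the distribution $f_\lambda=f(\lambda\,\cdot)$ is in $E$ and $\|f_\lambda\|_E=\lambda^k\|f\|_E$. For $\alpha\ge0$ let $BE^\alpha$ be the space of $f\in\mathcal S'$ with $\|f\|_{BE^\alpha}=\sup_{t>0}t^{\alpha/2}\|S(t)f\|_E<\infty$. Write $u\in C_w([0,\infty);BE^\alpha)$ if $u$ is bounded and norm continuous from $(0,\infty)$ to $BE^\alpha$ and $u(t)\to u(0)$ in $\mathcal S'$ as $t\searrow0$. **Theorem.** Let $p>3$, $\ell>2$ and $3\ell/2<p$. Let $E_p$ be an adequate Banach space whose norm has scaling degree $-3/p$. There are constants $C>0$ and $\varepsilon_0>0$ such that the following holds for every $0<\varepsilon\le\varepsilon_0$. Let $u_0\in (BE_p^{1-3/p})^3$ and let $V:(0,\infty)\to E_p^{3\times3}$ be weakly measurable (that is, $t\mapsto\langle V_{lk}(t),\varphi\rangle$ is measurable for all $\varphi\in\mathcal S$), with $$\|u_0\|_{BE_p^{1-3/p}}+\sup_{t>0}t^{1-3/(2p)}\|V(t)\|_{E_p}<\varepsilon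 .$$ Then the Navier–Stokes system $$u(t)=S(t)u_0-\int_0^tS(t-\tau)\mathbb P\nabla\cdot(u\otimes u)(\tau)\,d\tau+\int_0^tS(t-\tau)\mathbb P\nabla\cdot V(\tau)\,d\tau$$ (mild formulation, integrals in the weak sense, initial datum $u_0$ and external force $F=\nabla\cdot V$) has exactly one solution $u\in C_w([0,\infty);BE_p^{1-3/p})$ with $u(0)=u_0$ and $\sup_{t>0}t^{(1-3/p)/2}\|u(t)\|_{E_p}\le C\varepsilon$; the hyperdissipative system, in which $S$ is replaced by $S_\ell S$, with the same $u_0$ and $F$, has exactly one solution $w$ in the same class; and $$\lim_{t\to\infty}t^{(1-3/p)/2}\|u(t)-w(t)\|_{E_p}=0 .$$ -/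

import Mathlib

open MeasureTheory Filter Topology SchwartzMap Set
open scoped ENNReal NNReal

noncomputable section

/-- Euclidean space of dimension three. -/
abbrev R3 := EuclideanSpace ℝ (Fin 3)

/-- Real Schwartz functions on three-dimensional space. -/
abbrev TestFn := 𝓢(R3, ℝ)

/-- Real tempered distributions on three-dimensional space, with the topology of pointwise
convergence on test functions. -/
abbrev TempDist := TestFn →Lₚₜ[ℝ] ℝ

/-- The affine change of variables `φ ↦ φ (a • · + b)` on Schwartz functions
(for `a ≠ 0`; the value for `a = 0` is irrelevant and set to `0`). -/
def affinePull (a : ℝ) (b : R3) : TestFn →L[ℝ] TestFn :=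
  if ha : a ≠ 0 then
    compCLMOfAntilipschitz ℝ (K := ‖a‖₊⁻¹) (g := fun y : R3 => a • y + b) (by fun_prop)
      (AntilipschitzWith.of_le_mul_dist fun x y => by
        have h : 0 < ‖a‖ := norm_pos_iff.mpr ha
        rw [dist_add_right, dist_smul₀, NNReal.coe_inv, coe_nnnorm, inv_mul_cancel_left₀ h.ne'])
  else 0

theorem affinePull_apply {a : ℝ} (ha : a ≠ 0) (b : R3) (φ : TestFn) (y : R3) :
    affinePull a b φ y = φ (a • y + b) := by
  simp [affinePull, ha]

theorem gaussian_decay (k n : ℕ) :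
    ∃ C, ∀ x : R3, ‖x‖ ^ k * ‖iteratedFDeriv ℝ n (fun z : R3 => Real.exp (-(‖z‖ ^ 2 / 4))) x‖
      ≤ C := by
  have htg : Function.HasTemperateGrowth (fun z : R3 => -(‖z‖ ^ 2 / 4)) := by
    have h := (Function.HasTemperateGrowth.const (E := R3) (-(1 / 4 : ℝ))).mul
      (Function.hasTemperateGrowth_norm_sq R3)
    refine (congrArg Function.HasTemperateGrowth ?_).mp h
    funext z
    simp only [Pi.mul_apply]
    ring
  obtain ⟨m, A, hA, hbound⟩ := htg.norm_iteratedFDeriv_le_uniform n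
  set B : ℝ := A + 1 with hB
  have hB1 : 1 ≤ B := by linarith
  have key : ∀ x : R3, ‖iteratedFDeriv ℝ n (fun z : R3 => Real.exp (-(‖z‖ ^ 2 / 4))) x‖
      ≤ n.factorial * Real.exp (-(‖x‖ ^ 2 / 4)) * (B * (1 + ‖x‖) ^ m) ^ n := by
    intro x
    refine norm_iteratedFDeriv_comp_le (g := Real.exp) (N := (n : WithTop ℕ∞))
      Real.contDiff_exp (htg.1.of_le (by exact_mod_cast le_top)) le_rfl x (fun i _ => ?_)
      (fun i hi hin => ?_)
    · rw [norm_iteratedFDeriv_eq_norm_iteratedDeriv, iteratedDeriv_eq_iterate, Real.iter_deriv_exp,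
        Real.norm_eq_abs, abs_of_pos (Real.exp_pos _)]
    · have h1 : (1 : ℝ) ≤ B * (1 + ‖x‖) ^ m :=
        one_le_mul_of_one_le_of_one_le hB1 (one_le_pow₀ (by linarith [norm_nonneg x]))
      calc _ ≤ A * (1 + ‖x‖) ^ m := hbound i hin x
        _ ≤ B * (1 + ‖x‖) ^ m := by gcongr; linarith
        _ ≤ (B * (1 + ‖x‖) ^ m) ^ i := le_self_pow₀ h1 (by omega)
  set N : ℕ := k + m * n with hN
  have hexp : ∀ r : ℝ, 0 ≤ r → (1 + r) ^ N * Real.exp (-(r ^ 2 / 4)) ≤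
      N.factorial * Real.exp 2 := by
    intro r hr
    have h1 := Real.pow_div_factorial_le_exp (1 + r) (by linarith) N
    have hf : (0 : ℝ) < N.factorial := by exact_mod_cast N.factorial_pos
    rw [div_le_iff₀ hf] at h1
    calc (1 + r) ^ N * Real.exp (-(r ^ 2 / 4))
        ≤ (Real.exp (1 + r) * N.factorial) * Real.exp (-(r ^ 2 / 4)) := by gcongr
      _ = N.factorial * Real.exp (1 + r - r ^ 2 / 4) := by
          rw [sub_eq_add_neg, Real.exp_add (1 + r)]; ring
      _ ≤ N.factorial * Real.exp 2 := by
          gcongr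
          nlinarith [sq_nonneg (r - 2)]
  refine ⟨n.factorial * B ^ n * (N.factorial * Real.exp 2), fun x => ?_⟩
  have hx := norm_nonneg x
  calc _ ≤ (1 + ‖x‖) ^ k *
        (n.factorial * Real.exp (-(‖x‖ ^ 2 / 4)) * (B * (1 + ‖x‖) ^ m) ^ n) := by
        gcongr
        · linarith
        · exact key x
    _ = n.factorial * B ^ n * ((1 + ‖x‖) ^ N * Real.exp (-(‖x‖ ^ 2 / 4))) := by
        rw [hN, mul_pow, ← pow_mul, pow_add]; ring
    _ ≤ _ := by
        exact mul_le_mul_of_nonneg_left (hexp _ hx) (by positivity)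

/-- The Gaussian `exp (-|z|² / 4)` as a Schwartz function. -/
def gaussianTest : TestFn where
  toFun z := Real.exp (-(‖z‖ ^ 2 / 4))
  smooth' := Real.contDiff_exp.comp ((contDiff_norm_sq ℝ).div_const 4).neg
  decay' := gaussian_decay

/-- For `t > 0`, the Schwartz function
`y ↦ p(x - y, t) = (4πt)^(-3/2) exp (-|x - y|² / (4t))`. -/
def heatTest (t : ℝ) (x : R3) : TestFn :=
  (4 * Real.pi * t) ^ (-(3 / 2) : ℝ) •
    affinePull (-(Real.sqrt t)⁻¹) ((Real.sqrt t)⁻¹ • x) gaussianTest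

theorem heatTest_apply {t : ℝ} (ht : 0 < t) (x y : R3) :
    heatTest t x y =
      (4 * Real.pi * t) ^ (-(3 / 2) : ℝ) * Real.exp (-(‖x - y‖ ^ 2 / (4 * t))) := by
  have hs : 0 < Real.sqrt t := Real.sqrt_pos.mpr ht
  have h : (-(Real.sqrt t)⁻¹) • y + (Real.sqrt t)⁻¹ • x = (Real.sqrt t)⁻¹ • (x - y) := by
    rw [smul_sub, neg_smul]; abel
  have h2 : heatTest t x y = (4 * Real.pi * t) ^ (-(3 / 2) : ℝ) *
      gaussianTest ((-(Real.sqrt t)⁻¹) • y + (Real.sqrt t)⁻¹ • x) := by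
    rw [← affinePull_apply (neg_ne_zero.mpr (inv_ne_zero hs.ne'))]; rfl
  rw [h2, h]
  change _ * Real.exp (-(‖(Real.sqrt t)⁻¹ • (x - y)‖ ^ 2 / 4)) = _
  congr 3
  rw [norm_smul, mul_pow, Real.norm_eq_abs, sq_abs, inv_pow, Real.sq_sqrt ht.le]
  field_simp

/-- The heat semigroup on tempered distributions, `S(t) f = p(·, t) * f` for `t > 0`;
it is a smooth function. -/
def heat (t : ℝ) (f : TempDist) (x : R3) : ℝ := f (heatTest t x)

/-- The distribution `f` is (integration against) the function `g`. -/
def Represents (f : TempDist) (g : R3 → ℝ) : Prop :=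
  ∀ φ : TestFn, Integrable (fun x => g x * φ x) ∧ f φ = ∫ x, g x * φ x

/-! ### Product of distributions -/

/-- For `ε > 0`, the Schwartz function `y ↦ ρ_ε(x - y)` with `ρ_ε(z) = ε^(-3) ρ(z / ε)`. -/
def mollTest (ρ : TestFn) (ε : ℝ) (x : R3) : TestFn :=
  (ε ^ 3)⁻¹ • affinePull (-ε⁻¹) (ε⁻¹ • x) ρ

/-- `h` is the product of the tempered distributions `f` and `g`: for every Schwartz mollifier,
`(f * ρ_ε) (g * ρ_ε) → h` in the sense of tempered distributions as `ε ↘ 0`. -/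
def IsDistMul (f g h : TempDist) : Prop :=
  ∀ ρ : TestFn, ∫ x, ρ x = 1 → ∀ φ : TestFn,
    Tendsto (fun ε : ℝ => ∫ x, f (mollTest ρ ε x) * g (mollTest ρ ε x) * φ x)
      (𝓝[>] 0) (𝓝 (h φ))

open Classical in
/-- The product of two tempered distributions (`0` if it is not well defined). -/
def distMul (f g : TempDist) : TempDist :=
  if h : ∃ k, IsDistMul f g k then h.choose else 0

/-- The tensor product `f ⊗ g` of two vector fields. -/
def distTensor (f g : Fin 3 → TempDist) : Fin 3 → Fin 3 → TempDist :=
  fun l k => distMul (f l) (g k)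

/-! ### Semigroups and the projected divergence

A semigroup is given by its Fourier symbol `σ t ξ`. The operators with symbol `σ t ξ`, and
`σ t ξ` times the symbol of `ℙ ∇·`, are applied to a distribution in two steps:
`S(t/2)` turns it into a function, which is then convolved with the kernel having the remaining
symbol `residualSymbol σ t ξ = σ t ξ * exp (t|ξ|²/2)`. -/

/-- Symbol of the heat semigroup `exp (tΔ)`. -/
def heatSymbol (t : ℝ) (ξ : R3) : ℝ := Real.exp (-(t * ‖ξ‖ ^ 2))

/-- Symbol of the semigroup `S_ℓ(t) S(t) = exp (t (Δ - (-Δ)^(ℓ/2)))`. -/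
def hyperSymbol (ℓ : ℝ) (t : ℝ) (ξ : R3) : ℝ := Real.exp (-(t * (‖ξ‖ ^ 2 + ‖ξ‖ ^ ℓ)))

/-- What is left of the symbol `σ t` when `exp ((t/2)Δ)` is split off. -/
def residualSymbol (σ : ℝ → R3 → ℝ) (t : ℝ) (ξ : R3) : ℝ := σ t ξ * Real.exp (t / 2 * ‖ξ‖ ^ 2)

/-- Inverse Fourier transform `(2π)^(-3) ∫ m(ξ) exp (i x·ξ) dξ` of an even real symbol. -/
def evenKernel (m : R3 → ℝ) (x : R3) : ℝ :=
  ((2 * Real.pi) ^ 3)⁻¹ * ∫ ξ, m ξ * Real.cos (inner ℝ x ξ)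

/-- Inverse Fourier transform `(2π)^(-3) ∫ i m(ξ) exp (i x·ξ) dξ`, for an odd real `m`. -/
def oddKernel (m : R3 → ℝ) (x : R3) : ℝ :=
  -(((2 * Real.pi) ^ 3)⁻¹ * ∫ ξ, m ξ * Real.sin (inner ℝ x ξ))

/-- `ξ_l (δ_jk - ξ_j ξ_k / |ξ|²)`: up to the factor `i`, the symbol of `ℙ_jk ∂_l`. -/
def lerayDerivSymbol (j k l : Fin 3) (ξ : R3) : ℝ :=
  ξ l * ((if j = k then 1 else 0) - ξ j * ξ k / ‖ξ‖ ^ 2)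

/-- The semigroup with symbol `σ`, at time `t > 0`, applied to the distribution `f`. -/
def semigroupFn (σ : ℝ → R3 → ℝ) (t : ℝ) (f : TempDist) (x : R3) : ℝ :=
  ∫ y, evenKernel (residualSymbol σ t) y * heat (t / 2) f (x - y)

/-- The `j`-th component of `ℙ ∇·` composed with the semigroup with symbol `σ` at time `t > 0`,
applied to the matrix `H`; here `(∇·H)_k = ∑ l, ∂_l H_lk`. -/
def projDiv (σ : ℝ → R3 → ℝ) (t : ℝ) (H : Fin 3 → Fin 3 → TempDist) (j : Fin 3) (x : R3) : ℝ :=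
  ∑ k, ∑ l, ∫ y, oddKernel (fun ξ => lerayDerivSymbol j k l ξ * residualSymbol σ t ξ) y *
    heat (t / 2) (H l k) (x - y)

/-! ### Banach spaces of distributions -/

section Spaces

universe u

variable {E : Type u} [NormedAddCommGroup E] [NormedSpace ℝ E]

/-- `j` is the inclusion of the Schwartz functions in the space of distributions
embedded by `ι`. -/
def IsSchwartzInclusion (ι : E →L[ℝ] TempDist) (j : TestFn →L[ℝ] E) : Prop :=
  ∀ φ : TestFn, Represents (ι (j φ)) φ

/-- `𝓢 ⊂ E ⊂ 𝓢'` with continuous inclusions. -/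
def IsFunctional (ι : E →L[ℝ] TempDist) : Prop :=
  Function.Injective ι ∧ ∃ j : TestFn →L[ℝ] E, IsSchwartzInclusion ι j

/-- `𝓢 ⊂ E ⊂ 𝓢'` with continuous inclusions of dense range. -/
def IsDenselyFunctional (ι : E →L[ℝ] TempDist) : Prop :=
  Function.Injective ι ∧ DenseRange ι ∧
    ∃ j : TestFn →L[ℝ] E, IsSchwartzInclusion ι j ∧ DenseRange j

/-- `E` is the dual of a Banach space `F` with `𝓢 ⊂ F ⊂ 𝓢'`, continuously and densely,
the duality extending the pairing of distributions with Schwartz functions. -/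
def IsDualOfDenselyFunctional (ι : E →L[ℝ] TempDist) : Prop :=
  ∃ (F : Type u) (_ : NormedAddCommGroup F) (_ : NormedSpace ℝ F) (_ : CompleteSpace F)
    (ιF : F →L[ℝ] TempDist) (j : TestFn →L[ℝ] F) (Φ : E ≃ₗᵢ[ℝ] (F →L[ℝ] ℝ)),
    Function.Injective ιF ∧ DenseRange ιF ∧ IsSchwartzInclusion ιF j ∧ DenseRange j ∧
      ∀ (e : E) (φ : TestFn), Φ e (j φ) = ι e φ

/-- The norm of `E` is translation invariant: for `f ∈ E` and every `y`, the translate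
`τ_y f = f (· - y)` is in `E` and has the same norm. -/
def IsTranslationInvariant (ι : E →L[ℝ] TempDist) : Prop :=
  ∀ (y : R3) (f : E), ∃ g : E, (∀ φ : TestFn, ι g φ = ι f (affinePull 1 y φ)) ∧ ‖g‖ = ‖f‖

/-- Functional translation invariant Banach spaces of distributions. -/
def IsFunctionalTranslationInvariant (ι : E →L[ℝ] TempDist) : Prop :=
  IsFunctional ι ∧ (IsDenselyFunctional ι ∨ IsDualOfDenselyFunctional ι) ∧
    IsTranslationInvariant ι

/-- The norm of `E` has scaling degree `k`: for `f ∈ E` and `r > 0` the rescaled distribution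
`f_r = f (r ·)` is in `E`, of norm `r ^ k * ‖f‖`. -/
def HasScalingDegree (ι : E →L[ℝ] TempDist) (k : ℝ) : Prop :=
  ∀ r : ℝ, 0 < r → ∀ f : E, ∃ g : E,
    (∀ φ : TestFn, ι g φ = (r ^ 3)⁻¹ * ι f (affinePull r⁻¹ 0 φ)) ∧ ‖g‖ = r ^ k * ‖f‖

/-- The `E`-norm of the distribution given by the function `g` (`∞` if it is not in `E`). -/
def fnENorm (ι : E →L[ℝ] TempDist) (g : R3 → ℝ) : ℝ≥0∞ :=
  ⨅ (e : E) (_ : Represents (ι e) g), ‖e‖ₑ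

/-- The (extended) norm of `BE^α` on vector distributions:
`max_i sup_{t > 0} t^(α/2) ‖S(t) f_i‖_E`. -/
def besovNorm (ι : E →L[ℝ] TempDist) (α : ℝ) (f : Fin 3 → TempDist) : ℝ≥0∞ :=
  ⨆ (i : Fin 3) (t : ℝ) (_ : 0 < t), ENNReal.ofReal (t ^ (α / 2)) * fnENorm ι (heat t (f i))

/-- `f ∈ E³` as a vector of distributions. -/
def vecDist (ι : E →L[ℝ] TempDist) (f : Fin 3 → E) : Fin 3 → TempDist := fun i => ι (f i)

/-- Banach spaces adequate to the Navier–Stokes system. The norm of `E³` is the maximum of the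
norms of the components. -/
def IsAdequate (ι : E →L[ℝ] TempDist) : Prop :=
  IsFunctionalTranslationInvariant ι ∧
  (∀ f g : E, ∃ h : TempDist, IsDistMul (ι f) (ι g) h) ∧
  ∃ (T₀ : ℝ) (ω : ℝ → ℝ), 0 < T₀ ∧ (∀ τ ∈ Ioo 0 T₀, 0 < ω τ) ∧ IntegrableOn ω (Ioo 0 T₀) ∧
    ∀ f g : Fin 3 → E, ∀ τ ∈ Ioo 0 T₀, ∀ j : Fin 3,
      fnENorm ι (projDiv heatSymbol τ (distTensor (vecDist ι f) (vecDist ι g)) j) ≤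
        ENNReal.ofReal (ω τ * ‖f‖ * ‖g‖)

/-! ### Mild solutions -/

/-- `u ∈ C_w([0, ∞); BE^α)` with `u(0) = u₀`: bounded and norm continuous from `(0, ∞)` to
`BE^α`, and convergent to `u₀` in the sense of distributions as `t ↘ 0`. -/
structure IsWeaklyContinuousFrom (ι : E →L[ℝ] TempDist) (α : ℝ) (u₀ : Fin 3 → TempDist)
    (u : ℝ → Fin 3 → E) : Prop where
  bounded : ⨆ (t : ℝ) (_ : 0 < t), besovNorm ι α (vecDist ι (u t)) < ∞
  continuous : ∀ t : ℝ, 0 < t →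
    Tendsto (fun s => besovNorm ι α (vecDist ι (u s - u t))) (𝓝 t) (𝓝 0)
  initial : ∀ (i : Fin 3) (φ : TestFn), Tendsto (fun t => ι (u t i) φ) (𝓝[>] 0) (𝓝 (u₀ i φ))

/-- The integral equation
`u(t) = G(t) u₀ - ∫₀ᵗ G(t-τ) ℙ∇·(u ⊗ u)(τ) dτ + ∫₀ᵗ G(t-τ) ℙ∇·V(τ) dτ` for all `t > 0`,
where `G` is the semigroup with symbol `σ`; the integrals of distributions are weak ones. -/
def SolvesDuhamel (ι : E →L[ℝ] TempDist) (σ : ℝ → R3 → ℝ) (u₀ : Fin 3 → TempDist)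
    (V : ℝ → Fin 3 → Fin 3 → E) (u : ℝ → Fin 3 → E) : Prop :=
  ∀ t : ℝ, 0 < t → ∀ (i : Fin 3) (φ : TestFn),
    IntervalIntegrable (fun τ => ∫ x,
      projDiv σ (t - τ) (distTensor (vecDist ι (u τ)) (vecDist ι (u τ))) i x * φ x) volume 0 t ∧
    IntervalIntegrable (fun τ => ∫ x,
      projDiv σ (t - τ) (fun l k => ι (V τ l k)) i x * φ x) volume 0 t ∧
    ι (u t i) φ = (∫ x, semigroupFn σ t (u₀ i) x * φ x)
      - (∫ τ in (0 : ℝ)..t, ∫ x,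
          projDiv σ (t - τ) (distTensor (vecDist ι (u τ)) (vecDist ι (u τ))) i x * φ x)
      + ∫ τ in (0 : ℝ)..t, ∫ x, projDiv σ (t - τ) (fun l k => ι (V τ l k)) i x * φ x

/-- Global mild solutions, with data `u₀` and force `∇·V`, of the problem whose linear semigroup
has symbol `σ`, in the space `C_w([0, ∞); BE^(1-3/p))` and with
`t^((1-3/p)/2) ‖u(t)‖_E ≤ R` for all `t > 0`. -/
structure IsSmallSolution (ι : E →L[ℝ] TempDist) (σ : ℝ → R3 → ℝ) (p R : ℝ)
    (u₀ : Fin 3 → TempDist) (V : ℝ → Fin 3 → Fin 3 → E) (u : ℝ → Fin 3 → E) : Prop where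
  weaklyContinuous : IsWeaklyContinuousFrom ι (1 - 3 / p) u₀ u
  duhamel : SolvesDuhamel ι σ u₀ V u
  bound : ∀ t : ℝ, 0 < t → t ^ ((1 - 3 / p) / 2) * ‖u t‖ ≤ R

end Spaces

end

/-!
The integral equations are solved by a contraction argument in the norm `sup t^a ‖u(t)‖`, with
`a = (1 - 3/p) / 2`. The difference of the two solutions decays faster than each of them, because
the two semigroups differ little at large times.

**Convolutions on `E`.** The norm of `E` is translation invariant, and functions that are weakly
measurable and dominated by an integrable function have weak integrals in `E`
(`IsFunctionalTranslationInvariant.hasWeakIntegrals`): if `𝓢` is dense, `E` is separable and the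
integral is a Bochner integral; if `E` is a dual space, it is a Hahn–Banach extension. Integrable
kernels therefore act on `E` by convolution, with norm at most their `L¹` norm
(`IsSmearable.norm_smear_le`).

**Kernels.** Both semigroups are split as `exp (sΔ/2)` followed by a residual multiplier whose
kernel is bounded in `L¹` uniformly in `s` (`exists_smoothingSymbol_heat`,
`exists_smoothingSymbol_hyper`). For `exp (-|ξ|^ℓ)` this follows from Plancherel's theorem, as two
derivatives of the symbol are square integrable. The kernels of `ℙ ∇· exp (sΔ)` have `L¹` norm
`O(s^(-1/2))`, since the non-local part is a superposition of derivatives of Gaussians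
(`exists_kernelBound_leray`).

**The bilinear estimate.** Adequacy is needed at one positive time only. Dilations, which scale the
norm of `E` by the power `-3/p`, turn the estimate at that time into
`‖ℙ ∇· exp (sΔ) (f ⊗ g)‖ ≤ K s^(-(1/2 + 3/(2p))) ‖f‖ ‖g‖` for all `s`
(`IsAdequate.exists_projDist`). Here `1/2 + 3/(2p) = 1 - a < 1`. The regularized products converge
by hypothesis, so that their limit is a bounded, translation invariant bilinear map by the uniform
boundedness principle, and it preserves weak measurability.

**Mild solutions.** The convection term is a source of size `s^(-(1-a)) τ^(-2a)`, the force one of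
size `s^(-1/2) τ^(-(1/2+a))`; the beta integral bounds their Duhamel integrals by `t^(-a)`
(`exists_norm_duhamel_le`). The right-hand side of the equation is therefore a contraction of a small
ball (`IsMildSpace.exists_norm_mildMap_sub_le`), which gives existence and uniqueness
(`IsMildSpace.exists_isSmallSolution`). Applying `exp (rΔ)` to a source replaces `s^(-κ)` by
`r^(-a) s^(-(κ-a))`, which yields the bound and the continuity in the Besov-type norm
(`IsSource.isBesovRegular_duhamel`). Tested against a fixed function, heat flow up to time `s`
costs only `√s ‖e‖` (`IsSmearable.exists_heatOp_sub_le`); summed along dyadic times, this shows that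
the Duhamel integrals vanish weakly at time `0`, and that the semigroups may be applied to the
initial datum, which is not in `E`.

**Asymptotics.** Because `ℓ > 2`, the residual multipliers of the two semigroups differ by
`O(s^(-δ))` for a small `δ > 0` (`exists_residual_sub_bound`). The two right-hand sides at the same
curve then differ by `O(t^(-(a+δ)))`, and the contraction estimate, which holds for the weight
`t^(a+δ)` as well, transfers this bound to the difference of the solutions
(`IsMildSpace.exists_norm_sub_le`).
-/

noncomputable section

/-! ### Translations and convolutions of Schwartz functions -/

/-- The translation `φ ↦ φ (· + y)` of Schwartz functions. -/
abbrev shift (y : R3) : TestFn →L[ℝ] TestFn := affinePull 1 y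

theorem shift_apply (y : R3) (φ : TestFn) (x : R3) : shift y φ x = φ (x + y) := by
  rw [affinePull_apply one_ne_zero, one_smul]

theorem shift_shift (y z : R3) (φ : TestFn) : shift y (shift z φ) = shift (y + z) φ := by
  ext x; simp only [shift_apply, add_assoc]

theorem shift_zero (φ : TestFn) : shift 0 φ = φ := by
  ext x; simp only [shift_apply, add_zero]

theorem iteratedFDeriv_shift (y : R3) (φ : TestFn) (n : ℕ) (x : R3) :
    iteratedFDeriv ℝ n (shift y φ) x = iteratedFDeriv ℝ n φ (x + y) := by
  have : (shift y φ : R3 → ℝ) = fun x => φ (x + y) := by ext x; exact shift_apply y φ x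
  rw [this, iteratedFDeriv_comp_add_right]

/-- The order `n` weighted derivative `(1 + |x|) ^ N D^n φ (x)` of a Schwartz function. -/
def weightedDeriv (N n : ℕ) (φ : TestFn) : BoundedContinuousFunction R3 (R3 [×n]→L[ℝ] ℝ) :=
  BoundedContinuousFunction.ofNormedAddCommGroup
    (fun x => (1 + ‖x‖) ^ N • iteratedFDeriv ℝ n φ x)
    (((continuous_const.add continuous_norm).pow N).smul
      ((φ.smooth n).continuous_iteratedFDeriv le_rfl))
    (2 ^ N * (Finset.Iic (N, n)).sup (fun m => SchwartzMap.seminorm ℝ m.1 m.2) φ)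
    (fun x => by
      rw [norm_smul, Real.norm_of_nonneg (by positivity)]
      exact SchwartzMap.one_add_le_sup_seminorm_apply (𝕜 := ℝ) (m := (N, n)) le_rfl le_rfl φ x)

theorem weightedDeriv_apply (N n : ℕ) (φ : TestFn) (x : R3) :
    weightedDeriv N n φ x = (1 + ‖x‖) ^ N • iteratedFDeriv ℝ n φ x := rfl

/-- The Banach space of jets up to order `N` with weight `(1 + |x|) ^ N`. Its norm, pulled back
along `jet N`, runs through a fundamental system of continuous norms on Schwartz functions. -/
def JetSpace (N : ℕ) : Type :=
  ∀ n : Fin (N + 1), BoundedContinuousFunction R3 (R3 [×(n : ℕ)]→L[ℝ] ℝ)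

instance (N : ℕ) : NormedAddCommGroup (JetSpace N) :=
  inferInstanceAs (NormedAddCommGroup
    (∀ n : Fin (N + 1), BoundedContinuousFunction R3 (R3 [×(n : ℕ)]→L[ℝ] ℝ)))

instance (N : ℕ) : NormedSpace ℝ (JetSpace N) :=
  inferInstanceAs (NormedSpace ℝ
    (∀ n : Fin (N + 1), BoundedContinuousFunction R3 (R3 [×(n : ℕ)]→L[ℝ] ℝ)))

instance (N : ℕ) : CompleteSpace (JetSpace N) :=
  inferInstanceAs (CompleteSpace
    (∀ n : Fin (N + 1), BoundedContinuousFunction R3 (R3 [×(n : ℕ)]→L[ℝ] ℝ)))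

/-- The value at `x` of the order `n` component of a jet. -/
def JetSpace.eval (N : ℕ) (n : Fin (N + 1)) (x : R3) : JetSpace N →L[ℝ] (R3 [×(n : ℕ)]→L[ℝ] ℝ) :=
  (BoundedContinuousFunction.evalCLM ℝ x).comp
    (ContinuousLinearMap.proj (R := ℝ)
      (φ := fun n : Fin (N + 1) => BoundedContinuousFunction R3 (R3 [×(n : ℕ)]→L[ℝ] ℝ)) n)

theorem JetSpace.ext {N : ℕ} {u v : JetSpace N} (h : ∀ n x, JetSpace.eval N n x u = JetSpace.eval N n x v) :
    u = v := by
  refine funext fun n => ?_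
  ext1 x
  exact h n x

/-- The linear map sending a Schwartz function to its weighted derivatives up to order `N`. -/
def jet (N : ℕ) : TestFn →ₗ[ℝ] JetSpace N where
  toFun φ n := weightedDeriv N n φ
  map_add' φ ψ := by
    refine JetSpace.ext fun n x => ?_
    change (1 + ‖x‖) ^ N • iteratedFDeriv ℝ n (φ + ψ : TestFn) x =
      (1 + ‖x‖) ^ N • iteratedFDeriv ℝ n φ x + (1 + ‖x‖) ^ N • iteratedFDeriv ℝ n ψ x
    rw [← smul_add, ← iteratedFDeriv_add_apply (φ.smooth n).contDiffAt (ψ.smooth n).contDiffAt]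
    rfl
  map_smul' c φ := by
    refine JetSpace.ext fun n x => ?_
    change (1 + ‖x‖) ^ N • iteratedFDeriv ℝ n (c • φ : TestFn) x =
      c • (1 + ‖x‖) ^ N • iteratedFDeriv ℝ n φ x
    rw [smul_comm c, ← iteratedFDeriv_const_smul_apply (φ.smooth n).contDiffAt]
    rfl

theorem eval_jet (N : ℕ) (φ : TestFn) (n : Fin (N + 1)) (x : R3) :
    JetSpace.eval N n x (jet N φ) = (1 + ‖x‖) ^ N • iteratedFDeriv ℝ n φ x := rfl

theorem norm_jet_le {N : ℕ} {φ : TestFn} {M : ℝ} (hM : 0 ≤ M)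
    (h : ∀ n ≤ N, ∀ x, (1 + ‖x‖) ^ N * ‖iteratedFDeriv ℝ n φ x‖ ≤ M) : ‖jet N φ‖ ≤ M := by
  refine (pi_norm_le_iff_of_nonneg hM).2 fun n => ?_
  refine (BoundedContinuousFunction.norm_le hM).2 fun x => ?_
  change ‖(1 + ‖x‖) ^ N • iteratedFDeriv ℝ n φ x‖ ≤ M
  rw [norm_smul, Real.norm_of_nonneg (by positivity)]
  exact h n (Nat.lt_succ_iff.1 n.2) x

theorem le_norm_jet {N n : ℕ} (hn : n ≤ N) (φ : TestFn) (x : R3) :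
    (1 + ‖x‖) ^ N * ‖iteratedFDeriv ℝ n φ x‖ ≤ ‖jet N φ‖ := by
  have h1 : ‖weightedDeriv N n φ‖ ≤ ‖jet N φ‖ :=
    norm_le_pi_norm (G := fun n : Fin (N + 1) =>
      BoundedContinuousFunction R3 (R3 [×(n : ℕ)]→L[ℝ] ℝ)) (jet N φ) ⟨n, Nat.lt_succ_iff.2 hn⟩
  have h2 := (weightedDeriv N n φ).norm_coe_le_norm x
  rw [weightedDeriv_apply, norm_smul, Real.norm_of_nonneg (by positivity)] at h2
  exact h2.trans h1

theorem norm_jet_mono {M N : ℕ} (h : M ≤ N) (φ : TestFn) : ‖jet M φ‖ ≤ ‖jet N φ‖ := by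
  refine norm_jet_le (norm_nonneg _) fun n hn x => le_trans ?_ (le_norm_jet (hn.trans h) φ x)
  gcongr
  linarith [norm_nonneg x]

theorem jet_injective (N : ℕ) : Function.Injective (jet N) := by
  rw [injective_iff_map_eq_zero]
  intro φ h
  ext x
  have := le_norm_jet (Nat.zero_le N) φ x
  rw [h, norm_zero, norm_iteratedFDeriv_zero] at this
  have h1 : 0 < (1 + ‖x‖) ^ N := by positivity
  have h2 : ‖φ x‖ ≤ 0 := by nlinarith [norm_nonneg (φ x)]
  simpa using h2

theorem one_add_norm_le (x y : R3) : 1 + ‖x‖ ≤ (1 + ‖x + y‖) * (1 + ‖y‖) := by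
  have : ‖x‖ ≤ ‖x + y‖ + ‖y‖ := by
    simpa using norm_sub_le (x + y) y
  nlinarith [norm_nonneg (x + y), norm_nonneg y]

/-- Translating by `y` costs a factor `(1 + |y|) ^ N`, as `1 + |x| ≤ (1 + |x + y|) (1 + |y|)`. -/
theorem norm_jet_shift_le (N : ℕ) (φ : TestFn) (y : R3) :
    ‖jet N (shift y φ)‖ ≤ (1 + ‖y‖) ^ N * ‖jet N φ‖ := by
  refine norm_jet_le (by positivity) fun n hn x => ?_
  rw [iteratedFDeriv_shift]
  calc _ ≤ ((1 + ‖x + y‖) * (1 + ‖y‖)) ^ N * ‖iteratedFDeriv ℝ n φ (x + y)‖ := by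
        gcongr; exact one_add_norm_le x y
    _ = (1 + ‖y‖) ^ N * ((1 + ‖x + y‖) ^ N * ‖iteratedFDeriv ℝ n φ (x + y)‖) := by
        rw [mul_pow]; ring
    _ ≤ _ := by gcongr; exact le_norm_jet hn φ _

/-- Translations are Lipschitz from one jet norm to the next: one derivative more is spent on the
mean value inequality along the segment from `x` to `x + y`. -/
theorem norm_jet_shift_sub_le (N : ℕ) (φ : TestFn) (y : R3) :
    ‖jet N (shift y φ - φ)‖ ≤ (1 + ‖y‖) ^ N * ‖jet (N + 1) φ‖ * ‖y‖ := by
  refine norm_jet_le (by positivity) fun n hn x => ?_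
  have hd : iteratedFDeriv ℝ n (shift y φ - φ : TestFn) x =
      iteratedFDeriv ℝ n φ (x + y) - iteratedFDeriv ℝ n φ x := by
    rw [← iteratedFDeriv_shift]
    exact iteratedFDeriv_sub_apply ((shift y φ).smooth n).contDiffAt (φ.smooth n).contDiffAt
  have hpos : 0 < (1 + ‖x‖) ^ N := by positivity
  have key : ‖iteratedFDeriv ℝ n φ (x + y) - iteratedFDeriv ℝ n φ x‖ ≤
      ((1 + ‖y‖) ^ N * ‖jet (N + 1) φ‖ / (1 + ‖x‖) ^ N) * ‖x + y - x‖ := by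
    refine Convex.norm_image_sub_le_of_norm_fderiv_le (𝕜 := ℝ) (s := segment ℝ x (x + y))
      (fun z _ => ?_) (fun z hz => ?_) (convex_segment _ _) (left_mem_segment _ _ _)
      (right_mem_segment _ _ _)
    · exact ((φ.smooth (n + 1)).differentiable_iteratedFDeriv (by exact_mod_cast n.lt_succ_self)) z
    · rw [norm_fderiv_iteratedFDeriv, le_div_iff₀ hpos]
      rw [segment_eq_image'] at hz
      obtain ⟨θ, hθ, rfl⟩ := hz
      simp only [add_sub_cancel_left]
      have hy : ‖θ • y‖ ≤ ‖y‖ := by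
        rw [norm_smul, Real.norm_of_nonneg hθ.1]
        exact mul_le_of_le_one_left (norm_nonneg _) hθ.2
      calc _ ≤ ‖iteratedFDeriv ℝ (n + 1) φ (x + θ • y)‖ *
            ((1 + ‖x + θ • y‖) * (1 + ‖y‖)) ^ N := by
            gcongr
            refine (one_add_norm_le x (θ • y)).trans ?_
            gcongr
        _ = (1 + ‖y‖) ^ N *
            ((1 + ‖x + θ • y‖) ^ N * ‖iteratedFDeriv ℝ (n + 1) φ (x + θ • y)‖) := by
            rw [mul_pow]; ring
        _ ≤ (1 + ‖y‖) ^ N *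
            ((1 + ‖x + θ • y‖) ^ (N + 1) * ‖iteratedFDeriv ℝ (n + 1) φ (x + θ • y)‖) := by
            gcongr
            · linarith [norm_nonneg (x + θ • y)]
            · omega
        _ ≤ _ := by gcongr; exact le_norm_jet (by omega) φ _
  rw [hd]
  rw [add_sub_cancel_left] at key
  calc _ ≤ (1 + ‖x‖) ^ N * (((1 + ‖y‖) ^ N * ‖jet (N + 1) φ‖ / (1 + ‖x‖) ^ N) * ‖y‖) := by
        gcongr
    _ = _ := by field_simp

theorem continuous_jet_shift (N : ℕ) (φ : TestFn) : Continuous fun y => jet N (shift y φ) := by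
  rw [continuous_iff_continuousAt]
  intro y₀
  rw [ContinuousAt, tendsto_iff_norm_sub_tendsto_zero]
  have hb : Tendsto (fun y : R3 => (1 + ‖y - y₀‖) ^ N * ‖jet (N + 1) (shift y₀ φ)‖ * ‖y - y₀‖)
      (𝓝 y₀) (𝓝 0) := by
    have : Continuous fun y : R3 =>
      (1 + ‖y - y₀‖) ^ N * ‖jet (N + 1) (shift y₀ φ)‖ * ‖y - y₀‖ := by fun_prop
    simpa using this.tendsto y₀
  refine squeeze_zero (fun _ => norm_nonneg _) (fun y => ?_) hb
  have h := norm_jet_shift_sub_le N (shift y₀ φ) (y - y₀)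
  rwa [shift_shift, sub_add_cancel, map_sub] at h

/-- Continuous linear maps on Schwartz functions with values in a normed space are bounded by
one of the jet norms. -/
theorem exists_bound_jet {G : Type*} [NormedAddCommGroup G] [NormedSpace ℝ G]
    (L : TestFn →L[ℝ] G) : ∃ (N : ℕ) (C : ℝ), 0 ≤ C ∧ ∀ φ, ‖L φ‖ ≤ C * ‖jet N φ‖ := by
  have hq : Continuous ((normSeminorm ℝ G).comp L.toLinearMap) := by
    change Continuous fun φ => ‖L φ‖
    exact L.continuous.norm
  obtain ⟨s, C, -, hC⟩ := Seminorm.bound_of_continuous (schwartz_withSeminorms ℝ R3 ℝ) _ hq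
  set N := s.sup fun m => max m.1 m.2 with hN
  refine ⟨N, C, C.2, fun φ => (hC φ).trans ?_⟩
  rw [_root_.smul_apply, NNReal.smul_def, smul_eq_mul]
  gcongr
  refine Seminorm.finset_sup_apply_le (norm_nonneg _) fun m hm => ?_
  have hmN : max m.1 m.2 ≤ N := Finset.le_sup (f := fun m : ℕ × ℕ => max m.1 m.2) hm
  refine SchwartzMap.seminorm_le_bound ℝ m.1 m.2 φ (norm_nonneg _) fun x => ?_
  refine le_trans ?_ (le_norm_jet ((le_max_right _ _).trans hmN) φ x)
  gcongr
  calc ‖x‖ ^ m.1 ≤ (1 + ‖x‖) ^ m.1 := by gcongr; linarith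
    _ ≤ (1 + ‖x‖) ^ N := by
      gcongr
      · linarith [norm_nonneg x]
      · exact (le_max_left _ _).trans hmN

/-- Tempered distributions factor through one of the Banach spaces of jets, by the Hahn–Banach
theorem. -/
theorem exists_eq_comp_jet (f : TestFn →L[ℝ] ℝ) :
    ∃ (N : ℕ) (Λ : JetSpace N →L[ℝ] ℝ), ∀ φ, f φ = Λ (jet N φ) := by
  obtain ⟨N, C, -, hC⟩ := exists_bound_jet f
  let e := LinearEquiv.ofInjective (jet N) (jet_injective N)
  have he : ∀ x, jet N (e.symm x) = x := fun x => by
    conv_rhs => rw [← e.apply_symm_apply x]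
    rfl
  let g : LinearMap.range (jet N) →L[ℝ] ℝ :=
    LinearMap.mkContinuous (f.toLinearMap ∘ₗ e.symm.toLinearMap) C fun x => by
      have := hC (e.symm x)
      rw [he] at this
      exact this
  obtain ⟨Λ, hΛ, -⟩ := exists_extension_norm_eq _ g
  refine ⟨N, Λ, fun φ => ?_⟩
  have h := hΛ (e φ)
  have h2 : g (e φ) = f φ := by
    change f (e.symm (e φ)) = f φ
    rw [e.symm_apply_apply]
  rw [h2] at h
  exact h.symm

theorem continuous_apply_shift (f : TestFn →L[ℝ] ℝ) (φ : TestFn) :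
    Continuous fun y => f (shift y φ) := by
  obtain ⟨N, Λ, h⟩ := exists_eq_comp_jet f
  simp only [h]
  exact Λ.continuous.comp (continuous_jet_shift N φ)

theorem abs_apply_shift_le (f : TestFn →L[ℝ] ℝ) (φ : TestFn) :
    ∃ (N : ℕ) (C : ℝ), 0 ≤ C ∧ ∀ y, |f (shift y φ)| ≤ C * (1 + ‖y‖) ^ N := by
  obtain ⟨N, C, hC, h⟩ := exists_bound_jet f
  refine ⟨N, C * ‖jet N φ‖, by positivity, fun y => (h _).trans ?_⟩
  calc _ ≤ C * ((1 + ‖y‖) ^ N * ‖jet N φ‖) := by gcongr; exact norm_jet_shift_le N φ y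
    _ = _ := by ring

theorem integrable_one_add_norm_pow_mul (k : TestFn) (N : ℕ) :
    Integrable fun y : R3 => (1 + ‖y‖) ^ N * ‖k y‖ := by
  have h1 := (k.integrable_pow_mul volume N).const_mul (2 ^ N : ℝ)
  have h2 := (k.integrable (μ := volume)).norm.const_mul (2 ^ N : ℝ)
  refine (h1.add h2).mono' (by fun_prop) (ae_of_all _ fun y => ?_)
  rw [Real.norm_of_nonneg (by positivity)]
  simp only [Pi.add_apply]
  rw [← mul_add, ← add_one_mul, ← mul_assoc]
  gcongr
  rcases le_total ‖y‖ 1 with h | h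
  · calc (1 + ‖y‖) ^ N ≤ 2 ^ N * 1 := by rw [mul_one]; gcongr; linarith
      _ ≤ _ := by gcongr; linarith [pow_nonneg (norm_nonneg y) N]
  · calc (1 + ‖y‖) ^ N ≤ (2 * ‖y‖) ^ N := by gcongr; linarith
      _ = 2 ^ N * ‖y‖ ^ N := mul_pow _ _ _
      _ ≤ _ := by gcongr; linarith

theorem hasFDerivAt_integral_mul_shift {F : Type} [NormedAddCommGroup F] [NormedSpace ℝ F]
    (k : TestFn) (ψ : 𝓢(R3, F)) (x : R3) :
    HasFDerivAt (fun x => ∫ y, k y • ψ (x + y))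
      (∫ y, k y • SchwartzMap.fderivCLM ℝ R3 F ψ (x + y)) x := by
  have hmeas : ∀ {G : Type} [NormedAddCommGroup G] [NormedSpace ℝ G] (θ : 𝓢(R3, G)) (z : R3),
      AEStronglyMeasurable (fun y => k y • θ (z + y)) volume := fun θ z =>
    (k.continuous.smul (θ.continuous.comp (continuous_const.add continuous_id))).aestronglyMeasurable
  refine hasFDerivAt_integral_of_dominated_of_fderiv_le (s := univ) (F := fun x y => k y • ψ (x + y))
    (F' := fun x y => k y • SchwartzMap.fderivCLM ℝ R3 F ψ (x + y))
    (bound := fun y => SchwartzMap.seminorm ℝ 0 0 (SchwartzMap.fderivCLM ℝ R3 F ψ) * ‖k y‖)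
    univ_mem (Eventually.of_forall fun z => hmeas ψ z) ?_ (hmeas (SchwartzMap.fderivCLM ℝ R3 F ψ) x)
    (ae_of_all _ fun y z _ => ?_) (k.integrable.norm.const_mul _) (ae_of_all _ fun y z _ => ?_)
  · refine ((k.integrable (μ := volume)).norm.const_mul (SchwartzMap.seminorm ℝ 0 0 ψ)).mono'
      (hmeas ψ x) (ae_of_all _ fun y => ?_)
    rw [norm_smul, mul_comm]
    gcongr
    exact SchwartzMap.norm_le_seminorm ℝ ψ _
  · rw [norm_smul, mul_comm]
    gcongr
    exact SchwartzMap.norm_le_seminorm ℝ _ _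
  · have h := (ψ.hasFDerivAt (z + y)).comp z ((hasFDerivAt_id z).add_const y)
    have h2 := h.const_smul (k y)
    rw [ContinuousLinearMap.comp_id] at h2
    exact h2

theorem contDiff_integral_mul_shift (k : TestFn) (n : ℕ) :
    ∀ {F : Type} [NormedAddCommGroup F] [NormedSpace ℝ F] (ψ : 𝓢(R3, F)),
      ContDiff ℝ n (fun x => ∫ y, k y • ψ (x + y)) := by
  induction n with
  | zero =>
    intro F _ _ ψ
    exact contDiff_zero.2 (Differentiable.continuous
      fun x => (hasFDerivAt_integral_mul_shift k ψ x).differentiableAt)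
  | succ n ih =>
    intro F _ _ ψ
    -- The derivative is an integral of the same form, with the derivative of `ψ` for `ψ`.
    have : ((n + 1 : ℕ) : WithTop ℕ∞) = (n : WithTop ℕ∞) + 1 := by push_cast; rfl
    rw [this, contDiff_succ_iff_hasFDerivAt]
    · exact ⟨_, ih (SchwartzMap.fderivCLM ℝ R3 F ψ), hasFDerivAt_integral_mul_shift k ψ⟩

theorem iteratedFDeriv_integral_mul_shift (k : TestFn) (n : ℕ) :
    ∀ {F : Type} [NormedAddCommGroup F] [NormedSpace ℝ F] [CompleteSpace F] (ψ : 𝓢(R3, F))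
      (x : R3), iteratedFDeriv ℝ n (fun x => ∫ y, k y • ψ (x + y)) x =
        ∫ y, k y • iteratedFDeriv ℝ n ψ (x + y) := by
  induction n with
  | zero =>
    intro F _ _ _ ψ x
    simp only [iteratedFDeriv_zero_eq_comp, Function.comp_apply]
    have hL := (((continuousMultilinearCurryFin0 ℝ R3 F).symm.toContinuousLinearEquiv :
      F →L[ℝ] (R3 [×0]→L[ℝ] F))).integral_comp_comm (μ := volume)
      (φ := fun y => k y • ψ (x + y)) ?_
    · refine Eq.trans hL.symm (integral_congr_ae (ae_of_all _ fun y => ?_))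
      exact map_smul (continuousMultilinearCurryFin0 ℝ R3 F).symm _ _
    · refine ((k.integrable (μ := volume)).norm.const_mul (SchwartzMap.seminorm ℝ 0 0 ψ)).mono'
        (k.continuous.smul
          (ψ.continuous.comp (continuous_const.add continuous_id))).aestronglyMeasurable
        (ae_of_all _ fun y => ?_)
      rw [norm_smul, mul_comm]
      gcongr
      exact SchwartzMap.norm_le_seminorm ℝ ψ _
  | succ n ih =>
    intro F _ _ _ ψ x
    have hfd : fderiv ℝ (fun x => ∫ y, k y • ψ (x + y)) =
        fun x => ∫ y, k y • SchwartzMap.fderivCLM ℝ R3 F ψ (x + y) := by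
      funext z
      exact (hasFDerivAt_integral_mul_shift k ψ z).fderiv
    simp only [iteratedFDeriv_succ_eq_comp_right, Function.comp_apply, hfd]
    rw [ih (SchwartzMap.fderivCLM ℝ R3 F ψ) x]
    have hL := ContinuousLinearMap.integral_comp_comm (μ := volume) (𝕜 := ℝ)
      (((continuousMultilinearCurryRightEquiv' ℝ n R3 F).symm.toContinuousLinearEquiv :
        (R3 [×n]→L[ℝ] (R3 →L[ℝ] F)) →L[ℝ] (R3 [×(n + 1)]→L[ℝ] F)))
      (φ := fun y => k y • iteratedFDeriv ℝ n (SchwartzMap.fderivCLM ℝ R3 F ψ) (x + y)) ?_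
    · refine Eq.trans hL.symm (integral_congr_ae (ae_of_all _ fun y => ?_))
      exact map_smul (continuousMultilinearCurryRightEquiv' ℝ n R3 F).symm _ _
    · have hb : ∀ z, ‖iteratedFDeriv ℝ n (SchwartzMap.fderivCLM ℝ R3 F ψ) z‖ ≤
          SchwartzMap.seminorm ℝ 0 n (SchwartzMap.fderivCLM ℝ R3 F ψ) :=
        SchwartzMap.norm_iteratedFDeriv_le_seminorm ℝ _ n
      refine ((k.integrable (μ := volume)).norm.const_mul
        (SchwartzMap.seminorm ℝ 0 n (SchwartzMap.fderivCLM ℝ R3 F ψ))).mono'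
        (k.continuous.smul ((((SchwartzMap.fderivCLM ℝ R3 F ψ).smooth n).continuous_iteratedFDeriv
          le_rfl).comp (continuous_const.add continuous_id))).aestronglyMeasurable
        (ae_of_all _ fun y => ?_)
      rw [norm_smul, mul_comm]
      gcongr
      exact hb _

/-- The Schwartz function `x ↦ ∫ k(y) φ(x + y) dy`, the average of the translates of `φ` with
weight `k`. -/
def sconv (k φ : TestFn) : TestFn where
  toFun x := ∫ y, k y • φ (x + y)
  smooth' := contDiff_infty.2 fun n => contDiff_integral_mul_shift k n φ
  decay' K n := by
    set N := max K n with hN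
    refine ⟨∫ y, ‖jet N φ‖ * ((1 + ‖y‖) ^ N * ‖k y‖), fun x => ?_⟩
    rw [iteratedFDeriv_integral_mul_shift, ← Real.norm_of_nonneg (pow_nonneg (norm_nonneg x) K),
      ← norm_smul, ← integral_smul]
    refine norm_integral_le_of_norm_le ((integrable_one_add_norm_pow_mul k N).const_mul _)
      (ae_of_all _ fun y => ?_)
    rw [norm_smul, norm_smul, Real.norm_of_nonneg (pow_nonneg (norm_nonneg x) K)]
    calc ‖x‖ ^ K * (‖k y‖ * ‖iteratedFDeriv ℝ n φ (x + y)‖)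
        ≤ (1 + ‖x‖) ^ N * (‖k y‖ * ‖iteratedFDeriv ℝ n φ (x + y)‖) := by
          gcongr
          calc ‖x‖ ^ K ≤ (1 + ‖x‖) ^ K := by gcongr; linarith
            _ ≤ (1 + ‖x‖) ^ N := by
              gcongr
              · linarith [norm_nonneg x]
              · exact le_max_left _ _
      _ = ‖k y‖ * ((1 + ‖x‖) ^ N * ‖iteratedFDeriv ℝ n (shift y φ) x‖) := by
          rw [iteratedFDeriv_shift]; ring
      _ ≤ ‖k y‖ * ((1 + ‖y‖) ^ N * ‖jet N φ‖) := by
          exact mul_le_mul_of_nonneg_left ((le_norm_jet (le_max_right _ _) _ x).trans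
            (norm_jet_shift_le N φ y)) (norm_nonneg _)
      _ = _ := by ring

theorem sconv_apply (k φ : TestFn) (x : R3) : sconv k φ x = ∫ y, k y * φ (x + y) := rfl

/-- A tempered distribution commutes with averages of translates. -/
theorem apply_sconv (f : TestFn →L[ℝ] ℝ) (k φ : TestFn) :
    f (sconv k φ) = ∫ y, k y * f (shift y φ) := by
  obtain ⟨N, Λ, h⟩ := exists_eq_comp_jet f
  have hint : Integrable fun y => k y • jet N (shift y φ) := by
    refine ((integrable_one_add_norm_pow_mul k N).mul_const ‖jet N φ‖).mono'
      (k.continuous.smul (continuous_jet_shift N φ)).aestronglyMeasurable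
      (ae_of_all _ fun y => ?_)
    rw [norm_smul]
    calc _ ≤ ‖k y‖ * ((1 + ‖y‖) ^ N * ‖jet N φ‖) := by gcongr; exact norm_jet_shift_le N φ y
      _ = _ := by ring
  have hJ : jet N (sconv k φ) = ∫ y, k y • jet N (shift y φ) := by
    refine JetSpace.ext fun n x => ?_
    rw [← (JetSpace.eval N n x).integral_comp_comm hint, eval_jet]
    change (1 + ‖x‖) ^ N • iteratedFDeriv ℝ n (fun x => ∫ y, k y • φ (x + y)) x = _
    rw [iteratedFDeriv_integral_mul_shift, ← integral_smul]
    refine integral_congr_ae (ae_of_all _ fun y => ?_)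
    simp only [map_smul, eval_jet, iteratedFDeriv_shift]
    rw [smul_comm]
  simp only [h]
  rw [hJ, ← Λ.integral_comp_comm hint]
  simp only [map_smul, smul_eq_mul]

theorem TempDist.apply_sconv (f : TempDist) (k φ : TestFn) :
    f (sconv k φ) = ∫ y, k y * f (shift y φ) := _root_.apply_sconv f k φ

theorem TempDist.continuous_apply_shift (f : TempDist) (φ : TestFn) :
    Continuous fun y => f (shift y φ) := _root_.continuous_apply_shift f φ

theorem TempDist.abs_apply_shift_le (f : TempDist) (φ : TestFn) :
    ∃ (N : ℕ) (C : ℝ), 0 ≤ C ∧ ∀ y, |f (shift y φ)| ≤ C * (1 + ‖y‖) ^ N :=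
  _root_.abs_apply_shift_le f φ

theorem continuous_map_shift {G : Type*} [NormedAddCommGroup G] [NormedSpace ℝ G]
    (L : TestFn →L[ℝ] G) (φ : TestFn) : Continuous fun y => L (shift y φ) := by
  obtain ⟨N, C, hC, h⟩ := exists_bound_jet L
  rw [continuous_iff_continuousAt]
  intro y₀
  rw [ContinuousAt, tendsto_iff_norm_sub_tendsto_zero]
  have h1 := (tendsto_iff_norm_sub_tendsto_zero.1 ((continuous_jet_shift N φ).tendsto y₀)).const_mul C
  rw [mul_zero] at h1
  refine squeeze_zero (fun _ => norm_nonneg _) (fun y => ?_) h1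
  rw [← map_sub, ← map_sub]
  exact h _

/-! ### The heat kernel -/

theorem heatTest_apply_zero {t : ℝ} (ht : 0 < t) (y : R3) :
    heatTest t 0 y = (4 * Real.pi * t) ^ (-(3 / 2) : ℝ) * Real.exp (-(‖y‖ ^ 2 / (4 * t))) := by
  rw [heatTest_apply ht, zero_sub, norm_neg]

theorem heatTest_eq_shift {t : ℝ} (ht : 0 < t) (x : R3) :
    heatTest t x = shift (-x) (heatTest t 0) := by
  ext y
  rw [shift_apply, heatTest_apply ht, heatTest_apply_zero ht, ← norm_neg (x - y), neg_sub,
    sub_eq_add_neg]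

theorem heatTest_zero_neg {t : ℝ} (ht : 0 < t) (y : R3) : heatTest t 0 (-y) = heatTest t 0 y := by
  rw [heatTest_apply_zero ht, heatTest_apply_zero ht, norm_neg]

theorem heatTest_nonneg {t : ℝ} (ht : 0 < t) (y : R3) : 0 ≤ heatTest t 0 y := by
  rw [heatTest_apply_zero ht]; positivity

theorem heatTest_scale {t : ℝ} (ht : 0 < t) (z : R3) :
    Real.sqrt t ^ 3 * heatTest t 0 (Real.sqrt t • z) = heatTest 1 0 z := by
  have hs : 0 < Real.sqrt t := Real.sqrt_pos.mpr ht
  rw [heatTest_apply_zero ht, heatTest_apply_zero one_pos, norm_smul, Real.norm_of_nonneg hs.le,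
    mul_pow, Real.sq_sqrt ht.le, Real.mul_rpow (by positivity) ht.le, mul_one]
  have h1 : Real.sqrt t ^ 3 * t ^ (-(3 / 2) : ℝ) = 1 := by
    rw [Real.sqrt_eq_rpow, ← Real.rpow_natCast, ← Real.rpow_mul ht.le, ← Real.rpow_add ht]
    norm_num
  have h2 : t * ‖z‖ ^ 2 / (4 * t) = ‖z‖ ^ 2 / (4 * 1) := by field_simp
  rw [h2]
  linear_combination ((4 * Real.pi) ^ (-(3 / 2) : ℝ) * Real.exp (-(‖z‖ ^ 2 / (4 * 1)))) * h1

theorem finrank_R3 : Module.finrank ℝ R3 = 3 := by simp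

/-- Dilation of the integration variable on three-dimensional space. -/
theorem integral_dilate (F : R3 → ℝ) {r : ℝ} (hr : 0 < r) :
    ∫ y, F y = r ^ 3 * ∫ z, F (r • z) := by
  rw [Measure.integral_comp_smul, finrank_R3, smul_eq_mul, abs_of_pos (by positivity),
    ← mul_assoc, mul_inv_cancel₀ (by positivity), one_mul]

theorem integral_heatTest_mul {t : ℝ} (ht : 0 < t) (g : R3 → ℝ) :
    ∫ y, heatTest t 0 y * g y = ∫ z, heatTest 1 0 z * g (Real.sqrt t • z) := by
  rw [integral_dilate _ (Real.sqrt_pos.mpr ht), ← integral_const_mul]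
  congr 1; funext z
  rw [← heatTest_scale ht z]; ring

theorem integral_heatTest {t : ℝ} (ht : 0 < t) : ∫ y, heatTest t 0 y = 1 := by
  have h := GaussianFourier.integral_rexp_neg_mul_sq_norm (V := R3)
    (b := 1 / (4 * t)) (by positivity)
  have h2 : ∀ y, heatTest t 0 y =
      (4 * Real.pi * t) ^ (-(3 / 2) : ℝ) * Real.exp (-(1 / (4 * t)) * ‖y‖ ^ 2) := fun y => by
    rw [heatTest_apply_zero ht]; congr 2; ring
  simp only [h2]
  rw [integral_const_mul, h, finrank_R3]
  have : Real.pi / (1 / (4 * t)) = 4 * Real.pi * t := by field_simp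
  rw [this, ← Real.rpow_add (by positivity)]
  norm_num

theorem tendsto_integral_heatTest_mul {g : R3 → ℝ} (hg : Continuous g) {N : ℕ} {C : ℝ}
    (hb : ∀ y, |g y| ≤ C * (1 + ‖y‖) ^ N) :
    Tendsto (fun t => ∫ y, heatTest t 0 y * g y) (𝓝[>] 0) (𝓝 (g 0)) := by
  have hC : 0 ≤ C := by have := (abs_nonneg _).trans (hb 0); simpa using this
  have h0 : ∫ z, heatTest 1 0 z * g 0 = g 0 := by
    rw [integral_mul_const, integral_heatTest one_pos, one_mul]
  rw [← h0]
  have hlim : Tendsto (fun t : ℝ => ∫ z, heatTest 1 0 z * g (Real.sqrt t • z)) (𝓝[>] 0)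
      (𝓝 (∫ z, heatTest 1 0 z * g 0)) := by
    refine tendsto_integral_filter_of_dominated_convergence
      (fun z => C * ((1 + ‖z‖) ^ N * ‖heatTest 1 0 z‖)) ?_ ?_
      ((integrable_one_add_norm_pow_mul _ N).const_mul C) ?_
    · exact Eventually.of_forall fun t => ((heatTest 1 0).continuous.mul
        (hg.comp (continuous_const_smul _))).aestronglyMeasurable
    · filter_upwards [Ioo_mem_nhdsGT (one_pos : (0 : ℝ) < 1)] with t ht
      refine ae_of_all _ fun z => ?_
      have h1 : ‖Real.sqrt t • z‖ ≤ ‖z‖ := by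
        rw [norm_smul, Real.norm_of_nonneg (Real.sqrt_nonneg _)]
        exact mul_le_of_le_one_left (norm_nonneg _) (Real.sqrt_le_one.2 ht.2.le)
      calc ‖heatTest 1 0 z * g (Real.sqrt t • z)‖ = ‖heatTest 1 0 z‖ * |g (Real.sqrt t • z)| :=
            norm_mul _ _
        _ ≤ ‖heatTest 1 0 z‖ * (C * (1 + ‖z‖) ^ N) := by
            gcongr; exact (hb _).trans (by gcongr)
        _ = _ := by ring
    · refine ae_of_all _ fun z => ?_
      have h1 : Continuous fun t : ℝ => heatTest 1 0 z * g (Real.sqrt t • z) := by fun_prop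
      have h2 := h1.tendsto 0
      simp only [Real.sqrt_zero, zero_smul] at h2
      exact h2.mono_left nhdsWithin_le_nhds
  refine hlim.congr' ?_
  filter_upwards [self_mem_nhdsWithin] with t ht
  exact (integral_heatTest_mul ht g).symm

theorem sconv_heatTest_eq {t : ℝ} (ht : 0 < t) (φ : TestFn) :
    sconv (heatTest t 0) φ = sconv (affinePull (-1) 0 φ) (heatTest t 0) := by
  ext x
  rw [sconv_apply, sconv_apply]
  have h1 : ∀ y, affinePull (-1) 0 φ y = φ (-y) := fun y => by
    rw [affinePull_apply (by norm_num)]; simp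
  simp only [h1]
  rw [← integral_sub_left_eq_self (fun y => heatTest t 0 y * φ (x + y)) volume (-x)]
  congr 1; funext y
  rw [← heatTest_zero_neg ht]
  rw [mul_comm]
  congr 2 <;> abel

/-- The heat flow `∫ p(x - y, t) f`, paired with a Schwartz function. -/
theorem integral_heat_mul (f : TempDist) {t : ℝ} (ht : 0 < t) (φ : TestFn) :
    ∫ x, heat t f x * φ x = f (sconv (heatTest t 0) φ) := by
  rw [sconv_heatTest_eq ht, TempDist.apply_sconv, ← integral_neg_eq_self]
  congr 1; funext x
  rw [affinePull_apply (by norm_num), heat, heatTest_eq_shift ht, mul_comm]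
  simp

/-! ### Uniform bounds for the inclusion in the space of distributions -/

section Spaces

universe u

variable {E : Type u} [NormedAddCommGroup E] [NormedSpace ℝ E]

/-- The continuous functional `e ↦ ⟨e, φ⟩`. -/
def distPairing (ι : E →L[ℝ] TempDist) (φ : TestFn) : E →L[ℝ] ℝ :=
  (PointwiseConvergenceCLM.evalCLM (RingHom.id ℝ) ℝ φ).comp ι

theorem distPairing_apply (ι : E →L[ℝ] TempDist) (φ : TestFn) (e : E) : distPairing ι φ e = ι e φ := rfl

theorem distPairing_smul (ι : E →L[ℝ] TempDist) (c : ℝ) (φ : TestFn) :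
    distPairing ι (c • φ) = c • distPairing ι φ := by
  ext e; simp [distPairing_apply]

/-- Elements of the unit ball of `E` are uniformly bounded by one jet norm: by the uniform
boundedness principle, a sequence of test functions violating all such bounds would be
unbounded on some `e`. -/
theorem exists_uniform_bound [CompleteSpace E] (ι : E →L[ℝ] TempDist) :
    ∃ (N : ℕ) (C : ℝ), 0 ≤ C ∧ ∀ φ, ‖distPairing ι φ‖ ≤ C * ‖jet N φ‖ := by
  by_contra hcon
  push Not at hcon
  have hex : ∀ N : ℕ, ∃ φ, (N : ℝ) * ‖jet N φ‖ < ‖distPairing ι φ‖ := fun N => hcon N N N.cast_nonneg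
  choose φ hφ using hex
  have hpos : ∀ N, 0 < ‖jet N (φ N)‖ := fun N => by
    rw [norm_pos_iff]
    intro h0
    have h1 : φ N = 0 := jet_injective N (by rw [h0, map_zero])
    have h2 := hφ N
    rw [h1] at h2
    have h3 : distPairing ι 0 = 0 := by ext e; simp [distPairing_apply]
    simp [h3] at h2
  set ψ : ℕ → TestFn := fun N => ‖jet N (φ N)‖⁻¹ • φ N with hψ
  have hψ1 : ∀ N, ‖jet N (ψ N)‖ = 1 := fun N => by
    rw [hψ, map_smul, norm_smul, norm_inv, norm_norm, inv_mul_cancel₀ (hpos N).ne']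
  have hψ2 : ∀ N : ℕ, (N : ℝ) < ‖distPairing ι (ψ N)‖ := fun N => by
    rw [hψ, distPairing_smul, norm_smul, norm_inv, norm_norm, ← div_eq_inv_mul, lt_div_iff₀ (hpos N)]
    exact hφ N
  obtain ⟨C', hC'⟩ := banach_steinhaus (g := fun N => distPairing ι (ψ N)) fun e => by
    obtain ⟨N, C, hC, h⟩ := exists_bound_jet (ι e : TestFn →L[ℝ] ℝ)
    refine ⟨C + ∑ n ∈ Finset.range N, ‖distPairing ι (ψ n) e‖, fun n => ?_⟩
    rcases lt_or_ge n N with hn | hn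
    · have := Finset.single_le_sum (f := fun n => ‖distPairing ι (ψ n) e‖)
        (fun i _ => norm_nonneg _) (Finset.mem_range.2 hn)
      linarith
    · have h1 : ‖distPairing ι (ψ n) e‖ ≤ C * ‖jet N (ψ n)‖ := h (ψ n)
      have h2 : ‖jet N (ψ n)‖ ≤ 1 := (norm_jet_mono hn _).trans (hψ1 n).le
      have h3 := Finset.sum_nonneg (s := Finset.range N) (f := fun n => ‖distPairing ι (ψ n) e‖)
        fun i _ => norm_nonneg _
      nlinarith
  obtain ⟨n, hn⟩ := exists_nat_gt C'
  linarith [hC' n, hψ2 n]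

theorem abs_apply_le (ι : E →L[ℝ] TempDist) (e : E) (φ : TestFn) :
    |ι e φ| ≤ ‖distPairing ι φ‖ * ‖e‖ := (distPairing ι φ).le_opNorm e

theorem IsTranslationInvariant.abs_apply_shift_le {ι : E →L[ℝ] TempDist}
    (h : IsTranslationInvariant ι) (e : E) (φ : TestFn) (y : R3) :
    |ι e (shift y φ)| ≤ ‖distPairing ι φ‖ * ‖e‖ := by
  obtain ⟨g, hg, hn⟩ := h y e
  rw [← hg, ← hn]
  exact abs_apply_le ι g φ

/-- Pairings with a fixed Schwartz function are Lipschitz in the translation parameter. -/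
theorem IsTranslationInvariant.exists_lipschitz [CompleteSpace E] {ι : E →L[ℝ] TempDist}
    (h : IsTranslationInvariant ι) (φ : TestFn) :
    ∃ C, 0 ≤ C ∧ ∀ (e : E) (y z : R3),
      |ι e (shift z (shift y φ)) - ι e (shift z φ)| ≤ C * ‖y‖ * ‖e‖ := by
  obtain ⟨N, C, hC, hb⟩ := exists_uniform_bound ι
  refine ⟨C * (2 ^ N * ‖jet (N + 1) φ‖) + 2 * ‖distPairing ι φ‖, by positivity, fun e y z => ?_⟩
  -- For small `y` the difference `φ (· + y) - φ` is small in a jet norm, for large `y` translation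
  -- invariance bounds both terms.
  rcases le_total ‖y‖ 1 with hy | hy
  · rw [← map_sub, ← map_sub]
    have h1 := h.abs_apply_shift_le e (shift y φ - φ) z
    have h2 := (hb (shift y φ - φ)).trans
      (mul_le_mul_of_nonneg_left (norm_jet_shift_sub_le N φ y) hC)
    calc _ ≤ _ := h1
      _ ≤ C * ((1 + ‖y‖) ^ N * ‖jet (N + 1) φ‖ * ‖y‖) * ‖e‖ := by gcongr
      _ ≤ C * (2 ^ N * ‖jet (N + 1) φ‖ * ‖y‖) * ‖e‖ := by gcongr; linarith
      _ = C * (2 ^ N * ‖jet (N + 1) φ‖) * ‖y‖ * ‖e‖ := by ring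
      _ ≤ _ := by gcongr; linarith [norm_nonneg (distPairing ι φ)]
  · rw [shift_shift]
    have h1 := h.abs_apply_shift_le e φ (z + y)
    have h2 := h.abs_apply_shift_le e φ z
    calc _ ≤ |ι e (shift (z + y) φ)| + |ι e (shift z φ)| := abs_sub _ _
      _ ≤ (2 * ‖distPairing ι φ‖) * 1 * ‖e‖ := by linarith
      _ ≤ (2 * ‖distPairing ι φ‖) * ‖y‖ * ‖e‖ := by gcongr
      _ ≤ _ := by
        gcongr
        have : 0 ≤ C * (2 ^ N * ‖jet (N + 1) φ‖) := by positivity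
        linarith

/-! ### Weak integrals -/

/-- Functions with values in `E` which are weakly measurable and dominated by an integrable
function have a weak integral in `E`. -/
def HasWeakIntegrals (ι : E →L[ℝ] TempDist) : Prop :=
  ∀ (Ω : Type) [MeasurableSpace Ω] (μ : Measure Ω) (f : Ω → E) (g : Ω → ℝ),
    (∀ φ, AEMeasurable (fun ω => ι (f ω) φ) μ) → Integrable g μ → (∀ᵐ ω ∂μ, ‖f ω‖ ≤ g ω) →
      ∃ e : E, (∀ φ, ι e φ = ∫ ω, ι (f ω) φ ∂μ) ∧ ‖e‖ ≤ ∫ ω, g ω ∂μ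

theorem isSchwartzInclusion_injective {ι : E →L[ℝ] TempDist} {j : TestFn →L[ℝ] E}
    (hj : IsSchwartzInclusion ι j) : Function.Injective j := by
  rw [injective_iff_map_eq_zero]
  intro φ h
  have h1 := (hj φ φ).2
  rw [h, map_zero] at h1
  have h2 : ∫ x, φ x * φ x = 0 := h1.symm
  rw [integral_eq_zero_iff_of_nonneg (fun x => mul_self_nonneg _) (hj φ φ).1] at h2
  have h3 := (Continuous.ae_eq_iff_eq volume (φ.continuous.mul φ.continuous)
    continuous_zero).1 h2
  ext x
  have := congrFun h3 x
  simpa using this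

/-- In a dual space `E = F*` the functional `φ ↦ ∫ ⟨f, φ⟩` on `𝓢` is bounded for the norm of `F`;
its Hahn–Banach extension to `F` is the weak integral. -/
theorem hasWeakIntegrals_of_dual {ι : E →L[ℝ] TempDist} (h : IsDualOfDenselyFunctional ι) :
    HasWeakIntegrals ι := by
  obtain ⟨F, _, _, _, ιF, j, Φ, -, -, hj, -, hΦ⟩ := h
  intro Ω _ μ f g hf hg hfg
  have hb : ∀ φ, ∀ᵐ ω ∂μ, ‖ι (f ω) φ‖ ≤ g ω * ‖j φ‖ := fun φ => by
    filter_upwards [hfg] with ω hω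
    rw [← hΦ]
    calc ‖Φ (f ω) (j φ)‖ ≤ ‖Φ (f ω)‖ * ‖j φ‖ := (Φ (f ω)).le_opNorm _
      _ ≤ _ := by rw [Φ.norm_map]; gcongr
  have hint : ∀ φ, Integrable (fun ω => ι (f ω) φ) μ := fun φ =>
    (hg.mul_const ‖j φ‖).mono' (hf φ).aestronglyMeasurable (hb φ)
  have hg0 : 0 ≤ ∫ ω, g ω ∂μ := integral_nonneg_of_ae (by
    filter_upwards [hfg] with ω hω using (norm_nonneg _).trans hω)
  let e := LinearEquiv.ofInjective j.toLinearMap (isSchwartzInclusion_injective hj)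
  have he : ∀ x, j (e.symm x) = x := fun x => by
    conv_rhs => rw [← e.apply_symm_apply x]
    rfl
  -- The functional `φ ↦ ∫ ⟨f, φ⟩`, transported to the image of `𝓢` in `F`.
  let Λ : TestFn →ₗ[ℝ] ℝ :=
    { toFun := fun φ => ∫ ω, ι (f ω) φ ∂μ
      map_add' := fun φ ψ => by
        rw [← integral_add (hint φ) (hint ψ)]
        simp only [map_add]
      map_smul' := fun c φ => by
        simp only [map_smul, smul_eq_mul, RingHom.id_apply]
        rw [integral_const_mul] }
  let G : LinearMap.range j.toLinearMap →L[ℝ] ℝ :=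
    LinearMap.mkContinuous (Λ ∘ₗ e.symm.toLinearMap) (∫ ω, g ω ∂μ) fun x => by
      have h1 := norm_integral_le_of_norm_le (hg.mul_const _) (hb (e.symm x))
      rw [integral_mul_const, he] at h1
      exact h1
  obtain ⟨Ψ, hΨ, hn⟩ := exists_extension_norm_eq _ G
  refine ⟨Φ.symm Ψ, fun φ => ?_, ?_⟩
  · rw [← hΦ, Φ.apply_symm_apply]
    have h1 := hΨ (e φ)
    have h2 : G (e φ) = ∫ ω, ι (f ω) φ ∂μ := by
      change Λ (e.symm (e φ)) = _
      rw [e.symm_apply_apply]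
      rfl
    rw [h2] at h1
    exact h1
  · rw [Φ.symm.norm_map, hn]
    exact LinearMap.mkContinuous_norm_le _ hg0 _

/-- If `𝓢` is dense in `E`, then `E` is spanned by the countably many separable sets of
translates of the heat kernels at times `1 / (n + 1)`. -/
theorem separableSpace_of_denselyFunctional {ι : E →L[ℝ] TempDist}
    (h : IsDenselyFunctional ι) : TopologicalSpace.SeparableSpace E := by
  obtain ⟨-, -, j, -, hd⟩ := h
  have htpos : ∀ n : ℕ, (0 : ℝ) < 1 / (n + 1) := fun n => by positivity
  set S : Set E := ⋃ n : ℕ, range fun x : R3 => j (shift x (heatTest (1 / (n + 1)) 0)) with hS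
  have hsep : TopologicalSpace.IsSeparable (closure (Submodule.span ℝ S : Set E)) := by
    refine TopologicalSpace.IsSeparable.closure (TopologicalSpace.IsSeparable.span ?_)
    exact TopologicalSpace.IsSeparable.iUnion fun n => TopologicalSpace.isSeparable_range (continuous_map_shift j _)
  have htop : closure (Submodule.span ℝ S : Set E) = univ := by
    by_contra hne
    obtain ⟨e₀, he₀⟩ := (ne_univ_iff_exists_notMem _).1 hne
    obtain ⟨f, u, hfu, hf⟩ := geometric_hahn_banach_point_closed
      ((Submodule.span ℝ S).convex.closure) isClosed_closure he₀
    have hu : u < 0 := by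
      simpa using hf 0 (subset_closure (Submodule.span ℝ S).zero_mem)
    have hf0 : ∀ b ∈ Submodule.span ℝ S, f b = 0 := fun b hb => by
      by_contra hne
      have h1 := hf ((u / f b) • b) (subset_closure ((Submodule.span ℝ S).smul_mem _ hb))
      rw [map_smul, smul_eq_mul, div_mul_cancel₀ _ hne] at h1
      exact lt_irrefl _ h1
    -- A functional `f` vanishing on the heat kernels kills the heat regularizations of `φ`, which
    -- are averages of translated heat kernels, and hence their limit `φ`.
    have hfj : ∀ φ, f (j φ) = 0 := fun φ => by
      let L : TestFn →L[ℝ] ℝ := f.comp j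
      obtain ⟨N, C, -, hb⟩ := abs_apply_shift_le L φ
      have h1 := tendsto_integral_heatTest_mul (continuous_apply_shift L φ) hb
      rw [shift_zero] at h1
      have hseq : Tendsto (fun n : ℕ => (1 : ℝ) / (n + 1)) atTop (𝓝[>] 0) :=
        tendsto_nhdsWithin_iff.2 ⟨tendsto_one_div_add_atTop_nhds_zero_nat,
          Eventually.of_forall htpos⟩
      refine tendsto_nhds_unique (h1.comp hseq) ?_
      refine tendsto_const_nhds.congr fun n => ?_
      rw [Function.comp_apply, ← apply_sconv, sconv_heatTest_eq (htpos n), apply_sconv]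
      symm
      refine integral_eq_zero_of_ae (ae_of_all _ fun y => ?_)
      have : L (shift y (heatTest (1 / (n + 1)) 0)) = 0 :=
        hf0 _ (Submodule.subset_span (mem_iUnion.2 ⟨n, y, rfl⟩))
      exact mul_eq_zero_of_right _ this
    have hz : f = 0 := by
      have : (f : E → ℝ) = 0 := hd.equalizer f.continuous continuous_zero (funext hfj)
      ext e
      exact congrFun this e
    rw [hz] at hfu
    simp at hfu
    linarith
  rw [htop] at hsep
  exact TopologicalSpace.isSeparable_univ_iff.1 hsep

/-- A separable space has a countable separating family of test functions, so that weakly measurable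
functions are strongly measurable, and the weak integral is the Bochner integral. -/
theorem hasWeakIntegrals_of_dense [CompleteSpace E] {ι : E →L[ℝ] TempDist}
    (h : IsDenselyFunctional ι) : HasWeakIntegrals ι := by
  have := separableSpace_of_denselyFunctional h
  have hsc : SecondCountableTopology E := UniformSpace.secondCountable_of_separable E
  borelize E
  -- The complement of the origin is a Lindelöf space covered by the open sets `⟨e, φ⟩ ≠ 0`.
  obtain ⟨T, hT, hTu⟩ := TopologicalSpace.isOpen_iUnion_countable
    (fun φ : TestFn => {e : E | ι e φ ≠ 0}) fun φ =>
      isOpen_ne_fun (distPairing ι φ).continuous continuous_const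
  have hsepT : ∀ e : E, (∀ φ ∈ T, ι e φ = 0) → e = 0 := fun e he => by
    by_contra hne
    have h1 : ∃ φ, ι e φ ≠ 0 := by
      by_contra hall
      push Not at hall
      exact hne (h.1 (by rw [map_zero]; ext φ; exact hall φ))
    obtain ⟨φ, hφ⟩ := h1
    have h2 : e ∈ ⋃ φ : TestFn, {e : E | ι e φ ≠ 0} := mem_iUnion.2 ⟨φ, hφ⟩
    rw [← hTu] at h2
    obtain ⟨ψ, hψT, hψ⟩ := mem_iUnion₂.1 h2
    exact hψ (he ψ hψT)
  have : Countable T := hT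
  -- The countably many coordinates `⟨e, φ⟩` embed the Polish space `E` measurably in a product.
  have hemb : MeasurableEmbedding (fun (e : E) (φ : T) => ι e φ) := by
    refine Continuous.measurableEmbedding
      (continuous_pi fun φ => (distPairing ι (φ : TestFn)).continuous) fun e e' hee => ?_
    refine sub_eq_zero.1 (hsepT _ fun φ hφ => ?_)
    have h1 : ι e φ = ι e' φ := congrFun hee ⟨φ, hφ⟩
    change distPairing ι φ (e - e') = 0
    rw [map_sub, distPairing_apply, distPairing_apply, h1, sub_self]
  intro Ω _ μ f g hf hg hfg
  have hmeas : AEMeasurable f μ := by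
    rw [← hemb.aemeasurable_comp_iff]
    exact aemeasurable_pi_iff.2 fun φ => hf φ
  have hint : Integrable f μ := hg.mono' hmeas.aestronglyMeasurable hfg
  refine ⟨∫ ω, f ω ∂μ, fun φ => ?_, norm_integral_le_of_norm_le hg hfg⟩
  exact ((distPairing ι φ).integral_comp_comm hint).symm

theorem IsFunctionalTranslationInvariant.hasWeakIntegrals [CompleteSpace E]
    {ι : E →L[ℝ] TempDist} (h : IsFunctionalTranslationInvariant ι) : HasWeakIntegrals ι :=
  h.2.1.elim hasWeakIntegrals_of_dense hasWeakIntegrals_of_dual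

end Spaces

/-! ### Convolution kernels with given symbols -/

/-- The integral transform `(2π)^(-3) ∫ m(ξ) T(x·ξ) dξ`, of which `evenKernel` (`T = cos`) and
`oddKernel` (`T = -sin`) are the instances of interest. -/
def trigKernel (T : ℝ → ℝ) (m : R3 → ℝ) (x : R3) : ℝ :=
  ((2 * Real.pi) ^ 3)⁻¹ * ∫ ξ, m ξ * T (inner ℝ x ξ)

theorem evenKernel_eq_trigKernel : evenKernel = trigKernel Real.cos := rfl

theorem oddKernel_eq_trigKernel : oddKernel = trigKernel (fun s => -Real.sin s) := by
  funext m x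
  simp only [oddKernel, trigKernel, mul_neg, integral_neg]

/-- A continuous function bounded by `1` with an addition formula, such as `cos` and `-sin`. -/
structure IsTrig (T : ℝ → ℝ) : Prop where
  continuous : Continuous T
  abs_le_one : ∀ s, |T s| ≤ 1
  sub_formula : ∃ T' : ℝ → ℝ, ∀ s u, T (s - u) = T s * Real.cos u + T' s * Real.sin u

theorem isTrig_cos : IsTrig Real.cos :=
  ⟨Real.continuous_cos, Real.abs_cos_le_one, Real.sin, Real.cos_sub⟩

theorem isTrig_neg_sin : IsTrig (fun s => -Real.sin s) :=
  ⟨Real.continuous_sin.neg, fun s => by rw [abs_neg]; exact Real.abs_sin_le_one s, Real.cos,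
    fun s u => by rw [Real.sin_sub]; ring⟩

section trigKernel

variable {T : ℝ → ℝ} (hT : IsTrig T)

include hT

theorem IsTrig.integrable_mul {m : R3 → ℝ} (hm : Integrable m) (x : R3) :
    Integrable fun ξ => m ξ * T (inner ℝ x ξ) := by
  refine hm.norm.mono' (hm.aestronglyMeasurable.mul
    (hT.continuous.comp (by fun_prop)).aestronglyMeasurable) (ae_of_all _ fun ξ => ?_)
  rw [norm_mul]
  exact mul_le_of_le_one_right (norm_nonneg _) (hT.abs_le_one _)

theorem IsTrig.kernel_add {m m' : R3 → ℝ} (hm : Integrable m) (hm' : Integrable m') (x : R3) :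
    trigKernel T (fun ξ => m ξ + m' ξ) x = trigKernel T m x + trigKernel T m' x := by
  simp only [trigKernel, add_mul]
  rw [integral_add (hT.integrable_mul hm x) (hT.integrable_mul hm' x), mul_add]

theorem IsTrig.kernel_sub {m m' : R3 → ℝ} (hm : Integrable m) (hm' : Integrable m') (x : R3) :
    trigKernel T (fun ξ => m ξ - m' ξ) x = trigKernel T m x - trigKernel T m' x := by
  simp only [trigKernel, sub_mul]
  rw [integral_sub (hT.integrable_mul hm x) (hT.integrable_mul hm' x), mul_sub]

omit hT in
theorem trigKernel_const_mul (c : ℝ) (m : R3 → ℝ) (x : R3) :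
    trigKernel T (fun ξ => c * m ξ) x = c * trigKernel T m x := by
  simp only [trigKernel, mul_assoc]
  rw [integral_const_mul]; ring

omit hT in
theorem trigKernel_dilate (m : R3 → ℝ) {r : ℝ} (hr : 0 < r) (x : R3) :
    trigKernel T (fun ξ => m (r • ξ)) x = (r ^ 3)⁻¹ * trigKernel T m (r⁻¹ • x) := by
  simp only [trigKernel]
  rw [integral_dilate (fun ξ => m ξ * T (inner ℝ (r⁻¹ • x) ξ)) hr]
  have : ∀ ξ, inner ℝ (r⁻¹ • x) (r • ξ) = inner ℝ x ξ := fun ξ => by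
    rw [real_inner_smul_left, real_inner_smul_right, ← mul_assoc, inv_mul_cancel₀ hr.ne', one_mul]
  simp only [this]
  have : r ^ 3 ≠ 0 := by positivity
  field_simp

theorem IsTrig.continuous_kernel {m : R3 → ℝ} (hm : Integrable m) : Continuous (trigKernel T m) := by
  refine continuous_const.mul ?_
  refine continuous_of_dominated (bound := fun ξ => ‖m ξ‖)
    (fun x => (hT.integrable_mul hm x).aestronglyMeasurable)
    (fun x => ae_of_all _ fun ξ => ?_) hm.norm (ae_of_all _ fun ξ => ?_)
  · rw [norm_mul]
    exact mul_le_of_le_one_right (norm_nonneg _) (hT.abs_le_one _)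
  · exact continuous_const.mul (hT.continuous.comp (by fun_prop))

/-- Superposition of kernels. -/
theorem IsTrig.superposition {Ω : Type} [MeasurableSpace Ω] {μ : Measure Ω} [SFinite μ]
    {M : Ω → R3 → ℝ} (hmeas : Measurable (Function.uncurry M))
    (hint : Integrable (Function.uncurry M) (μ.prod volume)) {c : Ω → ℝ} (hc : Integrable c μ)
    (hk : ∀ᵐ ω ∂μ, Integrable (trigKernel T (M ω)) ∧ ∫ x, |trigKernel T (M ω) x| ≤ c ω) :
    Integrable (trigKernel T (fun ξ => ∫ ω, M ω ξ ∂μ)) ∧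
      ∫ x, |trigKernel T (fun ξ => ∫ ω, M ω ξ ∂μ) x| ≤ ∫ ω, c ω ∂μ := by
  have heq : ∀ x, trigKernel T (fun ξ => ∫ ω, M ω ξ ∂μ) x = ∫ ω, trigKernel T (M ω) x ∂μ := by
    intro x
    simp only [trigKernel]
    rw [integral_const_mul]
    congr 1
    simp only [← integral_mul_const]
    refine integral_integral_swap (f := fun ξ ω => M ω ξ * T (inner ℝ x ξ)) ?_
    refine hint.swap.norm.mono' ?_ (ae_of_all _ fun z => ?_)
    · refine Measurable.aestronglyMeasurable ?_
      exact (hmeas.comp measurable_swap).mul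
        (hT.continuous.measurable.comp (by fun_prop))
    · simp only [Function.uncurry, Function.comp]
      rw [norm_mul]
      exact mul_le_of_le_one_right (norm_nonneg _) (hT.abs_le_one _)
  have hsm : StronglyMeasurable (Function.uncurry fun ω x => trigKernel T (M ω) x) := by
    refine StronglyMeasurable.const_mul ?_ _
    have : StronglyMeasurable (fun z : (Ω × R3) × R3 => M z.1.1 z.2 * T (inner ℝ z.1.2 z.2)) := by
      refine Measurable.stronglyMeasurable ?_
      exact (hmeas.comp (by fun_prop : Measurable fun z : (Ω × R3) × R3 => (z.1.1, z.2))).mul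
        (hT.continuous.measurable.comp (by fun_prop))
    exact this.integral_prod_right
  have hprod : Integrable (Function.uncurry fun ω x => trigKernel T (M ω) x)
      (μ.prod volume) := by
    rw [integrable_prod_iff hsm.aestronglyMeasurable]
    refine ⟨hk.mono fun ω h => h.1, hc.mono' ?_ (hk.mono fun ω h => ?_)⟩
    · exact hsm.aestronglyMeasurable.norm.integral_prod_right'
    · rw [Real.norm_of_nonneg (integral_nonneg fun x => norm_nonneg _)]
      exact h.2
  have heq' : trigKernel T (fun ξ => ∫ ω, M ω ξ ∂μ) = fun x => ∫ ω, trigKernel T (M ω) x ∂μ :=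
    funext heq
  have h1 : Integrable fun x => ∫ ω, trigKernel T (M ω) x ∂μ := hprod.integral_prod_right
  refine ⟨heq' ▸ h1, ?_⟩
  simp only [heq]
  calc ∫ x, |∫ ω, trigKernel T (M ω) x ∂μ| ≤ ∫ x, ∫ ω, |trigKernel T (M ω) x| ∂μ :=
        integral_mono h1.abs hprod.abs.integral_prod_right
          fun x => abs_integral_le_integral_abs
    _ = ∫ ω, (∫ x, |trigKernel T (M ω) x|) ∂μ :=
        (integral_integral_swap (f := fun (ω : Ω) (x : R3) => |trigKernel T (M ω) x|) hprod.abs).symm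
    _ ≤ ∫ ω, c ω ∂μ :=
        integral_mono_ae hprod.abs.integral_prod_left hc (hk.mono fun ω h => h.2)

end trigKernel

theorem integrable_dilate {F : R3 → ℝ} (hF : Integrable F) {r : ℝ} (hr : r ≠ 0) :
    Integrable fun x => F (r • x) := hF.comp_smul hr

theorem integrable_kernel_dilate {T : ℝ → ℝ} {m : R3 → ℝ} (hm : Integrable (trigKernel T m))
    {r : ℝ} (hr : 0 < r) : Integrable (trigKernel T (fun ξ => m (r • ξ))) ∧
      ∫ x, |trigKernel T (fun ξ => m (r • ξ)) x| = ∫ x, |trigKernel T m x| := by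
  have h : trigKernel T (fun ξ => m (r • ξ)) =
    fun x => (r ^ 3)⁻¹ * trigKernel T m (r⁻¹ • x) := funext fun x => trigKernel_dilate m hr x
  refine ⟨?_, ?_⟩
  · rw [h]
    exact (integrable_dilate hm (inv_ne_zero hr.ne')).const_mul _
  · simp only [h, abs_mul]
    rw [integral_const_mul, integral_dilate (fun x => |trigKernel T m x|) (inv_pos.2 hr),
      abs_of_pos (by positivity), inv_pow]

/-! ### Relation with the Fourier transform -/

open FourierTransform in
theorem fourier_eq_kernels {m : R3 → ℝ} (hm : Integrable m) (x : R3) :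
    𝓕 (fun ξ => (m ξ : ℂ)) ((2 * Real.pi)⁻¹ • x) =
      ((2 * Real.pi) ^ 3 : ℝ) * ((evenKernel m x : ℂ) + oddKernel m x * Complex.I) := by
  have hπ : ((2 * Real.pi) ^ 3 : ℝ) ≠ 0 := by positivity
  rw [Real.fourier_eq']
  have h1 : ∀ ξ : R3, Complex.exp (↑(-2 * Real.pi * inner ℝ ξ ((2 * Real.pi)⁻¹ • x)) * Complex.I) •
      (m ξ : ℂ) = ((m ξ * Real.cos (inner ℝ x ξ) : ℝ) : ℂ) +
        ((m ξ * -Real.sin (inner ℝ x ξ) : ℝ) : ℂ) * Complex.I := fun ξ => by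
    have h2 : -2 * Real.pi * inner ℝ ξ ((2 * Real.pi)⁻¹ • x) = -inner ℝ x ξ := by
      rw [real_inner_smul_right, real_inner_comm]
      field_simp
    rw [h2, Complex.exp_mul_I, smul_eq_mul, ← Complex.ofReal_cos, ← Complex.ofReal_sin,
      Real.cos_neg, Real.sin_neg]
    push_cast
    ring
  simp only [h1]
  rw [integral_add (isTrig_cos.integrable_mul hm x).ofReal
    ((isTrig_neg_sin.integrable_mul hm x).ofReal.mul_const _), integral_mul_const,
    integral_complex_ofReal, integral_complex_ofReal]
  simp only [oddKernel_eq_trigKernel, evenKernel_eq_trigKernel, trigKernel]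
  rw [mul_add, ← mul_assoc, ← Complex.ofReal_mul, ← Complex.ofReal_mul, ← mul_assoc, ← mul_assoc,
    mul_inv_cancel₀ hπ, one_mul, one_mul]

theorem oddKernel_eq_zero_of_even {m : R3 → ℝ} (he : ∀ ξ, m (-ξ) = m ξ) (x : R3) :
    oddKernel m x = 0 := by
  have h : ∫ ξ, m ξ * Real.sin (inner ℝ x ξ) = -∫ ξ, m ξ * Real.sin (inner ℝ x ξ) := by
    conv_lhs => rw [← integral_neg_eq_self]
    rw [← integral_neg]
    congr 1; funext ξ
    rw [he, inner_neg_right, Real.sin_neg, mul_neg]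
  rw [oddKernel]
  have : ∫ ξ, m ξ * Real.sin (inner ℝ x ξ) = 0 := by linarith
  rw [this]; simp

theorem evenKernel_neg (m : R3 → ℝ) (x : R3) : evenKernel m (-x) = evenKernel m x := by
  simp only [evenKernel, inner_neg_left, Real.cos_neg]

open FourierTransform in
/-- Fourier inversion for even symbols with integrable kernel. -/
theorem integral_evenKernel_mul_cos {m : R3 → ℝ} (hc : Continuous m) (he : ∀ ξ, m (-ξ) = m ξ)
    (hm : Integrable m) (hk : Integrable (evenKernel m)) (ξ : R3) :
    ∫ x, evenKernel m x * Real.cos (inner ℝ x ξ) = m ξ := by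
  have hπ : (0 : ℝ) < 2 * Real.pi := by positivity
  set M : R3 → ℂ := fun ξ => (m ξ : ℂ) with hM
  have hF : ∀ w, 𝓕 M w = (((2 * Real.pi) ^ 3 * evenKernel m ((2 * Real.pi) • w) : ℝ) : ℂ) := by
    intro w
    have h := fourier_eq_kernels hm ((2 * Real.pi) • w)
    rw [smul_smul, inv_mul_cancel₀ hπ.ne', one_smul, oddKernel_eq_zero_of_even he] at h
    rw [h]
    push_cast
    ring
  have hFi : Integrable (𝓕 M) := by
    have : 𝓕 M = fun w => (((2 * Real.pi) ^ 3 * evenKernel m ((2 * Real.pi) • w) : ℝ) : ℂ) :=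
      funext hF
    rw [this]
    exact ((integrable_dilate hk hπ.ne').const_mul _).ofReal
  have hinv := congrFun (Continuous.fourierInv_fourier_eq
    (Complex.continuous_ofReal.comp hc : Continuous M) hm.ofReal hFi) ξ
  rw [Real.fourierInv_eq'] at hinv
  have h1 : ∀ v : R3, Complex.exp (↑(2 * Real.pi * inner ℝ v ξ) * Complex.I) • 𝓕 M v =
      (((2 * Real.pi) ^ 3 * (evenKernel m ((2 * Real.pi) • v) *
        Real.cos (inner ℝ ((2 * Real.pi) • v) ξ)) : ℝ) : ℂ) +
      (((2 * Real.pi) ^ 3 * (evenKernel m ((2 * Real.pi) • v) *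
        Real.sin (inner ℝ ((2 * Real.pi) • v) ξ)) : ℝ) : ℂ) * Complex.I := fun v => by
    rw [hF, real_inner_smul_left, Complex.exp_mul_I, smul_eq_mul, ← Complex.ofReal_cos,
      ← Complex.ofReal_sin]
    push_cast
    ring
  replace hinv := (integral_congr_ae (ae_of_all _ fun v => (h1 v).symm)).trans hinv
  have hc1 : Integrable fun x => evenKernel m x * Real.cos (inner ℝ x ξ) := by
    refine hk.norm.mono' (hk.aestronglyMeasurable.mul (by fun_prop)) (ae_of_all _ fun x => ?_)
    rw [norm_mul]
    exact mul_le_of_le_one_right (norm_nonneg _) (Real.abs_cos_le_one _)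
  have hs1 : Integrable fun x => evenKernel m x * Real.sin (inner ℝ x ξ) := by
    refine hk.norm.mono' (hk.aestronglyMeasurable.mul (by fun_prop)) (ae_of_all _ fun x => ?_)
    rw [norm_mul]
    exact mul_le_of_le_one_right (norm_nonneg _) (Real.abs_sin_le_one _)
  rw [integral_add ((integrable_dilate hc1 hπ.ne').const_mul _).ofReal
    (((integrable_dilate hs1 hπ.ne').const_mul _).ofReal.mul_const _), integral_mul_const,
    integral_complex_ofReal, integral_complex_ofReal, integral_const_mul, integral_const_mul,
    ← integral_dilate (fun x => evenKernel m x * Real.cos (inner ℝ x ξ)) hπ,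
    ← integral_dilate (fun x => evenKernel m x * Real.sin (inner ℝ x ξ)) hπ] at hinv
  have := congrArg Complex.re hinv
  simpa [hM] using this

/-- Complexification of real Schwartz functions. -/
def complexify (φ : TestFn) : 𝓢(R3, ℂ) := SchwartzMap.postcompCLM Complex.ofRealCLM φ

open FourierTransform in
theorem integrable_kernels_schwartz (φ : TestFn) :
    Integrable (evenKernel φ) ∧ Integrable (oddKernel φ) := by
  have hπ : (2 * Real.pi) ≠ 0 := by positivity
  have h1 : Integrable fun x : R3 => 𝓕 (fun ξ => (φ ξ : ℂ)) ((2 * Real.pi)⁻¹ • x) := by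
    have h2 : Integrable (𝓕 (complexify φ) : 𝓢(R3, ℂ)) := SchwartzMap.integrable _
    exact h2.comp_smul (inv_ne_zero hπ)
  simp only [fourier_eq_kernels φ.integrable] at h1
  have hre := h1.re.const_mul ((2 * Real.pi) ^ 3)⁻¹
  have him := h1.im.const_mul ((2 * Real.pi) ^ 3)⁻¹
  have hπ3 : ((2 * Real.pi) ^ 3) ≠ 0 := by positivity
  constructor
  · refine hre.congr (ae_of_all _ fun x => ?_)
    simp only [RCLike.re_to_complex, Complex.add_re, Complex.ofReal_re,
      Complex.mul_re, Complex.I_re, Complex.I_im, Complex.ofReal_im]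
    field_simp
    ring
  · refine him.congr (ae_of_all _ fun x => ?_)
    simp only [RCLike.im_to_complex, Complex.add_im, Complex.ofReal_re,
      Complex.mul_im, Complex.I_re, Complex.I_im, Complex.ofReal_im]
    field_simp
    ring

/-! ### Integrable kernels and multipliers -/

/-- The symbol `m` is integrable, and its kernel has `L¹` norm at most `C`. -/
structure KernelBound (T : ℝ → ℝ) (m : R3 → ℝ) (C : ℝ) : Prop where
  symbol : Integrable m
  kernel : Integrable (trigKernel T m)
  norm_le : ∫ x, |trigKernel T m x| ≤ C

/-- The even continuous symbol `m` is the Fourier transform of an integrable function of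
norm at most `C`. -/
structure EvenMultiplier (m : R3 → ℝ) (C : ℝ) : Prop extends KernelBound Real.cos m C where
  cont : Continuous m
  even : ∀ ξ, m (-ξ) = m ξ

namespace KernelBound

variable {T : ℝ → ℝ} {m m' : R3 → ℝ} {C C' : ℝ}

theorem nonneg (h : KernelBound T m C) : 0 ≤ C :=
  (integral_nonneg fun _ => abs_nonneg _).trans h.norm_le

theorem mono (h : KernelBound T m C) (hC : C ≤ C') : KernelBound T m C' :=
  ⟨h.symbol, h.kernel, h.norm_le.trans hC⟩

theorem congr (h : KernelBound T m C) (hm : ∀ ξ, m ξ = m' ξ) : KernelBound T m' C := by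
  rwa [← funext hm]

theorem add (hT : IsTrig T) (h : KernelBound T m C) (h' : KernelBound T m' C') :
    KernelBound T (fun ξ => m ξ + m' ξ) (C + C') := by
  have heq := funext (hT.kernel_add h.symbol h'.symbol)
  refine ⟨h.symbol.add h'.symbol, heq ▸ h.kernel.add h'.kernel, ?_⟩
  simp only [heq]
  refine (integral_mono (h.kernel.add h'.kernel).abs (h.kernel.abs.add h'.kernel.abs)
    fun x => abs_add_le _ _).trans ?_
  simp only [Pi.add_apply]
  rw [integral_add h.kernel.abs h'.kernel.abs]
  exact add_le_add h.norm_le h'.norm_le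

theorem const_mul (h : KernelBound T m C) (c : ℝ) :
    KernelBound T (fun ξ => c * m ξ) (|c| * C) := by
  have heq : trigKernel T (fun ξ => c * m ξ) = fun x => c * trigKernel T m x :=
    funext (trigKernel_const_mul c m)
  refine ⟨h.symbol.const_mul c, heq ▸ h.kernel.const_mul c, ?_⟩
  simp only [heq, abs_mul]
  rw [integral_const_mul]
  exact mul_le_mul_of_nonneg_left h.norm_le (abs_nonneg c)

theorem sub (hT : IsTrig T) (h : KernelBound T m C) (h' : KernelBound T m' C') :
    KernelBound T (fun ξ => m ξ - m' ξ) (C + C') := by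
  have := h.add hT (h'.const_mul (-1))
  simpa [sub_eq_add_neg] using this

theorem dilate (h : KernelBound T m C) {r : ℝ} (hr : 0 < r) :
    KernelBound T (fun ξ => m (r • ξ)) C :=
  ⟨integrable_dilate h.symbol hr.ne', (integrable_kernel_dilate h.kernel hr).1,
    (integrable_kernel_dilate h.kernel hr).2.le.trans h.norm_le⟩

theorem superposition (hT : IsTrig T) {Ω : Type} [MeasurableSpace Ω] {μ : Measure Ω} [SFinite μ]
    {M : Ω → R3 → ℝ} (hmeas : Measurable (Function.uncurry M)) {c d : Ω → ℝ}
    (hc : Integrable c μ) (hd : Integrable d μ)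
    (hk : ∀ᵐ ω ∂μ, KernelBound T (M ω) (c ω) ∧ ∫ ξ, |M ω ξ| ≤ d ω) :
    KernelBound T (fun ξ => ∫ ω, M ω ξ ∂μ) (∫ ω, c ω ∂μ) := by
  have hint : Integrable (Function.uncurry M) (μ.prod volume) := by
    rw [integrable_prod_iff hmeas.aestronglyMeasurable]
    refine ⟨hk.mono fun ω h => h.1.symbol, hd.mono' ?_ (hk.mono fun ω h => ?_)⟩
    · exact hmeas.aestronglyMeasurable.norm.integral_prod_right'
    · rw [Real.norm_of_nonneg (integral_nonneg fun x => norm_nonneg _)]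
      exact h.2
  have h := hT.superposition hmeas hint hc (hk.mono fun ω h => ⟨h.1.kernel, h.1.norm_le⟩)
  exact ⟨hint.integral_prod_right, h.1, h.2⟩

end KernelBound

namespace EvenMultiplier

variable {m m' : R3 → ℝ} {C C' : ℝ}

theorem inversion (h : EvenMultiplier m C) (ξ : R3) :
    ∫ x, evenKernel m x * Real.cos (inner ℝ x ξ) = m ξ :=
  integral_evenKernel_mul_cos h.cont h.even h.symbol h.kernel ξ

theorem integrable_mul_cos (h : EvenMultiplier m C) (ξ : R3) :
    Integrable fun x => evenKernel m x * Real.cos (inner ℝ x ξ) := by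
  refine h.kernel.norm.mono' (h.kernel.aestronglyMeasurable.mul (by fun_prop))
    (ae_of_all _ fun x => ?_)
  rw [norm_mul]
  exact mul_le_of_le_one_right (norm_nonneg _) (Real.abs_cos_le_one _)

theorem abs_le (h : EvenMultiplier m C) (ξ : R3) : |m ξ| ≤ C := by
  rw [← h.inversion ξ]
  refine abs_integral_le_integral_abs.trans (le_trans ?_ h.norm_le)
  refine integral_mono (h.integrable_mul_cos ξ).abs h.kernel.abs fun x => ?_
  change |evenKernel m x * _| ≤ |evenKernel m x|
  rw [abs_mul]
  exact mul_le_of_le_one_right (abs_nonneg _) (Real.abs_cos_le_one _)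

theorem mono (h : EvenMultiplier m C) (hC : C ≤ C') : EvenMultiplier m C' :=
  ⟨h.toKernelBound.mono hC, h.cont, h.even⟩

theorem congr (h : EvenMultiplier m C) (hm : ∀ ξ, m ξ = m' ξ) : EvenMultiplier m' C := by
  rwa [← funext hm]

theorem sub (h : EvenMultiplier m C) (h' : EvenMultiplier m' C') :
    EvenMultiplier (fun ξ => m ξ - m' ξ) (C + C') :=
  ⟨h.toKernelBound.sub isTrig_cos h'.toKernelBound, h.cont.sub h'.cont,
    fun ξ => by rw [h.even, h'.even]⟩

theorem const_mul (h : EvenMultiplier m C) (c : ℝ) :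
    EvenMultiplier (fun ξ => c * m ξ) (|c| * C) :=
  ⟨h.toKernelBound.const_mul c, h.cont.const_mul c, fun ξ => by rw [h.even]⟩

theorem dilate (h : EvenMultiplier m C) {r : ℝ} (hr : 0 < r) :
    EvenMultiplier (fun ξ => m (r • ξ)) C :=
  ⟨h.toKernelBound.dilate hr, h.cont.comp (continuous_const_smul r),
    fun ξ => by rw [smul_neg, h.even]⟩

theorem integral_mul_trig (h : EvenMultiplier m C) {T : ℝ → ℝ} (hT : IsTrig T) (x ξ : R3) :
    ∫ y, evenKernel m y * T (inner ℝ (x - y) ξ) = m ξ * T (inner ℝ x ξ) := by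
  obtain ⟨T', hT'⟩ := hT.sub_formula
  have hs1 : Integrable fun y => evenKernel m y * Real.sin (inner ℝ y ξ) := by
    refine h.kernel.norm.mono' (h.kernel.aestronglyMeasurable.mul (by fun_prop))
      (ae_of_all _ fun x => ?_)
    rw [norm_mul]
    exact mul_le_of_le_one_right (norm_nonneg _) (Real.abs_sin_le_one _)
  have hs0 : ∫ y, evenKernel m y * Real.sin (inner ℝ y ξ) = 0 := by
    have h1 : ∫ y, evenKernel m y * Real.sin (inner ℝ y ξ) =
        -∫ y, evenKernel m y * Real.sin (inner ℝ y ξ) := by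
      conv_lhs => rw [← integral_neg_eq_self]
      rw [← integral_neg]
      congr 1; funext y
      rw [evenKernel_neg, inner_neg_left, Real.sin_neg, mul_neg]
    linarith
  have h2 : ∀ y, evenKernel m y * T (inner ℝ (x - y) ξ) =
      T (inner ℝ x ξ) * (evenKernel m y * Real.cos (inner ℝ y ξ)) +
        T' (inner ℝ x ξ) * (evenKernel m y * Real.sin (inner ℝ y ξ)) := fun y => by
    rw [inner_sub_left, hT']; ring
  simp only [h2]
  rw [integral_add ((h.integrable_mul_cos ξ).const_mul _) (hs1.const_mul _), integral_const_mul,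
    integral_const_mul, hs0, h.inversion]
  ring

/-- The convolution theorem for an even multiplier and an arbitrary kernel. -/
theorem integral_kernel_mul (h : EvenMultiplier m C) {T : ℝ → ℝ} (hT : IsTrig T)
    (hm' : Integrable m') (x : R3) :
    ∫ y, evenKernel m y * trigKernel T m' (x - y) = trigKernel T (fun ξ => m ξ * m' ξ) x := by
  simp only [trigKernel]
  have h1 : ∀ y, evenKernel m y *
      (((2 * Real.pi) ^ 3)⁻¹ * ∫ ξ, m' ξ * T (inner ℝ (x - y) ξ)) =
      ((2 * Real.pi) ^ 3)⁻¹ * ∫ ξ, evenKernel m y * (m' ξ * T (inner ℝ (x - y) ξ)) := fun y => by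
    rw [integral_const_mul]; ring
  simp only [h1]
  rw [integral_const_mul]
  congr 1
  rw [integral_integral_swap]
  · congr 1; funext ξ
    have h2 : ∀ y, evenKernel m y * (m' ξ * T (inner ℝ (x - y) ξ)) =
        m' ξ * (evenKernel m y * T (inner ℝ (x - y) ξ)) := fun y => by ring
    simp only [h2]
    rw [integral_const_mul, h.integral_mul_trig hT]
    ring
  · have h3 : Integrable (fun z : R3 × R3 => evenKernel m z.1 * m' z.2) (volume.prod volume) :=
      h.kernel.mul_prod hm'
    refine h3.norm.mono' ?_ (ae_of_all _ fun z => ?_)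
    · have h4 : AEStronglyMeasurable (fun z : R3 × R3 => T (inner ℝ (x - z.1) z.2))
          (volume.prod volume) :=
        (hT.continuous.comp (by fun_prop)).aestronglyMeasurable
      refine (h3.aestronglyMeasurable.mul h4).congr (ae_of_all _ fun z => ?_)
      simp only [Function.uncurry, Pi.mul_apply]
      ring
    · simp only [Function.uncurry]
      rw [← mul_assoc, norm_mul]
      exact mul_le_of_le_one_right (norm_nonneg _) (hT.abs_le_one _)

theorem mul_kernelBound (h : EvenMultiplier m C) {T : ℝ → ℝ} (hT : IsTrig T)
    (h' : KernelBound T m' C') : KernelBound T (fun ξ => m ξ * m' ξ) (C * C') := by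
  have hprod : Integrable (fun z : R3 × R3 => evenKernel m z.2 * trigKernel T m' (z.1 - z.2))
      (volume.prod volume) :=
    h.kernel.convolution_integrand (ContinuousLinearMap.mul ℝ ℝ) h'.kernel
  have heq : trigKernel T (fun ξ => m ξ * m' ξ) =
      fun x => ∫ y, evenKernel m y * trigKernel T m' (x - y) :=
    funext fun x => (h.integral_kernel_mul hT h'.symbol x).symm
  refine ⟨?_, ?_, ?_⟩
  · refine (h'.symbol.norm.const_mul C).mono' (h.cont.aestronglyMeasurable.mul
      h'.symbol.aestronglyMeasurable) (ae_of_all _ fun ξ => ?_)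
    rw [norm_mul]
    exact mul_le_mul_of_nonneg_right (h.abs_le ξ) (norm_nonneg _)
  · rw [heq]
    exact hprod.integral_prod_left
  · simp only [heq]
    calc ∫ x, |∫ y, evenKernel m y * trigKernel T m' (x - y)|
        ≤ ∫ x, ∫ y, |evenKernel m y * trigKernel T m' (x - y)| :=
          integral_mono hprod.integral_prod_left.abs hprod.abs.integral_prod_left
            fun x => abs_integral_le_integral_abs
      _ = ∫ y, ∫ x, |evenKernel m y * trigKernel T m' (x - y)| :=
          integral_integral_swap (f := fun x y => |evenKernel m y * trigKernel T m' (x - y)|)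
            hprod.abs
      _ = ∫ y, |evenKernel m y| * ∫ x, |trigKernel T m' x| := by
          congr 1; funext y
          simp only [abs_mul]
          rw [integral_const_mul, integral_sub_right_eq_self (fun x => |trigKernel T m' x|)]
      _ = (∫ y, |evenKernel m y|) * ∫ x, |trigKernel T m' x| := integral_mul_const _ _
      _ ≤ C * C' := mul_le_mul h.norm_le h'.norm_le (integral_nonneg fun _ => abs_nonneg _)
          h.nonneg

theorem mul (h : EvenMultiplier m C) (h' : EvenMultiplier m' C') :
    EvenMultiplier (fun ξ => m ξ * m' ξ) (C * C') :=
  ⟨h.mul_kernelBound isTrig_cos h'.toKernelBound, h.cont.mul h'.cont,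
    fun ξ => by rw [h.even, h'.even]⟩

end EvenMultiplier

/-! ### Gaussian symbols -/

theorem exists_kernelBound_schwartz (φ : TestFn) :
    ∃ C, 0 ≤ C ∧ KernelBound Real.cos φ C ∧ KernelBound (fun s => -Real.sin s) φ C := by
  have h := integrable_kernels_schwartz φ
  rw [evenKernel_eq_trigKernel, oddKernel_eq_trigKernel] at h
  have h0 : ∀ T, 0 ≤ ∫ x, |trigKernel T φ x| := fun T => integral_nonneg fun _ => abs_nonneg _
  refine ⟨(∫ x, |trigKernel Real.cos φ x|) + ∫ x, |trigKernel (fun s => -Real.sin s) φ x|,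
    add_nonneg (h0 _) (h0 _), ⟨φ.integrable, h.1, ?_⟩, ⟨φ.integrable, h.2, ?_⟩⟩
  · linarith [h0 fun s => -Real.sin s]
  · linarith [h0 Real.cos]

/-- The Gaussian `exp (-|ξ|²)` as a Schwartz function. -/
def gaussianOne : TestFn := affinePull 2 0 gaussianTest

theorem gaussianOne_apply (ξ : R3) : gaussianOne ξ = Real.exp (-‖ξ‖ ^ 2) := by
  rw [gaussianOne, affinePull_apply two_ne_zero]
  change Real.exp (-(‖(2 : ℝ) • ξ + 0‖ ^ 2 / 4)) = _
  rw [add_zero, norm_smul, Real.norm_of_nonneg zero_le_two]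
  congr 1; ring

/-- A function of temperate growth times the Gaussian `exp (-|ξ|²)` has integrable kernels. -/
theorem exists_kernelBound_mul_gaussian {g : R3 → ℝ} (hg : g.HasTemperateGrowth) :
    ∃ C, 0 ≤ C ∧ KernelBound Real.cos (fun ξ => g ξ * Real.exp (-‖ξ‖ ^ 2)) C ∧
      KernelBound (fun s => -Real.sin s) (fun ξ => g ξ * Real.exp (-‖ξ‖ ^ 2)) C := by
  have h := exists_kernelBound_schwartz (SchwartzMap.smulLeftCLM ℝ g gaussianOne)
  have heq : (SchwartzMap.smulLeftCLM ℝ g gaussianOne : R3 → ℝ) =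
      fun ξ => g ξ * Real.exp (-‖ξ‖ ^ 2) := funext fun ξ => by
    rw [SchwartzMap.smulLeftCLM_apply_apply hg, gaussianOne_apply, smul_eq_mul]
  rwa [heq] at h

theorem heatSymbol_dilate {s : ℝ} (hs : 0 < s) (ξ : R3) :
    heatSymbol s ξ = Real.exp (-‖Real.sqrt s • ξ‖ ^ 2) := by
  rw [heatSymbol, norm_smul, Real.norm_of_nonneg (Real.sqrt_nonneg _), mul_pow, Real.sq_sqrt hs.le]

theorem heatSymbol_add (s t : ℝ) (ξ : R3) : heatSymbol (s + t) ξ = heatSymbol s ξ * heatSymbol t ξ := by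
  rw [heatSymbol, heatSymbol, heatSymbol, ← Real.exp_add]; congr 1; ring

theorem continuous_heatSymbol (s : ℝ) : Continuous (heatSymbol s) := by
  unfold heatSymbol; fun_prop

theorem heatSymbol_neg (s : ℝ) (ξ : R3) : heatSymbol s (-ξ) = heatSymbol s ξ := by
  rw [heatSymbol, heatSymbol, norm_neg]

theorem integrable_heatSymbol {s : ℝ} (hs : 0 < s) : Integrable (heatSymbol s) := by
  have h1 := integrable_dilate (gaussianOne.integrable (μ := volume)) (Real.sqrt_pos.2 hs).ne'
  refine h1.congr (ae_of_all _ fun ξ => ?_)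
  rw [heatSymbol_dilate hs]
  exact gaussianOne_apply _

open FourierTransform in
theorem evenKernel_heatSymbol {s : ℝ} (hs : 0 < s) : evenKernel (heatSymbol s) = heatTest s 0 := by
  funext x
  have h1 := fourier_eq_kernels (integrable_heatSymbol hs) x
  rw [oddKernel_eq_zero_of_even (heatSymbol_neg s)] at h1
  have h2 := fourier_gaussian_innerProductSpace (V := R3) (b := (s : ℂ)) (by simpa using hs)
    ((2 * Real.pi)⁻¹ • x)
  have h3 : (fun v : R3 => Complex.exp (-(s : ℂ) * ‖v‖ ^ 2)) =
      fun ξ => ((heatSymbol s ξ : ℝ) : ℂ) := by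
    funext v
    rw [heatSymbol]
    push_cast
    congr 1; ring
  rw [h3, h1, finrank_R3] at h2
  have h4 : ((Real.pi : ℂ) / s) ^ (((3 : ℕ) : ℂ) / 2) = (((Real.pi / s) ^ (3 / 2 : ℝ) : ℝ) : ℂ) := by
    rw [Complex.ofReal_cpow (by positivity)]
    push_cast
    rfl
  rw [h4] at h2
  have h5 : Complex.exp (-(Real.pi : ℂ) ^ 2 * ‖(2 * Real.pi)⁻¹ • x‖ ^ 2 / s) =
      ((Real.exp (-(‖x‖ ^ 2 / (4 * s))) : ℝ) : ℂ) := by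
    rw [norm_smul, Real.norm_of_nonneg (by positivity)]
    push_cast
    congr 1
    have : (Real.pi : ℂ) ≠ 0 := by exact_mod_cast Real.pi_ne_zero
    have : (s : ℂ) ≠ 0 := by exact_mod_cast hs.ne'
    field_simp
    norm_num
    ring
  rw [h5] at h2
  have h6 : (2 * Real.pi) ^ 3 * evenKernel (heatSymbol s) x =
      (Real.pi / s) ^ (3 / 2 : ℝ) * Real.exp (-(‖x‖ ^ 2 / (4 * s))) := by
    have : ((((2 * Real.pi) ^ 3 * evenKernel (heatSymbol s) x : ℝ)) : ℂ) =
      (((Real.pi / s) ^ (3 / 2 : ℝ) * Real.exp (-(‖x‖ ^ 2 / (4 * s))) : ℝ) : ℂ) := by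
      rw [Complex.ofReal_mul, Complex.ofReal_mul, ← h2]
      simp
    exact_mod_cast this
  rw [heatTest_apply_zero hs]
  have hπ : (0 : ℝ) < (2 * Real.pi) ^ 3 := by positivity
  refine mul_left_cancel₀ hπ.ne' (h6.trans ?_)
  rw [← mul_assoc]
  congr 1
  have h7 : (2 * Real.pi) ^ 3 = ((2 * Real.pi) ^ 2) ^ (3 / 2 : ℝ) := by
    rw [← Real.rpow_natCast (2 * Real.pi) 2, ← Real.rpow_mul (by positivity),
      ← Real.rpow_natCast]
    norm_num
  rw [h7, Real.rpow_neg (by positivity), ← Real.inv_rpow (by positivity),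
    ← Real.mul_rpow (by positivity) (by positivity)]
  congr 1
  field_simp
  ring

theorem evenMultiplier_heatSymbol {s : ℝ} (hs : 0 < s) : EvenMultiplier (heatSymbol s) 1 := by
  refine ⟨⟨integrable_heatSymbol hs, ?_, ?_⟩, continuous_heatSymbol s, heatSymbol_neg s⟩
  · rw [← evenKernel_eq_trigKernel, evenKernel_heatSymbol hs]
    exact (heatTest s 0).integrable
  · rw [← evenKernel_eq_trigKernel, evenKernel_heatSymbol hs]
    simp only [abs_of_nonneg (heatTest_nonneg hs _)]
    exact (integral_heatTest hs).le

/-! ### Symbols of the projected divergence and of fractional powers -/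

theorem hasTemperateGrowth_coord (j : Fin 3) : Function.HasTemperateGrowth (fun ξ : R3 => ξ j) :=
  (EuclideanSpace.proj j : R3 →L[ℝ] ℝ).hasTemperateGrowth

theorem heatSymbol_one (ξ : R3) : heatSymbol 1 ξ = Real.exp (-‖ξ‖ ^ 2) := by
  rw [heatSymbol, one_mul]

/-- The non-local part of the symbol of the Leray projected divergence is a superposition of
Gaussians times cubic monomials. -/
theorem exists_kernelBound_cubic (j k l : Fin 3) :
    ∃ C, KernelBound (fun s => -Real.sin s)
      (fun ξ => ξ l * ξ j * ξ k / ‖ξ‖ ^ 2 * heatSymbol 1 ξ) C := by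
  set g : R3 → ℝ := fun ξ => ξ l * ξ j * ξ k with hg
  have hgt : g.HasTemperateGrowth :=
    ((hasTemperateGrowth_coord l).mul (hasTemperateGrowth_coord j)).mul (hasTemperateGrowth_coord k)
  obtain ⟨C, hC, -, hK⟩ := exists_kernelBound_mul_gaussian hgt
  -- The cubic monomial gives the factor `r ^ (-3/2)`, which is integrable at infinity.
  have hM : ∀ r, 0 < r → ∀ ξ, g ξ * Real.exp (-(r * ‖ξ‖ ^ 2)) =
      r ^ (-(3 / 2) : ℝ) * (g (Real.sqrt r • ξ) * Real.exp (-‖Real.sqrt r • ξ‖ ^ 2)) := by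
    intro r hr ξ
    have h1 : g (Real.sqrt r • ξ) = Real.sqrt r ^ 3 * g ξ := by simp [hg]; ring
    have h2 : Real.sqrt r ^ 3 * r ^ (-(3 / 2) : ℝ) = 1 := by
      rw [Real.sqrt_eq_rpow, ← Real.rpow_natCast, ← Real.rpow_mul hr.le, ← Real.rpow_add hr]
      norm_num
    rw [h1, ← heatSymbol_dilate hr, heatSymbol]
    linear_combination (-(g ξ * Real.exp (-(r * ‖ξ‖ ^ 2)))) * h2
  have hrp : IntegrableOn (fun r : ℝ => r ^ (-(3 / 2) : ℝ)) (Ioi 1) :=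
    integrableOn_Ioi_rpow_of_lt (by norm_num) one_pos
  set I := ∫ ξ, |g ξ * Real.exp (-‖ξ‖ ^ 2)| with hI
  have h := KernelBound.superposition isTrig_neg_sin (μ := volume.restrict (Ioi (1 : ℝ)))
    (M := fun r ξ => g ξ * Real.exp (-(r * ‖ξ‖ ^ 2))) (c := fun r => r ^ (-(3 / 2) : ℝ) * C)
    (d := fun r => r ^ (-(3 / 2) : ℝ) * I) ?_ (hrp.mul_const C) (hrp.mul_const I) ?_
  · refine ⟨_, h.congr fun ξ => ?_⟩
    rw [integral_const_mul]
    rcases eq_or_ne ξ 0 with rfl | hξ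
    · simp [hg]
    · have hn : (0 : ℝ) < ‖ξ‖ ^ 2 := by positivity
      have h1 : ∀ r : ℝ, Real.exp (-(r * ‖ξ‖ ^ 2)) = Real.exp (-‖ξ‖ ^ 2 * r) := fun r => by
        congr 1; ring
      simp only [h1]
      -- `exp (-|ξ|²) / |ξ|² = ∫ exp (-r|ξ|²) dr` over `r > 1`.
      rw [integral_exp_mul_Ioi (by linarith), heatSymbol_one, mul_one]
      field_simp
      rfl
  · have : Measurable g := by simp only [hg]; fun_prop
    refine (this.comp measurable_snd).mul ?_
    fun_prop
  · filter_upwards [ae_restrict_mem measurableSet_Ioi] with r hr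
    have hr0 : (0 : ℝ) < r := one_pos.trans hr
    have hrp0 : (0 : ℝ) ≤ r ^ (-(3 / 2) : ℝ) := by positivity
    refine ⟨?_, ?_⟩
    · have h1 := (hK.dilate (Real.sqrt_pos.2 hr0)).const_mul (r ^ (-(3 / 2) : ℝ))
      rw [abs_of_nonneg hrp0] at h1
      exact h1.congr fun ξ => (hM r hr0 ξ).symm
    · simp only [hM r hr0]
      have h2 : (0 : ℝ) ≤ I := integral_nonneg fun _ => abs_nonneg _
      calc ∫ ξ, |r ^ (-(3 / 2) : ℝ) * (g (Real.sqrt r • ξ) * Real.exp (-‖Real.sqrt r • ξ‖ ^ 2))|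
          = r ^ (-(3 / 2) : ℝ) *
            ∫ ξ, |g (Real.sqrt r • ξ) * Real.exp (-‖Real.sqrt r • ξ‖ ^ 2)| := by
            rw [← integral_const_mul]
            congr 1; funext ξ
            rw [abs_mul, abs_of_nonneg hrp0]
        _ ≤ r ^ (-(3 / 2) : ℝ) * I := by
            gcongr
            rw [hI, integral_dilate (fun ξ => |g ξ * Real.exp (-‖ξ‖ ^ 2)|) (Real.sqrt_pos.2 hr0)]
            refine le_mul_of_one_le_left (integral_nonneg fun _ => abs_nonneg _) ?_
            exact one_le_pow₀ (Real.one_le_sqrt.2 (le_of_lt hr))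

theorem lerayDerivSymbol_smul (j k l : Fin 3) {r : ℝ} (hr : 0 < r) (ξ : R3) :
    lerayDerivSymbol j k l (r • ξ) = r * lerayDerivSymbol j k l ξ := by
  simp only [lerayDerivSymbol, PiLp.smul_apply, smul_eq_mul, norm_smul,
    Real.norm_of_nonneg hr.le]
  have h : r * ξ j * (r * ξ k) / (r * ‖ξ‖) ^ 2 = ξ j * ξ k / ‖ξ‖ ^ 2 := by
    rw [mul_pow, show r * ξ j * (r * ξ k) = r ^ 2 * (ξ j * ξ k) by ring,
      mul_div_mul_left _ _ (by positivity)]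
  rw [h]; ring

/-- The kernels of the projected divergence composed with the heat semigroup have `L¹` norm
`O(s^(-1/2))`. -/
theorem exists_kernelBound_leray :
    ∃ C, 0 ≤ C ∧ ∀ (j k l : Fin 3) (s : ℝ), 0 < s → KernelBound (fun s => -Real.sin s)
      (fun ξ => lerayDerivSymbol j k l ξ * heatSymbol s ξ) (C * s ^ (-(1 / 2) : ℝ)) := by
  have h1 : ∀ j k l : Fin 3, ∃ C, KernelBound (fun s => -Real.sin s)
      (fun ξ => lerayDerivSymbol j k l ξ * heatSymbol 1 ξ) C := by
    intro j k l
    obtain ⟨C₁, h₁⟩ := exists_kernelBound_cubic j k l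
    obtain ⟨C₂, -, -, h₂⟩ := exists_kernelBound_mul_gaussian (hasTemperateGrowth_coord l)
    refine ⟨_, ((h₂.const_mul (if j = k then 1 else 0)).sub isTrig_neg_sin h₁).congr fun ξ => ?_⟩
    rw [lerayDerivSymbol, heatSymbol_one]
    ring
  choose C hC using h1
  have hC0 : ∀ j k l, 0 ≤ C j k l := fun j k l => (hC j k l).nonneg
  refine ⟨∑ j, ∑ k, ∑ l, C j k l, Finset.sum_nonneg fun j _ => Finset.sum_nonneg fun k _ =>
    Finset.sum_nonneg fun l _ => hC0 j k l, fun j k l s hs => ?_⟩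
  have hle : C j k l ≤ ∑ j, ∑ k, ∑ l, C j k l := by
    calc C j k l ≤ ∑ l, C j k l :=
          Finset.single_le_sum (f := fun l => C j k l) (fun _ _ => hC0 _ _ _) (Finset.mem_univ l)
      _ ≤ ∑ k, ∑ l, C j k l := Finset.single_le_sum (f := fun k => ∑ l, C j k l)
          (fun _ _ => Finset.sum_nonneg fun _ _ => hC0 _ _ _) (Finset.mem_univ k)
      _ ≤ _ := Finset.single_le_sum (f := fun j => ∑ k, ∑ l, C j k l)
          (fun _ _ => Finset.sum_nonneg fun _ _ => Finset.sum_nonneg fun _ _ => hC0 _ _ _)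
          (Finset.mem_univ j)
  have hsp : (0 : ℝ) ≤ s ^ (-(1 / 2) : ℝ) := by positivity
  have h2 := ((hC j k l).dilate (Real.sqrt_pos.2 hs)).const_mul (s ^ (-(1 / 2) : ℝ))
  rw [abs_of_nonneg hsp] at h2
  refine (h2.congr fun ξ => ?_).mono ?_
  · rw [lerayDerivSymbol_smul j k l (Real.sqrt_pos.2 hs), heatSymbol_one, ← heatSymbol_dilate hs]
    have h3 : s ^ (-(1 / 2) : ℝ) * Real.sqrt s = 1 := by
      rw [Real.sqrt_eq_rpow, ← Real.rpow_add hs]; norm_num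
    linear_combination (lerayDerivSymbol j k l ξ * heatSymbol s ξ) * h3
  · rw [mul_comm]
    gcongr

theorem integrableOn_rpow_mul_one_add_rpow {β : ℝ} {n : ℕ} (hβ : 0 < β) (hn : β < n) :
    IntegrableOn (fun r : ℝ => r ^ (β - 1) * (1 + r) ^ (-(n : ℝ))) (Ioi 0) := by
  rw [← Ioc_union_Ioi_eq_Ioi zero_le_one]
  refine IntegrableOn.union ?_ ?_
  · have h1 : IntegrableOn (fun r : ℝ => r ^ (β - 1)) (Ioc 0 1) := by
      rw [← intervalIntegrable_iff_integrableOn_Ioc_of_le zero_le_one]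
      exact intervalIntegral.intervalIntegrable_rpow' (by linarith)
    refine h1.mono' (by fun_prop) ?_
    filter_upwards [ae_restrict_mem measurableSet_Ioc] with r hr
    have hr0 := hr.1
    rw [Real.norm_of_nonneg (by positivity)]
    refine mul_le_of_le_one_right (by positivity) ?_
    exact Real.rpow_le_one_of_one_le_of_nonpos (by linarith) (by simp)
  · have h1 : IntegrableOn (fun r : ℝ => r ^ (β - 1 - n)) (Ioi 1) :=
      integrableOn_Ioi_rpow_of_lt (by linarith) one_pos
    refine h1.mono' (by fun_prop) ?_
    filter_upwards [ae_restrict_mem measurableSet_Ioi] with r hr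
    have hr0 : (0 : ℝ) < r := one_pos.trans hr
    rw [Real.norm_of_nonneg (by positivity), sub_eq_add_neg (β - 1), Real.rpow_add hr0]
    gcongr ?_ * ?_
    exact Real.rpow_le_rpow_of_nonpos hr0 (by linarith) (by simp)

/-- The symbols `|ξ|^b exp (-s|ξ|²)`, written through the Gamma integral as a superposition of
`|ξ|^(2n) exp (-(s + r)|ξ|²)`. -/
theorem exists_evenMultiplier_rpow_mul_heatSymbol {b : ℝ} (hb : 0 < b) :
    ∃ C, 0 ≤ C ∧ ∀ s, 0 < s →
      EvenMultiplier (fun ξ => ‖ξ‖ ^ b * heatSymbol s ξ) (C * s ^ (-(b / 2))) := by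
  suffices h1 : ∃ C, KernelBound Real.cos (fun ξ => ‖ξ‖ ^ b * heatSymbol 1 ξ) C by
    obtain ⟨C, hC⟩ := h1
    have h2 : EvenMultiplier (fun ξ => ‖ξ‖ ^ b * heatSymbol 1 ξ) C :=
      ⟨hC, (continuous_norm.rpow_const fun _ => Or.inr hb.le).mul (continuous_heatSymbol 1),
        fun ξ => by rw [norm_neg, heatSymbol_neg]⟩
    refine ⟨C, hC.nonneg, fun s hs => ?_⟩
    have h3 := (h2.dilate (Real.sqrt_pos.2 hs)).const_mul (s ^ (-(b / 2)))
    rw [abs_of_nonneg (by positivity), mul_comm] at h3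
    refine h3.congr fun ξ => ?_
    rw [heatSymbol_one, ← heatSymbol_dilate hs, norm_smul, Real.norm_of_nonneg (Real.sqrt_nonneg _),
      Real.mul_rpow (Real.sqrt_nonneg _) (norm_nonneg _), Real.sqrt_eq_rpow, ← Real.rpow_mul hs.le]
    have h4 : s ^ (-(b / 2)) * s ^ (1 / 2 * b) = 1 := by
      rw [← Real.rpow_add hs, show -(b / 2) + 1 / 2 * b = 0 by ring, Real.rpow_zero]
    linear_combination (‖ξ‖ ^ b * heatSymbol s ξ) * h4
  -- `|ξ|^(2n) ∫ r^(β-1) exp (-r|ξ|²) dr = Γ(β) |ξ|^(2n - 2β)`, and `2n - 2β = b`. The kernel at `r`,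
  -- after multiplication by `exp (-|ξ|²)`, has norm `O((1 + r)^(-n))`, so the superposition
  -- converges because `0 < β < n`.
  obtain ⟨n, hn⟩ := exists_nat_gt (b / 2)
  set β : ℝ := n - b / 2 with hβ
  have hβ0 : 0 < β := by rw [hβ]; linarith
  have hβn : β < n := by rw [hβ]; linarith
  have hn0 : n ≠ 0 := by
    rintro rfl
    simp at hn
    linarith
  set g : R3 → ℝ := fun ξ => (‖ξ‖ ^ 2) ^ n with hg
  have hgt : g.HasTemperateGrowth := (Function.hasTemperateGrowth_norm_sq R3).pow n
  obtain ⟨C, hC, hK, -⟩ := exists_kernelBound_mul_gaussian hgt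
  set I := ∫ ξ, |g ξ * Real.exp (-‖ξ‖ ^ 2)| with hI
  have hI0 : (0 : ℝ) ≤ I := integral_nonneg fun _ => abs_nonneg _
  have hM : ∀ r, 0 < r → ∀ ξ, g ξ * Real.exp (-((1 + r) * ‖ξ‖ ^ 2)) = (1 + r) ^ (-(n : ℝ)) *
      (g (Real.sqrt (1 + r) • ξ) * Real.exp (-‖Real.sqrt (1 + r) • ξ‖ ^ 2)) := by
    intro r hr ξ
    have hr1 : 0 < 1 + r := by linarith
    have h1 : g (Real.sqrt (1 + r) • ξ) = (1 + r) ^ n * g ξ := by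
      simp only [hg, norm_smul, Real.norm_of_nonneg (Real.sqrt_nonneg _)]
      rw [mul_pow, Real.sq_sqrt hr1.le, mul_pow]
    rw [h1, ← heatSymbol_dilate hr1, heatSymbol, Real.rpow_neg hr1.le, Real.rpow_natCast]
    field_simp
  have hrp := integrableOn_rpow_mul_one_add_rpow hβ0 hβn
  have h := KernelBound.superposition isTrig_cos (μ := volume.restrict (Ioi (0 : ℝ)))
    (M := fun r ξ => r ^ (β - 1) * (g ξ * Real.exp (-((1 + r) * ‖ξ‖ ^ 2))))
    (c := fun r => r ^ (β - 1) * (1 + r) ^ (-(n : ℝ)) * C)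
    (d := fun r => r ^ (β - 1) * (1 + r) ^ (-(n : ℝ)) * I) ?_ (hrp.mul_const C)
    (hrp.mul_const I) ?_
  · refine ⟨_, (h.const_mul (Real.Gamma β)⁻¹).congr fun ξ => ?_⟩
    rcases eq_or_ne ξ 0 with rfl | hξ
    · simp [hg, hn0, Real.zero_rpow hb.ne']
    · have hn' : (0 : ℝ) < ‖ξ‖ := by positivity
      have h1 : ∀ r : ℝ, r ^ (β - 1) * (g ξ * Real.exp (-((1 + r) * ‖ξ‖ ^ 2))) =
          g ξ * heatSymbol 1 ξ * (r ^ (β - 1) * Real.exp (-(‖ξ‖ ^ 2 * r))) := fun r => by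
        rw [heatSymbol, show -((1 + r) * ‖ξ‖ ^ 2) = -(1 * ‖ξ‖ ^ 2) + -(‖ξ‖ ^ 2 * r) by ring,
          Real.exp_add]
        ring
      simp only [h1]
      rw [integral_const_mul, Real.integral_rpow_mul_exp_neg_mul_Ioi hβ0 (by positivity)]
      have h2 : g ξ * (1 / ‖ξ‖ ^ 2) ^ β = ‖ξ‖ ^ b := by
        show (‖ξ‖ ^ 2) ^ n * (1 / ‖ξ‖ ^ 2) ^ β = ‖ξ‖ ^ b
        rw [one_div, Real.inv_rpow (by positivity), ← Real.rpow_neg (by positivity)]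
        rw [← Real.rpow_natCast (‖ξ‖ ^ 2), ← Real.rpow_add (by positivity),
          ← Real.rpow_natCast, ← Real.rpow_mul hn'.le]
        congr 1
        rw [hβ]; push_cast; ring
      have h3 := (Real.Gamma_pos_of_pos hβ0).ne'
      rw [← h2]
      field_simp
  · have : Measurable g := by simp only [hg]; fun_prop
    refine Measurable.mul (by fun_prop) ((this.comp measurable_snd).mul ?_)
    fun_prop
  · filter_upwards [ae_restrict_mem measurableSet_Ioi] with r hr
    have hr0 : (0 : ℝ) < r := hr
    have hr1 : 0 < 1 + r := by linarith
    have hrp0 : (0 : ℝ) ≤ r ^ (β - 1) * (1 + r) ^ (-(n : ℝ)) := by positivity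
    have hM' : ∀ ξ, r ^ (β - 1) * (g ξ * Real.exp (-((1 + r) * ‖ξ‖ ^ 2))) =
        r ^ (β - 1) * (1 + r) ^ (-(n : ℝ)) *
          (g (Real.sqrt (1 + r) • ξ) * Real.exp (-‖Real.sqrt (1 + r) • ξ‖ ^ 2)) := fun ξ => by
      rw [hM r hr0, mul_assoc]
    refine ⟨?_, ?_⟩
    · have h1 := (hK.dilate (Real.sqrt_pos.2 hr1)).const_mul (r ^ (β - 1) * (1 + r) ^ (-(n : ℝ)))
      rw [abs_of_nonneg hrp0] at h1
      exact h1.congr fun ξ => (hM' ξ).symm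
    · simp only [hM', abs_mul _ (g _ * _), abs_of_nonneg hrp0]
      rw [integral_const_mul]
      gcongr
      rw [hI, integral_dilate (fun ξ => |g ξ * Real.exp (-‖ξ‖ ^ 2)|) (Real.sqrt_pos.2 hr1)]
      refine le_mul_of_one_le_left (integral_nonneg fun _ => abs_nonneg _) ?_
      exact one_le_pow₀ (Real.one_le_sqrt.2 (by linarith))

/-- If the semigroup `exp (-r|ξ|^b)` is bounded, then `1 - exp (-κ|ξ|^b)`, smoothed by the heat
semigroup at time `s`, is of size `κ s^(-b/2)`. -/
theorem exists_evenMultiplier_heat_mul_one_sub {b Ce : ℝ} (hb : 0 < b)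
    (he : ∀ r, 0 < r → EvenMultiplier (fun ξ => Real.exp (-(r * ‖ξ‖ ^ b))) Ce) :
    ∃ C, 0 ≤ C ∧ ∀ s κ, 0 < s → 0 < κ →
      EvenMultiplier (fun ξ => heatSymbol s ξ * (1 - Real.exp (-(κ * ‖ξ‖ ^ b))))
        (C * min 1 (κ * s ^ (-(b / 2)))) := by
  obtain ⟨C, hC, h⟩ := exists_evenMultiplier_rpow_mul_heatSymbol hb
  have hCe : 0 ≤ Ce := (he 1 one_pos).nonneg
  have hcn : Continuous fun ξ : R3 => ‖ξ‖ ^ b := continuous_norm.rpow_const fun _ => Or.inr hb.le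
  refine ⟨C * Ce + (1 + Ce), by positivity, fun s κ hs hκ => ?_⟩
  have hcont : Continuous fun ξ => heatSymbol s ξ * (1 - Real.exp (-(κ * ‖ξ‖ ^ b))) := by
    have := continuous_heatSymbol s
    fun_prop
  have heven : ∀ ξ, heatSymbol s (-ξ) * (1 - Real.exp (-(κ * ‖-ξ‖ ^ b))) =
      heatSymbol s ξ * (1 - Real.exp (-(κ * ‖ξ‖ ^ b))) := fun ξ => by
    rw [heatSymbol_neg, norm_neg]
  have hx : 0 ≤ κ * s ^ (-(b / 2)) := by positivity
  rcases le_total 1 (κ * s ^ (-(b / 2))) with hx1 | hx1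
  · rw [min_eq_left hx1]
    have h1 := (evenMultiplier_heatSymbol hs).sub ((evenMultiplier_heatSymbol hs).mul (he κ hκ))
    refine (h1.congr fun ξ => by ring).mono ?_
    rw [mul_one, one_mul]
    have : 0 ≤ C * Ce := by positivity
    linarith
  · rw [min_eq_right hx1]
    have hA := h s hs
    set A := ∫ ξ, |‖ξ‖ ^ b * heatSymbol s ξ| with hAdef
    have hint : ∀ c : ℝ, Integrable (fun _ : ℝ => c) (volume.restrict (Ioc 0 κ)) := fun c =>
      integrable_const c
    have h1 := KernelBound.superposition isTrig_cos (μ := volume.restrict (Ioc (0 : ℝ) κ))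
      (M := fun r ξ => Real.exp (-(r * ‖ξ‖ ^ b)) * (‖ξ‖ ^ b * heatSymbol s ξ))
      (c := fun _ => Ce * (C * s ^ (-(b / 2)))) (d := fun _ => A) ?_ (hint _) (hint _) ?_
    · refine ⟨(h1.congr fun ξ => ?_).mono ?_, hcont, heven⟩
      · rw [integral_mul_const, ← intervalIntegral.integral_of_le hκ.le]
        -- `1 - exp (-κ|ξ|^b)` is the integral of `|ξ|^b exp (-r|ξ|^b)` over `0 < r < κ`.
        have hd : ∀ r ∈ uIcc 0 κ, HasDerivAt (fun r : ℝ => -Real.exp (-(r * ‖ξ‖ ^ b)))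
            (Real.exp (-(r * ‖ξ‖ ^ b)) * ‖ξ‖ ^ b) r := fun r _ => by
          have h3 := ((hasDerivAt_id r).mul_const (‖ξ‖ ^ b)).neg.exp.neg
          refine h3.congr_deriv ?_
          simp
        have h4 := intervalIntegral.integral_eq_sub_of_hasDerivAt hd
          (by apply Continuous.intervalIntegrable; fun_prop)
        rw [intervalIntegral.integral_mul_const] at h4
        rw [← mul_assoc, h4]
        simp
        ring
      · simp only [integral_const, MeasurableSet.univ, measureReal_restrict_apply, univ_inter,
          Real.volume_real_Ioc_of_le hκ.le, sub_zero, smul_eq_mul]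
        have h5 : κ * (Ce * (C * s ^ (-(b / 2)))) = C * Ce * (κ * s ^ (-(b / 2))) := by ring
        rw [h5]
        gcongr
        linarith
    · refine Measurable.mul (by fun_prop) ?_
      exact (hcn.mul (continuous_heatSymbol s)).measurable.comp measurable_snd
    · filter_upwards [ae_restrict_mem measurableSet_Ioc] with r hr
      refine ⟨((he r hr.1).mul hA).toKernelBound, ?_⟩
      refine integral_mono ((he r hr.1).mul hA).symbol.abs hA.symbol.abs fun ξ => ?_
      change |_ * (‖ξ‖ ^ b * heatSymbol s ξ)| ≤ |‖ξ‖ ^ b * heatSymbol s ξ|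
      rw [abs_mul]
      refine mul_le_of_le_one_left (abs_nonneg _) ?_
      rw [abs_of_pos (Real.exp_pos _), Real.exp_le_one_iff, neg_nonpos]
      have := hr.1
      positivity

/-! ### The kernel of the hyperdissipative semigroup -/

open FourierTransform ContDiff TemperedDistribution in
/-- For functions in `L¹ ∩ L²` the Fourier integral agrees with the `L²` Fourier transform, and is
therefore square integrable: both are tested against compactly supported smooth functions. -/
theorem memLp_two_fourier {m : R3 → ℂ} (h1 : Integrable m) (h2 : MemLp m 2) :
    MemLp (𝓕 m) 2 := by
  set f : Lp (α := R3) ℂ 2 := h2.toLp m with hf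
  have hfm : f =ᵐ[volume] m := h2.coeFn_toLp
  have hcont : Continuous (𝓕 m) :=
    VectorFourier.fourierIntegral_continuous (μ := volume) (L := innerₗ R3)
      Real.continuous_fourierChar continuous_inner h1
  set G : Lp ℂ 2 (volume : Measure R3) := 𝓕 f with hG
  have hF : MemLp G 2 volume := Lp.memLp G
  refine (memLp_congr_ae ?_).1 hF
  refine ae_eq_of_integral_contDiff_smul_eq (hF.locallyIntegrable (by norm_num))
    hcont.locallyIntegrable fun g hg hgc => ?_
  have hg' : ContDiff ℝ ∞ (fun x => (g x : ℂ)) := Complex.ofRealCLM.contDiff.comp hg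
  have hgc' : HasCompactSupport (fun x => (g x : ℂ)) := hgc.comp_left (g := ((↑) : ℝ → ℂ)) (by simp)
  set φ : 𝓢(R3, ℂ) := hgc'.toSchwartzMap hg' with hφ
  have hφa : ∀ x, φ x = (g x : ℂ) := fun x => rfl
  have h := congrArg (fun L : 𝓢'(R3, ℂ) => L φ) (Lp.fourier_toTemperedDistribution_eq f)
  simp only [TemperedDistribution.fourier_apply, Lp.toTemperedDistribution_apply] at h
  have e1 : ∫ x, (𝓕 φ) x • f x = ∫ x, (𝓕 φ) x • m x :=
    integral_congr_ae (hfm.mono fun x hx => by simp only [hx])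
  have e2 : ∫ x, (𝓕 φ) x • m x = ∫ x, φ x • 𝓕 m x := by
    rw [SchwartzMap.fourier_coe]
    simpa using! (VectorFourier.integral_fourierIntegral_smul_eq_flip (L := innerₗ R3)
      (μ := volume) (ν := volume) Real.continuous_fourierChar continuous_inner φ.integrable h1)
  have e3 : ∀ x, φ x = (g x : ℂ) := hφa
  rw [e1, e2] at h
  simp only [e3] at h
  simpa using h.symm

theorem integrable_sq_evenKernel {m : R3 → ℝ} (h1 : Integrable m) (h2 : Integrable fun ξ => m ξ ^ 2)
    (he : ∀ ξ, m (-ξ) = m ξ) : Integrable fun x => evenKernel m x ^ 2 := by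
  have hm2 : MemLp (fun ξ => (m ξ : ℂ)) 2 := by
    rw [memLp_two_iff_integrable_sq_norm h1.ofReal.aestronglyMeasurable]
    simpa using h2
  have hm1 : Integrable fun ξ => (m ξ : ℂ) := h1.ofReal
  have h3 := memLp_two_fourier hm1 hm2
  rw [memLp_two_iff_integrable_sq_norm h3.aestronglyMeasurable] at h3
  have h4 := h3.comp_smul (R := (2 * Real.pi)⁻¹) (by positivity)
  simp only [fourier_eq_kernels h1, oddKernel_eq_zero_of_even he] at h4
  have h5 : Integrable fun x => ((2 * Real.pi) ^ 3) ^ 2 * evenKernel m x ^ 2 := by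
    refine h4.congr (ae_of_all _ fun x => ?_)
    simp [mul_pow, abs_of_pos Real.pi_pos]
  have hπ : ((2 * Real.pi) ^ 3) ^ 2 ≠ 0 := by positivity
  refine (h5.const_mul (((2 * Real.pi) ^ 3) ^ 2)⁻¹).congr (ae_of_all _ fun x => ?_)
  exact inv_mul_cancel_left₀ hπ _

/-- If `(1 + |x|²)` times the kernel of `m` is square integrable, then the kernel is integrable,
because `(1 + |x|²)⁻¹` is square integrable in dimension three. -/
theorem integrable_evenKernel_of_one_add_norm_sq {m M : R3 → ℝ} (h1 : Integrable m)
    (hM : Integrable M) (hM2 : Integrable fun ξ => M ξ ^ 2) (he : ∀ ξ, M (-ξ) = M ξ)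
    (h : ∀ x, evenKernel M x = (1 + ‖x‖ ^ 2) * evenKernel m x) : Integrable (evenKernel m) := by
  have h4 : Integrable fun x : R3 => (1 + ‖x‖ ^ 2) ^ (-(4 : ℝ) / 2) :=
    integrable_rpow_neg_one_add_norm_sq (by rw [finrank_R3]; norm_num)
  refine (h4.add (integrable_sq_evenKernel hM hM2 he)).mono'
    (isTrig_cos.continuous_kernel h1).aestronglyMeasurable (ae_of_all _ fun x => ?_)
  have hx : (0 : ℝ) < 1 + ‖x‖ ^ 2 := by positivity
  have h5 : evenKernel m x = (1 + ‖x‖ ^ 2)⁻¹ * evenKernel M x := by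
    rw [h]; field_simp
  have h6 : (1 + ‖x‖ ^ 2) ^ (-(4 : ℝ) / 2) = ((1 + ‖x‖ ^ 2)⁻¹) ^ 2 := by
    rw [show (-(4 : ℝ) / 2) = -((2 : ℕ) : ℝ) by norm_num, Real.rpow_neg hx.le, Real.rpow_natCast,
      inv_pow]
  rw [Pi.add_apply, h6, h5, Real.norm_eq_abs, abs_mul, abs_of_pos (inv_pos.2 hx),
    ← sq_abs (evenKernel M x)]
  nlinarith [sq_nonneg ((1 + ‖x‖ ^ 2)⁻¹ - |evenKernel M x|), sq_nonneg ((1 + ‖x‖ ^ 2)⁻¹),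
    sq_nonneg (|evenKernel M x|)]

theorem integral_lineDeriv_mul_cos {m m' : R3 → ℝ} {v : R3} (h : Integrable m) (h' : Integrable m')
    (hd : ∀ ξ, HasLineDerivAt ℝ m (m' ξ) ξ v) (x : R3) :
    ∫ ξ, m' ξ * Real.cos (inner ℝ x ξ) = inner ℝ x v * ∫ ξ, m ξ * Real.sin (inner ℝ x ξ) := by
  have hs : IsTrig (fun s => -Real.sin s) := isTrig_neg_sin
  have hin : ∀ ξ, HasLineDerivAt ℝ (fun ξ => inner ℝ x ξ) (inner ℝ x v) ξ v := fun ξ =>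
    ((innerSL ℝ x).hasFDerivAt (x := ξ)).hasLineDerivAt v
  have hg : ∀ ξ, HasLineDerivAt ℝ (fun ξ => Real.cos (inner ℝ x ξ))
      (-Real.sin (inner ℝ x ξ) * inner ℝ x v) ξ v := fun ξ => by
    have := (hin ξ : HasDerivAt _ _ _).cos
    simpa [HasLineDerivAt] using this
  have i1 := isTrig_cos.integrable_mul h x
  have i2 := isTrig_cos.integrable_mul h' x
  have i3 : Integrable fun ξ => m ξ * (-Real.sin (inner ℝ x ξ) * inner ℝ x v) := by
    simpa only [mul_assoc] using (hs.integrable_mul h x).mul_const (inner ℝ x v)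
  have key := integral_bilinear_hasLineDerivAt_right_eq_neg_left_of_integrable (μ := volume)
    (B := ContinuousLinearMap.mul ℝ ℝ) (f := m) (f' := m')
    (g := fun ξ => Real.cos (inner ℝ x ξ)) (v := v) i2 i3 i1 (fun ξ _ => hd ξ) (fun ξ _ => hg ξ)
  simp only [ContinuousLinearMap.mul_apply'] at key
  have : ∫ ξ, m ξ * (-Real.sin (inner ℝ x ξ) * inner ℝ x v) =
      -(inner ℝ x v * ∫ ξ, m ξ * Real.sin (inner ℝ x ξ)) := by
    rw [← integral_const_mul, ← integral_neg]
    congr 1; funext ξ; ring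
  linarith

theorem integral_lineDeriv_mul_sin {m m' : R3 → ℝ} {v : R3} (h : Integrable m) (h' : Integrable m')
    (hd : ∀ ξ, HasLineDerivAt ℝ m (m' ξ) ξ v) (x : R3) :
    ∫ ξ, m' ξ * Real.sin (inner ℝ x ξ) = -(inner ℝ x v * ∫ ξ, m ξ * Real.cos (inner ℝ x ξ)) := by
  have hin : ∀ ξ, HasLineDerivAt ℝ (fun ξ => inner ℝ x ξ) (inner ℝ x v) ξ v := fun ξ =>
    ((innerSL ℝ x).hasFDerivAt (x := ξ)).hasLineDerivAt v
  have hg : ∀ ξ, HasLineDerivAt ℝ (fun ξ => Real.sin (inner ℝ x ξ))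
      (Real.cos (inner ℝ x ξ) * inner ℝ x v) ξ v := fun ξ => by
    have := (hin ξ : HasDerivAt _ _ _).sin
    simpa [HasLineDerivAt] using this
  have i1 : Integrable fun ξ => m ξ * Real.sin (inner ℝ x ξ) := by
    simpa using (isTrig_neg_sin.integrable_mul h x).neg
  have i2 : Integrable fun ξ => m' ξ * Real.sin (inner ℝ x ξ) := by
    simpa using (isTrig_neg_sin.integrable_mul h' x).neg
  have i3 : Integrable fun ξ => m ξ * (Real.cos (inner ℝ x ξ) * inner ℝ x v) := by
    simpa only [mul_assoc] using (isTrig_cos.integrable_mul h x).mul_const (inner ℝ x v)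
  have key := integral_bilinear_hasLineDerivAt_right_eq_neg_left_of_integrable (μ := volume)
    (B := ContinuousLinearMap.mul ℝ ℝ) (f := m) (f' := m')
    (g := fun ξ => Real.sin (inner ℝ x ξ)) (v := v) i2 i3 i1 (fun ξ _ => hd ξ) (fun ξ _ => hg ξ)
  simp only [ContinuousLinearMap.mul_apply'] at key
  have : ∫ ξ, m ξ * (Real.cos (inner ℝ x ξ) * inner ℝ x v) =
      inner ℝ x v * ∫ ξ, m ξ * Real.cos (inner ℝ x ξ) := by
    rw [← integral_const_mul]
    congr 1; funext ξ; ring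
  linarith

/-- Two derivatives of the symbol multiply the kernel by minus the square of a coordinate. -/
theorem evenKernel_secondDeriv {m m' m'' : R3 → ℝ} {v : R3} (h : Integrable m) (h' : Integrable m')
    (h'' : Integrable m'') (hd : ∀ ξ, HasLineDerivAt ℝ m (m' ξ) ξ v)
    (hd' : ∀ ξ, HasLineDerivAt ℝ m' (m'' ξ) ξ v) (x : R3) :
    evenKernel m'' x = -(inner ℝ x v) ^ 2 * evenKernel m x := by
  rw [evenKernel, evenKernel, integral_lineDeriv_mul_cos h' h'' hd',
    integral_lineDeriv_mul_sin h h' hd]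
  ring

section Hyper

variable {ℓ : ℝ}

/-- The exponent `-4` makes the bound integrable, with its square, in dimension three. -/
theorem exists_rpow_mul_exp_le (hℓ : 2 < ℓ) {a : ℝ} (ha : 0 ≤ a) :
    ∃ C, 0 ≤ C ∧ ∀ r : ℝ, 0 ≤ r → r ^ a * Real.exp (-r ^ ℓ) ≤ C * (1 + r) ^ (-(4 : ℝ)) := by
  set n : ℕ := ⌈a⌉₊ with hn
  refine ⟨(n + 4).factorial * Real.exp 3, by positivity, fun r hr => ?_⟩
  have h1 : r ^ a ≤ (1 + r) ^ n := by
    calc r ^ a ≤ (1 + r) ^ a := Real.rpow_le_rpow hr (by linarith) ha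
      _ ≤ (1 + r) ^ (n : ℝ) := Real.rpow_le_rpow_of_exponent_le (by linarith) (Nat.le_ceil a)
      _ = _ := Real.rpow_natCast _ _
  have h2 : r ^ 2 ≤ 1 + r ^ ℓ := by
    rcases le_total r 1 with h | h
    · have : r ^ 2 ≤ 1 := pow_le_one₀ hr h
      have := Real.rpow_nonneg hr ℓ
      linarith
    · have : r ^ (2 : ℝ) ≤ r ^ ℓ := Real.rpow_le_rpow_of_exponent_le h hℓ.le
      rw [Real.rpow_two] at this
      linarith
  have h3 := Real.pow_div_factorial_le_exp (1 + r) (by linarith) (n + 4)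
  have hf : (0 : ℝ) < (n + 4).factorial := by exact_mod_cast (n + 4).factorial_pos
  rw [div_le_iff₀ hf] at h3
  have hr1 : 0 < 1 + r := by linarith
  have h4 : (1 + r) ^ (-(4 : ℝ)) = ((1 + r) ^ 4)⁻¹ := by
    rw [Real.rpow_neg hr1.le]; norm_cast
  rw [h4, ← div_eq_mul_inv, le_div_iff₀ (by positivity)]
  calc r ^ a * Real.exp (-r ^ ℓ) * (1 + r) ^ 4
      ≤ (1 + r) ^ n * Real.exp (-r ^ ℓ) * (1 + r) ^ 4 := by gcongr
    _ = (1 + r) ^ (n + 4) * Real.exp (-r ^ ℓ) := by rw [pow_add]; ring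
    _ ≤ (Real.exp (1 + r) * (n + 4).factorial) * Real.exp (-r ^ ℓ) := by gcongr
    _ = (n + 4).factorial * Real.exp (1 + r + -r ^ ℓ) := by rw [Real.exp_add (1 + r)]; ring
    _ ≤ _ := by
        gcongr
        nlinarith [sq_nonneg (r - 1)]

theorem hasLineDerivAt_exp_neg_norm_rpow (hℓ : 2 < ℓ) (v ξ : R3) :
    HasLineDerivAt ℝ (fun ξ : R3 => Real.exp (-‖ξ‖ ^ ℓ))
      (-ℓ * (‖ξ‖ ^ (ℓ - 2) * inner ℝ ξ v * Real.exp (-‖ξ‖ ^ ℓ))) ξ v := by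
  have h := ((hasFDerivAt_norm_rpow ξ (by linarith : 1 < ℓ)).neg.exp).hasLineDerivAt v
  refine HasDerivAt.congr_deriv h ?_
  simp
  ring

theorem hasLineDerivAt_norm_rpow_mul_inner (hℓ : 2 < ℓ) (v ξ : R3) :
    HasLineDerivAt ℝ (fun ξ : R3 => ‖ξ‖ ^ (ℓ - 2) * inner ℝ ξ v)
      (‖ξ‖ ^ (ℓ - 2) * inner ℝ v v + (ℓ - 2) * ‖ξ‖ ^ (ℓ - 4) * inner ℝ ξ v ^ 2) ξ v := by
  rcases eq_or_ne ξ 0 with rfl | hξ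
  · -- At the origin the difference quotient is `‖t v‖ ^ (ℓ - 2) * ‖v‖ ^ 2`.
    have hz : (0 : ℝ) ^ (ℓ - 2) = 0 := Real.zero_rpow (by linarith)
    simp only [norm_zero, hz, inner_zero_left, zero_mul, ne_eq, OfNat.ofNat_ne_zero,
      not_false_eq_true, zero_pow, mul_zero, add_zero]
    show HasDerivAt _ _ _
    rw [hasDerivAt_iff_tendsto_slope]
    have hc : Tendsto (fun t : ℝ => ‖t • v‖ ^ (ℓ - 2) * inner ℝ v v) (𝓝[≠] 0) (𝓝 0) := by
      have : Continuous fun t : ℝ => ‖t • v‖ ^ (ℓ - 2) * inner ℝ v v := by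
        refine Continuous.mul (Continuous.rpow_const (by fun_prop) fun _ => Or.inr (by linarith))
          continuous_const
      have h := this.tendsto 0
      rw [zero_smul, norm_zero, hz, zero_mul] at h
      exact h.mono_left nhdsWithin_le_nhds
    refine hc.congr' ?_
    filter_upwards [self_mem_nhdsWithin] with t ht
    have ht' : t ≠ 0 := ht
    simp only [slope_def_field, zero_add, zero_smul, norm_zero, hz, zero_mul, sub_zero,
      real_inner_smul_left]
    field_simp
  · have hn : (0 : ℝ) < ‖ξ‖ ^ 2 := by positivity
    have h1 : HasFDerivAt (fun ξ : R3 => ‖ξ‖ ^ 2) (2 • innerSL ℝ ξ) ξ :=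
      (hasStrictFDerivAt_norm_sq ξ).hasFDerivAt
    have h2 := (h1.rpow_const (p := (ℓ - 2) / 2) (Or.inl hn.ne')).hasLineDerivAt v
    have h3 : HasLineDerivAt ℝ (fun ξ : R3 => inner ℝ ξ v) (inner ℝ v v) ξ v := by
      have := ((innerSL ℝ v).hasFDerivAt (x := ξ)).hasLineDerivAt v
      simpa [real_inner_comm] using this
    have h4 := HasDerivAt.mul h2 h3
    have hp : ∀ (ζ : R3) (c : ℝ), (‖ζ‖ ^ 2) ^ (c / 2) = ‖ζ‖ ^ c := fun ζ c => by
      rw [← Real.rpow_natCast, ← Real.rpow_mul (norm_nonneg _)]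
      congr 1; push_cast; ring
    refine HasDerivAt.congr_deriv (HasDerivAt.congr_of_eventuallyEq h4
      (Eventually.of_forall fun t => ?_)) ?_
    · simp only [hp, Pi.mul_apply]
    have e : (‖ξ‖ ^ 2) ^ ((ℓ - 2) / 2 - 1) = ‖ξ‖ ^ (ℓ - 4) := by
      rw [← hp]; congr 1; ring
    simp only [zero_smul, add_zero, hp, e]
    simp
    ring

/-- The symbol `exp (-|ξ|^ℓ)`, `ℓ > 2`, has an integrable kernel: two derivatives of the symbol
are square integrable, so that by Plancherel `(1 + |x|²)` times the kernel is. -/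
theorem exists_evenMultiplier_exp_neg_norm_rpow (hℓ : 2 < ℓ) :
    ∃ C, ∀ r, 0 < r → EvenMultiplier (fun ξ => Real.exp (-(r * ‖ξ‖ ^ ℓ))) C := by
  obtain ⟨C0, hC0, h0⟩ := exists_rpow_mul_exp_le hℓ le_rfl
  obtain ⟨C1, hC1, h1⟩ := exists_rpow_mul_exp_le hℓ (a := ℓ - 1) (by linarith)
  obtain ⟨C2, hC2, h2⟩ := exists_rpow_mul_exp_le hℓ (a := ℓ - 2) (by linarith)
  obtain ⟨C3, hC3, h3⟩ := exists_rpow_mul_exp_le hℓ (a := 2 * ℓ - 2) (by linarith)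
  set m : R3 → ℝ := fun ξ => Real.exp (-‖ξ‖ ^ ℓ) with hm
  have hcm : Continuous m := by
    have : Continuous fun ξ : R3 => ‖ξ‖ ^ ℓ := continuous_norm.rpow_const fun _ => Or.inr (by linarith)
    fun_prop
  -- `m1 j` and `m2 j` are the first two derivatives of the symbol in the direction `j`; the second
  -- is of size `|ξ|^(ℓ-2)` near the origin, hence bounded, as `ℓ > 2`.
  set g : Fin 3 → R3 → ℝ := fun j ξ => ‖ξ‖ ^ (ℓ - 2) * inner ℝ ξ (EuclideanSpace.single j 1) with hg
  set g' : Fin 3 → R3 → ℝ := fun j ξ =>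
    ‖ξ‖ ^ (ℓ - 2) * inner ℝ (EuclideanSpace.single j 1 : R3) (EuclideanSpace.single j 1 : R3) +
      (ℓ - 2) * ‖ξ‖ ^ (ℓ - 4) * inner ℝ ξ (EuclideanSpace.single j 1) ^ 2 with hg'
  set m1 : Fin 3 → R3 → ℝ := fun j ξ => -ℓ * (g j ξ * m ξ) with hm1
  set m2 : Fin 3 → R3 → ℝ := fun j ξ => -ℓ * (g' j ξ * m ξ + g j ξ * m1 j ξ) with hm2
  have hd1 : ∀ j ξ, HasLineDerivAt ℝ m (m1 j ξ) ξ (EuclideanSpace.single j 1) := fun j ξ =>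
    hasLineDerivAt_exp_neg_norm_rpow hℓ _ ξ
  have hd2 : ∀ j ξ, HasLineDerivAt ℝ (m1 j) (m2 j ξ) ξ (EuclideanSpace.single j 1) := fun j ξ => by
    have ha := HasDerivAt.mul (hasLineDerivAt_norm_rpow_mul_inner hℓ (EuclideanSpace.single j 1) ξ)
      (hd1 j ξ)
    have hb := HasDerivAt.const_mul (-ℓ) ha
    refine HasDerivAt.congr_deriv hb ?_
    simp [hm2, hg', hg]
  have hin : ∀ (j : Fin 3) (ξ : R3), |inner ℝ ξ (EuclideanSpace.single j 1)| ≤ ‖ξ‖ := fun j ξ => by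
    simpa using abs_real_inner_le_norm ξ (EuclideanSpace.single j (1 : ℝ))
  have hb0 : ∀ ξ, |m ξ| ≤ C0 * (1 + ‖ξ‖) ^ (-(4 : ℝ)) := fun ξ => by
    rw [hm, abs_of_pos (Real.exp_pos _)]
    simpa using h0 ‖ξ‖ (norm_nonneg _)
  have hgb : ∀ j ξ, |g j ξ| ≤ ‖ξ‖ ^ (ℓ - 1) := fun j ξ => by
    rcases eq_or_ne ξ 0 with rfl | hξ
    · have : (0 : ℝ) ≤ 0 ^ (ℓ - 1) := Real.rpow_nonneg le_rfl _
      simpa [hg] using this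
    · rw [hg, abs_mul, abs_of_nonneg (by positivity)]
      calc _ ≤ ‖ξ‖ ^ (ℓ - 2) * ‖ξ‖ := by gcongr; exact hin j ξ
        _ = ‖ξ‖ ^ (ℓ - 1) := by
          rw [← Real.rpow_add_one (norm_ne_zero_iff.2 hξ)]; congr 1; ring
  have hgb' : ∀ j ξ, |g' j ξ| ≤ (ℓ - 1) * ‖ξ‖ ^ (ℓ - 2) := fun j ξ => by
    have hl : 0 ≤ ℓ - 2 := by linarith
    rcases eq_or_ne ξ 0 with rfl | hξ
    · have : (0 : ℝ) ^ (ℓ - 2) = 0 := Real.zero_rpow (by linarith)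
      simp [hg', this]
    · have hp : 0 ≤ ‖ξ‖ ^ (ℓ - 2) * inner ℝ (EuclideanSpace.single j 1 : R3)
          (EuclideanSpace.single j 1 : R3) := mul_nonneg (by positivity) real_inner_self_nonneg
      rw [hg', abs_of_nonneg (add_nonneg hp (by positivity))]
      have e : ‖ξ‖ ^ (ℓ - 4) * ‖ξ‖ ^ 2 = ‖ξ‖ ^ (ℓ - 2) := by
        rw [← Real.rpow_natCast, ← Real.rpow_add (norm_pos_iff.2 hξ)]; congr 1; push_cast; ring
      calc ‖ξ‖ ^ (ℓ - 2) * inner ℝ (EuclideanSpace.single j 1 : R3) (EuclideanSpace.single j 1 : R3)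
            + (ℓ - 2) * ‖ξ‖ ^ (ℓ - 4) * inner ℝ ξ (EuclideanSpace.single j 1) ^ 2
          ≤ ‖ξ‖ ^ (ℓ - 2) * 1 + (ℓ - 2) * ‖ξ‖ ^ (ℓ - 4) * ‖ξ‖ ^ 2 := by
            refine add_le_add (mul_le_mul_of_nonneg_left (by simp) (by positivity))
              (mul_le_mul_of_nonneg_left ?_ (by positivity))
            · exact (sq_abs _).symm.le.trans (pow_le_pow_left₀ (abs_nonneg _) (hin j ξ) 2)
        _ = _ := by rw [mul_assoc, e]; ring
  have hb1 : ∀ j ξ, |m1 j ξ| ≤ ℓ * C1 * (1 + ‖ξ‖) ^ (-(4 : ℝ)) := fun j ξ => by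
    have hmp : 0 < m ξ := Real.exp_pos _
    show |-ℓ * (g j ξ * m ξ)| ≤ _
    rw [abs_mul, abs_neg, abs_of_pos (by linarith : 0 < ℓ), abs_mul, abs_of_pos hmp, mul_assoc]
    refine mul_le_mul_of_nonneg_left ?_ (by linarith)
    exact (mul_le_mul_of_nonneg_right (hgb j ξ) hmp.le).trans (h1 ‖ξ‖ (norm_nonneg _))
  have hb2 : ∀ j ξ, |m2 j ξ| ≤ ℓ * ((ℓ - 1) * C2 + ℓ * C3) * (1 + ‖ξ‖) ^ (-(4 : ℝ)) := fun j ξ => by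
    have hmp : 0 < m ξ := Real.exp_pos _
    have hl : 0 ≤ ℓ - 1 := by linarith
    have hl' : 0 < ℓ := by linarith
    have t1 : |g' j ξ * m ξ| ≤ (ℓ - 1) * C2 * (1 + ‖ξ‖) ^ (-(4 : ℝ)) := by
      rw [abs_mul, abs_of_pos hmp]
      refine (mul_le_mul_of_nonneg_right (hgb' j ξ) hmp.le).trans ?_
      rw [mul_assoc, mul_assoc]
      exact mul_le_mul_of_nonneg_left (h2 ‖ξ‖ (norm_nonneg _)) hl
    have t2 : |g j ξ * m1 j ξ| ≤ ℓ * C3 * (1 + ‖ξ‖) ^ (-(4 : ℝ)) := by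
      have e : ‖ξ‖ ^ (ℓ - 1) * ‖ξ‖ ^ (ℓ - 1) = ‖ξ‖ ^ (2 * ℓ - 2) := by
        rw [← Real.rpow_add_of_nonneg (norm_nonneg _) hl hl]; congr 1; ring
      have : |g j ξ * m1 j ξ| = ℓ * (|g j ξ| * |g j ξ| * m ξ) := by
        show |g j ξ * (-ℓ * (g j ξ * m ξ))| = _
        rw [abs_mul, abs_mul (-ℓ), abs_mul _ (m ξ), abs_neg, abs_of_pos hl', abs_of_pos hmp]; ring
      rw [this, mul_assoc ℓ C3]
      refine mul_le_mul_of_nonneg_left ?_ hl'.le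
      calc |g j ξ| * |g j ξ| * m ξ ≤ ‖ξ‖ ^ (ℓ - 1) * ‖ξ‖ ^ (ℓ - 1) * m ξ := by
            gcongr <;> exact hgb j ξ
        _ ≤ _ := by rw [e]; exact h3 ‖ξ‖ (norm_nonneg _)
    show |-ℓ * (g' j ξ * m ξ + g j ξ * m1 j ξ)| ≤ _
    rw [abs_mul, abs_neg, abs_of_pos hl', mul_assoc ℓ ((ℓ - 1) * C2 + ℓ * C3)]
    refine mul_le_mul_of_nonneg_left ((abs_add_le _ _).trans ?_) hl'.le
    rw [add_mul _ _ ((1 + ‖ξ‖) ^ (-(4 : ℝ)))]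
    exact add_le_add t1 t2
  have hi4 : Integrable fun ξ : R3 => (1 + ‖ξ‖) ^ (-(4 : ℝ)) :=
    integrable_one_add_norm (by rw [finrank_R3]; norm_num)
  have hmg : ∀ j, Measurable (g j) := fun j => by simp only [hg]; fun_prop
  have hmg' : ∀ j, Measurable (g' j) := fun j => by simp only [hg']; fun_prop
  have hmm1 : ∀ j, Measurable (m1 j) := fun j => ((hmg j).mul hcm.measurable).const_mul _
  have hmm2 : ∀ j, Measurable (m2 j) := fun j =>
    (((hmg' j).mul hcm.measurable).add ((hmg j).mul (hmm1 j))).const_mul _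
  have hI0 : Integrable m := (hi4.const_mul C0).mono' hcm.aestronglyMeasurable (ae_of_all _ hb0)
  have hI1 : ∀ j, Integrable (m1 j) := fun j =>
    (hi4.const_mul _).mono' (hmm1 j).aestronglyMeasurable (ae_of_all _ (hb1 j))
  have hI2 : ∀ j, Integrable (m2 j) := fun j =>
    (hi4.const_mul _).mono' (hmm2 j).aestronglyMeasurable (ae_of_all _ (hb2 j))
  -- `M = (1 - Δ) m` has the kernel `(1 + |x|²)` times that of `m`.
  set M : R3 → ℝ := fun ξ => m ξ - ((m2 0 ξ + m2 1 ξ) + m2 2 ξ) with hM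
  have hMI : Integrable M := hI0.sub (((hI2 0).add (hI2 1)).add (hI2 2))
  set A := C0 + 3 * (ℓ * ((ℓ - 1) * C2 + ℓ * C3)) with hA
  have hMb : ∀ ξ, |M ξ| ≤ A * (1 + ‖ξ‖) ^ (-(4 : ℝ)) := fun ξ => by
    have := hb0 ξ
    have a0 := hb2 0 ξ
    have a1 := hb2 1 ξ
    have a2 := hb2 2 ξ
    rw [abs_le] at *
    constructor <;> simp only [hM] <;> nlinarith
  have hA0 : 0 ≤ A := by
    have : 0 ≤ ℓ - 1 := by linarith
    have : 0 ≤ ℓ := by linarith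
    positivity
  have hM2 : Integrable fun ξ => M ξ ^ 2 := by
    refine (hi4.const_mul (A * A)).mono' (hMI.aestronglyMeasurable.pow 2) (ae_of_all _ fun ξ => ?_)
    have hx : (1 + ‖ξ‖) ^ (-(4 : ℝ)) ≤ 1 :=
      Real.rpow_le_one_of_one_le_of_nonpos (by linarith [norm_nonneg ξ]) (by norm_num)
    have hx0 : 0 ≤ (1 + ‖ξ‖) ^ (-(4 : ℝ)) := by positivity
    rw [Real.norm_eq_abs, abs_of_nonneg (sq_nonneg _), ← sq_abs, sq]
    calc |M ξ| * |M ξ| ≤ (A * (1 + ‖ξ‖) ^ (-(4 : ℝ))) * (A * 1) := by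
          gcongr
          · exact hMb ξ
          · exact (hMb ξ).trans (mul_le_mul_of_nonneg_left hx hA0)
      _ = _ := by ring
  have hme : ∀ ξ, m (-ξ) = m ξ := fun ξ => by simp [hm]
  have hMe : ∀ ξ, M (-ξ) = M ξ := fun ξ => by simp [hM, hm2, hm1, hg, hg', hm]
  have hker : ∀ x, evenKernel M x = (1 + ‖x‖ ^ 2) * evenKernel m x := fun x => by
    have i1 : Integrable fun ξ => m2 0 ξ + m2 1 ξ := (hI2 0).add (hI2 1)
    have i2 : Integrable fun ξ => m2 0 ξ + m2 1 ξ + m2 2 ξ := i1.add (hI2 2)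
    rw [evenKernel_eq_trigKernel, hM, isTrig_cos.kernel_sub hI0 i2,
      isTrig_cos.kernel_add i1 (hI2 2), isTrig_cos.kernel_add (hI2 0) (hI2 1),
      ← evenKernel_eq_trigKernel]
    have hi : ∀ j, inner ℝ x (EuclideanSpace.single j (1 : ℝ)) = x j := fun j => by
      rw [EuclideanSpace.inner_single_right]; simp
    rw [evenKernel_secondDeriv hI0 (hI1 0) (hI2 0) (hd1 0) (hd2 0),
      evenKernel_secondDeriv hI0 (hI1 1) (hI2 1) (hd1 1) (hd2 1),
      evenKernel_secondDeriv hI0 (hI1 2) (hI2 2) (hd1 2) (hd2 2), EuclideanSpace.real_norm_sq_eq]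
    simp only [Fin.sum_univ_three, hi]
    ring
  have hk := integrable_evenKernel_of_one_add_norm_sq hI0 hMI hM2 hMe hker
  have hEM : EvenMultiplier m (∫ x, |evenKernel m x|) := ⟨⟨hI0, hk, le_rfl⟩, hcm, hme⟩
  refine ⟨∫ x, |evenKernel m x|, fun r hr => ?_⟩
  refine (hEM.dilate (r := r ^ ℓ⁻¹) (by positivity)).congr fun ξ => ?_
  show Real.exp (-‖r ^ ℓ⁻¹ • ξ‖ ^ ℓ) = _
  rw [norm_smul, Real.norm_of_nonneg (by positivity), Real.mul_rpow (by positivity)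
    (norm_nonneg _), ← Real.rpow_mul hr.le, inv_mul_cancel₀ (by linarith), Real.rpow_one]

end Hyper

/-! ### Averages of translates -/

/-- The distribution `k * H` tested against `φ`, for an integrable function `k`. -/
def translateAvg (k : R3 → ℝ) (H : TempDist) (φ : TestFn) : ℝ := ∫ y, k y * H (shift y φ)

/-- The distribution `H` has bounded translates: `H * φ` is bounded for each test function. -/
def HasBoundedTranslates (H : TempDist) : Prop := ∀ φ : TestFn, ∃ C, ∀ y, |H (shift y φ)| ≤ C

theorem integrable_mul_of_bounded {k g : R3 → ℝ} (hk : Integrable k) (hg : Continuous g) {B : ℝ}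
    (hB : ∀ y, |g y| ≤ B) : Integrable fun y => k y * g y :=
  hk.mul_bdd hg.aestronglyMeasurable (ae_of_all _ hB)

theorem HasBoundedTranslates.integrable {H : TempDist} (h : HasBoundedTranslates H) {k : R3 → ℝ}
    (hk : Integrable k) (φ : TestFn) : Integrable fun y => k y * H (shift y φ) := by
  obtain ⟨B, hB⟩ := h φ
  exact integrable_mul_of_bounded hk (TempDist.continuous_apply_shift H φ) hB

/-- Fubini for the integral of a convolution against a bounded continuous function. -/
theorem integral_mul_convolution {k k' g : R3 → ℝ} (hk : Integrable k) (hk' : Integrable k')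
    (hg : Continuous g) {B : ℝ} (hB : ∀ y, |g y| ≤ B) :
    ∫ x, (∫ y, k y * k' (x - y)) * g x = ∫ y, k y * ∫ z, k' z * g (y + z) := by
  have hprod : Integrable (fun z : R3 × R3 => k z.2 * k' (z.1 - z.2)) (volume.prod volume) :=
    hk.convolution_integrand (ContinuousLinearMap.mul ℝ ℝ) hk'
  have hprod' : Integrable (fun z : R3 × R3 => k z.2 * k' (z.1 - z.2) * g z.1)
      (volume.prod volume) :=
    hprod.mul_bdd (hg.comp continuous_fst).aestronglyMeasurable (ae_of_all _ fun z => hB _)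
  simp only [← integral_mul_const]
  rw [integral_integral_swap hprod']
  congr 1; funext y
  rw [← integral_const_mul, ← integral_sub_right_eq_self (fun z => k y * (k' z * g (y + z))) y]
  congr 1; funext x
  rw [add_sub_cancel]; ring

/-- The symbol `m m'` acts by convolution with the kernel of `m'` and then with that of `m`. -/
theorem EvenMultiplier.translateAvg_mul {m m' : R3 → ℝ} {C C' : ℝ} (h : EvenMultiplier m C)
    {T : ℝ → ℝ} (hT : IsTrig T) (h' : KernelBound T m' C') {H : TempDist}
    (hH : HasBoundedTranslates H) (φ : TestFn) :
    translateAvg (trigKernel T (fun ξ => m ξ * m' ξ)) H φ =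
      ∫ y, evenKernel m y * translateAvg (trigKernel T m') H (shift y φ) := by
  obtain ⟨B, hB⟩ := hH φ
  have h1 := integral_mul_convolution h.kernel h'.kernel (TempDist.continuous_apply_shift H φ) hB
  simp only [translateAvg, ← h.integral_kernel_mul hT h'.symbol, shift_shift]
  refine h1.trans ?_
  simp only [add_comm, evenKernel_eq_trigKernel]

theorem translateAvg_sub {k k' : R3 → ℝ} (hk : Integrable k) (hk' : Integrable k') {H : TempDist}
    (hH : HasBoundedTranslates H) (φ : TestFn) :
    translateAvg (fun y => k y - k' y) H φ = translateAvg k H φ - translateAvg k' H φ := by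
  simp only [translateAvg, sub_mul]
  exact integral_sub (hH.integrable hk φ) (hH.integrable hk' φ)

/-! ### The heat and the hyperdissipative semigroups -/

/-- The properties of the symbol of a semigroup on which the analysis of mild solutions rests:
with `exp (s|ξ|²/2)` taken off, the semigroup and its increments are given by integrable kernels,
and it is continuous at time `0`. -/
structure SmoothingSymbol (σ : ℝ → R3 → ℝ) (ℓ C : ℝ) : Prop where
  residual : ∀ s, 0 < s → EvenMultiplier (residualSymbol σ s) C
  leray : ∀ s, 0 < s → ∃ C', ∀ j k l, KernelBound (fun s => -Real.sin s)
    (fun ξ => lerayDerivSymbol j k l ξ * residualSymbol σ s ξ) C'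
  increment : ∀ s h, 0 < s → 0 < h →
    EvenMultiplier (fun ξ => (σ (s + h) ξ - σ s ξ) * Real.exp (s / 2 * ‖ξ‖ ^ 2))
      (C * min 1 (h * (s⁻¹ + s ^ (-(ℓ / 2)))))
  tendsto : ∀ H, HasBoundedTranslates H → ∀ φ : TestFn,
    Tendsto (fun t => translateAvg (evenKernel (σ t)) H φ) (𝓝[>] 0) (𝓝 (H φ))

theorem residualSymbol_mul_heatSymbol (σ : ℝ → R3 → ℝ) (s : ℝ) (ξ : R3) :
    residualSymbol σ s ξ * heatSymbol (s / 2) ξ = σ s ξ := by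
  rw [residualSymbol, heatSymbol, mul_assoc, ← Real.exp_add, add_neg_cancel, Real.exp_zero, mul_one]

theorem residualSymbol_heatSymbol (s : ℝ) (ξ : R3) :
    residualSymbol heatSymbol s ξ = heatSymbol (s / 2) ξ := by
  rw [residualSymbol, heatSymbol, heatSymbol, ← Real.exp_add]; congr 1; ring

theorem residualSymbol_hyperSymbol (ℓ s : ℝ) (ξ : R3) :
    residualSymbol (hyperSymbol ℓ) s ξ = Real.exp (-(s * ‖ξ‖ ^ ℓ)) * heatSymbol (s / 2) ξ := by
  rw [residualSymbol, hyperSymbol, heatSymbol, ← Real.exp_add, ← Real.exp_add]; congr 1; ring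

theorem evenMultiplier_exp_neg_norm_sq {r : ℝ} (hr : 0 < r) :
    EvenMultiplier (fun ξ => Real.exp (-(r * ‖ξ‖ ^ (2 : ℝ)))) 1 :=
  (evenMultiplier_heatSymbol hr).congr fun ξ => by rw [heatSymbol, Real.rpow_two]

theorem heat_tendsto {H : TempDist} (φ : TestFn) :
    Tendsto (fun t => translateAvg (evenKernel (heatSymbol t)) H φ) (𝓝[>] 0) (𝓝 (H φ)) := by
  obtain ⟨N, C, -, hb⟩ := TempDist.abs_apply_shift_le H φ
  have h := tendsto_integral_heatTest_mul (TempDist.continuous_apply_shift H φ) hb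
  rw [shift_zero] at h
  refine h.congr' ?_
  filter_upwards [self_mem_nhdsWithin] with t ht
  rw [translateAvg, evenKernel_heatSymbol ht]

theorem exists_smoothingSymbol_heat :
    ∃ C, 0 ≤ C ∧ ∀ ℓ C', C ≤ C' → SmoothingSymbol heatSymbol ℓ C' := by
  obtain ⟨C₁, hC₁, h₁⟩ := exists_evenMultiplier_heat_mul_one_sub two_pos
    (fun r hr => evenMultiplier_exp_neg_norm_sq hr)
  obtain ⟨C₂, hC₂, h₂⟩ := exists_kernelBound_leray
  refine ⟨1 + 2 * C₁, by positivity, fun ℓ C' hC' => ⟨fun s hs => ?_, fun s hs => ?_,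
    fun s h hs hh => ?_, fun H _ φ => heat_tendsto φ⟩⟩
  · exact ((evenMultiplier_heatSymbol (half_pos hs)).congr
      fun ξ => (residualSymbol_heatSymbol s ξ).symm).mono (by linarith)
  · exact ⟨_, fun j k l => (h₂ j k l (s / 2) (half_pos hs)).congr
      fun ξ => by rw [residualSymbol_heatSymbol]⟩
  · have e := (h₁ (s / 2) h (half_pos hs) hh).const_mul (-1)
    refine (e.congr fun ξ => ?_).mono ?_
    · have h3 : heatSymbol s ξ * Real.exp (s / 2 * ‖ξ‖ ^ 2) = heatSymbol (s / 2) ξ :=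
        residualSymbol_heatSymbol s ξ
      have h4 : Real.exp (-(h * ‖ξ‖ ^ (2 : ℝ))) = heatSymbol h ξ := by
        rw [heatSymbol, Real.rpow_two]
      rw [heatSymbol_add, h4]
      linear_combination (1 - heatSymbol h ξ) * h3
    · have hx : h * (s / 2) ^ (-(2 / 2) : ℝ) = 2 * (h * s⁻¹) := by
        rw [show (-(2 / 2) : ℝ) = -1 by norm_num, Real.rpow_neg_one]; field_simp
      have hm : min 1 (h * (s / 2) ^ (-(2 / 2) : ℝ)) ≤ 2 * min 1 (h * (s⁻¹ + s ^ (-(ℓ / 2)))) := by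
        have h0 : 0 ≤ h * s ^ (-(ℓ / 2)) := by positivity
        rw [hx]
        rcases le_total 1 (h * (s⁻¹ + s ^ (-(ℓ / 2)))) with h1 | h1
        · rw [min_eq_left h1]; linarith [min_le_left 1 (2 * (h * s⁻¹))]
        · rw [min_eq_right h1]; nlinarith [min_le_right 1 (2 * (h * s⁻¹))]
      have hp : 0 ≤ min 1 (h * (s⁻¹ + s ^ (-(ℓ / 2)))) := le_min zero_le_one (by positivity)
      rw [abs_neg, abs_one, one_mul]
      calc _ ≤ C₁ * (2 * min 1 (h * (s⁻¹ + s ^ (-(ℓ / 2))))) := by gcongr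
        _ = 2 * C₁ * min 1 (h * (s⁻¹ + s ^ (-(ℓ / 2)))) := by ring
        _ ≤ _ := by gcongr; linarith

/-- The kernels of `exp (-t|ξ|^ℓ)` times a heat kernel form an approximate identity: both factors
are dilates of a fixed integrable kernel of integral one. -/
theorem hyper_tendsto {ℓ Ce : ℝ} (hℓ : 2 < ℓ)
    (he : ∀ r, 0 < r → EvenMultiplier (fun ξ => Real.exp (-(r * ‖ξ‖ ^ ℓ))) Ce)
    {H : TempDist} (hH : HasBoundedTranslates H) (φ : TestFn) :
    Tendsto (fun t => translateAvg (evenKernel (hyperSymbol ℓ t)) H φ) (𝓝[>] 0) (𝓝 (H φ)) := by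
  obtain ⟨B, hB⟩ := hH φ
  set g : R3 → ℝ := fun y => H (shift y φ) with hg
  have hgc : Continuous g := TempDist.continuous_apply_shift H φ
  set K := evenKernel (fun ξ => Real.exp (-(1 * ‖ξ‖ ^ ℓ))) with hK
  set P := evenKernel (heatSymbol 1) with hP
  have hKi : Integrable K := (he 1 one_pos).kernel
  have hPi : Integrable P := (evenMultiplier_heatSymbol one_pos).kernel
  have hKone : ∫ x, K x = 1 := by
    have h := (he 1 one_pos).inversion 0
    simpa only [inner_zero_right, Real.cos_zero, mul_one, norm_zero,
      Real.zero_rpow (by linarith : ℓ ≠ 0), mul_zero, neg_zero, Real.exp_zero] using h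
  have hPone : ∫ x, P x = 1 := by
    have h := (evenMultiplier_heatSymbol one_pos).inversion 0
    simpa [heatSymbol] using h
  -- `exp (-t|ξ|^ℓ)` lives at the length scale `t^(1/ℓ)`, the heat kernel at the scale `√t`.
  have hscale : ∀ t, 0 < t → translateAvg (evenKernel (hyperSymbol ℓ t)) H φ =
      ∫ z : R3 × R3, K z.1 * P z.2 * g (t ^ ℓ⁻¹ • z.1 + Real.sqrt t • z.2) := by
    intro t ht
    have ht' : 0 < t ^ ℓ⁻¹ := by positivity
    have hs' : 0 < Real.sqrt t := Real.sqrt_pos.2 ht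
    have hKt : evenKernel (fun ξ => Real.exp (-(t * ‖ξ‖ ^ ℓ))) =
        fun x => ((t ^ ℓ⁻¹) ^ 3)⁻¹ * K ((t ^ ℓ⁻¹)⁻¹ • x) := by
      funext x
      rw [hK, evenKernel_eq_trigKernel, ← trigKernel_dilate _ ht']
      congr 1; funext ξ
      rw [norm_smul, Real.norm_of_nonneg ht'.le, Real.mul_rpow ht'.le (norm_nonneg _),
        ← Real.rpow_mul ht.le, inv_mul_cancel₀ (by linarith), Real.rpow_one, one_mul]
    have hPt : evenKernel (heatSymbol t) =
        fun x => (Real.sqrt t ^ 3)⁻¹ * P ((Real.sqrt t)⁻¹ • x) := by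
      funext x
      rw [hP, evenKernel_eq_trigKernel, ← trigKernel_dilate _ hs']
      congr 1; funext ξ
      rw [heatSymbol_dilate ht, heatSymbol_one]
    have h1 := (he t ht).translateAvg_mul isTrig_cos
      (evenMultiplier_heatSymbol ht).toKernelBound hH φ
    have h2 : (fun ξ : R3 => Real.exp (-(t * ‖ξ‖ ^ ℓ)) * heatSymbol t ξ) = hyperSymbol ℓ t := by
      funext ξ
      rw [hyperSymbol, heatSymbol, ← Real.exp_add]; congr 1; ring
    rw [h2, ← evenKernel_eq_trigKernel] at h1
    rw [h1, hKt, hPt, integral_dilate _ ht', ← integral_const_mul]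
    have hint : Integrable (fun z : R3 × R3 =>
        K z.1 * P z.2 * g (t ^ ℓ⁻¹ • z.1 + Real.sqrt t • z.2)) (volume.prod volume) :=
      (hKi.mul_prod hPi).mul_bdd (hgc.comp (by fun_prop)).aestronglyMeasurable
        (ae_of_all _ fun z => hB _)
    rw [Measure.volume_eq_prod, integral_prod _ hint]
    congr 1; funext z
    simp only [inv_smul_smul₀ ht'.ne']
    rw [translateAvg, integral_dilate _ hs']
    simp only [inv_smul_smul₀ hs'.ne', shift_shift, hg, add_comm (Real.sqrt t • _)]
    rw [← integral_const_mul, ← integral_const_mul, ← integral_const_mul]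
    congr 1; funext w
    field_simp
  have hlim : Tendsto (fun t => ∫ z : R3 × R3, K z.1 * P z.2 *
      g (t ^ ℓ⁻¹ • z.1 + Real.sqrt t • z.2)) (𝓝[>] 0) (𝓝 (∫ z : R3 × R3, K z.1 * P z.2 * g 0)) := by
    have hKP : Integrable (fun z : R3 × R3 => K z.1 * P z.2) := hKi.mul_prod hPi
    refine tendsto_integral_filter_of_dominated_convergence (fun z => ‖K z.1 * P z.2‖ * B)
      (Eventually.of_forall fun t => hKP.aestronglyMeasurable.mul
        (hgc.comp (by fun_prop)).aestronglyMeasurable)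
      (Eventually.of_forall fun t => ae_of_all _ fun z => ?_) (hKP.norm.mul_const B)
      (ae_of_all _ fun z => ?_)
    · rw [norm_mul]
      exact mul_le_mul_of_nonneg_left (hB _) (norm_nonneg _)
    · refine Tendsto.const_mul _ ?_
      have hc : Continuous fun t : ℝ => g (t ^ ℓ⁻¹ • z.1 + Real.sqrt t • z.2) := by
        have : Continuous fun t : ℝ => t ^ ℓ⁻¹ :=
          Real.continuous_rpow_const (inv_nonneg.2 (by linarith))
        fun_prop
      have h := hc.tendsto 0
      rw [Real.zero_rpow (inv_ne_zero (by linarith)), Real.sqrt_zero, zero_smul, zero_smul,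
        add_zero] at h
      exact h.mono_left nhdsWithin_le_nhds
  have hval : ∫ z : R3 × R3, K z.1 * P z.2 * g 0 = H φ := by
    rw [integral_mul_const, Measure.volume_eq_prod, integral_prod_mul, hKone, hPone, hg]
    simp [shift_zero]
  rw [hval] at hlim
  refine hlim.congr' ?_
  filter_upwards [self_mem_nhdsWithin] with t ht using (hscale t ht).symm

/-- The increments of the semigroup with symbol `exp (-s|ξ|² - s|ξ|^ℓ)` split into one of the heat
semigroup, of size `h / s`, and one of `exp (-s|ξ|^ℓ)`, of size `h s^(-ℓ/2)`. -/
theorem exists_smoothingSymbol_hyper {ℓ : ℝ} (hℓ : 2 < ℓ) :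
    ∃ C, 0 ≤ C ∧ ∀ C', C ≤ C' → SmoothingSymbol (hyperSymbol ℓ) ℓ C' := by
  obtain ⟨Ce, he⟩ := exists_evenMultiplier_exp_neg_norm_rpow hℓ
  have hCe : 0 ≤ Ce := (he 1 one_pos).nonneg
  obtain ⟨C₁, hC₁, h₁⟩ := exists_evenMultiplier_heat_mul_one_sub two_pos
    (fun r hr => evenMultiplier_exp_neg_norm_sq hr)
  obtain ⟨C₃, hC₃, h₃⟩ := exists_evenMultiplier_heat_mul_one_sub (by linarith : 0 < ℓ) he
  obtain ⟨C₂, hC₂, h₂⟩ := exists_kernelBound_leray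
  set D : ℝ := 2 * C₁ + 2 ^ (ℓ / 2) * C₃ with hD
  have hD0 : 0 ≤ D := by positivity
  refine ⟨Ce + Ce * D, by positivity, fun C' hC' => ⟨fun s hs => ?_, fun s hs => ?_,
    fun s h hs hh => ?_, fun H hH φ => hyper_tendsto hℓ he hH φ⟩⟩
  · have e := (he s hs).mul (evenMultiplier_heatSymbol (half_pos hs))
    refine (e.congr fun ξ => (residualSymbol_hyperSymbol ℓ s ξ).symm).mono ?_
    nlinarith [mul_nonneg hCe hD0]
  · exact ⟨_, fun j k l => ((he s hs).mul_kernelBound isTrig_neg_sin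
      (h₂ j k l (s / 2) (half_pos hs))).congr fun ξ => by rw [residualSymbol_hyperSymbol]; ring⟩
  · have e1 := h₁ (s / 2) h (half_pos hs) hh
    have e2 := (evenMultiplier_heatSymbol hh).mul (h₃ (s / 2) h (half_pos hs) hh)
    have e3 := (he s hs).mul ((e1.const_mul (-1)).sub e2)
    refine (e3.congr fun ξ => ?_).mono ?_
    · have hA : (hyperSymbol ℓ (s + h) ξ - hyperSymbol ℓ s ξ) * Real.exp (s / 2 * ‖ξ‖ ^ 2) =
          residualSymbol (hyperSymbol ℓ) s ξ * (hyperSymbol ℓ h ξ - 1) := by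
        have : hyperSymbol ℓ (s + h) ξ = hyperSymbol ℓ s ξ * hyperSymbol ℓ h ξ := by
          rw [hyperSymbol, hyperSymbol, hyperSymbol, ← Real.exp_add]; congr 1; ring
        rw [this, residualSymbol]; ring
      have hB : hyperSymbol ℓ h ξ = heatSymbol h ξ * Real.exp (-(h * ‖ξ‖ ^ ℓ)) := by
        rw [hyperSymbol, heatSymbol, ← Real.exp_add]; congr 1; ring
      have hC : Real.exp (-(h * ‖ξ‖ ^ (2 : ℝ))) = heatSymbol h ξ := by
        rw [heatSymbol, Real.rpow_two]
      rw [hA, residualSymbol_hyperSymbol, hB, hC]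
      ring
    · set x := h * (s⁻¹ + s ^ (-(ℓ / 2))) with hx
      have hmin : ∀ c y : ℝ, 1 ≤ c → 0 ≤ y → y ≤ x → min 1 (c * y) ≤ c * min 1 x := by
        intro c y hc hy hyx
        rcases le_total 1 x with h1 | h1
        · rw [min_eq_left h1]; linarith [min_le_left 1 (c * y)]
        · rw [min_eq_right h1]; nlinarith [min_le_right 1 (c * y)]
      have hp : 0 ≤ min 1 x := le_min zero_le_one (by positivity)
      have m1 : min 1 (h * (s / 2) ^ (-(2 / 2) : ℝ)) ≤ 2 * min 1 x := by
        have : h * (s / 2) ^ (-(2 / 2) : ℝ) = 2 * (h * s⁻¹) := by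
          rw [show (-(2 / 2) : ℝ) = -1 by norm_num, Real.rpow_neg_one]; field_simp
        rw [this]
        refine hmin 2 _ one_le_two (by positivity) ?_
        have : 0 ≤ h * s ^ (-(ℓ / 2)) := by positivity
        rw [hx, mul_add]; linarith
      have m2 : min 1 (h * (s / 2) ^ (-(ℓ / 2))) ≤ 2 ^ (ℓ / 2) * min 1 x := by
        have : h * (s / 2) ^ (-(ℓ / 2)) = 2 ^ (ℓ / 2) * (h * s ^ (-(ℓ / 2))) := by
          rw [Real.div_rpow hs.le two_pos.le, Real.rpow_neg two_pos.le]; field_simp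
        rw [this]
        refine hmin _ _ (Real.one_le_rpow one_le_two (by linarith)) (by positivity) ?_
        have : 0 ≤ h * s⁻¹ := by positivity
        rw [hx, mul_add]; linarith
      rw [abs_neg, abs_one, one_mul, one_mul]
      calc _ ≤ Ce * (C₁ * (2 * min 1 x) + C₃ * (2 ^ (ℓ / 2) * min 1 x)) := by gcongr
        _ = Ce * D * min 1 x := by rw [hD]; ring
        _ ≤ _ := by gcongr; linarith

theorem min_one_le_rpow {x θ : ℝ} (hx : 0 ≤ x) (h0 : 0 ≤ θ) (h1 : θ ≤ 1) : min 1 x ≤ x ^ θ := by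
  rcases le_total 1 x with h | h
  · rw [min_eq_left h]; exact Real.one_le_rpow h h0
  · rw [min_eq_right h]
    rcases hx.eq_or_lt with rfl | hx'
    · positivity
    · calc x = x ^ (1 : ℝ) := (Real.rpow_one x).symm
        _ ≤ x ^ θ := Real.rpow_le_rpow_of_exponent_ge hx' h h1

/-- For large times the two semigroups are close: `1 - exp (-s|ξ|^ℓ)` is small on the frequencies
of size `s^(-1/2)` because `ℓ > 2`. -/
theorem exists_residual_sub_bound {ℓ : ℝ} (hℓ : 2 < ℓ) :
    ∃ C, 0 ≤ C ∧ ∀ δ, 0 < δ → δ ≤ ℓ / 2 - 1 → δ ≤ 1 → ∀ s, 0 < s →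
      EvenMultiplier (fun ξ => residualSymbol heatSymbol s ξ - residualSymbol (hyperSymbol ℓ) s ξ)
        (C * s ^ (-δ)) := by
  obtain ⟨Ce, he⟩ := exists_evenMultiplier_exp_neg_norm_rpow hℓ
  obtain ⟨C, hC, h⟩ := exists_evenMultiplier_heat_mul_one_sub (by linarith : 0 < ℓ) he
  refine ⟨C * 2 ^ (ℓ / 2), by positivity, fun δ hδ hδℓ hδ1 s hs => ?_⟩
  refine ((h (s / 2) s (half_pos hs) hs).congr fun ξ => ?_).mono ?_
  · rw [residualSymbol_heatSymbol, residualSymbol_hyperSymbol]; ring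
  · have hx : s * (s / 2) ^ (-(ℓ / 2)) = 2 ^ (ℓ / 2) * s ^ (-(ℓ / 2 - 1)) := by
      rw [Real.div_rpow hs.le two_pos.le, Real.rpow_neg two_pos.le,
        show -(ℓ / 2 - 1) = -(ℓ / 2) + 1 by ring, Real.rpow_add_one hs.ne']
      field_simp
    have hc : (1 : ℝ) ≤ 2 ^ (ℓ / 2) := Real.one_le_rpow one_le_two (by linarith)
    rw [mul_assoc, hx]
    refine mul_le_mul_of_nonneg_left ?_ hC
    -- With `x = s^(-(ℓ/2 - 1))`, the bound `min 1 (C x) ≤ C s^(-δ)` uses `x ≤ s^(-δ)` for `s ≥ 1`,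
    -- and `1 ≤ s^(-δ)` for `s ≤ 1`.
    rcases le_total 1 s with h1 | h1
    · refine (min_le_right _ _).trans ?_
      gcongr
    · refine (min_le_left _ _).trans ?_
      have : 1 ≤ s ^ (-δ) := Real.one_le_rpow_of_pos_of_le_one_of_nonpos hs h1 (by linarith)
      nlinarith

/-! ### Multipliers on translation invariant spaces -/

section Multipliers

variable {E : Type*} [NormedAddCommGroup E] [NormedSpace ℝ E]

theorem pairing_add (ι : E →L[ℝ] TempDist) (e e' : E) (φ : TestFn) :
    ι (e + e') φ = ι e φ + ι e' φ := (distPairing ι φ).map_add e e'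

theorem pairing_sub (ι : E →L[ℝ] TempDist) (e e' : E) (φ : TestFn) :
    ι (e - e') φ = ι e φ - ι e' φ := (distPairing ι φ).map_sub e e'

theorem pairing_smul (ι : E →L[ℝ] TempDist) (c : ℝ) (e : E) (φ : TestFn) :
    ι (c • e) φ = c * ι e φ := (distPairing ι φ).map_smul c e

theorem pairing_zero (ι : E →L[ℝ] TempDist) (φ : TestFn) : ι 0 φ = 0 := (distPairing ι φ).map_zero

/-- The properties of a functional translation invariant space used below. -/
structure IsSmearable (ι : E →L[ℝ] TempDist) : Prop where
  injective : Function.Injective ι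
  translation : IsTranslationInvariant ι
  weakIntegrals : HasWeakIntegrals ι

theorem IsFunctionalTranslationInvariant.isSmearable [CompleteSpace E] {ι : E →L[ℝ] TempDist}
    (h : IsFunctionalTranslationInvariant ι) : IsSmearable ι :=
  ⟨h.1.1, h.2.2, h.hasWeakIntegrals⟩

open Classical in
/-- The convolution `k * e` of an integrable function `k` and an element `e` of the space
(`0` if it is not in the space). -/
def smear (ι : E →L[ℝ] TempDist) (k : R3 → ℝ) (e : E) : E :=
  if h : ∃ e', ∀ φ, ι e' φ = translateAvg k (ι e) φ then h.choose else 0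

/-- The operator with even symbol `m`. -/
def multOp (ι : E →L[ℝ] TempDist) (m : R3 → ℝ) (e : E) : E := smear ι (evenKernel m) e

/-- The heat semigroup on the space. -/
def heatOp (ι : E →L[ℝ] TempDist) (r : ℝ) (e : E) : E := multOp ι (heatSymbol r) e

theorem multOp_congr (ι : E →L[ℝ] TempDist) {m m' : R3 → ℝ} (h : ∀ ξ, m ξ = m' ξ) (e : E) :
    multOp ι m e = multOp ι m' e := by
  rw [funext h]

namespace IsSmearable

variable {ι : E →L[ℝ] TempDist} (hι : IsSmearable ι)
include hι

theorem ext {e e' : E} (h : ∀ φ, ι e φ = ι e' φ) : e = e' :=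
  hι.injective (by ext φ; exact h φ)

theorem hasBoundedTranslates (e : E) : HasBoundedTranslates (ι e) := fun φ =>
  ⟨_, fun y => hι.translation.abs_apply_shift_le e φ y⟩

theorem exists_translateAvg {k : R3 → ℝ} (hk : Integrable k) (e : E) :
    ∃ e', (∀ φ, ι e' φ = translateAvg k (ι e) φ) ∧ ‖e'‖ ≤ (∫ x, |k x|) * ‖e‖ := by
  choose g hg hn using fun y => hι.translation y e
  have hp : ∀ φ, (fun y => ι (k y • g y) φ) = fun y => k y * ι e (shift y φ) := fun φ => by
    funext y
    rw [pairing_smul, ← hg]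
  obtain ⟨e', h1, h2⟩ := hι.weakIntegrals R3 volume (fun y => k y • g y) (fun y => |k y| * ‖e‖)
    (fun φ => by
      rw [hp]
      exact hk.aemeasurable.mul (TempDist.continuous_apply_shift _ φ).aemeasurable)
    (hk.abs.mul_const _) (ae_of_all _ fun y => by rw [norm_smul, hn, Real.norm_eq_abs])
  refine ⟨e', fun φ => ?_, ?_⟩
  · rw [h1, translateAvg, hp]
  · rwa [integral_mul_const] at h2

theorem apply_smear {k : R3 → ℝ} (hk : Integrable k) (e : E) (φ : TestFn) :
    ι (smear ι k e) φ = translateAvg k (ι e) φ := by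
  have h : ∃ e', ∀ φ, ι e' φ = translateAvg k (ι e) φ :=
    (hι.exists_translateAvg hk e).imp fun _ h => h.1
  rw [smear, dif_pos h]
  exact h.choose_spec φ

theorem norm_smear_le {k : R3 → ℝ} (hk : Integrable k) (e : E) :
    ‖smear ι k e‖ ≤ (∫ x, |k x|) * ‖e‖ := by
  obtain ⟨e', h1, h2⟩ := hι.exists_translateAvg hk e
  rwa [hι.ext fun φ => (hι.apply_smear hk e φ).trans (h1 φ).symm]

variable {m m' : R3 → ℝ} {C C' : ℝ}

theorem apply_multOp (hm : EvenMultiplier m C) (e : E) (φ : TestFn) :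
    ι (multOp ι m e) φ = ∫ y, evenKernel m y * ι e (shift y φ) := hι.apply_smear hm.kernel e φ

theorem norm_multOp_le (hm : EvenMultiplier m C) (e : E) : ‖multOp ι m e‖ ≤ C * ‖e‖ :=
  (hι.norm_smear_le hm.kernel e).trans
    (mul_le_mul_of_nonneg_right hm.norm_le (norm_nonneg _))

theorem multOp_multOp (hm : EvenMultiplier m C) (hm' : EvenMultiplier m' C') (e : E) :
    multOp ι m (multOp ι m' e) = multOp ι (fun ξ => m ξ * m' ξ) e := hι.ext fun φ => by
  rw [hι.apply_multOp hm]
  simp only [hι.apply_multOp hm']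
  exact (((hι.apply_multOp (hm.mul hm') e φ).trans
    (hm.translateAvg_mul isTrig_cos hm'.toKernelBound (hι.hasBoundedTranslates e) φ))).symm

theorem multOp_sub (hm : EvenMultiplier m C) (e e' : E) :
    multOp ι m (e - e') = multOp ι m e - multOp ι m e' := hι.ext fun φ => by
  rw [pairing_sub, hι.apply_multOp hm, hι.apply_multOp hm, hι.apply_multOp hm]
  simp only [pairing_sub, mul_sub]
  exact integral_sub ((hι.hasBoundedTranslates e).integrable hm.kernel φ)
    ((hι.hasBoundedTranslates e').integrable hm.kernel φ)

theorem sub_multOp (hm : EvenMultiplier m C) (hm' : EvenMultiplier m' C') (e : E) :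
    multOp ι (fun ξ => m ξ - m' ξ) e = multOp ι m e - multOp ι m' e := hι.ext fun φ => by
  rw [pairing_sub, hι.apply_multOp (hm.sub hm'), hι.apply_multOp hm, hι.apply_multOp hm', evenKernel_eq_trigKernel]
  simp only [isTrig_cos.kernel_sub hm.symbol hm'.symbol]
  exact translateAvg_sub hm.kernel hm'.kernel (hι.hasBoundedTranslates e) φ

theorem multOp_heatOp_comm (hm : EvenMultiplier m C) {r : ℝ} (hr : 0 < r) (e : E) :
    multOp ι m (heatOp ι r e) = heatOp ι r (multOp ι m e) := by
  rw [heatOp, heatOp, hι.multOp_multOp hm (evenMultiplier_heatSymbol hr),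
    hι.multOp_multOp (evenMultiplier_heatSymbol hr) hm]
  exact multOp_congr ι (fun ξ => mul_comm _ _) e

end IsSmearable

end Multipliers

/-! ### Functions representing distributions -/

theorem heat_eq_shift (H : TempDist) {s : ℝ} (hs : 0 < s) (x : R3) :
    heat s H x = H (shift (-x) (heatTest s 0)) := by rw [heat, heatTest_eq_shift hs]

theorem continuous_heat (H : TempDist) {s : ℝ} (hs : 0 < s) : Continuous (heat s H) := by
  have : heat s H = fun x => H (shift (-x) (heatTest s 0)) := funext (heat_eq_shift H hs)
  rw [this]
  exact (TempDist.continuous_apply_shift H _).comp continuous_neg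

theorem HasBoundedTranslates.exists_heat_le {H : TempDist} (h : HasBoundedTranslates H) {s : ℝ}
    (hs : 0 < s) : ∃ B, ∀ x, |heat s H x| ≤ B := by
  obtain ⟨B, hB⟩ := h (heatTest s 0)
  exact ⟨B, fun x => by rw [heat_eq_shift H hs]; exact hB _⟩

theorem integral_heat_mul_eq_translateAvg (H : TempDist) {s : ℝ} (hs : 0 < s) (φ : TestFn) :
    ∫ x, heat s H x * φ x = translateAvg (evenKernel (heatSymbol s)) H φ := by
  rw [integral_heat_mul H hs, TempDist.apply_sconv, translateAvg, evenKernel_heatSymbol hs]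

/-- An integrable kernel convolved with a heat-regularized distribution, tested against `φ`. -/
theorem HasBoundedTranslates.integral_kernel_heat {H : TempDist} (h : HasBoundedTranslates H)
    {k : R3 → ℝ} (hk : Integrable k) {s : ℝ} (hs : 0 < s) (φ : TestFn) :
    Integrable (fun x => (∫ y, k y * heat s H (x - y)) * φ x) ∧
    ∫ x, (∫ y, k y * heat s H (x - y)) * φ x =
      ∫ y, k y * translateAvg (evenKernel (heatSymbol s)) H (shift y φ) := by
  obtain ⟨B, hB⟩ := h.exists_heat_le hs
  have hint : Integrable (fun z : R3 × R3 => φ z.1 * k z.2 * heat s H (z.1 - z.2))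
      (volume.prod volume) :=
    (φ.integrable.mul_prod hk).mul_bdd
      ((continuous_heat H hs).comp (by fun_prop)).aestronglyMeasurable (ae_of_all _ fun z => hB _)
  have heq : (fun x => (∫ y, k y * heat s H (x - y)) * φ x) =
      fun x => ∫ y, φ x * k y * heat s H (x - y) := by
    funext x
    rw [← integral_mul_const]
    congr 1; funext y; ring
  refine ⟨by rw [heq]; exact hint.integral_prod_left, ?_⟩
  rw [heq, integral_integral_swap hint]
  congr 1; funext y
  rw [← integral_heat_mul_eq_translateAvg H hs, ← integral_const_mul,
    ← integral_sub_right_eq_self (fun x => k y * (heat s H x * shift y φ x)) y]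
  congr 1; funext x
  rw [shift_apply, sub_add_cancel]; ring

theorem represents_heat {H f : TempDist} (hH : HasBoundedTranslates H) {s : ℝ} (hs : 0 < s)
    (h : ∀ φ, f φ = translateAvg (evenKernel (heatSymbol s)) H φ) : Represents f (heat s H) := by
  obtain ⟨B, hB⟩ := hH.exists_heat_le hs
  refine fun φ => ⟨?_, ?_⟩
  · simpa only [mul_comm] using integrable_mul_of_bounded φ.integrable (continuous_heat H hs) hB
  · rw [h, integral_heat_mul_eq_translateAvg H hs]

theorem Represents.unique {f f' : TempDist} {g : R3 → ℝ} (h : Represents f g)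
    (h' : Represents f' g) : f = f' := by
  ext φ; rw [(h φ).2, (h' φ).2]

section Norms

variable {E : Type*} [NormedAddCommGroup E] [NormedSpace ℝ E] {ι : E →L[ℝ] TempDist}

theorem fnENorm_eq (hι : Function.Injective ι) {e : E} {g : R3 → ℝ} (h : Represents (ι e) g) :
    fnENorm ι g = ‖e‖ₑ := by
  refine le_antisymm (iInf₂_le e h) (le_iInf₂ fun e' h' => ?_)
  rw [hι (h'.unique h)]

theorem exists_of_fnENorm_le (hι : Function.Injective ι) {g : R3 → ℝ} {c : ℝ} (hc : 0 ≤ c)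
    (h : fnENorm ι g ≤ ENNReal.ofReal c) : ∃ e, Represents (ι e) g ∧ ‖e‖ ≤ c := by
  have h1 : ∃ e, Represents (ι e) g := by
    by_contra hne
    push Not at hne
    have : fnENorm ι g = ⊤ := by simp [fnENorm, hne]
    rw [this, top_le_iff] at h
    exact ENNReal.ofReal_ne_top h
  obtain ⟨e, he⟩ := h1
  refine ⟨e, he, ?_⟩
  rwa [fnENorm_eq hι he, ← ofReal_norm, ENNReal.ofReal_le_ofReal_iff hc] at h

theorem IsSmearable.fnENorm_heat (hι : IsSmearable ι) {r : ℝ} (hr : 0 < r) (e : E) :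
    fnENorm ι (heat r (ι e)) = ‖heatOp ι r e‖ₑ :=
  fnENorm_eq hι.injective (represents_heat (hι.hasBoundedTranslates e) hr
    fun φ => hι.apply_multOp (evenMultiplier_heatSymbol hr) e φ)

theorem IsSmearable.besovNorm_le (hι : IsSmearable ι) {α c : ℝ} {u : Fin 3 → E}
    (h : ∀ i r, 0 < r → r ^ (α / 2) * ‖heatOp ι r (u i)‖ ≤ c) :
    besovNorm ι α (vecDist ι u) ≤ ENNReal.ofReal c := by
  refine iSup_le fun i => iSup₂_le fun r hr => ?_
  rw [vecDist, hι.fnENorm_heat hr, ← ofReal_norm, ← ENNReal.ofReal_mul (by positivity)]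
  exact ENNReal.ofReal_le_ofReal (h i r hr)

end Norms

/-! ### The projected divergence -/

theorem integral_mul_integral_comm {k k' g : R3 → ℝ} (hk : Integrable k) (hk' : Integrable k')
    (hg : Continuous g) {B : ℝ} (hB : ∀ y, |g y| ≤ B) :
    ∫ y, k y * ∫ z, k' z * g (y + z) = ∫ z, k' z * ∫ y, k y * g (z + y) := by
  have hint : Integrable (fun w : R3 × R3 => k w.1 * k' w.2 * g (w.1 + w.2))
      (volume.prod volume) :=
    (hk.mul_prod hk').mul_bdd (hg.comp (by fun_prop)).aestronglyMeasurable (ae_of_all _ fun w => hB _)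
  have h1 := integral_integral_swap (f := fun y z => k y * k' z * g (y + z)) hint
  calc ∫ y, k y * ∫ z, k' z * g (y + z) = ∫ y, ∫ z, k y * k' z * g (y + z) := by
        congr 1; funext y
        rw [← integral_const_mul]
        congr 1; funext z; ring
    _ = _ := h1
    _ = _ := by
        congr 1; funext z
        rw [← integral_const_mul]
        congr 1; funext y
        rw [add_comm z y]; ring

theorem HasBoundedTranslates.translateAvg_comm {H : TempDist} (h : HasBoundedTranslates H)
    {k k' : R3 → ℝ} (hk : Integrable k) (hk' : Integrable k') (φ : TestFn) :
    ∫ y, k y * translateAvg k' H (shift y φ) = ∫ y, k' y * translateAvg k H (shift y φ) := by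
  obtain ⟨B, hB⟩ := h φ
  simp only [translateAvg, shift_shift]
  have h1 := integral_mul_integral_comm hk hk' (TempDist.continuous_apply_shift H φ) hB
  simpa only [add_comm] using h1

theorem HasBoundedTranslates.continuous_translateAvg_shift {H : TempDist}
    (h : HasBoundedTranslates H) {k : R3 → ℝ} (hk : Integrable k) (φ : TestFn) :
    Continuous fun y => translateAvg k H (shift y φ) := by
  obtain ⟨B, hB⟩ := h φ
  simp only [translateAvg, shift_shift]
  refine continuous_of_dominated (bound := fun z => ‖k z‖ * B) (fun y => ?_)
    (fun y => ae_of_all _ fun z => ?_) (hk.norm.mul_const B) (ae_of_all _ fun z => ?_)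
  · exact hk.aestronglyMeasurable.mul ((TempDist.continuous_apply_shift H φ).comp
      (by fun_prop : Continuous fun z : R3 => z + y)).aestronglyMeasurable
  · rw [norm_mul]; exact mul_le_mul_of_nonneg_left (hB _) (norm_nonneg _)
  · exact continuous_const.mul ((TempDist.continuous_apply_shift H φ).comp
      (by fun_prop : Continuous fun y : R3 => z + y))

theorem HasBoundedTranslates.abs_translateAvg_le {H : TempDist} {φ : TestFn} {B : ℝ}
    (hB : ∀ y, |H (shift y φ)| ≤ B) {k : R3 → ℝ} (hk : Integrable k) (y : R3) :
    |translateAvg k H (shift y φ)| ≤ (∫ z, |k z|) * B := by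
  rw [← integral_mul_const]
  refine norm_integral_le_of_norm_le (f := fun z => k z * H (shift z (shift y φ)))
    (hk.abs.mul_const B) (ae_of_all _ fun z => ?_)
  rw [norm_mul, shift_shift]
  exact mul_le_mul_of_nonneg_left (hB _) (norm_nonneg _)

theorem EvenMultiplier.integrable_evenKernel {m : R3 → ℝ} {C : ℝ} (h : EvenMultiplier m C) :
    Integrable (evenKernel m) := h.kernel

/-- The kernel of `ℙ_jk ∂_l exp (sΔ)`. -/
def lerayKernel (j k l : Fin 3) (s : ℝ) : R3 → ℝ :=
  oddKernel fun ξ => lerayDerivSymbol j k l ξ * heatSymbol s ξ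

theorem kernelBound_integrable {m : R3 → ℝ} {C : ℝ}
    (h : KernelBound (fun s => -Real.sin s) m C) : Integrable (oddKernel m) := by
  rw [oddKernel_eq_trigKernel]; exact h.kernel

theorem exists_lerayKernel_bound : ∃ C, 0 ≤ C ∧ ∀ (j k l : Fin 3) (s : ℝ), 0 < s →
    Integrable (lerayKernel j k l s) ∧ ∫ x, |lerayKernel j k l s x| ≤ C * s ^ (-(1 / 2) : ℝ) := by
  obtain ⟨C, hC, h⟩ := exists_kernelBound_leray
  refine ⟨C, hC, fun j k l s hs => ⟨kernelBound_integrable (h j k l s hs), ?_⟩⟩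
  rw [lerayKernel, oddKernel_eq_trigKernel]
  exact (h j k l s hs).norm_le

theorem integrable_lerayKernel (j k l : Fin 3) {s : ℝ} (hs : 0 < s) :
    Integrable (lerayKernel j k l s) := by
  obtain ⟨C, -, h⟩ := exists_lerayKernel_bound
  exact (h j k l s hs).1

/-- The `j`-th component of `ℙ ∇· exp (sΔ) H`, tested against `φ`. -/
def projDist (s : ℝ) (H : Fin 3 → Fin 3 → TempDist) (j : Fin 3) (φ : TestFn) : ℝ :=
  ∑ k, ∑ l, translateAvg (lerayKernel j k l s) (H l k) φ

theorem integral_mul_projDist {H : Fin 3 → Fin 3 → TempDist}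
    (hH : ∀ l k, HasBoundedTranslates (H l k)) {s : ℝ} (hs : 0 < s) {k₀ : R3 → ℝ}
    (hk₀ : Integrable k₀) (j : Fin 3) (φ : TestFn) :
    ∫ y, k₀ y * projDist s H j (shift y φ) =
      ∑ k, ∑ l, ∫ y, k₀ y * translateAvg (lerayKernel j k l s) (H l k) (shift y φ) := by
  have hint : ∀ k l, Integrable fun y => k₀ y * translateAvg (lerayKernel j k l s) (H l k)
      (shift y φ) := fun k l => by
    obtain ⟨B, hB⟩ := hH l k φ
    have hi := integrable_lerayKernel j k l hs
    exact integrable_mul_of_bounded hk₀ ((hH l k).continuous_translateAvg_shift hi φ)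
      fun y => HasBoundedTranslates.abs_translateAvg_le hB hi y
  simp only [projDist, Finset.mul_sum]
  rw [integral_finsetSum _ fun k _ => integrable_finsetSum _ fun l _ => hint k l]
  refine Finset.sum_congr rfl fun k _ => ?_
  rw [integral_finsetSum _ fun l _ => hint k l]

/-- Splitting an even multiplier off the symbol of the projected divergence. -/
theorem EvenMultiplier.translateAvg_leray {m : R3 → ℝ} {C : ℝ} (hm : EvenMultiplier m C)
    {H : TempDist} (hH : HasBoundedTranslates H) (j k l : Fin 3) {s : ℝ} (hs : 0 < s)
    (φ : TestFn) {m' : R3 → ℝ} (h' : ∀ ξ, m' ξ = lerayDerivSymbol j k l ξ * (m ξ * heatSymbol s ξ)) :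
    translateAvg (oddKernel m') H φ =
      ∫ y, evenKernel m y * translateAvg (lerayKernel j k l s) H (shift y φ) := by
  obtain ⟨C', -, h⟩ := exists_kernelBound_leray
  have h1 := hm.translateAvg_mul isTrig_neg_sin (h j k l s hs) hH φ
  have h2 : m' = fun ξ => m ξ * (lerayDerivSymbol j k l ξ * heatSymbol s ξ) := by
    funext ξ; rw [h']; ring
  rw [h2, oddKernel_eq_trigKernel, h1, lerayKernel, oddKernel_eq_trigKernel]

theorem projDist_add {H : Fin 3 → Fin 3 → TempDist} (hH : ∀ l k, HasBoundedTranslates (H l k))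
    {s r : ℝ} (hs : 0 < s) (hr : 0 < r) (j : Fin 3) (φ : TestFn) :
    projDist (s + r) H j φ = ∫ y, evenKernel (heatSymbol r) y * projDist s H j (shift y φ) := by
  rw [integral_mul_projDist hH hs (evenMultiplier_heatSymbol hr).integrable_evenKernel]
  refine Finset.sum_congr rfl fun k _ => Finset.sum_congr rfl fun l _ => ?_
  exact (evenMultiplier_heatSymbol hr).translateAvg_leray (hH l k) j k l hs φ
    fun ξ => by rw [heatSymbol_add]; ring

/-- The projected divergence composed with a semigroup acts on `φ` through the projected
divergence composed with the heat semigroup at half the time. -/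
theorem SmoothingSymbol.integral_projDiv {σ : ℝ → R3 → ℝ} {ℓ C : ℝ} (hσ : SmoothingSymbol σ ℓ C)
    {H : Fin 3 → Fin 3 → TempDist} (hH : ∀ l k, HasBoundedTranslates (H l k))
    {s : ℝ} (hs : 0 < s) (j : Fin 3) (φ : TestFn) :
    ∫ x, projDiv σ s H j x * φ x =
      ∫ y, evenKernel (residualSymbol σ s) y * projDist (s / 2) H j (shift y φ) := by
  have hs2 := half_pos hs
  obtain ⟨C', hC'⟩ := hσ.leray s hs
  have hK : ∀ k l, Integrable (oddKernel fun ξ => lerayDerivSymbol j k l ξ * residualSymbol σ s ξ) :=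
    fun k l => kernelBound_integrable (hC' j k l)
  have h1 := fun k l => (hH l k).integral_kernel_heat (hK k l) hs2 φ
  rw [integral_mul_projDist hH hs2 (hσ.residual s hs).integrable_evenKernel]
  simp only [projDiv, Finset.sum_mul]
  rw [integral_finsetSum _ fun k _ => integrable_finsetSum _ fun l _ => (h1 k l).1]
  refine Finset.sum_congr rfl fun k _ => ?_
  rw [integral_finsetSum _ fun l _ => (h1 k l).1]
  refine Finset.sum_congr rfl fun l _ => ?_
  rw [(h1 k l).2, (hH l k).translateAvg_comm (hK k l) (evenMultiplier_heatSymbol hs2).integrable_evenKernel]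
  have h2 := (evenMultiplier_heatSymbol hs2).translateAvg_mul isTrig_neg_sin (hC' j k l) (hH l k) φ
  rw [← oddKernel_eq_trigKernel] at h2
  rw [← h2]
  exact (hσ.residual s hs).translateAvg_leray (hH l k) j k l hs2 φ fun ξ => by ring

theorem integral_projDiv_heat {H : Fin 3 → Fin 3 → TempDist}
    (hH : ∀ l k, HasBoundedTranslates (H l k)) {s : ℝ} (hs : 0 < s) (j : Fin 3) (φ : TestFn) :
    ∫ x, projDiv heatSymbol s H j x * φ x = projDist s H j φ := by
  obtain ⟨C, -, hC⟩ := exists_smoothingSymbol_heat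
  rw [(hC 0 C le_rfl).integral_projDiv hH hs, show residualSymbol heatSymbol s = heatSymbol (s / 2)
    from funext (residualSymbol_heatSymbol s), ← projDist_add hH (half_pos hs) (half_pos hs),
    add_halves]

theorem SmoothingSymbol.integral_semigroupFn {σ : ℝ → R3 → ℝ} {ℓ C : ℝ}
    (hσ : SmoothingSymbol σ ℓ C) {H : TempDist} (hH : HasBoundedTranslates H) {s : ℝ} (hs : 0 < s)
    (φ : TestFn) :
    ∫ x, semigroupFn σ s H x * φ x = translateAvg (evenKernel (σ s)) H φ := by
  have hs2 := half_pos hs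
  have h1 := (hσ.residual s hs).translateAvg_mul isTrig_cos
    (evenMultiplier_heatSymbol hs2).toKernelBound hH φ
  simp only [residualSymbol_mul_heatSymbol] at h1
  exact (hH.integral_kernel_heat (hσ.residual s hs).kernel hs2 φ).2.trans h1.symm

section Elements

variable {E : Type*} [NormedAddCommGroup E] [NormedSpace ℝ E] {ι : E →L[ℝ] TempDist}

theorem IsSmearable.exists_projDist (hι : IsSmearable ι) : ∃ C, 0 ≤ C ∧
    ∀ (V : Fin 3 → Fin 3 → E) (j : Fin 3) (s : ℝ), 0 < s →
      ∃ e, (∀ φ, ι e φ = projDist s (fun l k => ι (V l k)) j φ) ∧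
        ‖e‖ ≤ C * s ^ (-(1 / 2) : ℝ) * ‖V‖ := by
  obtain ⟨C, hC, h⟩ := exists_lerayKernel_bound
  refine ⟨9 * C, by positivity, fun V j s hs => ?_⟩
  refine ⟨∑ k, ∑ l, smear ι (lerayKernel j k l s) (V l k), fun φ => ?_, ?_⟩
  · have h1 : ∀ e, ι e φ = distPairing ι φ e := fun e => rfl
    rw [h1, map_sum]
    refine Finset.sum_congr rfl fun k _ => ?_
    rw [map_sum]
    exact Finset.sum_congr rfl fun l _ => hι.apply_smear (h j k l s hs).1 _ φ
  · have h2 : ∀ k l, ‖smear ι (lerayKernel j k l s) (V l k)‖ ≤ C * s ^ (-(1 / 2) : ℝ) * ‖V‖ :=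
      fun k l => (hι.norm_smear_le (h j k l s hs).1 _).trans (by
        gcongr
        · exact (h j k l s hs).2
        · exact (norm_le_pi_norm (V l) k).trans (norm_le_pi_norm V l))
    calc _ ≤ ∑ k : Fin 3, ∑ l : Fin 3, C * s ^ (-(1 / 2) : ℝ) * ‖V‖ :=
          (norm_sum_le _ _).trans (Finset.sum_le_sum fun k _ =>
            (norm_sum_le _ _).trans (Finset.sum_le_sum fun l _ => h2 k l))
      _ = _ := by simp; ring

end Elements

/-! ### Products of distributions in an adequate space -/

theorem mollTest_apply (ρ : TestFn) {ε : ℝ} (hε : 0 < ε) (x y : R3) :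
    mollTest ρ ε x y = (ε ^ 3)⁻¹ * ρ (ε⁻¹ • (x - y)) := by
  have h : mollTest ρ ε x y = (ε ^ 3)⁻¹ * affinePull (-ε⁻¹) (ε⁻¹ • x) ρ y := rfl
  rw [h, affinePull_apply (neg_ne_zero.2 (inv_ne_zero hε.ne'))]
  congr 2
  rw [smul_sub, neg_smul]; abel

theorem mollTest_eq_shift (ρ : TestFn) {ε : ℝ} (hε : 0 < ε) (x : R3) :
    mollTest ρ ε x = shift (-x) (mollTest ρ ε 0) := by
  ext y
  rw [shift_apply, mollTest_apply ρ hε, mollTest_apply ρ hε]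
  congr 3; abel

theorem shift_mollTest (ρ : TestFn) {ε : ℝ} (hε : 0 < ε) (x y : R3) :
    shift y (mollTest ρ ε x) = mollTest ρ ε (x - y) := by
  rw [mollTest_eq_shift ρ hε x, mollTest_eq_shift ρ hε (x - y), shift_shift]
  congr 2; abel

theorem affinePull_mollTest (ρ : TestFn) {ε r : ℝ} (hε : 0 < ε) (hr : 0 < r) (x : R3) :
    affinePull r⁻¹ 0 (mollTest ρ ε x) = r ^ 3 • mollTest ρ (r * ε) (r • x) := by
  ext y
  rw [affinePull_apply (inv_ne_zero hr.ne'), mollTest_apply ρ hε]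
  have h : (r ^ 3 • mollTest ρ (r * ε) (r • x)) y = r ^ 3 * mollTest ρ (r * ε) (r • x) y := rfl
  rw [h, mollTest_apply ρ (mul_pos hr hε), add_zero, ← mul_assoc]
  congr 1
  · field_simp
  · congr 1
    rw [mul_inv, mul_comm r⁻¹, ← smul_smul, smul_sub r⁻¹, inv_smul_smul₀ hr.ne']

/-- The integral of `φ` against the product of the regularizations, at scale `ε`, of two
distributions by a Gaussian mollifier. -/
def prodApprox (f g : TempDist) (φ : TestFn) (ε : ℝ) : ℝ :=
  ∫ x, f (mollTest (heatTest 1 0) ε x) * g (mollTest (heatTest 1 0) ε x) * φ x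

theorem tendsto_prodApprox {f g : TempDist} (h : ∃ k, IsDistMul f g k) (φ : TestFn) :
    Tendsto (prodApprox f g φ) (𝓝[>] 0) (𝓝 (distMul f g φ)) := by
  rw [distMul, dif_pos h]
  exact h.choose_spec _ (integral_heatTest one_pos) φ

theorem continuous_apply_mollTest (f : TempDist) (ρ : TestFn) {ε : ℝ} (hε : 0 < ε) :
    Continuous fun x => f (mollTest ρ ε x) := by
  have h : (fun x => f (mollTest ρ ε x)) = fun x => f (shift (-x) (mollTest ρ ε 0)) :=
    funext fun x => by rw [← mollTest_eq_shift ρ hε]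
  rw [h]
  exact (TempDist.continuous_apply_shift f _).comp continuous_neg

section Products

variable {E : Type*} [NormedAddCommGroup E] [NormedSpace ℝ E] {ι : E →L[ℝ] TempDist}

theorem IsSmearable.abs_apply_mollTest_le (hι : IsSmearable ι) (f : E) (ρ : TestFn) {ε : ℝ}
    (hε : 0 < ε) (x : R3) :
    |ι f (mollTest ρ ε x)| ≤ ‖distPairing ι (mollTest ρ ε 0)‖ * ‖f‖ := by
  rw [mollTest_eq_shift ρ hε]
  exact hι.translation.abs_apply_shift_le f _ _

theorem IsSmearable.integrable_prodApprox (hι : IsSmearable ι) (f g : E) (φ : TestFn) {ε : ℝ}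
    (hε : 0 < ε) : Integrable fun x => ι f (mollTest (heatTest 1 0) ε x) *
      ι g (mollTest (heatTest 1 0) ε x) * φ x := by
  have h1 := integrable_mul_of_bounded φ.integrable (continuous_apply_mollTest (ι f) _ hε)
    (hι.abs_apply_mollTest_le f (heatTest 1 0) hε)
  have h2 := integrable_mul_of_bounded h1 (continuous_apply_mollTest (ι g) _ hε)
    (hι.abs_apply_mollTest_le g (heatTest 1 0) hε)
  exact h2.congr (ae_of_all _ fun x => by simp only; ring)

/-- The regularized product as a bounded bilinear form. -/
theorem IsSmearable.exists_prodApprox (hι : IsSmearable ι) (φ : TestFn) {ε : ℝ} (hε : 0 < ε) :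
    ∃ A : E →L[ℝ] E →L[ℝ] ℝ, ∀ f g, A f g = prodApprox (ι f) (ι g) φ ε := by
  set ψ := mollTest (heatTest 1 0) ε with hψ
  have hi := fun f g => hι.integrable_prodApprox f g φ hε
  let L : E →ₗ[ℝ] E →ₗ[ℝ] ℝ := LinearMap.mk₂ ℝ (fun f g => prodApprox (ι f) (ι g) φ ε)
    (fun f f' g => by
      simp only [prodApprox]
      rw [← integral_add (hi f g) (hi f' g)]
      congr 1; funext x; rw [pairing_add]; ring)
    (fun c f g => by
      simp only [prodApprox]
      rw [smul_eq_mul, ← integral_const_mul]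
      congr 1; funext x; rw [pairing_smul]; ring)
    (fun f g g' => by
      simp only [prodApprox]
      rw [← integral_add (hi f g) (hi f g')]
      congr 1; funext x; rw [pairing_add]; ring)
    (fun c f g => by
      simp only [prodApprox]
      rw [smul_eq_mul, ← integral_const_mul]
      congr 1; funext x; rw [pairing_smul]; ring)
  set K := ‖distPairing ι (ψ 0)‖ with hK
  refine ⟨LinearMap.mkContinuous₂ L (K * K * ∫ x, ‖φ x‖) fun f g => ?_, fun f g => rfl⟩
  change ‖∫ x, ι f (ψ x) * ι g (ψ x) * φ x‖ ≤ _
  have hb : ∀ x, ‖ι f (ψ x) * ι g (ψ x) * φ x‖ ≤ K * K * ‖f‖ * ‖g‖ * ‖φ x‖ := fun x => by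
    rw [norm_mul, norm_mul]
    calc _ ≤ (K * ‖f‖) * (K * ‖g‖) * ‖φ x‖ := by
          gcongr
          · exact hι.abs_apply_mollTest_le f (heatTest 1 0) hε x
          · exact hι.abs_apply_mollTest_le g (heatTest 1 0) hε x
      _ = _ := by ring
  refine (norm_integral_le_of_norm_le (φ.integrable.norm.const_mul _) (ae_of_all _ hb)).trans ?_
  rw [integral_const_mul]
  exact le_of_eq (by ring)

/-- Any two elements of the space have a product. -/
def HasProducts (ι : E →L[ℝ] TempDist) : Prop := ∀ f g : E, ∃ h, IsDistMul (ι f) (ι g) h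

namespace HasProducts

variable (hp : HasProducts ι) (hι : IsSmearable ι)

include hp hι

theorem distMul_sub_left (f f' g : E) (φ : TestFn) :
    distMul (ι (f - f')) (ι g) φ = distMul (ι f) (ι g) φ - distMul (ι f') (ι g) φ := by
  refine tendsto_nhds_unique (tendsto_prodApprox (hp (f - f') g) φ)
    (((tendsto_prodApprox (hp f g) φ).sub (tendsto_prodApprox (hp f' g) φ)).congr' ?_)
  filter_upwards [self_mem_nhdsWithin] with ε hε
  obtain ⟨A, hA⟩ := hι.exists_prodApprox φ hε
  rw [← hA, ← hA, ← hA, map_sub]; rfl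

theorem distMul_sub_right (f g g' : E) (φ : TestFn) :
    distMul (ι f) (ι (g - g')) φ = distMul (ι f) (ι g) φ - distMul (ι f) (ι g') φ := by
  refine tendsto_nhds_unique (tendsto_prodApprox (hp f (g - g')) φ)
    (((tendsto_prodApprox (hp f g) φ).sub (tendsto_prodApprox (hp f g') φ)).congr' ?_)
  filter_upwards [self_mem_nhdsWithin] with ε hε
  obtain ⟨A, hA⟩ := hι.exists_prodApprox φ hε
  rw [← hA, ← hA, ← hA, map_sub]

/-- The product is bounded on `E × E` when tested against a fixed function, by the uniform
boundedness principle applied to the regularized products. -/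
theorem exists_bound [CompleteSpace E] (φ : TestFn) :
    ∃ C, ∀ f g : E, |distMul (ι f) (ι g) φ| ≤ C * ‖f‖ * ‖g‖ := by
  have hpos : ∀ n : ℕ, (0 : ℝ) < 1 / ((n : ℝ) + 1) := fun n => by positivity
  choose A hA using fun n : ℕ => hι.exists_prodApprox φ (hpos n)
  have hseq : Tendsto (fun n : ℕ => 1 / ((n : ℝ) + 1)) atTop (𝓝[>] 0) :=
    tendsto_nhdsWithin_iff.2 ⟨tendsto_one_div_add_atTop_nhds_zero_nat,
      Eventually.of_forall fun n => hpos n⟩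
  have hlim : ∀ f g, Tendsto (fun n => A n f g) atTop (𝓝 (distMul (ι f) (ι g) φ)) := fun f g => by
    simp only [hA]
    exact (tendsto_prodApprox (hp f g) φ).comp hseq
  have h1 : ∀ f, ∃ C, ∀ n, ‖A n f‖ ≤ C := fun f => banach_steinhaus fun g => by
    obtain ⟨C, hC⟩ := (Metric.isBounded_range_of_tendsto _ (hlim f g)).exists_norm_le
    exact ⟨C, fun n => hC _ (mem_range_self n)⟩
  obtain ⟨C, hC⟩ := banach_steinhaus h1
  refine ⟨C, fun f g => le_of_tendsto (hlim f g).abs (Eventually.of_forall fun n => ?_)⟩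
  exact ((A n).le_opNorm₂ f g).trans (by gcongr; exact hC n)

omit hι in
theorem distMul_shift {f g f' g' : E} {y : R3} (hf : ∀ φ, ι f' φ = ι f (shift y φ))
    (hg : ∀ φ, ι g' φ = ι g (shift y φ)) (φ : TestFn) :
    distMul (ι f') (ι g') φ = distMul (ι f) (ι g) (shift y φ) := by
  refine tendsto_nhds_unique (tendsto_prodApprox (hp f' g') φ)
    ((tendsto_prodApprox (hp f g) (shift y φ)).congr' ?_)
  filter_upwards [self_mem_nhdsWithin] with ε hε
  simp only [prodApprox, hf, hg, shift_mollTest _ hε]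
  rw [← integral_sub_right_eq_self _ y]
  congr 1; funext x
  rw [shift_apply, sub_add_cancel]

/-- The translates of a product are bounded, as translations act isometrically on the factors. -/
theorem exists_bound_shift [CompleteSpace E] (φ : TestFn) :
    ∃ C, ∀ (f g : E) (y : R3), |distMul (ι f) (ι g) (shift y φ)| ≤ C * ‖f‖ * ‖g‖ := by
  obtain ⟨C, hC⟩ := hp.exists_bound hι φ
  refine ⟨C, fun f g y => ?_⟩
  obtain ⟨f', hf, hfn⟩ := hι.translation y f
  obtain ⟨g', hg, hgn⟩ := hι.translation y g
  rw [← hp.distMul_shift hf hg, ← hfn, ← hgn]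
  exact hC f' g'

theorem hasBoundedTranslates [CompleteSpace E] (f g : E) :
    HasBoundedTranslates (distMul (ι f) (ι g)) := fun φ => by
  obtain ⟨C, hC⟩ := hp.exists_bound_shift hι φ
  exact ⟨_, hC f g⟩

omit hι in
theorem distMul_dilate {f g f' g' : E} {r : ℝ} (hr : 0 < r)
    (hf : ∀ φ, ι f' φ = (r ^ 3)⁻¹ * ι f (affinePull r⁻¹ 0 φ))
    (hg : ∀ φ, ι g' φ = (r ^ 3)⁻¹ * ι g (affinePull r⁻¹ 0 φ)) (φ : TestFn) :
    distMul (ι f') (ι g') φ = (r ^ 3)⁻¹ * distMul (ι f) (ι g) (affinePull r⁻¹ 0 φ) := by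
  have hscale : Tendsto (fun ε : ℝ => r * ε) (𝓝[>] 0) (𝓝[>] 0) := by
    refine tendsto_nhdsWithin_iff.2 ⟨?_, ?_⟩
    · have : Continuous fun ε : ℝ => r * ε := by fun_prop
      simpa using (this.tendsto 0).mono_left nhdsWithin_le_nhds
    · filter_upwards [self_mem_nhdsWithin] with ε hε using mul_pos hr hε
  refine tendsto_nhds_unique (tendsto_prodApprox (hp f' g') φ)
    ((((tendsto_prodApprox (hp f g) (affinePull r⁻¹ 0 φ)).comp hscale).const_mul _).congr' ?_)
  filter_upwards [self_mem_nhdsWithin] with ε hε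
  have h1 : ∀ (e : TempDist) x, (r ^ 3)⁻¹ * e (r ^ 3 • mollTest (heatTest 1 0) (r * ε) (r • x)) =
      e (mollTest (heatTest 1 0) (r * ε) (r • x)) := fun e x => by
    rw [map_smul, smul_eq_mul, inv_mul_cancel_left₀ (by positivity)]
  simp only [prodApprox, hf, hg, affinePull_mollTest _ hε hr, h1, Function.comp_apply]
  rw [integral_dilate _ hr, inv_mul_cancel_left₀ (by positivity)]
  congr 1; funext x
  rw [affinePull_apply (inv_ne_zero hr.ne'), inv_smul_smul₀ hr.ne', add_zero]

omit hι in
/-- Products of weakly measurable curves are weakly measurable, as limits of regularized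
products. -/
theorem measurable_distMul {Ω : Type} [MeasurableSpace Ω] {u v : Ω → E}
    (hu : ∀ φ, Measurable fun ω => ι (u ω) φ) (hv : ∀ φ, Measurable fun ω => ι (v ω) φ)
    (φ : TestFn) : Measurable fun ω => distMul (ι (u ω)) (ι (v ω)) φ := by
  have hpos : ∀ n : ℕ, (0 : ℝ) < 1 / ((n : ℝ) + 1) := fun n => by positivity
  have hseq : Tendsto (fun n : ℕ => 1 / ((n : ℝ) + 1)) atTop (𝓝[>] 0) :=
    tendsto_nhdsWithin_iff.2 ⟨tendsto_one_div_add_atTop_nhds_zero_nat,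
      Eventually.of_forall fun n => hpos n⟩
  refine measurable_of_tendsto_metrizable (f := fun (n : ℕ) ω =>
    prodApprox (ι (u ω)) (ι (v ω)) φ (1 / ((n : ℝ) + 1))) (fun n => ?_)
    (tendsto_pi_nhds.2 fun ω => (tendsto_prodApprox (hp (u ω) (v ω)) φ).comp hseq)
  have hm : ∀ w : Ω → E, (∀ φ, Measurable fun ω => ι (w ω) φ) → StronglyMeasurable
      (Function.uncurry fun (ω : Ω) (x : R3) =>
        ι (w ω) (mollTest (heatTest 1 0) (1 / ((n : ℝ) + 1)) x)) := fun w hw => by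
    have h1 := stronglyMeasurable_uncurry_of_continuous_of_stronglyMeasurable
      (u := fun (x : R3) (ω : Ω) => ι (w ω) (mollTest (heatTest 1 0) (1 / ((n : ℝ) + 1)) x))
      (fun ω => continuous_apply_mollTest (ι (w ω)) _ (hpos n))
      (fun x => (hw _).stronglyMeasurable)
    exact h1.comp_measurable measurable_swap
  have h2 : StronglyMeasurable (Function.uncurry fun (ω : Ω) (x : R3) =>
      ι (u ω) (mollTest (heatTest 1 0) (1 / ((n : ℝ) + 1)) x) *
        ι (v ω) (mollTest (heatTest 1 0) (1 / ((n : ℝ) + 1)) x) * φ x) :=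
    ((hm u hu).mul (hm v hv)).mul (φ.continuous.stronglyMeasurable.comp_measurable measurable_snd)
  exact h2.integral_prod_right.measurable

end HasProducts

end Products

/-! ### The bilinear term at positive times -/

theorem lerayKernel_dilate (j k l : Fin 3) {r s : ℝ} (hr : 0 < r) (y : R3) :
    lerayKernel j k l s y = r * r ^ 3 * lerayKernel j k l (r ^ 2 * s) (r • y) := by
  have h1 := trigKernel_dilate (T := fun s => -Real.sin s)
    (fun ξ => lerayDerivSymbol j k l ξ * heatSymbol (r ^ 2 * s) ξ) (inv_pos.2 hr) y
  have h2 : (fun ξ : R3 => lerayDerivSymbol j k l (r⁻¹ • ξ) * heatSymbol (r ^ 2 * s) (r⁻¹ • ξ)) =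
      fun ξ => r⁻¹ * (lerayDerivSymbol j k l ξ * heatSymbol s ξ) := by
    funext ξ
    have : heatSymbol (r ^ 2 * s) (r⁻¹ • ξ) = heatSymbol s ξ := by
      rw [heatSymbol, heatSymbol, norm_smul, Real.norm_of_nonneg (inv_nonneg.2 hr.le)]
      congr 2; field_simp
    rw [lerayDerivSymbol_smul _ _ _ (inv_pos.2 hr), this, mul_assoc]
  rw [h2, trigKernel_const_mul, inv_inv, inv_pow, inv_inv] at h1
  rw [lerayKernel, lerayKernel, oddKernel_eq_trigKernel, mul_assoc, ← h1, mul_inv_cancel_left₀ hr.ne']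

theorem affinePull_shift {r : ℝ} (hr : 0 < r) (y : R3) (φ : TestFn) :
    affinePull r⁻¹ 0 (shift y φ) = shift (r • y) (affinePull r⁻¹ 0 φ) := by
  have hr' := inv_ne_zero hr.ne'
  ext x
  rw [shift_apply, affinePull_apply hr', affinePull_apply hr', shift_apply]
  simp [smul_add, smul_smul, inv_mul_cancel₀ hr.ne']

theorem projDist_dilate {H H' : Fin 3 → Fin 3 → TempDist} {r : ℝ} (hr : 0 < r)
    (h : ∀ l k φ, H' l k φ = (r ^ 3)⁻¹ * H l k (affinePull r⁻¹ 0 φ)) (s : ℝ) (j : Fin 3)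
    (φ : TestFn) :
    projDist s H' j φ = r * (r ^ 3)⁻¹ * projDist (r ^ 2 * s) H j (affinePull r⁻¹ 0 φ) := by
  simp only [projDist, Finset.mul_sum]
  refine Finset.sum_congr rfl fun k _ => Finset.sum_congr rfl fun l _ => ?_
  rw [translateAvg, translateAvg, integral_dilate (fun y => lerayKernel j k l (r ^ 2 * s) y *
    H l k (shift y (affinePull r⁻¹ 0 φ))) hr, ← integral_const_mul, ← integral_const_mul]
  congr 1; funext y
  rw [h, affinePull_shift hr, lerayKernel_dilate j k l hr]
  ring

section Tensor

variable {E : Type*} [NormedAddCommGroup E] [NormedSpace ℝ E] {ι : E →L[ℝ] TempDist}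

theorem IsAdequate.isSmearable [CompleteSpace E] (hE : IsAdequate ι) : IsSmearable ι :=
  hE.1.isSmearable

theorem IsAdequate.hasProducts (hE : IsAdequate ι) : HasProducts ι := hE.2.1

/-- Adequacy at a single time and the scaling of the norm bound the bilinear term at all times. -/
theorem IsAdequate.exists_projDist [CompleteSpace E] (hE : IsAdequate ι) {p : ℝ} (hp : 0 < p)
    (hscal : HasScalingDegree ι (-3 / p)) : ∃ K, 0 ≤ K ∧
      ∀ (f g : Fin 3 → E) (j : Fin 3) (s : ℝ), 0 < s →
        ∃ e, (∀ φ, ι e φ = projDist s (distTensor (vecDist ι f) (vecDist ι g)) j φ) ∧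
          ‖e‖ ≤ K * s ^ (-(1 / 2 + 3 / (2 * p))) * ‖f‖ * ‖g‖ := by
  have hι := hE.isSmearable
  have hprod := hE.hasProducts
  obtain ⟨-, -, T₀, ω, hT₀, hω, -, hbound⟩ := hE
  set τ := T₀ / 2 with hτ
  have hτ0 : 0 < τ := half_pos hT₀
  have hτm : τ ∈ Ioo 0 T₀ := ⟨hτ0, half_lt_self hT₀⟩
  have hωτ := hω τ hτm
  refine ⟨ω τ * τ ^ (1 / 2 + 3 / (2 * p)), by positivity, fun f g j s hs => ?_⟩
  -- Dilation by `r` moves the time `s` to the time `τ` of the hypothesis.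
  set r := Real.sqrt (s / τ) with hr
  have hr0 : 0 < r := Real.sqrt_pos.2 (by positivity)
  have hrs : r ^ 2 * τ = s := by rw [hr, Real.sq_sqrt (by positivity)]; field_simp
  choose f' hf hfn using fun i => hscal r hr0 (f i)
  choose g' hg hgn using fun i => hscal r hr0 (g i)
  have hnorm : ∀ h h' : Fin 3 → E, (∀ i, ‖h' i‖ = r ^ (-3 / p) * ‖h i‖) →
      ‖h'‖ ≤ r ^ (-3 / p) * ‖h‖ := fun h h' hh => by
    refine (pi_norm_le_iff_of_nonneg (by positivity)).2 fun i => ?_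
    rw [hh]
    gcongr
    exact norm_le_pi_norm h i
  obtain ⟨e₀, he₀, hn₀⟩ := exists_of_fnENorm_le hι.injective (by positivity)
    (hbound f' g' τ hτm j)
  have hrep : ∀ φ, ι e₀ φ = projDist τ (distTensor (vecDist ι f') (vecDist ι g')) j φ := fun φ => by
    rw [(he₀ φ).2]
    exact integral_projDiv_heat (fun l k => hprod.hasBoundedTranslates hι (f' l) (g' k)) hτ0 j φ
  obtain ⟨e₁, he₁, hn₁⟩ := hscal r⁻¹ (inv_pos.2 hr0) e₀
  refine ⟨r⁻¹ • e₁, fun φ => ?_, ?_⟩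
  · have h1 : affinePull r⁻¹ 0 (affinePull r⁻¹⁻¹ 0 φ) = φ := by
      ext x
      rw [inv_inv, affinePull_apply (inv_ne_zero hr0.ne'), affinePull_apply hr0.ne', add_zero,
        add_zero, smul_inv_smul₀ hr0.ne']
    have h2 := projDist_dilate (H := distTensor (vecDist ι f) (vecDist ι g))
      (H' := distTensor (vecDist ι f') (vecDist ι g')) hr0
      (fun l k φ => hprod.distMul_dilate hr0 (hf l) (hg k) φ) τ j (affinePull r⁻¹⁻¹ 0 φ)
    rw [pairing_smul, he₁, hrep, h2, h1, hrs]
    field_simp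
  · rw [norm_smul, hn₁, Real.norm_of_nonneg (by positivity)]
    have hrr : r = (s / τ) ^ (1 / 2 : ℝ) := by rw [hr, Real.sqrt_eq_rpow]
    -- The derivative contributes a factor `r⁻¹`, the two norms on the right and the one on the left
    -- the factors `r ^ (-3/p)`, twice, and `r ^ (3/p)`.
    have hexp : r⁻¹ * r⁻¹ ^ (-3 / p) * (r ^ (-3 / p) * r ^ (-3 / p)) =
        s ^ (-(1 / 2 + 3 / (2 * p))) * τ ^ (1 / 2 + 3 / (2 * p)) := by
      rw [Real.inv_rpow hr0.le, ← Real.rpow_neg hr0.le, ← Real.rpow_neg_one r, ← Real.rpow_add hr0,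
        ← Real.rpow_add hr0, ← Real.rpow_add hr0, hrr, ← Real.rpow_mul (by positivity),
        Real.div_rpow hs.le hτ0.le, div_eq_mul_inv, ← Real.rpow_neg hτ0.le]
      congr 2 <;> field_simp <;> ring
    calc r⁻¹ * (r⁻¹ ^ (-3 / p) * ‖e₀‖)
        ≤ r⁻¹ * (r⁻¹ ^ (-3 / p) * (ω τ * (r ^ (-3 / p) * ‖f‖) * (r ^ (-3 / p) * ‖g‖))) := by
          gcongr
          refine hn₀.trans ?_
          gcongr
          · exact hnorm f f' hfn
          · exact hnorm g g' hgn
      _ = ω τ * (r⁻¹ * r⁻¹ ^ (-3 / p) * (r ^ (-3 / p) * r ^ (-3 / p))) * ‖f‖ * ‖g‖ := by ring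
      _ = _ := by rw [hexp]; ring

end Tensor

/-! ### Summation over dyadic times -/

/-- If a quantity changes by at most `C s ^ θ` when the time is doubled, then adding a suitable
multiple of `s ^ θ` makes it monotone along dyadic times. -/
theorem dyadic_mono {Q : ℝ → ℝ} {C θ c : ℝ} (hc : C ≤ c * (2 ^ θ - 1)) {n : ℕ} {s : ℝ}
    (hs : 0 < s) (h : ∀ i < n, Q (2 ^ i * s) ≤ Q (2 ^ (i + 1) * s) + C * (2 ^ i * s) ^ θ) :
    Q s + c * s ^ θ ≤ Q (2 ^ n * s) + c * (2 ^ n * s) ^ θ := by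
  induction n with
  | zero => simp
  | succ n ih =>
    refine (ih fun i hi => h i (hi.trans n.lt_succ_self)).trans ?_
    have h1 := h n n.lt_succ_self
    have h2 : (2 ^ (n + 1) * s) ^ θ = 2 ^ θ * (2 ^ n * s) ^ θ := by
      rw [pow_succ', mul_assoc, Real.mul_rpow two_pos.le (by positivity)]
    have h3 : 0 ≤ (2 ^ n * s) ^ θ := by positivity
    rw [h2]
    nlinarith [mul_le_mul_of_nonneg_right hc h3]

theorem exists_two_pow_mul_mem {s : ℝ} (hs : 0 < s) (hs1 : s ≤ 1) :
    ∃ n : ℕ, 1 ≤ 2 ^ n * s ∧ 2 ^ n * s ≤ 2 ∧ ∀ i < n, 2 ^ i * s ≤ 1 := by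
  obtain ⟨n, hn⟩ := pow_unbounded_of_one_lt s⁻¹ (one_lt_two (α := ℝ))
  have hex : ∃ n : ℕ, 1 ≤ 2 ^ n * s := ⟨n, by
    have := mul_lt_mul_of_pos_right hn hs
    rw [inv_mul_cancel₀ hs.ne'] at this
    exact this.le⟩
  classical
  refine ⟨Nat.find hex, Nat.find_spec hex, ?_, fun i hi => (not_le.1 (Nat.find_min hex hi)).le⟩
  rcases Nat.eq_zero_or_pos (Nat.find hex) with h0 | h0
  · rw [h0]; linarith
  · have h1 := not_le.1 (Nat.find_min hex (Nat.sub_lt h0 one_pos))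
    obtain ⟨m, hm⟩ := Nat.exists_eq_succ_of_ne_zero h0.ne'
    rw [hm] at h1 ⊢
    rw [Nat.succ_sub_one] at h1
    rw [Nat.succ_eq_add_one, pow_succ']
    linarith

section Moment

/-- The first moment of the heat kernel. -/
theorem exists_heat_moment : ∃ M, 0 ≤ M ∧ ∀ s, 0 < s →
    Integrable (fun y => heatTest s 0 y * ‖y‖) ∧
      ∫ y, heatTest s 0 y * ‖y‖ = M * Real.sqrt s := by
  refine ⟨∫ y, heatTest 1 0 y * ‖y‖, integral_nonneg fun y =>
    mul_nonneg (heatTest_nonneg one_pos y) (norm_nonneg y), fun s hs => ⟨?_, ?_⟩⟩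
  · refine (integrable_one_add_norm_pow_mul (heatTest s 0) 1).mono'
      (by fun_prop) (ae_of_all _ fun y => ?_)
    rw [norm_mul, norm_norm, pow_one, mul_comm]
    gcongr
    linarith
  · rw [integral_heatTest_mul hs]
    simp only [norm_smul, Real.norm_of_nonneg (Real.sqrt_nonneg s)]
    rw [← integral_mul_const]
    congr 1; funext z; ring

variable {E : Type*} [NormedAddCommGroup E] [NormedSpace ℝ E] {ι : E →L[ℝ] TempDist}

/-- The heat semigroup at time `s` changes the pairing with a fixed test function by `√s`. -/
theorem IsSmearable.exists_heatOp_sub_le [CompleteSpace E] (hι : IsSmearable ι) (φ : TestFn) :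
    ∃ C, 0 ≤ C ∧ ∀ (e : E) (y : R3) (s : ℝ), 0 < s →
      |ι (heatOp ι s e) (shift y φ) - ι e (shift y φ)| ≤ C * Real.sqrt s * ‖e‖ := by
  obtain ⟨M, hM, h⟩ := exists_heat_moment
  obtain ⟨C, hC, hL⟩ := hι.translation.exists_lipschitz φ
  refine ⟨C * M, by positivity, fun e y s hs => ?_⟩
  have hms := evenMultiplier_heatSymbol hs
  have h1 := hι.apply_multOp hms e (shift y φ)
  have h2 : ι e (shift y φ) = ∫ z, evenKernel (heatSymbol s) z * ι e (shift y φ) := by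
    rw [integral_mul_const, evenKernel_heatSymbol hs, integral_heatTest hs, one_mul]
  rw [heatOp, h1]
  conv_lhs => rw [h2]
  rw [← integral_sub ((hι.hasBoundedTranslates e).integrable hms.integrable_evenKernel _)
    (hms.integrable_evenKernel.mul_const _)]
  have h3 : C * M * Real.sqrt s * ‖e‖ = ∫ z, C * ‖e‖ * (heatTest s 0 z * ‖z‖) := by
    rw [integral_const_mul, (h s hs).2]; ring
  rw [h3]
  refine norm_integral_le_of_norm_le (f := fun z => evenKernel (heatSymbol s) z *
    ι e (shift z (shift y φ)) - evenKernel (heatSymbol s) z * ι e (shift y φ))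
    ((h s hs).1.const_mul _) (ae_of_all _ fun z => ?_)
  have hcomm : shift z (shift y φ) = shift y (shift z φ) := by
    rw [shift_shift, shift_shift, add_comm]
  rw [← mul_sub, norm_mul, evenKernel_heatSymbol hs, Real.norm_of_nonneg (heatTest_nonneg hs z),
    hcomm]
  have h4 := mul_le_mul_of_nonneg_left (hL e z y) (heatTest_nonneg hs z)
  exact h4.trans (le_of_eq (by ring))

end Moment

/-! ### Time integrals -/

theorem integrableOn_rpow_Ioo {μ t : ℝ} (hμ : μ < 1) (ht : 0 < t) :
    IntegrableOn (fun τ : ℝ => τ ^ (-μ)) (Ioo 0 t) ∧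
      ∫ τ in Ioo 0 t, τ ^ (-μ) = t ^ (1 - μ) / (1 - μ) := by
  have h := intervalIntegral.intervalIntegrable_rpow' (a := 0) (b := t) (r := -μ) (by linarith)
  refine ⟨((intervalIntegrable_iff_integrableOn_Ioo_of_le ht.le).1 h), ?_⟩
  rw [← integral_Ioc_eq_integral_Ioo, ← intervalIntegral.integral_of_le ht.le,
    integral_rpow (Or.inl (by linarith)), Real.zero_rpow (by linarith), sub_zero,
    neg_add_eq_sub]

theorem integrableOn_sub_rpow_Ioo {α a b : ℝ} (hα : α < 1) (hab : a < b) :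
    IntegrableOn (fun τ : ℝ => (b - τ) ^ (-α)) (Ioo a b) ∧
      ∫ τ in Ioo a b, (b - τ) ^ (-α) = (b - a) ^ (1 - α) / (1 - α) := by
  have h := (intervalIntegral.intervalIntegrable_rpow' (a := b - a) (b := 0) (r := -α)
    (by linarith)).comp_sub_left b
  rw [sub_sub_cancel, sub_zero] at h
  refine ⟨((intervalIntegrable_iff_integrableOn_Ioo_of_le hab.le).1 h), ?_⟩
  rw [← integral_Ioc_eq_integral_Ioo, ← intervalIntegral.integral_of_le hab.le,
    intervalIntegral.integral_comp_sub_left (fun s => s ^ (-α)) b, sub_self,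
    integral_rpow (Or.inl (by linarith)), Real.zero_rpow (by linarith), sub_zero,
    neg_add_eq_sub]

/-- A bound for the beta integral over `(0, t)`. -/
theorem exists_beta_bound {α μ : ℝ} (hα0 : 0 ≤ α) (hα : α < 1) (hμ0 : 0 ≤ μ) (hμ : μ < 1) :
    ∃ B, 0 ≤ B ∧ ∀ t : ℝ, 0 < t →
      IntegrableOn (fun τ => (t - τ) ^ (-α) * τ ^ (-μ)) (Ioo 0 t) ∧
        ∫ τ in Ioo 0 t, (t - τ) ^ (-α) * τ ^ (-μ) ≤ B * t ^ (1 - α - μ) := by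
  have hα' : 0 < 1 - α := by linarith
  have hμ' : 0 < 1 - μ := by linarith
  refine ⟨2 ^ α / (1 - μ) + 2 ^ μ / (1 - α), by positivity, fun t ht => ?_⟩
  obtain ⟨i1, e1⟩ := integrableOn_rpow_Ioo hμ ht
  obtain ⟨i2, e2⟩ := integrableOn_sub_rpow_Ioo hα ht
  rw [sub_zero] at e2
  -- Each factor is at most its value at `t / 2` on one of the two halves of the interval.
  have hb : ∀ τ ∈ Ioo 0 t, (t - τ) ^ (-α) * τ ^ (-μ) ≤
      (t / 2) ^ (-α) * τ ^ (-μ) + (t / 2) ^ (-μ) * (t - τ) ^ (-α) := by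
    rintro τ ⟨h0, h1⟩
    have h2 : 0 < t - τ := by linarith
    have p1 : 0 ≤ τ ^ (-μ) := by positivity
    have p2 : 0 ≤ (t - τ) ^ (-α) := by positivity
    have p3 : 0 ≤ (t / 2) ^ (-α) := by positivity
    have p4 : 0 ≤ (t / 2) ^ (-μ) := by positivity
    rcases le_total τ (t / 2) with h | h
    · have : (t - τ) ^ (-α) ≤ (t / 2) ^ (-α) :=
        Real.rpow_le_rpow_of_nonpos (by linarith) (by linarith) (by linarith)
      nlinarith [mul_nonneg p4 p2, mul_le_mul_of_nonneg_right this p1]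
    · have : τ ^ (-μ) ≤ (t / 2) ^ (-μ) :=
        Real.rpow_le_rpow_of_nonpos (by linarith) (by linarith) (by linarith)
      nlinarith [mul_nonneg p3 p1, mul_le_mul_of_nonneg_right this p2]
  have hi := (i1.const_mul ((t / 2) ^ (-α))).add (i2.const_mul ((t / 2) ^ (-μ)))
  have hmeas : AEStronglyMeasurable (fun τ => (t - τ) ^ (-α) * τ ^ (-μ))
      (volume.restrict (Ioo 0 t)) := i2.aestronglyMeasurable.mul i1.aestronglyMeasurable
  have hI : IntegrableOn (fun τ => (t - τ) ^ (-α) * τ ^ (-μ)) (Ioo 0 t) := by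
    refine hi.mono' hmeas ?_
    filter_upwards [ae_restrict_mem measurableSet_Ioo] with τ hτ
    have h2 : 0 < t - τ := by linarith [hτ.2]
    have h3 : 0 < τ := hτ.1
    rw [Real.norm_of_nonneg (by positivity)]
    exact hb τ hτ
  refine ⟨hI, (setIntegral_mono_on hI hi measurableSet_Ioo hb).trans (le_of_eq ?_)⟩
  have := integral_add (i1.const_mul ((t / 2) ^ (-α))) (i2.const_mul ((t / 2) ^ (-μ)))
  refine this.trans ?_
  rw [integral_const_mul, integral_const_mul, e1, e2, Real.div_rpow ht.le two_pos.le,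
    Real.div_rpow ht.le two_pos.le, Real.rpow_neg two_pos.le, Real.rpow_neg two_pos.le]
  have x1 : t ^ (-α) * t ^ (1 - μ) = t ^ (1 - α - μ) := by
    rw [← Real.rpow_add ht]; congr 1; ring
  have x2 : t ^ (-μ) * t ^ (1 - α) = t ^ (1 - α - μ) := by
    rw [← Real.rpow_add ht]; congr 1; ring
  rw [div_inv_eq_mul, div_inv_eq_mul, add_mul]
  congr 1
  · rw [← x1]; ring
  · rw [← x2]; ring

/-! ### Weak integrals over time intervals -/

section Sources

variable {E : Type*} [NormedAddCommGroup E] [NormedSpace ℝ E] {ι : E →L[ℝ] TempDist}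

theorem IsSmearable.exists_setIntegral (hι : IsSmearable ι) {a b : ℝ} {f : ℝ → E} {g : ℝ → ℝ}
    (hf : ∀ φ, Measurable fun τ : Ioo a b => ι (f τ) φ) (hg : IntegrableOn g (Ioo a b))
    (hfg : ∀ τ ∈ Ioo a b, ‖f τ‖ ≤ g τ) :
    ∃ e : E, (∀ φ, ι e φ = ∫ τ in Ioo a b, ι (f τ) φ) ∧ ‖e‖ ≤ ∫ τ in Ioo a b, g τ :=
  hι.weakIntegrals ℝ (volume.restrict (Ioo a b)) f g
    (fun φ => aemeasurable_restrict_of_measurable_subtype measurableSet_Ioo (hf φ)) hg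
    ((ae_restrict_mem measurableSet_Ioo).mono hfg)

theorem integrableOn_pairing {a b : ℝ} {f : ℝ → E} {g : ℝ → ℝ}
    (hf : ∀ φ, Measurable fun τ : Ioo a b => ι (f τ) φ) (hg : IntegrableOn g (Ioo a b))
    (hfg : ∀ τ ∈ Ioo a b, ‖f τ‖ ≤ g τ) (φ : TestFn) :
    IntegrableOn (fun τ => ι (f τ) φ) (Ioo a b) := by
  refine (hg.const_mul ‖distPairing ι φ‖).mono'
    (aemeasurable_restrict_of_measurable_subtype measurableSet_Ioo (hf φ)).aestronglyMeasurable ?_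
  filter_upwards [ae_restrict_mem measurableSet_Ioo] with τ hτ
  exact (abs_apply_le ι _ φ).trans (mul_le_mul_of_nonneg_left (hfg τ hτ) (norm_nonneg _))

/-- Multipliers commute with weak integrals. -/
theorem IsSmearable.multOp_setIntegral (hι : IsSmearable ι) {a b : ℝ} {f : ℝ → E} {g : ℝ → ℝ}
    (hf : ∀ φ, Measurable fun τ : Ioo a b => ι (f τ) φ) (hg : IntegrableOn g (Ioo a b))
    (hfg : ∀ τ ∈ Ioo a b, ‖f τ‖ ≤ g τ) {m : R3 → ℝ} {C : ℝ} (hm : EvenMultiplier m C) {e : E}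
    (he : ∀ φ, ι e φ = ∫ τ in Ioo a b, ι (f τ) φ) (φ : TestFn) :
    ι (multOp ι m e) φ = ∫ τ in Ioo a b, ι (multOp ι m (f τ)) φ := by
  rw [hι.apply_multOp hm]
  simp only [he, hι.apply_multOp hm]
  simp only [← integral_subtype_comap measurableSet_Ioo fun τ => ι (f τ) _,
    ← integral_subtype_comap measurableSet_Ioo fun τ => ∫ y, evenKernel m y * ι (f τ) (shift y φ)]
  simp only [← integral_const_mul]
  set ν : Measure (Ioo a b) := Measure.comap Subtype.val volume with hν
  have hg' : Integrable (fun τ : Ioo a b => g τ) ν := by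
    rw [IntegrableOn, ← map_comap_subtype_coe measurableSet_Ioo] at hg
    exact (MeasurableEmbedding.subtype_coe measurableSet_Ioo).integrable_map_iff.1 hg
  have : IsFiniteMeasure ν := ⟨by
    rw [hν, comap_subtype_coe_apply measurableSet_Ioo, image_univ, Subtype.range_coe]
    exact measure_Ioo_lt_top⟩
  rw [integral_integral_swap]
  refine ((hm.integrable_evenKernel.norm.mul_prod (hg'.const_mul ‖distPairing ι φ‖))).mono' ?_
    (ae_of_all _ fun z => ?_)
  · have h1 : StronglyMeasurable (Function.uncurry fun (y : R3) (τ : Ioo a b) =>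
        ι (f τ) (shift y φ)) :=
      stronglyMeasurable_uncurry_of_continuous_of_stronglyMeasurable
        (fun τ => TempDist.continuous_apply_shift (ι (f τ)) φ)
        (fun y => (hf _).stronglyMeasurable)
    exact hm.integrable_evenKernel.aestronglyMeasurable.comp_fst.mul h1.aestronglyMeasurable
  · simp only [Function.uncurry, norm_mul]
    gcongr
    exact (hι.translation.abs_apply_shift_le _ φ z.1).trans
      (mul_le_mul_of_nonneg_left (hfg _ z.2.2) (norm_nonneg _))

/-- A family `N s τ`, to be thought of as `exp (sΔ)` applied to a source at time `τ` which need
not be in the space: a flow in `s`, weakly measurable in `τ`, and of size `s^(-κ) τ^(-μ)`. -/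
structure IsSource (ι : E →L[ℝ] TempDist) (κ μ A : ℝ) (N : ℝ → ℝ → E) : Prop where
  flow : ∀ s r τ, 0 < s → 0 < r → 0 < τ → N (s + r) τ = heatOp ι r (N s τ)
  measurable : ∀ s, 0 < s → ∀ φ, Measurable fun τ : Ioi (0 : ℝ) => ι (N s τ) φ
  bound : ∀ s τ, 0 < s → 0 < τ → ‖N s τ‖ ≤ A * s ^ (-κ) * τ ^ (-μ)

/-- The semigroup with symbol `σ` at time `s`, applied to the source at time `τ`. -/
def evolve (ι : E →L[ℝ] TempDist) (σ : ℝ → R3 → ℝ) (N : ℝ → ℝ → E) (s τ : ℝ) : E :=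
  multOp ι (residualSymbol σ s) (N (s / 2) τ)

namespace IsSource

variable {κ μ A : ℝ} {N N' : ℝ → ℝ → E}

theorem const_nonneg (h : IsSource ι κ μ A N) : 0 ≤ A := by
  simpa using (norm_nonneg _).trans (h.bound 1 1 one_pos one_pos)

theorem sub (hι : IsSmearable ι) (h : IsSource ι κ μ A N) {A' : ℝ} (h' : IsSource ι κ μ A' N') :
    IsSource ι κ μ (A + A') (fun s τ => N s τ - N' s τ) where
  flow s r τ hs hr hτ := by
    rw [h.flow s r τ hs hr hτ, h'.flow s r τ hs hr hτ]
    exact (hι.multOp_sub (evenMultiplier_heatSymbol hr) _ _).symm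
  measurable s hs φ := by
    simp only [pairing_sub]
    exact (h.measurable s hs φ).sub (h'.measurable s hs φ)
  bound s τ hs hτ := by
    refine (norm_sub_le _ _).trans ((add_le_add (h.bound s τ hs hτ) (h'.bound s τ hs hτ)).trans
      (le_of_eq (by ring)))

/-- Smoothing by the heat semigroup at time `r` trades decay in `r` for regularity in `s`. -/
theorem shift (h : IsSource ι κ μ A N) {b r : ℝ} (hb : 0 ≤ b) (hbκ : b ≤ κ) (hr : 0 < r) :
    IsSource ι (κ - b) μ (A * r ^ (-b)) (fun s τ => N (s + r) τ) where
  flow s q τ hs hq hτ := by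
    rw [show s + q + r = (s + r) + q by ring]
    exact h.flow (s + r) q τ (add_pos hs hr) hq hτ
  measurable s hs φ := h.measurable (s + r) (add_pos hs hr) φ
  bound s τ hs hτ := by
    refine (h.bound (s + r) τ (add_pos hs hr) hτ).trans ?_
    have hA := h.const_nonneg
    have h1 : (s + r) ^ (-κ) ≤ r ^ (-b) * s ^ (-(κ - b)) := by
      rw [show -κ = -b + -(κ - b) by ring, Real.rpow_add (add_pos hs hr)]
      exact mul_le_mul (Real.rpow_le_rpow_of_nonpos hr (by linarith) (by linarith))
        (Real.rpow_le_rpow_of_nonpos hs (by linarith) (by linarith)) (by positivity)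
        (by positivity)
    calc A * (s + r) ^ (-κ) * τ ^ (-μ) ≤ A * (r ^ (-b) * s ^ (-(κ - b))) * τ ^ (-μ) := by gcongr
      _ = _ := by ring

variable {σ : ℝ → R3 → ℝ} {ℓ C : ℝ}

theorem norm_evolve_le (hι : IsSmearable ι) (hσ : SmoothingSymbol σ ℓ C) (h : IsSource ι κ μ A N)
    {s τ : ℝ} (hs : 0 < s) (hτ : 0 < τ) :
    ‖evolve ι σ N s τ‖ ≤ C * (2 ^ κ * A) * (s ^ (-κ) * τ ^ (-μ)) := by
  have hC := (hσ.residual s hs).nonneg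
  refine (hι.norm_multOp_le (hσ.residual s hs) _).trans ?_
  refine (mul_le_mul_of_nonneg_left (h.bound (s / 2) τ (half_pos hs) hτ) hC).trans (le_of_eq ?_)
  rw [Real.div_rpow hs.le two_pos.le, Real.rpow_neg two_pos.le, div_inv_eq_mul]
  ring

theorem evolve_add_sub (hι : IsSmearable ι) (hσ : SmoothingSymbol σ ℓ C) (h : IsSource ι κ μ A N)
    {s r τ : ℝ} (hs : 0 < s) (hr : 0 < r) (hτ : 0 < τ) :
    evolve ι σ N (s + r) τ - evolve ι σ N s τ =
      multOp ι (fun ξ => (σ (s + r) ξ - σ s ξ) * Real.exp (s / 2 * ‖ξ‖ ^ 2)) (N (s / 2) τ) := by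
  have h1 : N ((s + r) / 2) τ = heatOp ι (r / 2) (N (s / 2) τ) := by
    rw [add_div]; exact h.flow _ _ _ (half_pos hs) (half_pos hr) hτ
  have hm := hσ.residual (s + r) (add_pos hs hr)
  have hh := evenMultiplier_heatSymbol (half_pos hr)
  rw [evolve, evolve, h1, heatOp, hι.multOp_multOp hm hh,
    ← hι.sub_multOp (hm.mul hh) (hσ.residual s hs)]
  refine multOp_congr ι (fun ξ => ?_) _
  have h2 : Real.exp ((s + r) / 2 * ‖ξ‖ ^ 2) * heatSymbol (r / 2) ξ =
      Real.exp (s / 2 * ‖ξ‖ ^ 2) := by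
    rw [heatSymbol, ← Real.exp_add]; congr 1; ring
  rw [residualSymbol, residualSymbol, mul_assoc, h2]
  ring

/-- The increments in time of the evolved source are controlled by those of the symbol. -/
theorem norm_evolve_add_sub_le (hι : IsSmearable ι) (hσ : SmoothingSymbol σ ℓ C)
    (h : IsSource ι κ μ A N) {s r τ : ℝ} (hs : 0 < s) (hr : 0 < r) (hτ : 0 < τ) :
    ‖evolve ι σ N (s + r) τ - evolve ι σ N s τ‖ ≤
      C * (2 ^ κ * A) * (min 1 (r * (s⁻¹ + s ^ (-(ℓ / 2)))) * (s ^ (-κ) * τ ^ (-μ))) := by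
  rw [h.evolve_add_sub hι hσ hs hr hτ]
  have hm := hσ.increment s r hs hr
  refine (hι.norm_multOp_le hm _).trans ?_
  refine (mul_le_mul_of_nonneg_left (h.bound (s / 2) τ (half_pos hs) hτ) hm.nonneg).trans
    (le_of_eq ?_)
  rw [Real.div_rpow hs.le two_pos.le, Real.rpow_neg two_pos.le, div_inv_eq_mul]
  ring

end IsSource

theorem measurable_sub_right_of_measurable {F : ℝ → ℝ → ℝ}
    (hF : Measurable fun q : Ioi (0 : ℝ) × Ioi (0 : ℝ) => F q.1 q.2) {a b t : ℝ} (ha : 0 ≤ a)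
    (hb : b ≤ t) : Measurable fun τ : Ioo a b => F (t - τ) τ := by
  have h1 : Measurable fun τ : Ioo a b => t - (τ : ℝ) := measurable_subtype_coe.const_sub t
  have h2 : Measurable fun τ : Ioo a b => (⟨t - τ, sub_pos.2 (τ.2.2.trans_le hb)⟩ : Ioi (0 : ℝ)) :=
    h1.subtype_mk
  have h3 : Measurable fun τ : Ioo a b => (⟨τ, ha.trans_lt τ.2.1⟩ : Ioi (0 : ℝ)) :=
    measurable_subtype_coe.subtype_mk
  exact hF.comp (h2.prodMk h3)

/-- A function whose increments to the right are Lipschitz, uniformly away from `0`, is continuous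
on `(0, ∞)`. -/
theorem continuousOn_of_local_increment {F : ℝ → ℝ}
    (h : ∀ b, 0 < b → ∃ L, ∀ s r, b ≤ s → 0 < r → |F (s + r) - F s| ≤ L * r) :
    ContinuousOn F (Ioi 0) := by
  intro s₀ hs₀
  have hs₀' : (0 : ℝ) < s₀ := hs₀
  obtain ⟨L, hL⟩ := h (s₀ / 2) (half_pos hs₀')
  have hd : ∀ s s', s₀ / 2 ≤ s → s₀ / 2 ≤ s' → |F s - F s'| ≤ L * |s - s'| := by
    intro s s' hs hs'
    rcases lt_trichotomy s s' with hlt | rfl | hlt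
    · have := hL s (s' - s) hs (by linarith)
      rw [add_sub_cancel] at this
      rwa [abs_sub_comm, abs_sub_comm s, abs_of_pos (by linarith : 0 < s' - s)]
    · simp
    · have := hL s' (s - s') hs' (by linarith)
      rw [add_sub_cancel] at this
      rwa [abs_of_pos (by linarith : 0 < s - s')]
  refine ContinuousAt.continuousWithinAt ?_
  rw [ContinuousAt, tendsto_iff_norm_sub_tendsto_zero]
  have hz : Tendsto (fun s => L * |s - s₀|) (𝓝 s₀) (𝓝 0) := by
    have : Continuous fun s => L * |s - s₀| := by fun_prop
    simpa using this.tendsto s₀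
  refine squeeze_zero' (Eventually.of_forall fun _ => norm_nonneg _) ?_ hz
  filter_upwards [Ioi_mem_nhds (half_lt_self hs₀')] with s hs
  exact hd s s₀ (le_of_lt hs) (half_le_self hs₀'.le)

namespace IsSource

variable {κ μ A : ℝ} {N N' : ℝ → ℝ → E} {σ : ℝ → R3 → ℝ} {ℓ C : ℝ}

theorem measurable_evolve_right (hι : IsSmearable ι) (hσ : SmoothingSymbol σ ℓ C)
    (h : IsSource ι κ μ A N) {s : ℝ} (hs : 0 < s) (φ : TestFn) :
    Measurable fun τ : Ioi (0 : ℝ) => ι (evolve ι σ N s τ) φ := by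
  simp only [evolve, hι.apply_multOp (hσ.residual s hs)]
  have h1 : StronglyMeasurable (Function.uncurry fun (y : R3) (τ : Ioi (0 : ℝ)) =>
      ι (N (s / 2) τ) (_root_.shift y φ)) :=
    stronglyMeasurable_uncurry_of_continuous_of_stronglyMeasurable
      (fun τ => TempDist.continuous_apply_shift (ι (N (s / 2) τ)) φ)
      (fun y => (h.measurable (s / 2) (half_pos hs) _).stronglyMeasurable)
  have h2 : StronglyMeasurable (evenKernel (residualSymbol σ s)) :=
    (isTrig_cos.continuous_kernel (hσ.residual s hs).symbol).stronglyMeasurable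
  have h3 : StronglyMeasurable (Function.uncurry fun (τ : Ioi (0 : ℝ)) (y : R3) =>
      evenKernel (residualSymbol σ s) y * ι (N (s / 2) τ) (_root_.shift y φ)) :=
    (h2.comp_measurable measurable_snd).mul (h1.comp_measurable measurable_swap)
  exact h3.integral_prod_right.measurable

theorem continuousOn_evolve (hι : IsSmearable ι) (hσ : SmoothingSymbol σ ℓ C)
    (h : IsSource ι κ μ A N) (hκ : 0 ≤ κ) (hℓ : 0 ≤ ℓ) {τ : ℝ} (hτ : 0 < τ) (φ : TestFn) :
    ContinuousOn (fun s => ι (evolve ι σ N s τ) φ) (Ioi 0) := by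
  have hA := h.const_nonneg
  have hC := (hσ.residual 1 one_pos).nonneg
  refine continuousOn_of_local_increment fun b hb =>
    ⟨‖distPairing ι φ‖ * (C * (2 ^ κ * A) * ((b⁻¹ + b ^ (-(ℓ / 2))) * (b ^ (-κ) * τ ^ (-μ)))),
      fun s r hs hr => ?_⟩
  have hs0 : 0 < s := hb.trans_le hs
  rw [← pairing_sub]
  refine (abs_apply_le ι _ φ).trans ?_
  rw [mul_assoc]
  refine mul_le_mul_of_nonneg_left ((h.norm_evolve_add_sub_le hι hσ hs0 hr hτ).trans ?_)
    (norm_nonneg _)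
  have h1 : s ^ (-(ℓ / 2)) ≤ b ^ (-(ℓ / 2)) :=
    Real.rpow_le_rpow_of_nonpos hb hs (by linarith)
  have h2 : s ^ (-κ) ≤ b ^ (-κ) := Real.rpow_le_rpow_of_nonpos hb hs (by linarith)
  have h3 : s⁻¹ ≤ b⁻¹ := inv_anti₀ hb hs
  calc _ ≤ C * (2 ^ κ * A) * (r * (b⁻¹ + b ^ (-(ℓ / 2))) * (b ^ (-κ) * τ ^ (-μ))) := by
        gcongr
        exact (min_le_right _ _).trans (by gcongr)
    _ = _ := by ring

/-- Joint measurability, from continuity in `s` and measurability in `τ`. -/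
theorem measurable_evolve (hι : IsSmearable ι) (hσ : SmoothingSymbol σ ℓ C)
    (h : IsSource ι κ μ A N) (hκ : 0 ≤ κ) (hℓ : 0 ≤ ℓ) (φ : TestFn) :
    Measurable fun q : Ioi (0 : ℝ) × Ioi (0 : ℝ) => ι (evolve ι σ N q.1 q.2) φ := by
  have h1 : StronglyMeasurable (Function.uncurry fun (s τ : Ioi (0 : ℝ)) =>
      ι (evolve ι σ N s τ) φ) :=
    stronglyMeasurable_uncurry_of_continuous_of_stronglyMeasurable
      (fun τ => continuousOn_iff_continuous_domRestrict.1 (h.continuousOn_evolve hι hσ hκ hℓ τ.2 φ))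
      (fun s => (h.measurable_evolve_right hι hσ s.2 φ).stronglyMeasurable)
  exact h1.measurable

theorem measurable_evolve_sub (hι : IsSmearable ι) (hσ : SmoothingSymbol σ ℓ C)
    (h : IsSource ι κ μ A N) (hκ : 0 ≤ κ) (hℓ : 0 ≤ ℓ) {a b t : ℝ} (ha : 0 ≤ a) (hb : b ≤ t)
    (φ : TestFn) : Measurable fun τ : Ioo a b => ι (evolve ι σ N (t - τ) τ) φ :=
  measurable_sub_right_of_measurable (F := fun s τ => ι (evolve ι σ N s τ) φ)
    (h.measurable_evolve hι hσ hκ hℓ φ) ha hb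

end IsSource

end Sources

/-! ### The Duhamel integral of a source -/

section Duhamel

variable {E : Type*} [NormedAddCommGroup E] [NormedSpace ℝ E] {ι : E →L[ℝ] TempDist}

/-- The weak integral over `0 < τ < t` of the semigroup with symbol `σ` at time `t - τ` applied to
the source at time `τ`. It is an arbitrary element if the weak integral does not exist in `E`; for
sources it does, by `IsSource.duhamel_spec`. -/
def duhamel (ι : E →L[ℝ] TempDist) (σ : ℝ → R3 → ℝ) (N : ℝ → ℝ → E) (t : ℝ) : E :=
  Classical.epsilon fun e => ∀ φ, ι e φ = ∫ τ in Ioo 0 t, ι (evolve ι σ N (t - τ) τ) φ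

namespace IsSource

variable {κ μ A A' : ℝ} {N N' : ℝ → ℝ → E} {σ : ℝ → R3 → ℝ} {ℓ C : ℝ}

theorem integrableOn_evolve (hι : IsSmearable ι) (hσ : SmoothingSymbol σ ℓ C)
    (h : IsSource ι κ μ A N) (hκ : 0 ≤ κ) (hκ1 : κ < 1) (hμ : 0 ≤ μ) (hμ1 : μ < 1) (hℓ : 0 ≤ ℓ)
    {t : ℝ} (ht : 0 < t) (φ : TestFn) :
    IntegrableOn (fun τ => ι (evolve ι σ N (t - τ) τ) φ) (Ioo 0 t) := by
  obtain ⟨B, -, hB⟩ := exists_beta_bound hκ hκ1 hμ hμ1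
  exact integrableOn_pairing (f := fun τ => evolve ι σ N (t - τ) τ)
    (fun φ => h.measurable_evolve_sub hι hσ hκ hℓ le_rfl le_rfl φ)
    ((hB t ht).1.const_mul (C * (2 ^ κ * A)))
    (fun τ hτ => h.norm_evolve_le hι hσ (sub_pos.2 hτ.2) hτ.1) φ

theorem duhamel_spec (hι : IsSmearable ι) (hσ : SmoothingSymbol σ ℓ C)
    (h : IsSource ι κ μ A N) (hκ : 0 ≤ κ) (hκ1 : κ < 1) (hμ : 0 ≤ μ) (hμ1 : μ < 1) (hℓ : 0 ≤ ℓ)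
    {t : ℝ} (ht : 0 < t) (φ : TestFn) :
    ι (duhamel ι σ N t) φ = ∫ τ in Ioo 0 t, ι (evolve ι σ N (t - τ) τ) φ := by
  obtain ⟨B, -, hB⟩ := exists_beta_bound hκ hκ1 hμ hμ1
  obtain ⟨e, he, -⟩ := hι.exists_setIntegral (f := fun τ => evolve ι σ N (t - τ) τ)
    (fun φ => h.measurable_evolve_sub hι hσ hκ hℓ le_rfl le_rfl φ)
    ((hB t ht).1.const_mul (C * (2 ^ κ * A)))
    (fun τ hτ => h.norm_evolve_le hι hσ (sub_pos.2 hτ.2) hτ.1)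
  exact Classical.epsilon_spec (p := fun e => ∀ φ, ι e φ =
    ∫ τ in Ioo 0 t, ι (evolve ι σ N (t - τ) τ) φ) ⟨e, he⟩ φ

/-- The bound of the source that enters may have another exponent than the one which makes the
Duhamel integral meaningful, and is needed only up to the time considered. -/
theorem _root_.exists_norm_duhamel_le (hι : IsSmearable ι) (hσ : SmoothingSymbol σ ℓ C)
    (hκ : 0 ≤ κ) (hκ1 : κ < 1) (hμ : 0 ≤ μ) (hμ1 : μ < 1) (hℓ : 0 ≤ ℓ) {ν : ℝ} (hν : 0 ≤ ν)
    (hν1 : ν < 1) :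
    ∃ B, 0 ≤ B ∧ ∀ (N : ℝ → ℝ → E) (A A' t : ℝ), IsSource ι κ μ A N → 0 ≤ A' → 0 < t →
      (∀ s τ, 0 < s → 0 < τ → τ < t → ‖N s τ‖ ≤ A' * s ^ (-κ) * τ ^ (-ν)) →
        ‖duhamel ι σ N t‖ ≤ B * A' * t ^ (1 - κ - ν) := by
  obtain ⟨B, hB0, hB⟩ := exists_beta_bound hκ hκ1 hν hν1
  have hC := (hσ.residual 1 one_pos).nonneg
  refine ⟨C * 2 ^ κ * B, by positivity, fun N A A' t h hA' ht hb => ?_⟩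
  obtain ⟨e, he, hn⟩ := hι.exists_setIntegral (f := fun τ => evolve ι σ N (t - τ) τ)
    (fun φ => h.measurable_evolve_sub hι hσ hκ hℓ le_rfl le_rfl φ)
    ((hB t ht).1.const_mul (C * (2 ^ κ * A')))
    (fun τ hτ => by
      have hs : 0 < t - τ := sub_pos.2 hτ.2
      refine (hι.norm_multOp_le (hσ.residual _ hs) _).trans ?_
      refine (mul_le_mul_of_nonneg_left (hb _ τ (half_pos hs) hτ.1 hτ.2) hC).trans (le_of_eq ?_)
      rw [Real.div_rpow hs.le two_pos.le, Real.rpow_neg two_pos.le, div_inv_eq_mul]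
      ring)
  rw [hι.ext fun φ => (h.duhamel_spec hι hσ hκ hκ1 hμ hμ1 hℓ ht φ).trans (he φ).symm]
  refine hn.trans ?_
  rw [integral_const_mul]
  refine (mul_le_mul_of_nonneg_left (hB t ht).2 (by positivity)).trans (le_of_eq (by ring))

theorem duhamel_sub (hι : IsSmearable ι) (hσ : SmoothingSymbol σ ℓ C)
    (h : IsSource ι κ μ A N) (h' : IsSource ι κ μ A' N')
    (hκ : 0 ≤ κ) (hκ1 : κ < 1) (hμ : 0 ≤ μ) (hμ1 : μ < 1) (hℓ : 0 ≤ ℓ) {t : ℝ} (ht : 0 < t) :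
    duhamel ι σ (fun s τ => N s τ - N' s τ) t = duhamel ι σ N t - duhamel ι σ N' t :=
  hι.ext fun φ => by
    rw [pairing_sub, (h.sub hι h').duhamel_spec hι hσ hκ hκ1 hμ hμ1 hℓ ht,
      h.duhamel_spec hι hσ hκ hκ1 hμ hμ1 hℓ ht, h'.duhamel_spec hι hσ hκ hκ1 hμ hμ1 hℓ ht,
      ← integral_sub (h.integrableOn_evolve hι hσ hκ hκ1 hμ hμ1 hℓ ht φ)
        (h'.integrableOn_evolve hι hσ hκ hκ1 hμ hμ1 hℓ ht φ)]
    refine setIntegral_congr_fun measurableSet_Ioo fun τ hτ => ?_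
    simp only [evolve]
    rw [hι.multOp_sub (hσ.residual _ (sub_pos.2 hτ.2)), pairing_sub]

/-- The heat semigroup commutes with the Duhamel integral, and acts by a shift of the source. -/
theorem heatOp_duhamel (hι : IsSmearable ι) (hσ : SmoothingSymbol σ ℓ C)
    (h : IsSource ι κ μ A N) (hκ : 0 ≤ κ) (hκ1 : κ < 1) (hμ : 0 ≤ μ) (hμ1 : μ < 1) (hℓ : 0 ≤ ℓ)
    {t r : ℝ} (ht : 0 < t) (hr : 0 < r) :
    heatOp ι r (duhamel ι σ N t) = duhamel ι σ (fun s τ => N (s + r) τ) t :=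
  hι.ext fun φ => by
    obtain ⟨B, -, hB⟩ := exists_beta_bound hκ hκ1 hμ hμ1
    have hs := h.shift le_rfl hκ hr
    rw [sub_zero] at hs
    rw [hs.duhamel_spec hι hσ hκ hκ1 hμ hμ1 hℓ ht, heatOp,
      hι.multOp_setIntegral (f := fun τ => evolve ι σ N (t - τ) τ)
      (fun φ => h.measurable_evolve_sub hι hσ hκ hℓ le_rfl le_rfl φ)
      ((hB t ht).1.const_mul (C * (2 ^ κ * A)))
      (fun τ hτ => h.norm_evolve_le hι hσ (sub_pos.2 hτ.2) hτ.1)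
      (evenMultiplier_heatSymbol hr) (h.duhamel_spec hι hσ hκ hκ1 hμ hμ1 hℓ ht)]
    refine setIntegral_congr_fun measurableSet_Ioo fun τ hτ => ?_
    have hs : 0 < t - τ := sub_pos.2 hτ.2
    simp only [evolve]
    rw [h.flow _ _ _ (half_pos hs) hr hτ.1, hι.multOp_heatOp_comm (hσ.residual _ hs) hr]
    rfl

/-- Hölder continuity in time of the Duhamel integral, with constants depending only on the
size of the source. -/
theorem _root_.exists_duhamel_modulus (hι : IsSmearable ι) (hσ : SmoothingSymbol σ ℓ C)
    (hκ : 0 ≤ κ) (hμ : 0 ≤ μ) (hμ1 : μ < 1) (hℓ : 2 ≤ ℓ) {θ : ℝ} (hθ : 0 < θ) (hθ1 : θ ≤ 1)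
    (hθκ : κ + θ * (ℓ / 2) < 1) :
    ∃ K, 0 ≤ K ∧ ∀ (N : ℝ → ℝ → E) (A : ℝ), IsSource ι κ μ A N → ∀ t h, 0 < t → 0 < h → h ≤ 1 →
      ‖duhamel ι σ N (t + h) - duhamel ι σ N t‖ ≤
        K * A * h ^ θ * (t ^ (1 - (κ + θ) - μ) + t ^ (1 - (κ + θ * (ℓ / 2)) - μ) + t ^ (-μ)) := by
  have hθℓ : θ ≤ θ * (ℓ / 2) := by nlinarith
  have hκ1 : κ < 1 := by linarith
  have hκ1' : 0 < 1 - κ := by linarith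
  have hℓ0 : 0 ≤ ℓ := by linarith
  obtain ⟨B₁, hB₁0, hB₁⟩ := exists_beta_bound (α := κ + θ) (by linarith) (by linarith) hμ hμ1
  obtain ⟨B₂, hB₂0, hB₂⟩ := exists_beta_bound (α := κ + θ * (ℓ / 2)) (by linarith) hθκ hμ hμ1
  have hC := (hσ.residual 1 one_pos).nonneg
  refine ⟨C * 2 ^ κ * (B₁ + B₂ + 1 / (1 - κ)), by positivity, fun N A hN t h ht hh hh1 => ?_⟩
  have hA := hN.const_nonneg
  have hth : 0 < t + h := by linarith
  have hD : 0 ≤ C * (2 ^ κ * A) := by positivity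
  -- The difference is the integral over `(0, t)` of the increment of the semigroup, which is `e₁`,
  -- and the integral over `(t, t + h)`, which is `e₂`.
  obtain ⟨e₁, he₁, hn₁⟩ := hι.exists_setIntegral (a := 0) (b := t)
    (f := fun τ => evolve ι σ N (t + h - τ) τ - evolve ι σ N (t - τ) τ)
    (g := fun τ => C * (2 ^ κ * A) * (h ^ θ * ((t - τ) ^ (-(κ + θ)) * τ ^ (-μ) +
      (t - τ) ^ (-(κ + θ * (ℓ / 2))) * τ ^ (-μ))))
    (fun φ => by
      simp only [pairing_sub]
      exact (hN.measurable_evolve_sub hι hσ hκ hℓ0 le_rfl (by linarith) φ).sub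
        (hN.measurable_evolve_sub hι hσ hκ hℓ0 le_rfl le_rfl φ))
    ((((hB₁ t ht).1.add (hB₂ t ht).1).const_mul _).const_mul _)
    (fun τ hτ => by
      have hs : 0 < t - τ := sub_pos.2 hτ.2
      have h1 := hN.norm_evolve_add_sub_le hι hσ hs hh hτ.1
      rw [show t - τ + h = t + h - τ by ring] at h1
      refine h1.trans (mul_le_mul_of_nonneg_left ?_ hD)
      have p1 : 0 ≤ (t - τ)⁻¹ := by positivity
      have p2 : 0 ≤ (t - τ) ^ (-(ℓ / 2)) := by positivity
      have p3 : 0 ≤ (t - τ) ^ (-κ) * τ ^ (-μ) :=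
        mul_nonneg (Real.rpow_nonneg hs.le _) (Real.rpow_nonneg hτ.1.le _)
      -- Part of the smallness in `h` is given up for an integrable singularity at `τ = t`.
      have h2 : min 1 (h * ((t - τ)⁻¹ + (t - τ) ^ (-(ℓ / 2)))) ≤
          h ^ θ * ((t - τ) ^ (-θ) + (t - τ) ^ (-(θ * (ℓ / 2)))) := by
        refine (min_one_le_rpow (by positivity) hθ.le hθ1).trans ?_
        rw [Real.mul_rpow hh.le (by positivity)]
        refine mul_le_mul_of_nonneg_left ((Real.rpow_add_le_add_rpow p1 p2 hθ.le hθ1).trans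
          (le_of_eq ?_)) (by positivity)
        rw [← Real.rpow_neg_one, ← Real.rpow_mul hs.le, ← Real.rpow_mul hs.le]
        congr 2 <;> ring
      refine (mul_le_mul_of_nonneg_right h2 p3).trans (le_of_eq ?_)
      rw [neg_add, neg_add, Real.rpow_add hs, Real.rpow_add hs]
      ring)
  obtain ⟨i2, ei2⟩ := integrableOn_sub_rpow_Ioo hκ1 (by linarith : t < t + h)
  obtain ⟨e₂, he₂, hn₂⟩ := hι.exists_setIntegral (a := t) (b := t + h)
    (f := fun τ => evolve ι σ N (t + h - τ) τ)
    (g := fun τ => C * (2 ^ κ * A) * (t ^ (-μ) * (t + h - τ) ^ (-κ)))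
    (fun φ => hN.measurable_evolve_sub hι hσ hκ hℓ0 ht.le le_rfl φ)
    ((i2.const_mul _).const_mul _)
    (fun τ hτ => by
      have hs : 0 < t + h - τ := sub_pos.2 hτ.2
      refine (hN.norm_evolve_le hι hσ hs (ht.trans hτ.1)).trans
        (mul_le_mul_of_nonneg_left ?_ hD)
      rw [mul_comm]
      exact mul_le_mul_of_nonneg_right
        (Real.rpow_le_rpow_of_nonpos ht hτ.1.le (by linarith)) (by positivity))
  have hsum : duhamel ι σ N (t + h) - duhamel ι σ N t = e₁ + e₂ := hι.ext fun φ => by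
    have hI := hN.integrableOn_evolve hι hσ hκ hκ1 hμ hμ1 hℓ0 hth φ
    have hI0 := hI.mono_set (Ioo_subset_Ioo_right (by linarith : t ≤ t + h))
    have hI1 := hI.mono_set (Ioo_subset_Ioo_left ht.le : Ioo t (t + h) ⊆ _)
    have hJ := hN.integrableOn_evolve hι hσ hκ hκ1 hμ hμ1 hℓ0 ht φ
    rw [pairing_sub, pairing_add, he₁, he₂, hN.duhamel_spec hι hσ hκ hκ1 hμ hμ1 hℓ0 hth,
      hN.duhamel_spec hι hσ hκ hκ1 hμ hμ1 hℓ0 ht]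
    simp only [pairing_sub]
    rw [integral_sub hI0 hJ]
    have hsplit := intervalIntegral.integral_add_adjacent_intervals
      ((intervalIntegrable_iff_integrableOn_Ioo_of_le ht.le).2 hI0)
      ((intervalIntegrable_iff_integrableOn_Ioo_of_le (by linarith)).2 hI1)
    rw [intervalIntegral.integral_of_le ht.le, intervalIntegral.integral_of_le (by linarith),
      intervalIntegral.integral_of_le hth.le, integral_Ioc_eq_integral_Ioo,
      integral_Ioc_eq_integral_Ioo, integral_Ioc_eq_integral_Ioo] at hsplit
    rw [← hsplit]
    ring
  rw [hsum]
  refine (norm_add_le _ _).trans ((add_le_add hn₁ hn₂).trans ?_)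
  have hadd := integral_add (hB₁ t ht).1 (hB₂ t ht).1
  rw [integral_const_mul, integral_const_mul, hadd, integral_const_mul, integral_const_mul, ei2,
    add_sub_cancel_left]
  have h3 : h ^ (1 - κ) ≤ h ^ θ := Real.rpow_le_rpow_of_exponent_ge hh hh1 (by linarith)
  have b1 := (hB₁ t ht).2
  have b2 := (hB₂ t ht).2
  set X := t ^ (1 - (κ + θ) - μ) with hX
  set Y := t ^ (1 - (κ + θ * (ℓ / 2)) - μ) with hY
  set Z := t ^ (-μ) with hZ
  have hX0 : 0 ≤ X := by positivity
  have hY0 : 0 ≤ Y := by positivity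
  have hZ0 : 0 ≤ Z := by positivity
  have hH0 : 0 ≤ h ^ θ := by positivity
  have h4 : h ^ (1 - κ) / (1 - κ) ≤ h ^ θ * (1 / (1 - κ)) := by
    rw [mul_one_div]; gcongr
  have hq : 0 ≤ 1 / (1 - κ) := by positivity
  calc _ ≤ C * (2 ^ κ * A) * (h ^ θ * (B₁ * X + B₂ * Y)) +
        C * (2 ^ κ * A) * (Z * (h ^ θ * (1 / (1 - κ)))) := by gcongr
    _ = C * (2 ^ κ * A) * h ^ θ * (B₁ * X + B₂ * Y + (1 / (1 - κ)) * Z) := by ring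
    _ ≤ C * (2 ^ κ * A) * h ^ θ * ((B₁ + B₂ + 1 / (1 - κ)) * (X + Y + Z)) := by
        refine mul_le_mul_of_nonneg_left ?_ (by positivity)
        set q := 1 / (1 - κ)
        nlinarith [mul_nonneg hB₁0 hY0, mul_nonneg hB₁0 hZ0, mul_nonneg hB₂0 hX0,
          mul_nonneg hB₂0 hZ0, mul_nonneg hq hX0, mul_nonneg hq hY0]
    _ = _ := by ring

/-- Tested against a fixed function, a source is less singular by half a derivative. -/
theorem exists_abs_apply_le [CompleteSpace E] (hι : IsSmearable ι)
    (h : IsSource ι κ μ A N) (hκ : 0 ≤ κ) {κ' : ℝ} (hκ' : 1 / 2 < κ') (hκκ' : κ ≤ κ')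
    (φ : TestFn) :
    ∃ c, 0 ≤ c ∧ ∀ s τ y, 0 < s → s ≤ 1 → 0 < τ →
      |ι (N s τ) (_root_.shift y φ)| ≤ c * s ^ (1 / 2 - κ') * τ ^ (-μ) := by
  have hA := h.const_nonneg
  obtain ⟨C, hC, hL⟩ := hι.exists_heatOp_sub_le φ
  set θ := 1 / 2 - κ' with hθ
  have hθ0 : θ < 0 := by rw [hθ]; linarith
  have h2θ : (2 : ℝ) ^ θ < 1 := Real.rpow_lt_one_of_one_lt_of_neg one_lt_two hθ0
  have hgap : 0 < 1 - (2 : ℝ) ^ θ := by linarith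
  refine ⟨‖distPairing ι φ‖ * A + C * A / (1 - 2 ^ θ), by positivity, fun s τ y hs hs1 hτ => ?_⟩
  obtain ⟨n, hn1, -, hn⟩ := exists_two_pow_mul_mem hs hs1
  have hp : 0 ≤ τ ^ (-μ) := by positivity
  -- The exponent `θ` is negative, so `c` is negative, too: the increments sum to `O(s^θ)`.
  have hdy := dyadic_mono (Q := fun s => |ι (N s τ) (_root_.shift y φ)|) (C := C * A * τ ^ (-μ))
    (θ := θ) (c := -(C * A / (1 - 2 ^ θ) * τ ^ (-μ))) (le_of_eq (by field_simp; ring)) (n := n) hs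
    (fun i hi => by
      have hq : 0 < 2 ^ i * s := by positivity
      have h1 := hL (N (2 ^ i * s) τ) y (2 ^ i * s) hq
      rw [← h.flow _ _ _ hq hq hτ, ← two_mul, ← mul_assoc, ← pow_succ'] at h1
      have h2 := h.bound (2 ^ i * s) τ hq hτ
      have h3 : Real.sqrt (2 ^ i * s) * (2 ^ i * s) ^ (-κ) ≤ (2 ^ i * s) ^ θ := by
        rw [Real.sqrt_eq_rpow, ← Real.rpow_add hq]
        exact Real.rpow_le_rpow_of_exponent_ge hq (hn i hi) (by rw [hθ]; linarith)
      have h4 : C * Real.sqrt (2 ^ i * s) * ‖N (2 ^ i * s) τ‖ ≤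
          C * A * τ ^ (-μ) * (2 ^ i * s) ^ θ := by
        calc _ ≤ C * Real.sqrt (2 ^ i * s) * (A * (2 ^ i * s) ^ (-κ) * τ ^ (-μ)) := by gcongr
          _ = C * A * τ ^ (-μ) * (Real.sqrt (2 ^ i * s) * (2 ^ i * s) ^ (-κ)) := by ring
          _ ≤ _ := by gcongr
      have h5 := abs_sub_abs_le_abs_sub (ι (N (2 ^ i * s) τ) (_root_.shift y φ))
        (ι (N (2 ^ (i + 1) * s) τ) (_root_.shift y φ))
      rw [abs_sub_comm] at h5
      linarith)
  have hQ : |ι (N (2 ^ n * s) τ) (_root_.shift y φ)| ≤ ‖distPairing ι φ‖ * A * τ ^ (-μ) := by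
    refine (hι.translation.abs_apply_shift_le _ φ y).trans ?_
    rw [mul_assoc]
    refine mul_le_mul_of_nonneg_left ((h.bound _ τ (by positivity) hτ).trans ?_) (norm_nonneg _)
    have : (2 ^ n * s) ^ (-κ) ≤ 1 := Real.rpow_le_one_of_one_le_of_nonpos hn1 (by linarith)
    calc A * (2 ^ n * s) ^ (-κ) * τ ^ (-μ) ≤ A * 1 * τ ^ (-μ) := by gcongr
      _ = A * τ ^ (-μ) := by ring
  have hsθ : 1 ≤ s ^ θ := Real.one_le_rpow_of_pos_of_le_one_of_nonpos hs hs1 hθ0.le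
  have hz : 0 ≤ C * A / (1 - 2 ^ θ) * τ ^ (-μ) * (2 ^ n * s) ^ θ := by positivity
  have hx : ‖distPairing ι φ‖ * A * τ ^ (-μ) * 1 ≤ ‖distPairing ι φ‖ * A * τ ^ (-μ) * s ^ θ := by
    gcongr
  nlinarith [hdy, hQ, hz, hx]

/-- The Duhamel integral vanishes weakly at time `0`. Testing gains half a derivative, so that the
beta integral has the positive power `t^(3/2 - κ' - μ)`. -/
theorem tendsto_duhamel [CompleteSpace E] (hι : IsSmearable ι) (hσ : SmoothingSymbol σ ℓ C)
    (h : IsSource ι κ μ A N) (hκ : 0 ≤ κ) (hκ1 : κ < 1) (hμ : 0 ≤ μ) (hμ1 : μ < 1) (hℓ : 0 ≤ ℓ)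
    {κ' : ℝ} (hκ' : 1 / 2 < κ') (hκκ' : κ ≤ κ') (hκμ : κ' + μ < 3 / 2) (φ : TestFn) :
    Tendsto (fun t => ι (duhamel ι σ N t) φ) (𝓝[>] 0) (𝓝 0) := by
  obtain ⟨c, hc, hN⟩ := h.exists_abs_apply_le hι hκ hκ' hκκ' φ
  obtain ⟨B, hB0, hB⟩ := exists_beta_bound (α := κ' - 1 / 2) (by linarith) (by linarith) hμ hμ1
  have hC := (hσ.residual 1 one_pos).nonneg
  set D := C * (c * 2 ^ (κ' - 1 / 2)) with hD
  have hD0 : 0 ≤ D := by positivity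
  have hz : Tendsto (fun t : ℝ => D * (B * t ^ (1 - (κ' - 1 / 2) - μ))) (𝓝[>] 0) (𝓝 0) := by
    have h1 : ContinuousAt (fun t : ℝ => D * (B * t ^ (1 - (κ' - 1 / 2) - μ))) 0 :=
      continuousAt_const.mul (continuousAt_const.mul
        (Real.continuousAt_rpow_const _ _ (Or.inr (by linarith))))
    have h2 := h1.tendsto.mono_left (nhdsWithin_le_nhds (s := Ioi 0))
    rwa [Real.zero_rpow (by linarith), mul_zero, mul_zero] at h2
  refine squeeze_zero_norm' ?_ hz
  filter_upwards [Ioo_mem_nhdsGT (zero_lt_one (α := ℝ))] with t ht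
  rw [h.duhamel_spec hι hσ hκ hκ1 hμ hμ1 hℓ ht.1]
  have hint := (hB t ht.1).1.const_mul D
  refine (norm_integral_le_of_norm_le hint ?_).trans ?_
  · filter_upwards [ae_restrict_mem measurableSet_Ioo] with τ hτ
    have hs : 0 < t - τ := sub_pos.2 hτ.2
    have hm := hσ.residual (t - τ) hs
    have h0 : |ι (evolve ι σ N (t - τ) τ) φ| ≤
        (∫ z, |evenKernel (residualSymbol σ (t - τ)) z|) *
          (c * ((t - τ) / 2) ^ (1 / 2 - κ') * τ ^ (-μ)) := by
      rw [evolve, hι.apply_multOp hm]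
      have := HasBoundedTranslates.abs_translateAvg_le (H := ι (N ((t - τ) / 2) τ)) (φ := φ)
        (fun y => hN ((t - τ) / 2) τ y (half_pos hs) (by linarith [ht.2, hτ.1]) hτ.1)
        hm.integrable_evenKernel 0
      rwa [shift_zero] at this
    have hq : 0 ≤ c * ((t - τ) / 2) ^ (1 / 2 - κ') * τ ^ (-μ) :=
      mul_nonneg (mul_nonneg hc (Real.rpow_nonneg (half_pos hs).le _)) (Real.rpow_nonneg hτ.1.le _)
    refine (h0.trans (mul_le_mul_of_nonneg_right hm.norm_le hq)).trans (le_of_eq ?_)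
    rw [show 1 / 2 - κ' = -(κ' - 1 / 2) by ring, Real.div_rpow hs.le two_pos.le,
      Real.rpow_neg two_pos.le (κ' - 1 / 2), div_inv_eq_mul, hD]
    ring
  · rw [integral_const_mul]
    exact mul_le_mul_of_nonneg_left (hB t ht.1).2 hD0

/-- The Duhamel integrals of the heat and of the hyperdissipative semigroup differ by a term
smaller by a factor `t^(-δ)`. -/
theorem _root_.exists_norm_duhamel_heat_sub_hyper_le (hι : IsSmearable ι) (hℓ : 2 < ℓ)
    (hκ : 0 ≤ κ) (hμ : 0 ≤ μ) (hμ1 : μ < 1) {δ : ℝ} (hδ : 0 < δ) (hδℓ : δ ≤ ℓ / 2 - 1)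
    (hδ1 : δ ≤ 1) (hκδ : κ + δ < 1) :
    ∃ K, 0 ≤ K ∧ ∀ (N : ℝ → ℝ → E) (A : ℝ), IsSource ι κ μ A N → ∀ t, 0 < t →
      ‖duhamel ι heatSymbol N t - duhamel ι (hyperSymbol ℓ) N t‖ ≤
        K * A * t ^ (1 - (κ + δ) - μ) := by
  obtain ⟨B, hB0, hB⟩ := exists_beta_bound (α := κ + δ) (by linarith) hκδ hμ hμ1
  obtain ⟨C, hC, hdiff⟩ := exists_residual_sub_bound hℓ
  obtain ⟨C₁, -, hC₁⟩ := exists_smoothingSymbol_heat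
  obtain ⟨C₂, -, hC₂⟩ := exists_smoothingSymbol_hyper hℓ
  have h1 := hC₁ ℓ C₁ le_rfl
  have h2 := hC₂ C₂ le_rfl
  have hκ1 : κ < 1 := by linarith
  have hℓ0 : 0 ≤ ℓ := by linarith
  refine ⟨C * 2 ^ κ * B, by positivity, fun N A h t ht => ?_⟩
  have hA := h.const_nonneg
  obtain ⟨e, he, hn⟩ := hι.exists_setIntegral (a := 0) (b := t)
    (f := fun τ => evolve ι heatSymbol N (t - τ) τ - evolve ι (hyperSymbol ℓ) N (t - τ) τ)
    (fun φ => by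
      simp only [pairing_sub]
      exact (h.measurable_evolve_sub hι h1 hκ hℓ0 le_rfl le_rfl φ).sub
        (h.measurable_evolve_sub hι h2 hκ hℓ0 le_rfl le_rfl φ))
    ((hB t ht).1.const_mul (C * (2 ^ κ * A)))
    (fun τ hτ => by
      have hs : 0 < t - τ := sub_pos.2 hτ.2
      have hm := hdiff δ hδ hδℓ hδ1 (t - τ) hs
      rw [evolve, evolve, ← hι.sub_multOp (h1.residual _ hs) (h2.residual _ hs)]
      refine (hι.norm_multOp_le hm _).trans
        ((mul_le_mul_of_nonneg_left (h.bound _ τ (half_pos hs) hτ.1) hm.nonneg).trans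
          (le_of_eq ?_))
      rw [Real.div_rpow hs.le two_pos.le, Real.rpow_neg two_pos.le, div_inv_eq_mul, neg_add,
        Real.rpow_add hs]
      ring)
  have : duhamel ι heatSymbol N t - duhamel ι (hyperSymbol ℓ) N t = e := hι.ext fun φ => by
    rw [pairing_sub, he, h.duhamel_spec hι h1 hκ hκ1 hμ hμ1 hℓ0 ht,
      h.duhamel_spec hι h2 hκ hκ1 hμ hμ1 hℓ0 ht,
      ← integral_sub (h.integrableOn_evolve hι h1 hκ hκ1 hμ hμ1 hℓ0 ht φ)
        (h.integrableOn_evolve hι h2 hκ hκ1 hμ hμ1 hℓ0 ht φ)]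
    simp only [pairing_sub]
  rw [this]
  refine hn.trans ?_
  rw [integral_const_mul]
  refine (mul_le_mul_of_nonneg_left (hB t ht).2 (by positivity)).trans (le_of_eq (by ring))

end IsSource

end Duhamel

/-! ### Time regularity in the Besov-type norm -/

section Besov

variable {E : Type*} [NormedAddCommGroup E] [NormedSpace ℝ E] {ι : E →L[ℝ] TempDist}

/-- A one-sided modulus of continuity that is locally uniform gives a two-sided one. -/
theorem eventually_le_of_increment {L : ℝ → ℝ} (hL : ContinuousOn L (Ioi 0)) {θ t : ℝ}
    (ht : 0 < t) : ∀ᶠ s in 𝓝 t, ∀ G : ℝ → ℝ → ℝ, (∀ s, G s s = 0) →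
      (∀ s s', G s s' = G s' s) →
      (∀ t h, 0 < t → 0 < h → h ≤ 1 → G (t + h) t ≤ L t * h ^ θ) →
        G s t ≤ (|L t| + 1) * |s - t| ^ θ := by
  have h1 : ∀ᶠ s in 𝓝 t, L s < |L t| + 1 :=
    (hL.continuousAt (Ioi_mem_nhds ht)).eventually_lt_const
      ((le_abs_self _).trans_lt (lt_add_one _))
  filter_upwards [h1, Ioi_mem_nhds ht, Ioo_mem_nhds (sub_one_lt t) (lt_add_one t)]
    with s hs hs0 hs1 G hG0 hGs hG
  have hs0' : 0 < s := hs0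
  rcases lt_trichotomy s t with hlt | rfl | hlt
  · have h2 := hG s (t - s) hs0' (by linarith) (by linarith [hs1.1])
    rw [add_sub_cancel] at h2
    rw [hGs, abs_sub_comm, abs_of_pos (by linarith : 0 < t - s)]
    exact h2.trans (mul_le_mul_of_nonneg_right hs.le (by have := sub_pos.2 hlt; positivity))
  · rw [hG0]; positivity
  · have h2 := hG t (s - t) ht (by linarith) (by linarith [hs1.2])
    rw [add_sub_cancel] at h2
    rw [abs_of_pos (by linarith : 0 < s - t)]
    exact h2.trans (mul_le_mul_of_nonneg_right (by linarith [le_abs_self (L t)])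
      (by have := sub_pos.2 hlt; positivity))

/-- The curve `u` is bounded, and locally Hölder continuous on `(0, ∞)`, for the norm
`sup_r r^a ‖exp (rΔ) ·‖`. -/
structure IsBesovRegular (ι : E →L[ℝ] TempDist) (a : ℝ) (u : ℝ → E) : Prop where
  bounded : ∃ M, ∀ t r, 0 < t → 0 < r → r ^ a * ‖heatOp ι r (u t)‖ ≤ M
  holder : ∃ (θ : ℝ) (L : ℝ → ℝ), 0 < θ ∧ ContinuousOn L (Ioi 0) ∧ ∀ t h r, 0 < t → 0 < h → h ≤ 1 →
    0 < r → r ^ a * ‖heatOp ι r (u (t + h) - u t)‖ ≤ L t * h ^ θ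

theorem IsSmearable.heatOp_sub (hι : IsSmearable ι) {r : ℝ} (hr : 0 < r) (e e' : E) :
    heatOp ι r (e - e') = heatOp ι r e - heatOp ι r e' :=
  hι.multOp_sub (evenMultiplier_heatSymbol hr) e e'

namespace IsBesovRegular

variable {a : ℝ} {u v : ℝ → E}

theorem congr (hu : IsBesovRegular ι a u) (h : ∀ t, 0 < t → v t = u t) : IsBesovRegular ι a v := by
  obtain ⟨M, hM⟩ := hu.bounded
  obtain ⟨θ, L, hθ, hL, hb⟩ := hu.holder
  refine ⟨⟨M, fun t r ht hr => ?_⟩, ⟨θ, L, hθ, hL, fun t s r ht hs hs1 hr => ?_⟩⟩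
  · rw [h t ht]; exact hM t r ht hr
  · rw [h t ht, h _ (add_pos ht hs)]; exact hb t s r ht hs hs1 hr

theorem sub (hι : IsSmearable ι) (hu : IsBesovRegular ι a u) (hv : IsBesovRegular ι a v) :
    IsBesovRegular ι a (fun t => u t - v t) := by
  obtain ⟨M, hM⟩ := hu.bounded
  obtain ⟨M', hM'⟩ := hv.bounded
  obtain ⟨θ, L, hθ, hL, hb⟩ := hu.holder
  obtain ⟨θ', L', hθ', hL', hb'⟩ := hv.holder
  refine ⟨⟨M + M', fun t r ht hr => ?_⟩, ⟨min θ θ', fun t => |L t| + |L' t|, lt_min hθ hθ',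
    hL.abs.add hL'.abs, fun t h r ht hh hh1 hr => ?_⟩⟩
  · rw [hι.heatOp_sub hr]
    have h1 := mul_le_mul_of_nonneg_left (norm_sub_le (heatOp ι r (u t)) (heatOp ι r (v t)))
      (Real.rpow_nonneg hr.le a)
    rw [mul_add] at h1
    exact h1.trans (add_le_add (hM t r ht hr) (hM' t r ht hr))
  · rw [show u (t + h) - v (t + h) - (u t - v t) = (u (t + h) - u t) - (v (t + h) - v t) by abel,
      hι.heatOp_sub hr]
    have h1 := mul_le_mul_of_nonneg_left (norm_sub_le (heatOp ι r (u (t + h) - u t))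
      (heatOp ι r (v (t + h) - v t))) (Real.rpow_nonneg hr.le a)
    rw [mul_add] at h1
    refine h1.trans ((add_le_add (hb t h r ht hh hh1 hr) (hb' t h r ht hh hh1 hr)).trans ?_)
    rw [add_mul]
    have e1 : h ^ θ ≤ h ^ min θ θ' := Real.rpow_le_rpow_of_exponent_ge hh hh1 (min_le_left _ _)
    have e2 : h ^ θ' ≤ h ^ min θ θ' := Real.rpow_le_rpow_of_exponent_ge hh hh1 (min_le_right _ _)
    gcongr
    · exact le_abs_self _
    · exact le_abs_self _

theorem eventually_le (hι : IsSmearable ι) (hu : IsBesovRegular ι a u) {t : ℝ} (ht : 0 < t) :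
    ∃ θ c : ℝ, 0 < θ ∧ ∀ᶠ s in 𝓝 t, ∀ r, 0 < r →
      r ^ a * ‖heatOp ι r (u s - u t)‖ ≤ c * |s - t| ^ θ := by
  obtain ⟨θ, L, hθ, hL, hb⟩ := hu.holder
  refine ⟨θ, |L t| + 1, hθ, ?_⟩
  filter_upwards [eventually_le_of_increment hL ht] with s hs r hr
  refine hs (fun s t => r ^ a * ‖heatOp ι r (u s - u t)‖) (fun s => ?_) (fun s s' => ?_)
    (fun t h ht hh hh1 => hb t h r ht hh hh1 hr)
  · rw [hι.heatOp_sub hr, sub_self, norm_zero, mul_zero]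
  · simp only [hι.heatOp_sub hr, norm_sub_rev]

end IsBesovRegular

theorem tendsto_mul_abs_sub_rpow (c : ℝ) {θ : ℝ} (hθ : 0 < θ) (t : ℝ) :
    Tendsto (fun s => c * |s - t| ^ θ) (𝓝 t) (𝓝 0) := by
  have h : Continuous fun s : ℝ => c * |s - t| ^ θ :=
    continuous_const.mul ((continuous_id.sub continuous_const).abs.rpow_const fun s => Or.inr hθ.le)
  simpa [Real.zero_rpow hθ.ne'] using h.tendsto t

/-- A curve of vector fields with Besov regular components is norm continuous. -/
theorem tendsto_besovNorm_sub (hι : IsSmearable ι) {α : ℝ} {u : ℝ → Fin 3 → E}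
    (hu : ∀ i, IsBesovRegular ι (α / 2) fun t => u t i) {t : ℝ} (ht : 0 < t) :
    Tendsto (fun s => besovNorm ι α (vecDist ι (u s - u t))) (𝓝 t) (𝓝 0) := by
  choose θ c hθ hc using fun i => (hu i).eventually_le hι ht
  have hz : Tendsto (fun s => ENNReal.ofReal (∑ i, |c i| * |s - t| ^ θ i)) (𝓝 t) (𝓝 0) := by
    have h := tendsto_finsetSum Finset.univ fun i (_ : i ∈ Finset.univ) =>
      tendsto_mul_abs_sub_rpow |c i| (hθ i) t
    rw [Finset.sum_const_zero] at h
    have h2 := (ENNReal.continuous_ofReal.tendsto 0).comp h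
    rwa [ENNReal.ofReal_zero] at h2
  refine tendsto_of_tendsto_of_tendsto_of_le_of_le' tendsto_const_nhds hz
    (Eventually.of_forall fun _ => zero_le) ?_
  filter_upwards [eventually_all.2 hc] with s hs
  refine hι.besovNorm_le fun i r hr => ?_
  refine (hs i r hr).trans ((mul_le_mul_of_nonneg_right (le_abs_self (c i)) (by positivity)).trans ?_)
  exact Finset.single_le_sum (f := fun i => |c i| * |s - t| ^ θ i)
    (fun i _ => by positivity) (Finset.mem_univ i)

theorem iSup_besovNorm_lt_top (hι : IsSmearable ι) {α : ℝ} {u : ℝ → Fin 3 → E}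
    (hu : ∀ i, IsBesovRegular ι (α / 2) fun t => u t i) :
    ⨆ (t : ℝ) (_ : 0 < t), besovNorm ι α (vecDist ι (u t)) < ∞ := by
  choose M hM using fun i => (hu i).bounded
  refine lt_of_le_of_lt (iSup₂_le fun t ht => hι.besovNorm_le (c := ∑ i, |M i|) fun i r hr => ?_)
    ENNReal.ofReal_lt_top
  exact ((hM i t r ht hr).trans (le_abs_self _)).trans
    (Finset.single_le_sum (f := fun i => |M i|) (fun i _ => abs_nonneg _) (Finset.mem_univ i))

/-- If all heat regularizations of a curve are continuous, the curve is weakly measurable. -/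
theorem measurable_pairing_of_heatOp (hι : IsSmearable ι) {u : ℝ → E}
    (h : ∀ r, 0 < r → ∀ t, 0 < t → Tendsto (fun s => heatOp ι r (u s - u t)) (𝓝 t) (𝓝 0))
    (φ : TestFn) : Measurable fun t : Ioi (0 : ℝ) => ι (u t) φ := by
  have hpos : ∀ n : ℕ, (0 : ℝ) < 1 / ((n : ℝ) + 1) := fun n => by positivity
  have hseq : Tendsto (fun n : ℕ => 1 / ((n : ℝ) + 1)) atTop (𝓝[>] 0) :=
    tendsto_nhdsWithin_iff.2 ⟨tendsto_one_div_add_atTop_nhds_zero_nat,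
      Eventually.of_forall fun n => hpos n⟩
  refine measurable_of_tendsto_metrizable
    (f := fun (n : ℕ) (t : Ioi (0 : ℝ)) => ι (heatOp ι (1 / ((n : ℝ) + 1)) (u t)) φ) (fun n => ?_)
    (tendsto_pi_nhds.2 fun t => ?_)
  · have hc : ContinuousOn (fun t => ι (heatOp ι (1 / ((n : ℝ) + 1)) (u t)) φ) (Ioi 0) := by
      intro t ht
      refine ContinuousAt.continuousWithinAt ?_
      have h1 := ((distPairing ι φ).continuous.tendsto 0).comp (h _ (hpos n) t ht)
      rw [map_zero] at h1
      rw [ContinuousAt, ← tendsto_sub_nhds_zero_iff]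
      refine h1.congr fun s => ?_
      rw [Function.comp_apply, hι.heatOp_sub (hpos n), map_sub]; rfl
    exact (continuousOn_iff_continuous_domRestrict.1 hc).measurable
  · refine ((heat_tendsto (H := ι (u t)) φ).comp hseq).congr fun n => ?_
    exact (hι.apply_multOp (evenMultiplier_heatSymbol (hpos n)) (u t) φ).symm

theorem IsBesovRegular.measurable_pairing (hι : IsSmearable ι) {a : ℝ} {u : ℝ → E}
    (hu : IsBesovRegular ι a u) (φ : TestFn) : Measurable fun t : Ioi (0 : ℝ) => ι (u t) φ := by
  refine measurable_pairing_of_heatOp hι (fun r hr t ht => ?_) φ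
  obtain ⟨θ, c, hθ, hc⟩ := hu.eventually_le hι ht
  have hz := tendsto_mul_abs_sub_rpow (c / r ^ a) hθ t
  refine squeeze_zero_norm' ?_ hz
  filter_upwards [hc] with s hs
  have hra : 0 < r ^ a := by positivity
  have := hs r hr
  rw [div_mul_eq_mul_div, le_div_iff₀ hra]
  linarith

/-- Curves that are norm continuous for the Besov-type norm are weakly measurable. -/
theorem measurable_pairing_of_besovNorm (hι : IsSmearable ι) {α : ℝ} {u : ℝ → Fin 3 → E}
    (h : ∀ t, 0 < t → Tendsto (fun s => besovNorm ι α (vecDist ι (u s - u t))) (𝓝 t) (𝓝 0))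
    (i : Fin 3) (φ : TestFn) : Measurable fun t : Ioi (0 : ℝ) => ι (u t i) φ := by
  refine measurable_pairing_of_heatOp (u := fun t => u t i) hι (fun r hr t ht => ?_) φ
  rw [tendsto_zero_iff_norm_tendsto_zero]
  have hra : 0 < r ^ (α / 2) := by positivity
  have h1 : ∀ s, ENNReal.ofReal ‖heatOp ι r (u s i - u t i)‖ ≤
      ENNReal.ofReal (r ^ (α / 2))⁻¹ * besovNorm ι α (vecDist ι (u s - u t)) := fun s => by
    have h2 : ENNReal.ofReal (r ^ (α / 2)) * fnENorm ι (heat r (vecDist ι (u s - u t) i)) ≤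
        besovNorm ι α (vecDist ι (u s - u t)) :=
      le_iSup_of_le i (le_iSup₂_of_le r hr le_rfl)
    rw [vecDist, hι.fnENorm_heat hr, ← ofReal_norm] at h2
    refine le_trans (le_of_eq ?_) (mul_le_mul_right h2 (ENNReal.ofReal (r ^ (α / 2))⁻¹))
    rw [← mul_assoc, ← ENNReal.ofReal_mul (by positivity), inv_mul_cancel₀ hra.ne',
      ENNReal.ofReal_one, one_mul]
    rfl
  have h3 := ENNReal.Tendsto.const_mul (a := ENNReal.ofReal (r ^ (α / 2))⁻¹) (h t ht)
    (Or.inr ENNReal.ofReal_ne_top)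
  rw [mul_zero] at h3
  have h4 := tendsto_of_tendsto_of_tendsto_of_le_of_le tendsto_const_nhds h3
    (fun _ => zero_le) h1
  have h5 := (ENNReal.tendsto_toReal ENNReal.zero_ne_top).comp h4
  refine h5.congr fun s => ?_
  simp

/-- Duhamel integrals are Besov regular: smoothing by `exp (rΔ)` turns the source into one with
bound `A r^(-a)` and exponent `κ - a`. -/
theorem IsSource.isBesovRegular_duhamel (hι : IsSmearable ι) {κ μ A a ℓ C : ℝ} {N : ℝ → ℝ → E}
    {σ : ℝ → R3 → ℝ} (hσ : SmoothingSymbol σ ℓ C) (h : IsSource ι κ μ A N) (hκ1 : κ < 1)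
    (hμ : 0 ≤ μ) (hμ1 : μ < 1) (hℓ : 2 ≤ ℓ) (ha : 0 ≤ a) (haκ : a ≤ κ) (hκμ : κ + μ = 1 + a) :
    IsBesovRegular ι a (duhamel ι σ N) := by
  have hκ : 0 ≤ κ := ha.trans haκ
  have hℓ0 : 0 ≤ ℓ := by linarith
  have hA := h.const_nonneg
  constructor
  · obtain ⟨B, hB, hb⟩ := exists_norm_duhamel_le hι hσ (sub_nonneg.2 haκ) (by linarith) hμ hμ1 hℓ0
      hμ hμ1
    refine ⟨B * A, fun t r ht hr => ?_⟩
    have hs := h.shift ha haκ hr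
    rw [h.heatOp_duhamel hι hσ hκ hκ1 hμ hμ1 hℓ0 ht hr]
    have h1 := hb _ _ _ t hs hs.const_nonneg ht fun s τ hs' hτ _ => hs.bound s τ hs' hτ
    rw [show 1 - (κ - a) - μ = 0 by linarith, Real.rpow_zero, mul_one] at h1
    refine (mul_le_mul_of_nonneg_left h1 (by positivity)).trans (le_of_eq ?_)
    have : r ^ a * r ^ (-a) = 1 := by rw [← Real.rpow_add hr, add_neg_cancel, Real.rpow_zero]
    calc _ = B * A * (r ^ a * r ^ (-a)) := by ring
      _ = _ := by rw [this, mul_one]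
  · set θ := min 1 ((1 - κ) / ℓ) with hθ
    have hℓp : 0 < ℓ := by linarith
    -- Any small `θ` makes the singularity `κ - a + θℓ/2` of the increment integrable.
    have hθ0 : 0 < θ := lt_min one_pos (div_pos (by linarith) hℓp)
    have hθκ : θ * ℓ ≤ 1 - κ := by
      have := min_le_right 1 ((1 - κ) / ℓ)
      rwa [le_div_iff₀ hℓp] at this
    obtain ⟨K, hK, hb⟩ := exists_duhamel_modulus hι hσ (sub_nonneg.2 haκ) hμ hμ1 hℓ hθ0
      (min_le_left _ _) (by nlinarith : (κ - a) + θ * (ℓ / 2) < 1)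
    refine ⟨θ, fun t => K * A * (t ^ (1 - ((κ - a) + θ) - μ) +
      t ^ (1 - ((κ - a) + θ * (ℓ / 2)) - μ) + t ^ (-μ)), hθ0, ?_, fun t q r ht hq hq1 hr => ?_⟩
    · have hc : ∀ x : ℝ, ContinuousOn (fun t : ℝ => t ^ x) (Ioi 0) := fun x t ht =>
        (Real.continuousAt_rpow_const t x (Or.inl (ne_of_gt ht))).continuousWithinAt
      exact continuousOn_const.mul (((hc _).add (hc _)).add (hc _))
    · have hs := h.shift ha haκ hr
      rw [hι.heatOp_sub hr, h.heatOp_duhamel hι hσ hκ hκ1 hμ hμ1 hℓ0 ht hr,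
        h.heatOp_duhamel hι hσ hκ hκ1 hμ hμ1 hℓ0 (add_pos ht hq) hr]
      refine (mul_le_mul_of_nonneg_left (hb _ _ hs t q ht hq hq1) (by positivity)).trans
        (le_of_eq ?_)
      have : r ^ a * r ^ (-a) = 1 := by rw [← Real.rpow_add hr, add_neg_cancel, Real.rpow_zero]
      set X := t ^ (1 - ((κ - a) + θ) - μ) + t ^ (1 - ((κ - a) + θ * (ℓ / 2)) - μ) + t ^ (-μ)
      calc _ = K * A * X * q ^ θ * (r ^ a * r ^ (-a)) := by ring
        _ = _ := by rw [this, mul_one]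

end Besov

/-! ### The initial datum -/

section Datum

variable {E : Type*} [NormedAddCommGroup E] [NormedSpace ℝ E] {ι : E →L[ℝ] TempDist}

theorem sconv_heatTest_sconv {s r : ℝ} (hs : 0 < s) (hr : 0 < r) (φ : TestFn) :
    sconv (heatTest s 0) (sconv (heatTest r 0) φ) = sconv (heatTest (s + r) 0) φ := by
  ext x
  obtain ⟨B, hB⟩ : ∃ B, ∀ y, |φ (x + y)| ≤ B := by
    obtain ⟨B, -, hB⟩ := φ.decay 0 0
    exact ⟨B, fun y => by simpa using hB (x + y)⟩
  have hes := evenMultiplier_heatSymbol hs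
  have her := evenMultiplier_heatSymbol hr
  have h1 := integral_mul_convolution hes.integrable_evenKernel her.integrable_evenKernel
    (g := fun y => φ (x + y)) (by fun_prop) hB
  have h2 := hes.integral_kernel_mul isTrig_cos her.symbol
  simp only [← evenKernel_eq_trigKernel, ← heatSymbol_add] at h2
  simp only [h2] at h1
  rw [show (fun ξ => heatSymbol (s + r) ξ) = heatSymbol (s + r) from rfl,
    evenKernel_heatSymbol hs, evenKernel_heatSymbol hr, evenKernel_heatSymbol (add_pos hs hr)] at h1
  simp only [sconv_apply, add_assoc]
  exact h1.symm

/-- The elements `e t` of the space are the heat regularizations of the distribution `f`, and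
have size `t^(-a)`. -/
structure IsDatum (ι : E →L[ℝ] TempDist) (a M : ℝ) (f : TempDist) (e : ℝ → E) : Prop where
  apply : ∀ t, 0 < t → ∀ φ, ι (e t) φ = f (sconv (heatTest t 0) φ)
  bound : ∀ t, 0 < t → ‖e t‖ ≤ M * t ^ (-a)

theorem exists_isDatum (hι : IsSmearable ι) {α M : ℝ} (hM : 0 ≤ M) {f : Fin 3 → TempDist}
    (h : besovNorm ι α f ≤ ENNReal.ofReal M) (i : Fin 3) : ∃ e, IsDatum ι (α / 2) M (f i) e := by
  have h1 : ∀ t, 0 < t → ∃ e, Represents (ι e) (heat t (f i)) ∧ ‖e‖ ≤ M * t ^ (-(α / 2)) := by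
    intro t ht
    refine exists_of_fnENorm_le hι.injective (by positivity) ?_
    have h2 : ENNReal.ofReal (t ^ (α / 2)) * fnENorm ι (heat t (f i)) ≤ ENNReal.ofReal M := by
      refine le_trans ?_ h
      refine le_iSup_of_le i ?_
      exact le_iSup₂ (f := fun (t : ℝ) (_ : 0 < t) =>
        ENNReal.ofReal (t ^ (α / 2)) * fnENorm ι (heat t (f i))) t ht
    refine le_trans (le_of_eq ?_) ((mul_le_mul_left h2 (ENNReal.ofReal (t ^ (-(α / 2))))).trans
      (ENNReal.ofReal_mul hM).ge)
    rw [mul_right_comm, ← ENNReal.ofReal_mul (by positivity), ← Real.rpow_add ht, add_neg_cancel,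
      Real.rpow_zero, ENNReal.ofReal_one, one_mul]
  choose! e he hn using h1
  exact ⟨e, fun t ht φ => by rw [((he t ht) φ).2, integral_heat_mul _ ht], hn⟩

namespace IsDatum

variable {a M ℓ C : ℝ} {f : TempDist} {e : ℝ → E} {σ : ℝ → R3 → ℝ}

/-- The heat regularizations of a datum are a source that does not depend on time. -/
theorem isSource (hι : IsSmearable ι) (h : IsDatum ι a M f e) :
    IsSource ι a 0 M (fun s _ => e s) where
  flow s r τ hs hr hτ := hι.ext fun φ => by
    rw [h.apply _ (add_pos hs hr), ← sconv_heatTest_sconv hs hr, ← h.apply s hs,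
      TempDist.apply_sconv, heatOp, hι.apply_multOp (evenMultiplier_heatSymbol hr),
      evenKernel_heatSymbol hr]
  measurable s hs φ := measurable_const
  bound s τ hs hτ := by simpa using h.bound s hs

/-- Along dyadic times the pairings of the heat regularizations with a translate of `φ` change by
`s^(1/2 - a)`, which is summable because `a < 1/2`; hence they stay bounded as `s` tends to `0`. -/
theorem hasBoundedTranslates [CompleteSpace E] (hι : IsSmearable ι) (h : IsDatum ι a M f e)
    (ha0 : 0 ≤ a) (ha : a < 1 / 2) : HasBoundedTranslates f := by
  intro φ
  have hN := h.isSource hι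
  have hM := hN.const_nonneg
  obtain ⟨C, hC, hL⟩ := hι.exists_heatOp_sub_le φ
  set θ := 1 / 2 - a with hθ
  have hθ0 : 0 < θ := by rw [hθ]; linarith
  have h2θ : 1 < (2 : ℝ) ^ θ := Real.one_lt_rpow one_lt_two hθ0
  have hgap : 0 < (2 : ℝ) ^ θ - 1 := by linarith
  set c := C * M / (2 ^ θ - 1) with hc
  have hc0 : 0 ≤ c := by positivity
  refine ⟨‖distPairing ι φ‖ * M + c * 2 ^ θ, fun y => ?_⟩
  have key : ∀ s, 0 < s → s ≤ 1 → |ι (e s) (_root_.shift y φ)| ≤ ‖distPairing ι φ‖ * M + c * 2 ^ θ := by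
    intro s hs hs1
    obtain ⟨n, hn1, hn2, hn⟩ := exists_two_pow_mul_mem hs hs1
    -- The exponent `θ` is positive: the increments sum to the order of the last time, at most
    -- `2^θ`.
    have hdy := dyadic_mono (Q := fun s => |ι (e s) (_root_.shift y φ)|) (C := C * M)
      (θ := θ) (c := c) (le_of_eq (by rw [hc]; field_simp)) (n := n) hs
      (fun i hi => by
        have hq : 0 < 2 ^ i * s := by positivity
        have h1 := hL (e (2 ^ i * s)) y (2 ^ i * s) hq
        rw [← hN.flow _ _ 1 hq hq one_pos, ← two_mul, ← mul_assoc, ← pow_succ'] at h1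
        have h2 := h.bound (2 ^ i * s) hq
        have h3 : Real.sqrt (2 ^ i * s) * (2 ^ i * s) ^ (-a) = (2 ^ i * s) ^ θ := by
          rw [Real.sqrt_eq_rpow, ← Real.rpow_add hq]; congr 1
        have h4 : C * Real.sqrt (2 ^ i * s) * ‖e (2 ^ i * s)‖ ≤ C * M * (2 ^ i * s) ^ θ := by
          calc _ ≤ C * Real.sqrt (2 ^ i * s) * (M * (2 ^ i * s) ^ (-a)) := by gcongr
            _ = C * M * (Real.sqrt (2 ^ i * s) * (2 ^ i * s) ^ (-a)) := by ring
            _ = _ := by rw [h3]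
        have h5 := abs_sub_abs_le_abs_sub (ι (e (2 ^ i * s)) (_root_.shift y φ))
          (ι (e (2 ^ (i + 1) * s)) (_root_.shift y φ))
        rw [abs_sub_comm] at h5
        linarith)
    have hQ : |ι (e (2 ^ n * s)) (_root_.shift y φ)| ≤ ‖distPairing ι φ‖ * M := by
      refine (hι.translation.abs_apply_shift_le _ φ y).trans ?_
      refine mul_le_mul_of_nonneg_left ((h.bound _ (by positivity)).trans ?_) (norm_nonneg _)
      exact mul_le_of_le_one_right hM (Real.rpow_le_one_of_one_le_of_nonpos hn1 (by linarith))
    have hz : c * (2 ^ n * s) ^ θ ≤ c * 2 ^ θ := by gcongr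
    have hx : 0 ≤ c * s ^ θ := by positivity
    linarith [hdy, hQ, hz, hx]
  have hlim := (heat_tendsto (H := f) (_root_.shift y φ)).abs
  refine le_of_tendsto hlim ?_
  filter_upwards [Ioo_mem_nhdsGT (zero_lt_one (α := ℝ))] with s hs
  have h1 := key s hs.1 hs.2.le
  rwa [h.apply s hs.1, TempDist.apply_sconv, ← evenKernel_heatSymbol hs.1] at h1

theorem apply_evolve (hι : IsSmearable ι) (hσ : SmoothingSymbol σ ℓ C) (h : IsDatum ι a M f e)
    (hf : HasBoundedTranslates f) {t : ℝ} (ht : 0 < t) (φ : TestFn) :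
    ι (evolve ι σ (fun s _ => e s) t 1) φ = translateAvg (evenKernel (σ t)) f φ := by
  have h1 := (hσ.residual t ht).translateAvg_mul isTrig_cos
    (evenMultiplier_heatSymbol (half_pos ht)).toKernelBound hf φ
  simp only [residualSymbol_mul_heatSymbol, ← evenKernel_eq_trigKernel] at h1
  rw [evolve, hι.apply_multOp (hσ.residual t ht)]
  refine Eq.trans ?_ h1.symm
  congr 1; funext y
  rw [h.apply _ (half_pos ht), TempDist.apply_sconv, translateAvg,
    ← evenKernel_heatSymbol (half_pos ht)]

/-- The semigroup applied to a datum is Besov regular, with a locally Lipschitz modulus: smoothing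
by `exp (rΔ)` makes it a source of size `r^(-a)` without singularity. The source does not depend on
time, and is evaluated at time `1`. -/
theorem isBesovRegular_evolve (hι : IsSmearable ι) (hσ : SmoothingSymbol σ ℓ C)
    (h : IsDatum ι a M f e) (ha : 0 ≤ a) :
    IsBesovRegular ι a fun t => evolve ι σ (fun s _ => e s) t 1 := by
  have hN := h.isSource hι
  have hM := hN.const_nonneg
  have hC := (hσ.residual 1 one_pos).nonneg
  have hev : ∀ t r, 0 < t → 0 < r → heatOp ι r (evolve ι σ (fun s _ => e s) t 1) =
      evolve ι σ (fun s _ => e (s + r)) t 1 := fun t r ht hr => by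
    rw [evolve, evolve, hN.flow _ _ 1 (half_pos ht) hr one_pos,
      hι.multOp_heatOp_comm (hσ.residual t ht) hr]
  have hr1 : ∀ r : ℝ, 0 < r → r ^ a * r ^ (-a) = 1 := fun r hr => by
    rw [← Real.rpow_add hr, add_neg_cancel, Real.rpow_zero]
  refine ⟨⟨C * M, fun t r ht hr => ?_⟩, ⟨1, fun t => C * M * (t⁻¹ + t ^ (-(ℓ / 2))), one_pos, ?_,
    fun t q r ht hq hq1 hr => ?_⟩⟩
  · have hs := hN.shift ha le_rfl hr
    rw [hev t r ht hr]
    have h1 := hs.norm_evolve_le hι hσ ht one_pos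
    simp only [sub_self, neg_zero, Real.rpow_zero, mul_one, one_mul] at h1
    refine (mul_le_mul_of_nonneg_left h1 (by positivity)).trans (le_of_eq ?_)
    calc _ = C * M * (r ^ a * r ^ (-a)) := by ring
      _ = _ := by rw [hr1 r hr, mul_one]
  · have hc : ∀ x : ℝ, ContinuousOn (fun t : ℝ => t ^ x) (Ioi 0) := fun x t ht =>
      (Real.continuousAt_rpow_const t x (Or.inl (ne_of_gt ht))).continuousWithinAt
    exact continuousOn_const.mul ((continuousOn_inv₀.mono fun t ht => ne_of_gt ht).add (hc _))
  · have hs := hN.shift ha le_rfl hr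
    rw [hι.heatOp_sub hr, hev t r ht hr, hev _ r (add_pos ht hq) hr]
    have h1 := hs.norm_evolve_add_sub_le hι hσ ht hq one_pos
    simp only [sub_self, neg_zero, Real.rpow_zero, mul_one, one_mul] at h1
    have h2 := min_le_right 1 (q * (t⁻¹ + t ^ (-(ℓ / 2))))
    refine (mul_le_mul_of_nonneg_left h1 (by positivity)).trans ?_
    rw [Real.rpow_one]
    calc _ = C * M * (r ^ a * r ^ (-a)) * min 1 (q * (t⁻¹ + t ^ (-(ℓ / 2)))) := by ring
      _ ≤ C * M * (r ^ a * r ^ (-a)) * (q * (t⁻¹ + t ^ (-(ℓ / 2)))) := by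
          rw [hr1 r hr]; gcongr
      _ = _ := by rw [hr1 r hr]; ring

end IsDatum

/-- The heat and the hyperdissipative semigroup applied to a datum differ by a term smaller by a
factor `t^(-δ)`. -/
theorem exists_norm_evolve_heat_sub_hyper_le (hι : IsSmearable ι) {ℓ a δ : ℝ} (hℓ : 2 < ℓ)
    (hδ : 0 < δ) (hδℓ : δ ≤ ℓ / 2 - 1) (hδ1 : δ ≤ 1) :
    ∃ K, 0 ≤ K ∧ ∀ (M : ℝ) (f : TempDist) (e : ℝ → E), IsDatum ι a M f e → ∀ t, 0 < t →
      ‖evolve ι heatSymbol (fun s _ => e s) t 1 - evolve ι (hyperSymbol ℓ) (fun s _ => e s) t 1‖ ≤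
        K * M * t ^ (-(a + δ)) := by
  obtain ⟨C, hC, hdiff⟩ := exists_residual_sub_bound hℓ
  obtain ⟨C₁, -, hC₁⟩ := exists_smoothingSymbol_heat
  obtain ⟨C₂, -, hC₂⟩ := exists_smoothingSymbol_hyper hℓ
  refine ⟨C * 2 ^ a, by positivity, fun M f e h t ht => ?_⟩
  have hm := hdiff δ hδ hδℓ hδ1 t ht
  rw [evolve, evolve, ← hι.sub_multOp ((hC₁ ℓ C₁ le_rfl).residual _ ht)
    ((hC₂ C₂ le_rfl).residual _ ht)]
  refine (hι.norm_multOp_le hm _).trans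
    ((mul_le_mul_of_nonneg_left (h.bound _ (half_pos ht)) hm.nonneg).trans (le_of_eq ?_))
  rw [Real.div_rpow ht.le two_pos.le, Real.rpow_neg two_pos.le, div_inv_eq_mul, neg_add,
    Real.rpow_add ht]
  ring

end Datum

/-! ### The mild formulation as a fixed point equation -/

section Mild

variable {E : Type*} [NormedAddCommGroup E] [NormedSpace ℝ E] {ι : E →L[ℝ] TempDist}

/-- The family `ℙ ∇· exp (sΔ) H(τ)` in the space, for a curve `H` of matrices of distributions. It
is an arbitrary element where this distribution is not in `E`, see `divSource_spec`. -/
def divSource (ι : E →L[ℝ] TempDist) (H : ℝ → Fin 3 → Fin 3 → TempDist) (j : Fin 3) (s τ : ℝ) : E :=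
  Classical.epsilon fun e => ∀ φ, ι e φ = projDist s (H τ) j φ

section DivSource

variable {H : ℝ → Fin 3 → Fin 3 → TempDist} {j : Fin 3} {κ μ A : ℝ}

theorem divSource_spec {s τ : ℝ} (h : ∃ e, ∀ φ, ι e φ = projDist s (H τ) j φ) (φ : TestFn) :
    ι (divSource ι H j s τ) φ = projDist s (H τ) j φ :=
  Classical.epsilon_spec (p := fun e => ∀ φ, ι e φ = projDist s (H τ) j φ) h φ

theorem measurable_projDist
    (hm : ∀ l k φ, Measurable fun τ : Ioi (0 : ℝ) => H τ l k φ) {s : ℝ} (hs : 0 < s)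
    (φ : TestFn) : Measurable fun τ : Ioi (0 : ℝ) => projDist s (H τ) j φ := by
  simp only [projDist]
  refine Finset.measurable_sum _ fun k _ => Finset.measurable_sum _ fun l _ => ?_
  have h1 : StronglyMeasurable (Function.uncurry fun (y : R3) (τ : Ioi (0 : ℝ)) =>
      H τ l k (shift y φ)) :=
    stronglyMeasurable_uncurry_of_continuous_of_stronglyMeasurable
      (fun τ => TempDist.continuous_apply_shift (H τ l k) φ)
      (fun y => (hm l k _).stronglyMeasurable)
  -- The kernel is measurable up to a null set, which does not affect the integrals in `y`.
  obtain ⟨g, hg, hge⟩ := (integrable_lerayKernel j k l hs).aestronglyMeasurable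
  have h3 : StronglyMeasurable (Function.uncurry fun (τ : Ioi (0 : ℝ)) (y : R3) =>
      g y * H τ l k (shift y φ)) :=
    (hg.comp_measurable measurable_snd).mul (h1.comp_measurable measurable_swap)
  have h4 : (fun τ : Ioi (0 : ℝ) => translateAvg (lerayKernel j k l s) (H τ l k) φ) =
      fun τ : Ioi (0 : ℝ) => ∫ y, g y * H τ l k (shift y φ) :=
    funext fun τ => integral_congr_ae (hge.mono fun y hy => by simp only [hy])
  rw [h4]
  exact h3.integral_prod_right.measurable

theorem isSource_divSource (hι : IsSmearable ι)
    (hH : ∀ τ, 0 < τ → ∀ l k, HasBoundedTranslates (H τ l k))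
    (hm : ∀ l k φ, Measurable fun τ : Ioi (0 : ℝ) => H τ l k φ)
    (hb : ∀ s τ, 0 < s → 0 < τ → ∃ e, (∀ φ, ι e φ = projDist s (H τ) j φ) ∧
      ‖e‖ ≤ A * s ^ (-κ) * τ ^ (-μ)) :
    IsSource ι κ μ A (divSource ι H j) := by
  have hspec : ∀ s τ, 0 < s → 0 < τ → ∀ φ, ι (divSource ι H j s τ) φ = projDist s (H τ) j φ :=
    fun s τ hs hτ => divSource_spec ((hb s τ hs hτ).imp fun _ h => h.1)
  refine ⟨fun s r τ hs hr hτ => hι.ext fun φ => ?_, fun s hs φ => ?_, fun s τ hs hτ => ?_⟩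
  · rw [hspec _ _ (add_pos hs hr) hτ, projDist_add (hH τ hτ) hs hr, heatOp,
      hι.apply_multOp (evenMultiplier_heatSymbol hr)]
    simp only [hspec s τ hs hτ]
  · have h4 : (fun τ : Ioi (0 : ℝ) => ι (divSource ι H j s τ) φ) =
        fun τ : Ioi (0 : ℝ) => projDist s (H τ) j φ := funext fun τ => hspec s τ hs τ.2 φ
    rw [h4]
    exact measurable_projDist hm hs φ
  · obtain ⟨e, he, hn⟩ := hb s τ hs hτ
    rwa [hι.ext fun φ => (hspec s τ hs hτ φ).trans (he φ).symm]

theorem SmoothingSymbol.apply_evolve_divSource (hι : IsSmearable ι) {σ : ℝ → R3 → ℝ} {ℓ C : ℝ}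
    (hσ : SmoothingSymbol σ ℓ C) {s τ : ℝ} (hs : 0 < s)
    (hH : ∀ l k, HasBoundedTranslates (H τ l k))
    (hb : ∃ e, ∀ φ, ι e φ = projDist (s / 2) (H τ) j φ) (φ : TestFn) :
    ι (evolve ι σ (divSource ι H j) s τ) φ = ∫ x, projDiv σ s (H τ) j x * φ x := by
  rw [hσ.integral_projDiv hH hs, evolve, hι.apply_multOp (hσ.residual s hs)]
  simp only [divSource_spec hb]

/-- The weak time integral in the mild formulation is given by the Duhamel integral of the
source. -/
theorem intervalIntegrable_projDiv (hι : IsSmearable ι) {σ : ℝ → R3 → ℝ} {ℓ C : ℝ}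
    (hσ : SmoothingSymbol σ ℓ C) (hN : IsSource ι κ μ A (divSource ι H j))
    (hκ : 0 ≤ κ) (hκ1 : κ < 1) (hμ : 0 ≤ μ) (hμ1 : μ < 1) (hℓ : 0 ≤ ℓ)
    (hH : ∀ τ, 0 < τ → ∀ l k, HasBoundedTranslates (H τ l k))
    (hb : ∀ s τ, 0 < s → 0 < τ → ∃ e, ∀ φ, ι e φ = projDist s (H τ) j φ) {t : ℝ} (ht : 0 < t)
    (φ : TestFn) :
    IntervalIntegrable (fun τ => ∫ x, projDiv σ (t - τ) (H τ) j x * φ x) volume 0 t ∧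
      ∫ τ in (0 : ℝ)..t, ∫ x, projDiv σ (t - τ) (H τ) j x * φ x =
        ι (duhamel ι σ (divSource ι H j) t) φ := by
  have heq : EqOn (fun τ => ι (evolve ι σ (divSource ι H j) (t - τ) τ) φ)
      (fun τ => ∫ x, projDiv σ (t - τ) (H τ) j x * φ x) (Ioo 0 t) := fun τ hτ =>
    hσ.apply_evolve_divSource hι (sub_pos.2 hτ.2) (hH τ hτ.1)
      (hb _ _ (half_pos (sub_pos.2 hτ.2)) hτ.1) φ
  constructor
  · rw [intervalIntegrable_iff_integrableOn_Ioo_of_le ht.le]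
    exact (hN.integrableOn_evolve hι hσ hκ hκ1 hμ hμ1 hℓ ht φ).congr_fun heq measurableSet_Ioo
  · rw [intervalIntegral.integral_of_le ht.le, integral_Ioc_eq_integral_Ioo,
      hN.duhamel_spec hι hσ hκ hκ1 hμ hμ1 hℓ ht]
    exact (setIntegral_congr_fun measurableSet_Ioo heq).symm

end DivSource

/-- What the fixed point argument uses of the space, with `a = (1 - 3/p) / 2`: products exist, and
`ℙ ∇· exp (sΔ)` maps `E` to itself with norm `s^(-1/2)` and `E · E` to `E` with norm
`s^(-(1 - a)) = s^(-(1/2 + 3/(2p)))`. -/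
structure IsMildSpace (ι : E →L[ℝ] TempDist) (a K : ℝ) : Prop where
  smearable : IsSmearable ι
  products : HasProducts ι
  pos : 0 < a
  lt : a < 1 / 2
  nonneg : 0 ≤ K
  bilinear : ∀ (f g : Fin 3 → E) (j : Fin 3) (s : ℝ), 0 < s →
    ∃ e, (∀ φ, ι e φ = projDist s (distTensor (vecDist ι f) (vecDist ι g)) j φ) ∧
      ‖e‖ ≤ K * s ^ (-(1 - a)) * ‖f‖ * ‖g‖
  linear : ∀ (V : Fin 3 → Fin 3 → E) (j : Fin 3) (s : ℝ), 0 < s →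
    ∃ e, (∀ φ, ι e φ = projDist s (fun l k => ι (V l k)) j φ) ∧
      ‖e‖ ≤ K * s ^ (-(1 / 2) : ℝ) * ‖V‖

theorem IsAdequate.exists_isMildSpace [CompleteSpace E] (hE : IsAdequate ι) {p : ℝ} (hp : 3 < p)
    (hscal : HasScalingDegree ι (-3 / p)) : ∃ K, IsMildSpace ι ((1 - 3 / p) / 2) K := by
  have hp0 : 0 < p := by linarith
  have h3p : 0 < 3 / p := by positivity
  have h3p1 : 3 / p < 1 := by rw [div_lt_one hp0]; exact hp
  obtain ⟨K₁, hK₁, h₁⟩ := hE.exists_projDist hp0 hscal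
  obtain ⟨K₂, hK₂, h₂⟩ := hE.isSmearable.exists_projDist
  refine ⟨max K₁ K₂, hE.isSmearable, hE.hasProducts, by linarith, by linarith,
    hK₁.trans (le_max_left _ _), fun f g j s hs => ?_, fun V j s hs => ?_⟩
  · obtain ⟨e, he, hn⟩ := h₁ f g j s hs
    refine ⟨e, he, hn.trans ?_⟩
    rw [show 1 / 2 + 3 / (2 * p) = 1 - (1 - 3 / p) / 2 by field_simp; ring]
    gcongr
    exact le_max_left _ _
  · obtain ⟨e, he, hn⟩ := h₂ V j s hs
    refine ⟨e, he, hn.trans ?_⟩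
    gcongr
    exact le_max_right _ _

/-- Weakly measurable curves of vector fields with `‖u(t)‖ ≤ R t^(-a)`. -/
structure IsDecaying (ι : E →L[ℝ] TempDist) (a R : ℝ) (u : ℝ → Fin 3 → E) : Prop where
  measurable : ∀ i φ, Measurable fun t : Ioi (0 : ℝ) => ι (u t i) φ
  bound : ∀ t, 0 < t → ‖u t‖ ≤ R * t ^ (-a)

theorem IsDecaying.nonneg {a R : ℝ} {u : ℝ → Fin 3 → E} (hu : IsDecaying ι a R u) : 0 ≤ R := by
  simpa using (norm_nonneg _).trans (hu.bound 1 one_pos)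

/-- The data of the problem, of size `ε`: the force is `∇·V`, and `e i` consists of the heat
regularizations of the `i`-th component of the initial datum. -/
structure IsMildData (ι : E →L[ℝ] TempDist) (a ε : ℝ) (u₀ : Fin 3 → TempDist)
    (e : Fin 3 → ℝ → E) (V : ℝ → Fin 3 → Fin 3 → E) : Prop where
  datum : ∀ i, IsDatum ι a ε (u₀ i) (e i)
  measurable : ∀ l k φ, Measurable fun t : Ioi (0 : ℝ) => ι (V t l k) φ
  bound : ∀ t, 0 < t → ‖V t‖ ≤ ε * t ^ (-(1 / 2 + a))

/-- The source `ℙ ∇· exp (sΔ) (u ⊗ u)(τ)`. -/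
def convection (ι : E →L[ℝ] TempDist) (u : ℝ → Fin 3 → E) (j : Fin 3) : ℝ → ℝ → E :=
  divSource ι (fun τ => distTensor (vecDist ι (u τ)) (vecDist ι (u τ))) j

/-- The source `ℙ ∇· exp (sΔ) V(τ)`. -/
def forcing (ι : E →L[ℝ] TempDist) (V : ℝ → Fin 3 → Fin 3 → E) (j : Fin 3) : ℝ → ℝ → E :=
  divSource ι (fun τ l k => ι (V τ l k)) j

/-- The right-hand side of the integral equation, as a map on curves of vector fields. The datum
enters as a source that does not depend on time, evaluated at time `1`. -/
def mildMap (ι : E →L[ℝ] TempDist) (σ : ℝ → R3 → ℝ) (e : Fin 3 → ℝ → E)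
    (V : ℝ → Fin 3 → Fin 3 → E) (u : ℝ → Fin 3 → E) (t : ℝ) (j : Fin 3) : E :=
  evolve ι σ (fun s _ => e j s) t 1 -
    (duhamel ι σ (convection ι u j) t - duhamel ι σ (forcing ι V j) t)

namespace IsMildSpace

variable {a K R ε : ℝ} {u v : ℝ → Fin 3 → E} {u₀ : Fin 3 → TempDist} {e : Fin 3 → ℝ → E}
  {V : ℝ → Fin 3 → Fin 3 → E} {σ : ℝ → R3 → ℝ} {ℓ C : ℝ}

theorem isSource_convection [CompleteSpace E] (hS : IsMildSpace ι a K) (hu : IsDecaying ι a R u)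
    (j : Fin 3) : IsSource ι (1 - a) (2 * a) (K * R ^ 2) (convection ι u j) := by
  refine isSource_divSource hS.smearable (fun τ _ l k =>
    hS.products.hasBoundedTranslates hS.smearable (u τ l) (u τ k)) (fun l k φ =>
    hS.products.measurable_distMul (u := fun τ : Ioi (0 : ℝ) => u τ l)
      (v := fun τ : Ioi (0 : ℝ) => u τ k) (hu.measurable l) (hu.measurable k) φ)
    fun s τ hs hτ => ?_
  obtain ⟨e, he, hn⟩ := hS.bilinear (u τ) (u τ) j s hs
  refine ⟨e, he, hn.trans ?_⟩
  have hK := hS.nonneg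
  have h1 := hu.bound τ hτ
  have hR := hu.nonneg
  calc K * s ^ (-(1 - a)) * ‖u τ‖ * ‖u τ‖
      ≤ K * s ^ (-(1 - a)) * (R * τ ^ (-a)) * (R * τ ^ (-a)) := by gcongr
    _ = K * R ^ 2 * s ^ (-(1 - a)) * (τ ^ (-a) * τ ^ (-a)) := by ring
    _ = _ := by rw [← Real.rpow_add hτ]; congr 2; ring

theorem isSource_forcing (hS : IsMildSpace ι a K) (hd : IsMildData ι a ε u₀ e V)
    (j : Fin 3) : IsSource ι (1 / 2) (1 / 2 + a) (K * ε) (forcing ι V j) := by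
  refine isSource_divSource hS.smearable (fun τ _ l k =>
    hS.smearable.hasBoundedTranslates (V τ l k)) hd.measurable fun s τ hs hτ => ?_
  obtain ⟨e, he, hn⟩ := hS.linear (V τ) j s hs
  refine ⟨e, he, hn.trans ?_⟩
  have hK := hS.nonneg
  calc K * s ^ (-(1 / 2) : ℝ) * ‖V τ‖ ≤ K * s ^ (-(1 / 2) : ℝ) * (ε * τ ^ (-(1 / 2 + a))) := by
        gcongr; exact hd.bound τ hτ
    _ = _ := by ring

/-- The bilinear estimate in the form of a Lipschitz bound:
`u ⊗ u - v ⊗ v = (u - v) ⊗ u + v ⊗ (u - v)`. -/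
theorem norm_convection_sub_le [CompleteSpace E] (hS : IsMildSpace ι a K) (u v : ℝ → Fin 3 → E)
    (j : Fin 3) {s : ℝ} (hs : 0 < s) (τ : ℝ) :
    ‖convection ι u j s τ - convection ι v j s τ‖ ≤
      K * s ^ (-(1 - a)) * (‖u τ‖ + ‖v τ‖) * ‖u τ - v τ‖ := by
  obtain ⟨e₁, he₁, hn₁⟩ := hS.bilinear (u τ - v τ) (u τ) j s hs
  obtain ⟨e₂, he₂, hn₂⟩ := hS.bilinear (v τ) (u τ - v τ) j s hs
  have hspec := fun (w : ℝ → Fin 3 → E) => divSource_spec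
    (H := fun τ => distTensor (vecDist ι (w τ)) (vecDist ι (w τ))) (τ := τ)
    ((hS.bilinear (w τ) (w τ) j s hs).imp fun _ h => h.1)
  have hsum : convection ι u j s τ - convection ι v j s τ = e₁ + e₂ :=
    hS.smearable.ext fun φ => by
      rw [pairing_sub, pairing_add, he₁, he₂, convection, convection, hspec u, hspec v]
      simp only [projDist, ← Finset.sum_add_distrib, ← Finset.sum_sub_distrib]
      refine Finset.sum_congr rfl fun k _ => Finset.sum_congr rfl fun l _ => ?_
      have hi := fun f g : E => (hS.products.hasBoundedTranslates hS.smearable f g).integrable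
        (integrable_lerayKernel j k l hs) φ
      simp only [translateAvg, distTensor, vecDist, Pi.sub_apply]
      rw [← integral_sub (hi _ _) (hi _ _), ← integral_add (hi _ _) (hi _ _)]
      congr 1; funext y
      rw [hS.products.distMul_sub_left hS.smearable, hS.products.distMul_sub_right hS.smearable]
      ring
  rw [hsum]
  refine (norm_add_le _ _).trans ((add_le_add hn₁ hn₂).trans (le_of_eq (by ring)))

/-- The integral equation is the fixed point equation of `mildMap`. -/
theorem solvesDuhamel_iff [CompleteSpace E] (hS : IsMildSpace ι a K) (hσ : SmoothingSymbol σ ℓ C)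
    (hℓ : 0 ≤ ℓ) (hd : IsMildData ι a ε u₀ e V) (hu : IsDecaying ι a R u) :
    SolvesDuhamel ι σ u₀ V u ↔ ∀ t, 0 < t → u t = mildMap ι σ e V u t := by
  have ha := hS.pos
  have ha2 := hS.lt
  have h1 := fun j t (ht : 0 < t) (φ : TestFn) => intervalIntegrable_projDiv hS.smearable hσ
    (hS.isSource_convection hu j) (by linarith) (by linarith) (by linarith) (by linarith) hℓ
    (fun τ _ l k => hS.products.hasBoundedTranslates hS.smearable (u τ l) (u τ k))
    (fun s τ hs _ => (hS.bilinear (u τ) (u τ) j s hs).imp fun _ h => h.1) ht φ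
  have h2 := fun j t (ht : 0 < t) (φ : TestFn) => intervalIntegrable_projDiv hS.smearable hσ
    (hS.isSource_forcing hd j) (by linarith) (by linarith) (by linarith) (by linarith) hℓ
    (fun τ _ l k => hS.smearable.hasBoundedTranslates (V τ l k))
    (fun s τ hs _ => (hS.linear (V τ) j s hs).imp fun _ h => h.1) ht φ
  have hbt := fun i => (hd.datum i).hasBoundedTranslates hS.smearable ha.le ha2
  have h3 : ∀ t, 0 < t → ∀ i φ, ι (mildMap ι σ e V u t i) φ =
      (∫ x, semigroupFn σ t (u₀ i) x * φ x)
      - (∫ τ in (0 : ℝ)..t, ∫ x,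
          projDiv σ (t - τ) (distTensor (vecDist ι (u τ)) (vecDist ι (u τ))) i x * φ x)
      + ∫ τ in (0 : ℝ)..t, ∫ x, projDiv σ (t - τ) (fun l k => ι (V τ l k)) i x * φ x := by
    intro t ht i φ
    rw [(h1 i t ht φ).2, (h2 i t ht φ).2, hσ.integral_semigroupFn (hbt i) ht,
      ← (hd.datum i).apply_evolve hS.smearable hσ (hbt i) ht, mildMap, pairing_sub, pairing_sub,
      convection, forcing]
    ring
  constructor
  · intro h t ht
    funext i
    refine hS.smearable.ext fun φ => ?_
    rw [(h t ht i φ).2.2, h3 t ht]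
  · intro h t ht i φ
    exact ⟨(h1 i t ht φ).1, (h2 i t ht φ).1, by rw [← h3 t ht, h t ht]⟩

/-- For both sources `κ + μ = 1 + a`, the exponents of the critical scaling. -/
theorem isBesovRegular_mildMap [CompleteSpace E] (hS : IsMildSpace ι a K)
    (hσ : SmoothingSymbol σ ℓ C) (hℓ : 2 ≤ ℓ) (hd : IsMildData ι a ε u₀ e V)
    (hu : IsDecaying ι a R u) (j : Fin 3) :
    IsBesovRegular ι a fun t => mildMap ι σ e V u t j := by
  have ha := hS.pos
  have ha2 := hS.lt
  refine ((hd.datum j).isBesovRegular_evolve hS.smearable hσ ha.le).sub hS.smearable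
    (IsBesovRegular.sub hS.smearable ?_ ?_)
  · exact (hS.isSource_convection hu j).isBesovRegular_duhamel hS.smearable hσ (by linarith)
      (by linarith) (by linarith) hℓ ha.le (by linarith) (by ring)
  · exact (hS.isSource_forcing hd j).isBesovRegular_duhamel hS.smearable hσ (by norm_num)
      (by linarith) (by linarith) hℓ ha.le (by linarith) (by ring)

/-- The right-hand side of the integral equation assumes the initial datum weakly. -/
theorem tendsto_mildMap [CompleteSpace E] (hS : IsMildSpace ι a K)
    (hσ : SmoothingSymbol σ ℓ C) (hℓ : 0 ≤ ℓ) (hd : IsMildData ι a ε u₀ e V)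
    (hu : IsDecaying ι a R u) (j : Fin 3) (φ : TestFn) :
    Tendsto (fun t => ι (mildMap ι σ e V u t j) φ) (𝓝[>] 0) (𝓝 (u₀ j φ)) := by
  have ha := hS.pos
  have ha2 := hS.lt
  have hbt := (hd.datum j).hasBoundedTranslates hS.smearable ha.le ha2
  have h0 : Tendsto (fun t => ι (evolve ι σ (fun s _ => e j s) t 1) φ) (𝓝[>] 0) (𝓝 (u₀ j φ)) := by
    refine (hσ.tendsto _ hbt φ).congr' ?_
    filter_upwards [self_mem_nhdsWithin] with t ht
    exact ((hd.datum j).apply_evolve hS.smearable hσ hbt ht φ).symm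
  have h1 := (hS.isSource_convection hu j).tendsto_duhamel hS.smearable hσ (by linarith)
    (by linarith) (by linarith) (by linarith) hℓ (κ' := 1 - a) (by linarith) le_rfl
    (by linarith) φ
  -- The forcing has `κ = 1/2`; any `κ'` strictly between `1/2` and `1 - a` serves, here the
  -- midpoint.
  have h2 := (hS.isSource_forcing hd j).tendsto_duhamel hS.smearable hσ (by linarith)
    (by linarith) (by linarith) (by linarith) hℓ (κ' := 3 / 4 - a / 2) (by linarith) (by linarith)
    (by linarith) φ
  have h3 := h0.sub (h1.sub h2)
  rw [sub_zero, sub_zero] at h3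
  refine h3.congr fun t => ?_
  rw [mildMap, pairing_sub, pairing_sub]

theorem exists_norm_mildMap_le [CompleteSpace E] (hS : IsMildSpace ι a K)
    (hσ : SmoothingSymbol σ ℓ C) (hℓ : 0 ≤ ℓ) : ∃ B, 0 ≤ B ∧ ∀ (ε R : ℝ) (u₀ : Fin 3 → TempDist)
      (e : Fin 3 → ℝ → E) (V : ℝ → Fin 3 → Fin 3 → E) (u : ℝ → Fin 3 → E), 0 ≤ ε → 0 ≤ R →
      IsMildData ι a ε u₀ e V → IsDecaying ι a R u → ∀ t, 0 < t →
        ‖mildMap ι σ e V u t‖ ≤ B * (ε + R ^ 2) * t ^ (-a) := by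
  have ha := hS.pos
  have ha2 := hS.lt
  have hK := hS.nonneg
  have hC := (hσ.residual 1 one_pos).nonneg
  have hι := hS.smearable
  obtain ⟨B₁, hB₁, h₁⟩ := exists_norm_duhamel_le hι hσ (κ := 1 - a) (μ := 2 * a) (ν := 2 * a)
    (by linarith) (by linarith) (by linarith) (by linarith) hℓ (by linarith) (by linarith)
  obtain ⟨B₂, hB₂, h₂⟩ := exists_norm_duhamel_le hι hσ (κ := 1 / 2) (μ := 1 / 2 + a)
    (ν := 1 / 2 + a)
    (by linarith) (by linarith) (by linarith) (by linarith) hℓ (by linarith) (by linarith)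
  refine ⟨C * 2 ^ a + B₁ * K + B₂ * K, by positivity,
    fun ε R u₀ e V u hε hR hd hu t ht => ?_⟩
  refine (pi_norm_le_iff_of_nonneg (by positivity)).2 fun j => ?_
  have hc := hS.isSource_convection hu j
  have hf := hS.isSource_forcing hd j
  have b0 := ((hd.datum j).isSource hι).norm_evolve_le hι hσ ht one_pos
  have b1 := h₁ _ _ (K * R ^ 2) t hc (by positivity) ht fun s τ hs hτ _ => hc.bound s τ hs hτ
  have b2 := h₂ _ _ (K * ε) t hf (by positivity) ht fun s τ hs hτ _ => hf.bound s τ hs hτ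
  rw [show 1 - (1 - a) - 2 * a = -a by ring] at b1
  rw [show 1 - 1 / 2 - (1 / 2 + a) = -a by ring] at b2
  rw [Real.one_rpow, mul_one] at b0
  have hP : 0 ≤ t ^ (-a) := by positivity
  refine (norm_sub_le _ _).trans ((add_le_add b0 ((norm_sub_le _ _).trans
    (add_le_add b1 b2))).trans ?_)
  have e1 : ε ≤ ε + R ^ 2 := by nlinarith
  have e2 : R ^ 2 ≤ ε + R ^ 2 := by linarith
  calc _ = (C * 2 ^ a * ε + B₁ * K * R ^ 2 + B₂ * K * ε) * t ^ (-a) := by ring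
    _ ≤ (C * 2 ^ a * (ε + R ^ 2) + B₁ * K * (ε + R ^ 2) + B₂ * K * (ε + R ^ 2)) * t ^ (-a) := by
        gcongr
    _ = _ := by ring

/-- Contraction estimate. With `ν = a` it gives existence and uniqueness; a larger `ν` transfers
additional decay of the difference of two curves. -/
theorem exists_norm_mildMap_sub_le [CompleteSpace E] (hS : IsMildSpace ι a K)
    (hσ : SmoothingSymbol σ ℓ C) (hℓ : 0 ≤ ℓ) {ν : ℝ} (hν : 0 ≤ ν) (hν1 : a + ν < 1) :
    ∃ B, 0 ≤ B ∧ ∀ (e : Fin 3 → ℝ → E) (V : ℝ → Fin 3 → Fin 3 → E) (u v : ℝ → Fin 3 → E)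
      (R X t : ℝ), 0 ≤ R → 0 ≤ X → IsDecaying ι a R u → IsDecaying ι a R v → 0 < t →
      (∀ τ, 0 < τ → τ < t → ‖u τ - v τ‖ ≤ X * τ ^ (-ν)) →
        ‖mildMap ι σ e V u t - mildMap ι σ e V v t‖ ≤ B * R * X * t ^ (-ν) := by
  have ha := hS.pos
  have ha2 := hS.lt
  have hK := hS.nonneg
  have hι := hS.smearable
  obtain ⟨B, hB, h⟩ := exists_norm_duhamel_le hι hσ (κ := 1 - a) (μ := 2 * a) (ν := a + ν)
    (by linarith) (by linarith) (by linarith) (by linarith) hℓ (by linarith) (by linarith)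
  refine ⟨B * (K * 2), by positivity, fun e V u v R X t hR hX hu hv ht hX' => ?_⟩
  refine (pi_norm_le_iff_of_nonneg (by positivity)).2 fun j => ?_
  have hcu := hS.isSource_convection hu j
  have hcv := hS.isSource_convection hv j
  have hbd := h _ _ (K * (2 * R) * X) t (hcu.sub hι hcv) (by positivity) ht
    fun s τ hs hτ hτt => by
      refine (hS.norm_convection_sub_le u v j hs τ).trans ?_
      have b1 := hu.bound τ hτ
      have b2 := hv.bound τ hτ
      calc K * s ^ (-(1 - a)) * (‖u τ‖ + ‖v τ‖) * ‖u τ - v τ‖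
          ≤ K * s ^ (-(1 - a)) * (R * τ ^ (-a) + R * τ ^ (-a)) * (X * τ ^ (-ν)) := by
            gcongr
            exact hX' τ hτ hτt
        _ = K * (2 * R) * X * s ^ (-(1 - a)) * (τ ^ (-a) * τ ^ (-ν)) := by ring
        _ = _ := by rw [← Real.rpow_add hτ, neg_add]
  rw [hcu.duhamel_sub hι hσ hcv (by linarith) (by linarith) (by linarith) (by linarith) hℓ ht,
    show 1 - (1 - a) - (a + ν) = -ν by ring] at hbd
  have : (mildMap ι σ e V u t - mildMap ι σ e V v t) j =
      -(duhamel ι σ (convection ι u j) t - duhamel ι σ (convection ι v j) t) := by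
    rw [Pi.sub_apply, mildMap, mildMap]; abel
  rw [this, norm_neg]
  exact hbd.trans (le_of_eq (by ring))

/-- The right-hand sides of the two integral equations differ by a term with additional decay. -/
theorem exists_norm_mildMap_heat_sub_hyper_le [CompleteSpace E] (hS : IsMildSpace ι a K)
    (hℓ : 2 < ℓ) {δ : ℝ} (hδ : 0 < δ) (hδℓ : δ ≤ ℓ / 2 - 1) (hδa : δ < a) :
    ∃ B, 0 ≤ B ∧ ∀ (ε R : ℝ) (u₀ : Fin 3 → TempDist)
      (e : Fin 3 → ℝ → E) (V : ℝ → Fin 3 → Fin 3 → E) (u : ℝ → Fin 3 → E), 0 ≤ ε →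
      IsMildData ι a ε u₀ e V → IsDecaying ι a R u → ∀ t, 0 < t →
        ‖mildMap ι heatSymbol e V u t - mildMap ι (hyperSymbol ℓ) e V u t‖ ≤
          B * (ε + R ^ 2) * t ^ (-(a + δ)) := by
  have ha := hS.pos
  have ha2 := hS.lt
  have hK := hS.nonneg
  have hι := hS.smearable
  obtain ⟨B₀, hB₀, h₀⟩ := exists_norm_evolve_heat_sub_hyper_le hι (a := a) hℓ hδ hδℓ (by linarith)
  obtain ⟨B₁, hB₁, h₁⟩ := exists_norm_duhamel_heat_sub_hyper_le hι hℓ (κ := 1 - a)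
    (μ := 2 * a) (by linarith) (by linarith) (by linarith) hδ hδℓ (by linarith) (by linarith)
  obtain ⟨B₂, hB₂, h₂⟩ := exists_norm_duhamel_heat_sub_hyper_le hι hℓ (κ := 1 / 2)
    (μ := 1 / 2 + a) (by linarith) (by linarith) (by linarith) hδ hδℓ (by linarith) (by linarith)
  refine ⟨B₀ + B₁ * K + B₂ * K, by positivity, fun ε R u₀ e V u hε hd hu t ht => ?_⟩
  refine (pi_norm_le_iff_of_nonneg (by positivity)).2 fun j => ?_
  have b0 := h₀ _ _ _ (hd.datum j) t ht
  have b1 := h₁ _ _ (hS.isSource_convection hu j) t ht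
  have b2 := h₂ _ _ (hS.isSource_forcing hd j) t ht
  rw [show 1 - (1 - a + δ) - 2 * a = -(a + δ) by ring] at b1
  rw [show 1 - (1 / 2 + δ) - (1 / 2 + a) = -(a + δ) by ring] at b2
  have hsplit : ∀ x y z x' y' z' : E,
      (x - (y - z)) - (x' - (y' - z')) = (x - x') - ((y - y') - (z - z')) := fun _ _ _ _ _ _ => by
    abel
  rw [Pi.sub_apply, mildMap, mildMap, hsplit]
  refine (norm_sub_le _ _).trans ((add_le_add b0 ((norm_sub_le _ _).trans
    (add_le_add b1 b2))).trans ?_)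
  have e1 : ε ≤ ε + R ^ 2 := by nlinarith
  have e2 : R ^ 2 ≤ ε + R ^ 2 := by linarith
  calc _ = (B₀ * ε + B₁ * K * R ^ 2 + B₂ * K * ε) * t ^ (-(a + δ)) := by ring
    _ ≤ (B₀ * (ε + R ^ 2) + B₁ * K * (ε + R ^ 2) + B₂ * K * (ε + R ^ 2)) * t ^ (-(a + δ)) := by
        gcongr
    _ = _ := by ring

end IsMildSpace

end Mild

/-! ### Existence, uniqueness and asymptotics -/

section Solutions

variable {E : Type*} [NormedAddCommGroup E] [NormedSpace ℝ E] {ι : E →L[ℝ] TempDist}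

theorem IsDecaying.norm_sub_le {a R : ℝ} {u v : ℝ → Fin 3 → E} (hu : IsDecaying ι a R u)
    (hv : IsDecaying ι a R v) {t : ℝ} (ht : 0 < t) : ‖u t - v t‖ ≤ 2 * R * t ^ (-a) :=
  (_root_.norm_sub_le _ _).trans
    ((add_le_add (hu.bound t ht) (hv.bound t ht)).trans (le_of_eq (by ring)))

/-- The contraction principle on the weakly measurable curves with `‖u(t)‖ ≤ R t^(-a)`. -/
theorem exists_fixedPoint_of_contraction [CompleteSpace E] {a R : ℝ} (hR : 0 ≤ R)
    {Φ : (ℝ → Fin 3 → E) → ℝ → Fin 3 → E}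
    (hmap : ∀ u, IsDecaying ι a R u → IsDecaying ι a R (Φ u))
    (hcontr : ∀ u v X, IsDecaying ι a R u → IsDecaying ι a R v → 0 ≤ X →
      (∀ t, 0 < t → ‖u t - v t‖ ≤ X * t ^ (-a)) →
        ∀ t, 0 < t → ‖Φ u t - Φ v t‖ ≤ X / 2 * t ^ (-a)) :
    ∃ u, IsDecaying ι a R u ∧ ∀ t, 0 < t → u t = Φ u t := by
  set w : ℕ → ℝ → Fin 3 → E := fun n => Φ^[n] 0 with hw
  have hw_succ : ∀ n, w (n + 1) = Φ (w n) := fun n => Function.iterate_succ_apply' Φ n 0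
  have hdec : ∀ n, IsDecaying ι a R (w n) := by
    intro n
    induction n with
    | zero =>
      refine ⟨fun i φ => ?_, fun t ht => ?_⟩
      · have h0 : (fun t : Ioi (0 : ℝ) => ι (w 0 t i) φ) = fun _ => 0 :=
          funext fun t => pairing_zero ι φ
        rw [h0]
        exact measurable_const
      · have h0 : w 0 t = 0 := rfl
        rw [h0, norm_zero]
        positivity
    | succ n ih => rw [hw_succ]; exact hmap _ ih
  have hstep : ∀ n t, 0 < t → ‖w (n + 1) t - w n t‖ ≤ R / 2 ^ n * t ^ (-a) := by
    intro n
    induction n with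
    | zero =>
      intro t ht
      have h0 : w 0 t = 0 := rfl
      rw [h0, sub_zero, pow_zero, div_one]
      exact (hdec 1).bound t ht
    | succ n ih =>
      intro t ht
      have h1 := hcontr _ _ _ (hdec (n + 1)) (hdec n) (by positivity) ih t ht
      rw [hw_succ (n + 1)]
      nth_rewrite 2 [hw_succ n]
      rwa [div_div, ← pow_succ] at h1
  have hgeo : ∀ t, 0 < t → ∀ n, dist (w n t) (w (n + 1) t) ≤ 2 * (R * t ^ (-a)) / 2 / 2 ^ n :=
    fun t ht n => by
      rw [dist_eq_norm, norm_sub_rev]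
      exact (hstep n t ht).trans (le_of_eq (by ring))
  have hlim : ∀ t, 0 < t → ∃ x, Tendsto (fun n => w n t) atTop (𝓝 x) := fun t ht =>
    cauchySeq_tendsto_of_complete (cauchySeq_of_le_geometric_two (hgeo t ht))
  choose! u hu using hlim
  have hdist : ∀ n t, 0 < t → ‖w n t - u t‖ ≤ 2 * R / 2 ^ n * t ^ (-a) := fun n t ht => by
    rw [← dist_eq_norm]
    refine (dist_le_of_le_geometric_two_of_tendsto (hgeo t ht) (hu t ht) n).trans
      (le_of_eq (by ring))
  have hudec : IsDecaying ι a R u := by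
    refine ⟨fun i φ => ?_, fun t ht => ?_⟩
    · refine measurable_of_tendsto_metrizable (fun n => (hdec n).measurable i φ)
        (tendsto_pi_nhds.2 fun t => ?_)
      exact ((distPairing ι φ).continuous.tendsto _).comp
        (((continuous_apply i).tendsto _).comp (hu t t.2))
    · exact le_of_tendsto (hu t ht).norm (Eventually.of_forall fun n => (hdec n).bound t ht)
  refine ⟨u, hudec, fun t ht => tendsto_nhds_unique ((tendsto_add_atTop_iff_nat 1).2 (hu t ht)) ?_⟩
  rw [tendsto_iff_norm_sub_tendsto_zero]
  have hz : Tendsto (fun n : ℕ => R * t ^ (-a) * (1 / 2) ^ n) atTop (𝓝 0) := by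
    have := (tendsto_pow_atTop_nhds_zero_of_lt_one (r := (1 / 2 : ℝ)) (by norm_num)
      (by norm_num)).const_mul (R * t ^ (-a))
    rwa [mul_zero] at this
  refine squeeze_zero (fun _ => norm_nonneg _) (fun n => ?_) hz
  rw [hw_succ]
  refine (hcontr _ _ _ (hdec n) hudec (by positivity) (hdist n) t ht).trans (le_of_eq ?_)
  rw [one_div, inv_pow]
  field_simp

theorem le_of_forall_le_add_div_two_pow {x y c : ℝ} (h : ∀ n : ℕ, x ≤ y + c / 2 ^ n) : x ≤ y := by
  have hz : Tendsto (fun n : ℕ => y + c * (1 / 2) ^ n) atTop (𝓝 (y + c * 0)) :=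
    ((tendsto_pow_atTop_nhds_zero_of_lt_one (r := (1 / 2 : ℝ)) (by norm_num)
      (by norm_num)).const_mul c).const_add y
  rw [mul_zero, add_zero] at hz
  refine ge_of_tendsto hz (Eventually.of_forall fun n => (h n).trans (le_of_eq ?_))
  rw [one_div, inv_pow, div_eq_mul_inv]

/-- A contraction has at most one fixed point among the curves with `‖u(t)‖ ≤ R t^(-a)`. -/
theorem eq_of_fixedPoint_of_contraction {a R : ℝ}
    {Φ : (ℝ → Fin 3 → E) → ℝ → Fin 3 → E}
    (hcontr : ∀ u v X, IsDecaying ι a R u → IsDecaying ι a R v → 0 ≤ X →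
      (∀ t, 0 < t → ‖u t - v t‖ ≤ X * t ^ (-a)) →
        ∀ t, 0 < t → ‖Φ u t - Φ v t‖ ≤ X / 2 * t ^ (-a))
    {u v : ℝ → Fin 3 → E} (hu : IsDecaying ι a R u) (hv : IsDecaying ι a R v)
    (hfu : ∀ t, 0 < t → u t = Φ u t) (hfv : ∀ t, 0 < t → v t = Φ v t) {t : ℝ} (ht : 0 < t) :
    u t = v t := by
  have hR := hu.nonneg
  have key : ∀ n : ℕ, ∀ t, 0 < t → ‖u t - v t‖ ≤ 2 * R / 2 ^ n * t ^ (-a) := by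
    intro n
    induction n with
    | zero => intro t ht; simpa using hu.norm_sub_le hv ht
    | succ n ih =>
      intro t ht
      rw [hfu t ht, hfv t ht]
      refine (hcontr u v _ hu hv (by positivity) ih t ht).trans (le_of_eq ?_)
      rw [div_div, ← pow_succ]
  have h0 : ‖u t - v t‖ ≤ 0 := le_of_forall_le_add_div_two_pow (c := 2 * R * t ^ (-a)) fun n =>
    (key n t ht).trans (le_of_eq (by ring))
  exact sub_eq_zero.1 (norm_le_zero_iff.1 h0)

namespace IsMildSpace

variable {a K p ℓ C : ℝ} {σ : ℝ → R3 → ℝ}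

/-- A decaying fixed point lies in the solution class: the Besov bound, the norm continuity and the
initial condition are properties of the right-hand side of the equation. -/
theorem isSmallSolution [CompleteSpace E] {R ε : ℝ} {u : ℝ → Fin 3 → E} {u₀ : Fin 3 → TempDist}
    {e : Fin 3 → ℝ → E} {V : ℝ → Fin 3 → Fin 3 → E} (hS : IsMildSpace ι ((1 - 3 / p) / 2) K)
    (hσ : SmoothingSymbol σ ℓ C) (hℓ : 2 ≤ ℓ) (hd : IsMildData ι ((1 - 3 / p) / 2) ε u₀ e V)
    (hu : IsDecaying ι ((1 - 3 / p) / 2) R u) (hfix : ∀ t, 0 < t → u t = mildMap ι σ e V u t) :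
    IsSmallSolution ι σ p R u₀ V u := by
  have hreg : ∀ i, IsBesovRegular ι ((1 - 3 / p) / 2) fun t => u t i := fun i =>
    (hS.isBesovRegular_mildMap hσ hℓ hd hu i).congr fun t ht => by rw [← hfix t ht]
  refine ⟨⟨iSup_besovNorm_lt_top hS.smearable hreg,
    fun t ht => tendsto_besovNorm_sub hS.smearable hreg ht, fun i φ => ?_⟩,
    (hS.solvesDuhamel_iff hσ (by linarith) hd hu).2 hfix, fun t ht => ?_⟩
  · refine (hS.tendsto_mildMap hσ (by linarith) hd hu i φ).congr' ?_
    filter_upwards [self_mem_nhdsWithin] with t ht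
    rw [hfix t ht]
  · have h := mul_le_mul_of_nonneg_left (hu.bound t ht)
      (Real.rpow_nonneg ht.le ((1 - 3 / p) / 2))
    rwa [mul_left_comm, ← Real.rpow_add ht, add_neg_cancel, Real.rpow_zero, mul_one] at h

/-- Solutions are decaying curves, with weak measurability a consequence of norm continuity, so that
uniqueness in the solution class is uniqueness of the fixed point. -/
theorem _root_.IsSmallSolution.isDecaying (hι : IsSmearable ι) {R : ℝ} {u : ℝ → Fin 3 → E}
    {u₀ : Fin 3 → TempDist} {V : ℝ → Fin 3 → Fin 3 → E} (h : IsSmallSolution ι σ p R u₀ V u) :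
    IsDecaying ι ((1 - 3 / p) / 2) R u := by
  refine ⟨measurable_pairing_of_besovNorm hι h.weaklyContinuous.continuous, fun t ht => ?_⟩
  have h1 := mul_le_mul_of_nonneg_right (h.bound t ht)
    (Real.rpow_nonneg ht.le (-((1 - 3 / p) / 2)))
  rwa [mul_right_comm, ← Real.rpow_add ht, add_neg_cancel, Real.rpow_zero, one_mul] at h1

theorem exists_isSmallSolution [CompleteSpace E] (hS : IsMildSpace ι ((1 - 3 / p) / 2) K)
    (hσ : SmoothingSymbol σ ℓ C) (hℓ : 2 ≤ ℓ) : ∃ B, 0 ≤ B ∧ ∀ (ε R : ℝ) (u₀ : Fin 3 → TempDist)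
      (e : Fin 3 → ℝ → E) (V : ℝ → Fin 3 → Fin 3 → E), 0 ≤ ε → 0 ≤ R → B * (ε + R ^ 2) ≤ R →
      B * R ≤ 1 / 2 → IsMildData ι ((1 - 3 / p) / 2) ε u₀ e V →
        ∃ u, IsSmallSolution ι σ p R u₀ V u ∧ (∀ t, 0 < t → u t = mildMap ι σ e V u t) ∧
          ∀ u', IsSmallSolution ι σ p R u₀ V u' → EqOn u' u (Ioi 0) := by
  have ha := hS.pos
  have ha2 := hS.lt
  set a := (1 - 3 / p) / 2 with hadef
  obtain ⟨B₁, hB₁, h₁⟩ := hS.exists_norm_mildMap_le hσ (by linarith)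
  obtain ⟨B₂, hB₂, h₂⟩ := hS.exists_norm_mildMap_sub_le hσ (by linarith) ha.le (by linarith)
  refine ⟨B₁ + B₂, by positivity, fun ε R u₀ e V hε hR hsmall hsmall' hd => ?_⟩
  have hmap : ∀ u, IsDecaying ι a R u → IsDecaying ι a R (mildMap ι σ e V u) := fun u hu =>
    ⟨fun i φ => (hS.isBesovRegular_mildMap hσ hℓ hd hu i).measurable_pairing hS.smearable φ,
      fun t ht => (h₁ ε R u₀ e V u hε hR hd hu t ht).trans (by
        refine mul_le_mul_of_nonneg_right ?_ (by positivity)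
        have : 0 ≤ B₂ * (ε + R ^ 2) := by positivity
        linarith)⟩
  have hcontr : ∀ u v X, IsDecaying ι a R u → IsDecaying ι a R v → 0 ≤ X →
      (∀ t, 0 < t → ‖u t - v t‖ ≤ X * t ^ (-a)) →
        ∀ t, 0 < t → ‖mildMap ι σ e V u t - mildMap ι σ e V v t‖ ≤ X / 2 * t ^ (-a) := by
    intro u v X hu hv hX huv t ht
    refine (h₂ e V u v R X t hR hX hu hv ht fun τ hτ _ => huv τ hτ).trans
      (mul_le_mul_of_nonneg_right ?_ (by positivity))
    have : B₂ * R ≤ 1 / 2 := le_trans (by nlinarith [mul_nonneg hB₁ hR]) hsmall'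
    nlinarith
  obtain ⟨u, hu, hfix⟩ := exists_fixedPoint_of_contraction hR hmap hcontr
  refine ⟨u, hS.isSmallSolution hσ hℓ hd hu hfix, hfix, fun u' hu' t ht => ?_⟩
  have hdec := hu'.isDecaying hS.smearable
  exact eq_of_fixedPoint_of_contraction hcontr hdec hu
    ((hS.solvesDuhamel_iff hσ (by linarith) hd hdec).1 hu'.duhamel) hfix ht

/-- Fixed points of the two maps approach each other with an additional factor `t^(-δ)`: if
`‖u - w‖ ≤ X t^(-(a + δ))` up to time `T`, then the same holds with `c + X / 2` for `X`, so that
finally `X = 2 c`. -/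
theorem exists_norm_sub_le [CompleteSpace E] (hS : IsMildSpace ι a K) (hℓ : 2 < ℓ) :
    ∃ δ B, 0 < δ ∧ 0 ≤ B ∧ ∀ (ε R : ℝ) (u₀ : Fin 3 → TempDist)
      (e : Fin 3 → ℝ → E) (V : ℝ → Fin 3 → Fin 3 → E) (u w : ℝ → Fin 3 → E), 0 ≤ ε →
      B * R ≤ 1 / 2 → IsMildData ι a ε u₀ e V → IsDecaying ι a R u → IsDecaying ι a R w →
      (∀ t, 0 < t → u t = mildMap ι heatSymbol e V u t) →
      (∀ t, 0 < t → w t = mildMap ι (hyperSymbol ℓ) e V w t) →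
        ∃ c, ∀ t, 0 < t → ‖u t - w t‖ ≤ c * t ^ (-(a + δ)) := by
  have ha := hS.pos
  have ha2 := hS.lt
  obtain ⟨δ, hδ, hδa, hδℓ, hδ1⟩ : ∃ δ : ℝ, 0 < δ ∧ δ < a ∧ δ ≤ ℓ / 2 - 1 ∧ 2 * a + δ < 1 := by
    refine ⟨min (a / 2) (min (ℓ / 2 - 1) ((1 - 2 * a) / 2)),
      lt_min (by linarith) (lt_min (by linarith) (by linarith)), ?_, ?_, ?_⟩
    · exact (min_le_left _ _).trans_lt (by linarith)
    · exact (min_le_right _ _).trans (min_le_left _ _)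
    · have := (min_le_right (a / 2) (min (ℓ / 2 - 1) ((1 - 2 * a) / 2))).trans (min_le_right _ _)
      linarith
  obtain ⟨C₂, -, hC₂⟩ := exists_smoothingSymbol_hyper hℓ
  obtain ⟨B₁, hB₁, h₁⟩ := hS.exists_norm_mildMap_heat_sub_hyper_le hℓ hδ hδℓ hδa
  obtain ⟨B₂, hB₂, h₂⟩ := hS.exists_norm_mildMap_sub_le (hC₂ C₂ le_rfl) (by linarith)
    (ν := a + δ) (by linarith) (by linarith)
  refine ⟨δ, B₂, hδ, hB₂, fun ε R u₀ e V u w hε hsmall hd hu hw hfu hfw => ?_⟩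
  have hR := hu.nonneg
  set c := B₁ * (ε + R ^ 2) with hc
  have hc0 : 0 ≤ c := by positivity
  have key : ∀ (T : ℝ), 0 < T → ∀ n : ℕ, ∀ t, 0 < t → t ≤ T →
      ‖u t - w t‖ ≤ (2 * c + 2 * R * T ^ δ / 2 ^ n) * t ^ (-(a + δ)) := by
    intro T hT n
    induction n with
    | zero =>
      intro t ht htT
      refine (hu.norm_sub_le hw ht).trans ?_
      have e1 : t ^ (-a) = t ^ δ * t ^ (-(a + δ)) := by
        rw [← Real.rpow_add ht]; congr 1; ring
      have e2 : t ^ δ ≤ T ^ δ := Real.rpow_le_rpow ht.le htT hδ.le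
      rw [e1, ← mul_assoc, pow_zero, div_one]
      refine mul_le_mul_of_nonneg_right ?_ (by positivity)
      nlinarith [mul_le_mul_of_nonneg_left e2 hR]
    | succ n ih =>
      intro t ht htT
      have b1 := h₁ ε R u₀ e V u hε hd hu t ht
      have b2 := h₂ e V u w R (2 * c + 2 * R * T ^ δ / 2 ^ n) t hR (by positivity) hu hw ht
        fun τ hτ hτt => ih τ hτ (hτt.le.trans htT)
      have e1 : u t - w t = (mildMap ι heatSymbol e V u t - mildMap ι (hyperSymbol ℓ) e V u t) +
          (mildMap ι (hyperSymbol ℓ) e V u t - mildMap ι (hyperSymbol ℓ) e V w t) := by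
        rw [sub_add_sub_cancel, ← hfu t ht, ← hfw t ht]
      rw [e1]
      refine (norm_add_le _ _).trans ((add_le_add b1 b2).trans ?_)
      rw [← add_mul]
      refine mul_le_mul_of_nonneg_right ?_ (by positivity)
      have hX : 0 ≤ 2 * c + 2 * R * T ^ δ / 2 ^ n := by positivity
      have e2 := mul_le_mul_of_nonneg_right hsmall hX
      have e3 : 2 * R * T ^ δ / 2 ^ (n + 1) = 2 * R * T ^ δ / 2 ^ n / 2 := by
        rw [pow_succ, div_div]
      rw [e3]
      linarith
  refine ⟨2 * c, fun t ht => le_of_forall_le_add_div_two_pow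
    (c := 2 * R * t ^ δ * t ^ (-(a + δ))) fun n => ?_⟩
  exact (key t ht n t ht le_rfl).trans (le_of_eq (by ring))

end IsMildSpace

/-- The smallness hypothesis on initial datum and force in terms of elements of the space. -/
theorem exists_isMildData (hι : IsSmearable ι) {p ε : ℝ} (hε : 0 ≤ ε) {u₀ : Fin 3 → TempDist}
    {V : ℝ → Fin 3 → Fin 3 → E}
    (hV : ∀ (l k : Fin 3) (φ : TestFn), Measurable fun t : Ioi (0 : ℝ) => ι (V t l k) φ)
    (h : besovNorm ι (1 - 3 / p) u₀ +
      (⨆ (t : ℝ) (_ : 0 < t), ENNReal.ofReal (t ^ (1 - 3 / (2 * p)) * ‖V t‖))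
        < ENNReal.ofReal ε) :
    ∃ e, IsMildData ι ((1 - 3 / p) / 2) ε u₀ e V := by
  choose e he using exists_isDatum hι hε (le_self_add.trans h.le)
  refine ⟨e, he, hV, fun t ht => ?_⟩
  have h1 : ENNReal.ofReal (t ^ (1 - 3 / (2 * p)) * ‖V t‖) ≤ ENNReal.ofReal ε :=
    (le_iSup₂ (f := fun (t : ℝ) (_ : 0 < t) =>
      ENNReal.ofReal (t ^ (1 - 3 / (2 * p)) * ‖V t‖)) t ht).trans (le_add_self.trans h.le)
  rw [ENNReal.ofReal_le_ofReal_iff hε] at h1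
  have h2 := mul_le_mul_of_nonneg_right h1 (Real.rpow_nonneg ht.le (-(1 - 3 / (2 * p))))
  rw [mul_right_comm, ← Real.rpow_add ht, add_neg_cancel, Real.rpow_zero, one_mul] at h2
  rwa [show 1 / 2 + (1 - 3 / p) / 2 = 1 - 3 / (2 * p) by
    rw [div_mul_eq_div_div_swap]; ring]

end Solutions

theorem mainTheorem10 {E : Type*} [NormedAddCommGroup E] [NormedSpace ℝ E] [CompleteSpace E]
    (ι : E →L[ℝ] TempDist) (p ℓ : ℝ) (hp : 3 < p) (hℓ : 2 < ℓ) (hpℓ : 3 * ℓ / 2 < p)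
    (hE : IsAdequate ι) (hscal : HasScalingDegree ι (-3 / p)) :
    ∃ C : ℝ, 0 < C ∧ ∃ ε₀ : ℝ, 0 < ε₀ ∧ ∀ ε : ℝ, 0 < ε → ε ≤ ε₀ →
      ∀ (u₀ : Fin 3 → TempDist) (V : ℝ → Fin 3 → Fin 3 → E),
        (∀ (l k : Fin 3) (φ : TestFn), Measurable fun t : Set.Ioi (0 : ℝ) => ι (V t l k) φ) →
        besovNorm ι (1 - 3 / p) u₀ +
          (⨆ (t : ℝ) (_ : 0 < t), ENNReal.ofReal (t ^ (1 - 3 / (2 * p)) * ‖V t‖))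
            < ENNReal.ofReal ε →
        ∃ u w : ℝ → Fin 3 → E,
          IsSmallSolution ι heatSymbol p (C * ε) u₀ V u ∧
          (∀ u', IsSmallSolution ι heatSymbol p (C * ε) u₀ V u' → Set.EqOn u' u (Set.Ioi 0)) ∧
          IsSmallSolution ι (hyperSymbol ℓ) p (C * ε) u₀ V w ∧
          (∀ w', IsSmallSolution ι (hyperSymbol ℓ) p (C * ε) u₀ V w' →
            Set.EqOn w' w (Set.Ioi 0)) ∧
          Tendsto (fun t : ℝ => t ^ ((1 - 3 / p) / 2) * ‖u t - w t‖) atTop (𝓝 0) := by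
  obtain ⟨K, hS⟩ := hE.exists_isMildSpace hp hscal
  obtain ⟨C₁, -, hC₁⟩ := exists_smoothingSymbol_heat
  obtain ⟨C₂, -, hC₂⟩ := exists_smoothingSymbol_hyper hℓ
  obtain ⟨B₁, hB₁, h₁⟩ := hS.exists_isSmallSolution (hC₁ ℓ C₁ le_rfl) hℓ.le
  obtain ⟨B₂, hB₂, h₂⟩ := hS.exists_isSmallSolution (hC₂ C₂ le_rfl) hℓ.le
  obtain ⟨δ, B₃, hδ, hB₃, h₃⟩ := hS.exists_norm_sub_le hℓ
  set B := B₁ + B₂ + B₃ + 1 with hB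
  have hB0 : 0 < B := by positivity
  -- With `R = 2Bε`, both `B (ε + R²) ≤ R` and `B R ≤ 1/2` amount to `4B²ε ≤ 1`.
  refine ⟨2 * B, by positivity, 1 / (4 * B ^ 2), by positivity, fun ε hε hε₀ u₀ V hV hsmall => ?_⟩
  obtain ⟨e, hd⟩ := exists_isMildData hS.smearable hε.le hV hsmall
  have hε' : 4 * B ^ 2 * ε ≤ 1 := by
    rw [le_div_iff₀ (by positivity)] at hε₀; linarith
  have hR : 0 ≤ 2 * B * ε := by positivity
  have s1 : B * (ε + (2 * B * ε) ^ 2) ≤ 2 * B * ε := by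
    have := mul_le_mul_of_nonneg_left hε' (by positivity : 0 ≤ B * ε)
    nlinarith
  have s2 : B * (2 * B * ε) ≤ 1 / 2 := by linarith
  have mono : ∀ b, b ≤ B → b * (ε + (2 * B * ε) ^ 2) ≤ 2 * B * ε ∧ b * (2 * B * ε) ≤ 1 / 2 :=
    fun b hb => ⟨(mul_le_mul_of_nonneg_right hb (by positivity)).trans s1,
      (mul_le_mul_of_nonneg_right hb hR).trans s2⟩
  have m1 := mono B₁ (by linarith)
  have m2 := mono B₂ (by linarith)
  obtain ⟨u, hu, hfu, huu⟩ := h₁ ε (2 * B * ε) u₀ e V hε.le hR m1.1 m1.2 hd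
  obtain ⟨w, hw, hfw, hwu⟩ := h₂ ε (2 * B * ε) u₀ e V hε.le hR m2.1 m2.2 hd
  refine ⟨u, w, hu, huu, hw, hwu, ?_⟩
  obtain ⟨c, hc⟩ := h₃ ε (2 * B * ε) u₀ e V u w hε.le (mono B₃ (by linarith)).2 hd
    (hu.isDecaying hS.smearable) (hw.isDecaying hS.smearable) hfu hfw
  have hz : Tendsto (fun t : ℝ => c * t ^ (-δ)) atTop (𝓝 0) := by
    simpa using (tendsto_rpow_neg_atTop hδ).const_mul c
  refine squeeze_zero' ?_ ?_ hz
  · filter_upwards [eventually_gt_atTop 0] with t ht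
    positivity
  · filter_upwards [eventually_gt_atTop 0] with t ht
    refine (mul_le_mul_of_nonneg_left (hc t ht) (by positivity)).trans (le_of_eq ?_)
    rw [mul_left_comm, ← Real.rpow_add ht]
    congr 2; ring

end
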